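/- Let $X$ be a compact smooth manifold with boundary, of dimension $n+1\ge 1$, let $\mathring X$ be its interior, and let $g$ be a smooth Riemannian metric on $\mathring X$ such that $(\mathring X,g)$ is asymptotically hyperbolic: for a boundary defining function $\rho$ of $\partial X$ (that is, $\rho\in C^\infty(X)$, $\rho>0$ on $\mathring X$, $\rho=0$ and $d\rho\neq 0$ on $\partial X$), $\rho^2g$ extends to a smooth Riemannian metric on $X$ up to $\partial X$, and $|d\rho|_{\rho^2 g}=1$ on $\partial X$. Suppose that $(\mathring X,g)$ is geodesically convex: any two points of $\mathring X$ are joined by exactly one geodesic (up to parametrization; the constant curve if the points coincide). Let $r$ be the Riemannian distance of $g$, let $p(z,\zeta)=\frac12(|\zeta|^2_{g^*(z)}-1)$ on $T^*\mathring X$, and let $H_p=\sum_j\frac{\partial p}{\partial\zeta_j}\partial_{z_j}-\frac{\partial p}{\partial z_j}\partial_{\zeta_j}$ be its Hamilton vector field. Identify $T^*(\mathring X\times\mathring X)=T^*\mathring X\times T^*\mathring X$, with points $(z,\zeta,z',\zeta')$, let $H_p$ act on the factor $(z,\zeta)$, and put $$S^*\mathrm{Diag}=\{z=z',\ \zeta=\zeta',\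 p(z',\zeta')=0\},\qquad \Lambda=\bigcup_{t\ge 0}\exp(tH_p)\,S^*\mathrm{Diag}.$$ Then: 1. $\Lambda=\{(z,\zeta,z',\zeta'):\ \exists\, t\ge 0,\ (z,\zeta)=\exp(tH_p)(z',\zeta'),\ p(z',\zeta')=0\}$. 2. $\Lambda$ is a $C^\infty$ embedded submanifold of $T^*(\mathring X\times\mathring X)$ of dimension $2(n+1)$, with boundary $S^*\mathrm{Diag}$, and it is Lagrangian for the (twisted) symplectic form $\sum_j d\zeta_j\wedge dz_j-\sum_j d\zeta_j'\wedge dz_j'$. 3. The function $r$ is $C^\infty$ on $\{(z,z'):z\ne z'\}$, and $$\Lambda\setminus S^*\mathrm{Diag}=\{(z,\zeta,z',\zeta'):\ z\neq z',\ \zeta=d_zr(z,z'),\ \zeta'=-d_{z'}r(z,z')\}.$$ 4. Equivalently, with the sign of $\zeta'$ reversed: let $S^*_-\mathrm{Diag}=\{z=z',\ \zeta=-\zeta',\ p(z',\zeta')=0\}$ and $\Lambda_-=\bigcup_{t\ge0}\exp(tH_p)\,S^*_-\mathrm{Diag}$. Then $\Lambda_-=\{(z,\zeta,z',\zeta'):(z,\zeta,z',-\zeta')\in\Lambda\}$;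 it is a $C^\infty$ embedded submanifold with boundary $S^*_-\mathrm{Diag}$, of dimension $2(n+1)$, Lagrangian for the canonical symplectic form $\sum_j d\zeta_j\wedge dz_j+\sum_j d\zeta_j'\wedge dz_j'$; and $\Lambda_-\setminus S^*_-\mathrm{Diag}$ is the graph of the differential $dr$ over $\{z\neq z'\}$. -/

import Mathlib

open Set Bundle Manifold
open scoped Manifold ContDiff Topology

noncomputable section

namespace AHM

section Metrics

variable {m : ℕ} {H : Type*} [TopologicalSpace H]
  {I : ModelWithCorners ℝ (EuclideanSpace ℝ (Fin m)) H}
  {N : Type*} [TopologicalSpace N] [ChartedSpace H N] [IsManifold I ∞ N]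

/-- A smooth Riemannian metric on a smooth manifold `N` (possibly with boundary, in which case
the metric is smooth and non-degenerate up to the boundary). -/
abbrev Metric (I : ModelWithCorners ℝ (EuclideanSpace ℝ (Fin m)) H)
    (N : Type*) [TopologicalSpace N] [ChartedSpace H N] [IsManifold I ∞ N] : Type _ :=
  ContMDiffRiemannianMetric I ∞ (EuclideanSpace ℝ (Fin m)) (fun x : N => TangentSpace I x)

/-- The linear map `v ↦ g(x)(v, ·)` from `T_x N` to `T_x^* N`. -/
def flatMap (g : Metric I N) (x : N) :
    EuclideanSpace ℝ (Fin m) →ₗ[ℝ] (EuclideanSpace ℝ (Fin m) →L[ℝ] ℝ) :=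
  (g.inner x).toLinearMap

theorem flatMap_injective (g : Metric I N) (x : N) : Function.Injective (flatMap g x) := by
  rw [← LinearMap.ker_eq_bot, LinearMap.ker_eq_bot']
  intro v hv
  by_contra hne
  have h1 : 0 < g.inner x v v := g.pos x v hne
  have h2 : g.inner x v v = 0 := congrArg (fun L => L v) hv
  exact h1.ne' h2

theorem finrank_dual_eq :
    Module.finrank ℝ (EuclideanSpace ℝ (Fin m)) =
      Module.finrank ℝ (EuclideanSpace ℝ (Fin m) →L[ℝ] ℝ) :=
  (InnerProductSpace.toDual ℝ (EuclideanSpace ℝ (Fin m))).toLinearEquiv.finrank_eq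

/-- The isomorphism `𝒢 : T_x N → T_x^* N`, `v ↦ g(x)(v, ·)`, induced by the metric. -/
def flat (g : Metric I N) (x : N) :
    TangentSpace I x ≃ₗ[ℝ] (TangentSpace I x →L[ℝ] ℝ) :=
  (LinearEquiv.ofInjectiveOfFinrankEq (flatMap g x) (flatMap_injective g x) finrank_dual_eq :
    EuclideanSpace ℝ (Fin m) ≃ₗ[ℝ] (EuclideanSpace ℝ (Fin m) →L[ℝ] ℝ))

/-- The dual metric `g^*(x)(ξ, η) = g(x)(𝒢⁻¹ ξ, 𝒢⁻¹ η)` on `T_x^* N`. -/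
def dualMetric (g : Metric I N) (x : N) (ξ η : TangentSpace I x →L[ℝ] ℝ) : ℝ :=
  g.inner x ((flat g x).symm ξ) ((flat g x).symm η)

/-- The Riemannian distance: the infimum of the `g`-lengths of the `C^1` paths joining two
points. -/
def rdist (g : Metric I N) (x y : N) : ℝ :=
  letI : RiemannianBundle (fun x : N => TangentSpace I x) := ⟨g.toRiemannianMetric⟩
  (riemannianEDist I x y).toReal

end Metrics

section CotangentBundle

/-- The model space `ℝ^m × (ℝ^m)^*` of a cotangent bundle. -/
abbrev CotModel (m : ℕ) : Type :=
  EuclideanSpace ℝ (Fin m) × (EuclideanSpace ℝ (Fin m) →L[ℝ] ℝ)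

/-- The model with corners of a cotangent bundle. -/
abbrev cotI (m : ℕ) := (𝓡 m).prod 𝓘(ℝ, EuclideanSpace ℝ (Fin m) →L[ℝ] ℝ)

/-- The cotangent bundle `T^*M`, with its smooth manifold structure. A point is written
`⟨z, ζ⟩` with `ζ ∈ T_z^* M`. -/
abbrev Cotangent (m : ℕ) (M : Type*) [TopologicalSpace M]
    [ChartedSpace (EuclideanSpace ℝ (Fin m)) M] [IsManifold (𝓡 m) ∞ M] : Type _ :=
  TotalSpace (EuclideanSpace ℝ (Fin m) →L[ℝ] ℝ)
    (fun x : M => TangentSpace (𝓡 m) x →L[ℝ] ℝ)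

/-- The symplectic form `∑ dζ_j ∧ dz_j` on `ℝ^m × (ℝ^m)^*`. -/
def modelForm {m : ℕ} (V W : CotModel m) : ℝ := V.2 W.1 - W.2 V.1

/-- The Hamilton vector in canonical coordinates,
`∑ ∂p/∂ζ_j ∂/∂z_j - ∂p/∂z_j ∂/∂ζ_j`, of a function with differential `dp`. -/
def modelHamilton {m : ℕ} (dp : CotModel m →L[ℝ] ℝ) : CotModel m :=
  (WithLp.toLp 2 fun j => dp (0, EuclideanSpace.proj j),
    -(dp.comp (ContinuousLinearMap.inl ℝ _ _)))

/-- Consistency of the two formulas: `ω(V, H_p) = dp(V)`. -/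
theorem modelForm_modelHamilton {m : ℕ} (dp : CotModel m →L[ℝ] ℝ) (V : CotModel m) :
    modelForm V (modelHamilton dp) = dp V := by
  obtain ⟨v, α⟩ := V
  have hα : α = ∑ j, α (EuclideanSpace.single j 1) •
      (EuclideanSpace.proj j : EuclideanSpace ℝ (Fin m) →L[ℝ] ℝ) := by
    ext w
    have hw : w = ∑ j, w j • EuclideanSpace.single j (1 : ℝ) := by
      ext i
      simp [Finset.sum_apply, Pi.single_apply]
    conv_lhs => rw [hw]
    simp [mul_comm]
  have h2 : dp (0, α) = ∑ j, α (EuclideanSpace.single j 1) * dp (0, EuclideanSpace.proj j) := by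
    have h3 : dp (0, α) = (dp.comp (ContinuousLinearMap.inr ℝ _ _)) α := rfl
    rw [h3]
    conv_lhs => rw [hα]
    rw [map_sum]
    simp only [map_smul, smul_eq_mul]
    rfl
  have h4 : α (WithLp.toLp 2 fun j => dp (0, EuclideanSpace.proj j)) = dp (0, α) := by
    rw [h2]
    conv_lhs => rw [hα]
    simp
  have h5 : ((v, α) : CotModel m) = (v, 0) + (0, α) := by simp
  rw [h5, map_add]
  simp [modelForm, modelHamilton, h4]
  ring

variable {m : ℕ} {M : Type*} [TopologicalSpace M]
  [ChartedSpace (EuclideanSpace ℝ (Fin m)) M] [IsManifold (𝓡 m) ∞ M]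

/-- The preferred chart of `T^*M` at `q₀` is the canonical one: `(z, ζ)` is sent to the coordinates
of `z` in the chart `φ` of `M` at the base point of `q₀`, and to the components of `ζ` in that chart
(`ζ` composed with the derivative of `φ⁻¹`). -/
theorem extChartAt_cotangent (q₀ q : Cotangent m M)
    (hq : q.proj ∈ (chartAt (EuclideanSpace ℝ (Fin m)) q₀.proj).source) :
    extChartAt (cotI m) q₀ q =
      (extChartAt (𝓡 m) q₀.proj q.proj,
        (q.snd).comp (mfderivWithin 𝓘(ℝ, EuclideanSpace ℝ (Fin m)) (𝓡 m)
          (extChartAt (𝓡 m) q₀.proj).symm (range (𝓡 m)) (extChartAt (𝓡 m) q₀.proj q.proj))) := by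
  rw [FiberBundle.extChartAt, ← TangentBundle.symmL_trivializationAt hq]
  simp [hom_trivializationAt_apply, ContinuousLinearMap.inCoordinates]
  rfl

/-- The canonical symplectic form `ω = ∑ dζ_j ∧ dz_j` of `T^*M`. In Mathlib a tangent vector at
`q ∈ T^*M` is represented by its components in the preferred chart of `T^*M` at `q`; this chart
is the canonical one, `(z_j, ζ_j)`, by `extChartAt_cotangent`. -/
def canonicalForm (q : Cotangent m M) (V W : TangentSpace (cotI m) q) : ℝ :=
  modelForm (V : CotModel m) (W : CotModel m)

/-- The Hamilton vector field `H_p` of a function `p` on `T^*M` with respect to the canonical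
symplectic form. -/
def hamiltonField (p : Cotangent m M → ℝ) (q : Cotangent m M) : TangentSpace (cotI m) q :=
  modelHamilton (mfderiv (cotI m) 𝓘(ℝ, ℝ) p q)

/-- `HamiltonFlow p t a b` says that `b = exp(t H_p)(a)` (for `t ≥ 0`): the integral curve of
`H_p` which starts at `a` is defined on `[0, t]` and ends at `b`. -/
def HamiltonFlow (p : Cotangent m M → ℝ) (t : ℝ) (a b : Cotangent m M) : Prop :=
  ∃ γ : ℝ → Cotangent m M,
    IsMIntegralCurveOn (I := cotI m) γ (hamiltonField p) (Icc 0 t) ∧ γ 0 = a ∧ γ t = b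

/-- The energy function `p(z, ζ) = (|ζ|²_{g^*(z)} - 1) / 2` on `T^*M`. -/
def energy (g : Metric (𝓡 m) M) (q : Cotangent m M) : ℝ :=
  (dualMetric g q.proj q.snd q.snd - 1) / 2

/-- A geodesic `α : [0, 1] → M` of `g`, with affine parameter: the projection of an integral
curve of `H_p` (any energy level is allowed, so constant curves are included). The values of `α`
outside `[0, 1]` are irrelevant. -/
def IsGeodesic (g : Metric (𝓡 m) M) (α : ℝ → M) : Prop :=
  ∃ γ : ℝ → Cotangent m M,
    IsMIntegralCurveOn (I := cotI m) γ (hamiltonField (energy g)) (Icc 0 1) ∧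
      ∀ t ∈ Icc (0 : ℝ) 1, (γ t).proj = α t

/-- `(M, g)` is geodesically convex: any two points are joined by exactly one geodesic. -/
def GeodesicallyConvex (g : Metric (𝓡 m) M) : Prop :=
  ∀ z' z : M, (∃ α : ℝ → M, IsGeodesic g α ∧ α 0 = z' ∧ α 1 = z) ∧
    ∀ α β : ℝ → M, IsGeodesic g α → α 0 = z' → α 1 = z →
      IsGeodesic g β → β 0 = z' → β 1 = z → EqOn α β (Icc 0 1)

end CotangentBundle

section AsymptoticallyHyperbolic

variable {m : ℕ} [NeZero m] {M : Type*} [TopologicalSpace M]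
  [ChartedSpace (EuclideanSpace ℝ (Fin m)) M] [IsManifold (𝓡 m) ∞ M]
  {X : Type*} [TopologicalSpace X] [ChartedSpace (EuclideanHalfSpace m) X]
  [IsManifold (𝓡∂ m) ∞ X]

/-- `ρ ∈ C^∞(X)` is a defining function of `∂X`. -/
structure IsBoundaryDefining (m : ℕ) [NeZero m] {X : Type*} [TopologicalSpace X]
    [ChartedSpace (EuclideanHalfSpace m) X] (ρ : X → ℝ) : Prop where
  smooth : ContMDiff (𝓡∂ m) 𝓘(ℝ, ℝ) ∞ ρ
  pos : ∀ y ∈ (𝓡∂ m).interior X, 0 < ρ y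
  zero : ∀ y ∈ (𝓡∂ m).boundary X, ρ y = 0
  deriv_ne : ∀ y ∈ (𝓡∂ m).boundary X, mfderiv (𝓡∂ m) 𝓘(ℝ, ℝ) ρ y ≠ 0

/-- `(M, g)` is an asymptotically hyperbolic manifold, where `ι : M → X` identifies `M` with the
interior of the manifold with boundary `X`: for a defining function `ρ` of `∂X`, the metric
`ρ² g` extends to a smooth Riemannian metric `gbar` up to `∂X`, and `|dρ| = 1` on `∂X` with
respect to `gbar`. (If this holds for one defining function then it holds for all of them.) -/
structure IsAsymptoticallyHyperbolic (ι : M → X) (g : Metric (𝓡 m) M) : Prop where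
  localDiffeo : IsLocalDiffeomorph (𝓡 m) (𝓡∂ m) ∞ ι
  injective : Function.Injective ι
  range_eq : range ι = (𝓡∂ m).interior X
  conformal : ∃ (ρ : X → ℝ) (gbar : Metric (𝓡∂ m) X), IsBoundaryDefining m ρ ∧
    (∀ (x : M) (v w : TangentSpace (𝓡 m) x),
      gbar.inner (ι x) (mfderiv (𝓡 m) (𝓡∂ m) ι x v) (mfderiv (𝓡 m) (𝓡∂ m) ι x w) =
        ρ (ι x) ^ 2 * g.inner x v w) ∧
    ∀ y ∈ (𝓡∂ m).boundary X,
      dualMetric gbar y (mfderiv (𝓡∂ m) 𝓘(ℝ, ℝ) ρ y) (mfderiv (𝓡∂ m) 𝓘(ℝ, ℝ) ρ y) = 1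

end AsymptoticallyHyperbolic

section Lagrangian

variable {m : ℕ} {M : Type*} [TopologicalSpace M]
  [ChartedSpace (EuclideanSpace ℝ (Fin m)) M] [IsManifold (𝓡 m) ∞ M]

/-- The model with corners of `T^*(M × M) = T^*M × T^*M`, whose points are written
`(z, ζ, z', ζ') = (⟨z, ζ⟩, ⟨z', ζ'⟩)`. -/
abbrev cotI₂ (m : ℕ) := (cotI m).prod (cotI m)

/-- The canonical symplectic form `∑ dζ_j ∧ dz_j + ∑ dζ'_j ∧ dz'_j` of `T^*(M × M)`. -/
def sumForm (q : Cotangent m M × Cotangent m M) (V W : TangentSpace (cotI₂ m) q) : ℝ :=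
  canonicalForm q.1 (V : CotModel m × CotModel m).1 (W : CotModel m × CotModel m).1 +
    canonicalForm q.2 (V : CotModel m × CotModel m).2 (W : CotModel m × CotModel m).2

/-- The twisted symplectic form `∑ dζ_j ∧ dz_j - ∑ dζ'_j ∧ dz'_j` of `T^*M × T^*M`. -/
def twistedForm (q : Cotangent m M × Cotangent m M) (V W : TangentSpace (cotI₂ m) q) : ℝ :=
  canonicalForm q.1 (V : CotModel m × CotModel m).1 (W : CotModel m × CotModel m).1 -
    canonicalForm q.2 (V : CotModel m × CotModel m).2 (W : CotModel m × CotModel m).2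

/-- `L ⊆ T^*M × T^*M`, with the subspace topology, is a smooth embedded submanifold with boundary
`B`, it has dimension `2m` (half the dimension of the ambient manifold), and `Ω` vanishes on its
tangent spaces. -/
def IsLagrangianSubmanifold [NeZero m]
    (Ω : ∀ q : Cotangent m M × Cotangent m M,
      TangentSpace (cotI₂ m) q → TangentSpace (cotI₂ m) q → ℝ)
    (L B : Set (Cotangent m M × Cotangent m M)) : Prop :=
  ∃ _ : ChartedSpace (EuclideanHalfSpace (2 * m)) L,
    IsManifold (𝓡∂ (2 * m)) ∞ L ∧
    IsSmoothEmbedding (𝓡∂ (2 * m)) (cotI₂ m) ∞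
      (Subtype.val : L → Cotangent m M × Cotangent m M) ∧
    (Subtype.val '' (𝓡∂ (2 * m)).boundary L = B) ∧
    ∀ (x : L) (v w : TangentSpace (𝓡∂ (2 * m)) x),
      Ω x.1
        (mfderiv (𝓡∂ (2 * m)) (cotI₂ m)
          (Subtype.val : L → Cotangent m M × Cotangent m M) x v)
        (mfderiv (𝓡∂ (2 * m)) (cotI₂ m)
          (Subtype.val : L → Cotangent m M × Cotangent m M) x w) = 0

/-- `⋃_{t ≥ 0} exp(t H_p) S`, where `p` is the energy function of the left factor. -/
def flowout (g : Metric (𝓡 m) M) (S : Set (Cotangent m M × Cotangent m M)) :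
    Set (Cotangent m M × Cotangent m M) :=
  ⋃ t ∈ Ici (0 : ℝ), {q | ∃ a ∈ S, HamiltonFlow (energy g) t a.1 q.1 ∧ q.2 = a.2}

/-- `S^*Diag = {z = z', ζ = ζ', p(z', ζ') = 0}`. -/
def sDiag (g : Metric (𝓡 m) M) : Set (Cotangent m M × Cotangent m M) :=
  {q | q.1 = q.2 ∧ energy g q.2 = 0}

/-- `Λ = ⋃_{t ≥ 0} exp(t H_p) S^*Diag`. -/
def Lam (g : Metric (𝓡 m) M) : Set (Cotangent m M × Cotangent m M) := flowout g (sDiag g)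

/-- The unit conormal bundle `{z = z', ζ = -ζ', p(z', ζ') = 0}` of the diagonal: the image of
`S^*Diag` under `(z, ζ, z', ζ') ↦ (z, ζ, z', -ζ')`. -/
def sConormal (g : Metric (𝓡 m) M) : Set (Cotangent m M × Cotangent m M) :=
  {q | q.1 = ⟨q.2.proj, -q.2.snd⟩ ∧ energy g q.2 = 0}

/-- The flow-out of the unit conormal bundle of the diagonal. -/
def LamConormal (g : Metric (𝓡 m) M) : Set (Cotangent m M × Cotangent m M) :=
  flowout g (sConormal g)

end Lagrangian

end AHM

end

/-! The argument lives on the cotangent bundle and follows the flow exp(tH_p) and its effect on the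
Liouville form θ = ζ dz.

Completeness. Since |d log ρ|_g = |dρ|_{ρ²g} is bounded on the compact manifold X, log ρ is
Lipschitz for the distance of g. Balls of finite radius therefore stay away from ∂X and have compact
closure (`IsAsymptoticallyHyperbolic.properMetric`). Energy conservation then confines integral
curves to compact disc bundles, so the flow exists for all times and is smooth
(`exists_isMIntegralCurve`, `contMDiff_flow`).

The Liouville form. Cartan's formula and conservation of p give, for a family F of covectors, the
pull-back of θ under (t, u) ↦ exp(tH_p)F(u) as |F|² dt + F*θ + t d(p∘F) (`liouville_flow`). At fixed
time t = 1 this is the first variation formula: d(p∘F) is the end covector applied to the variation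
of the endpoint minus the initial covector applied to the variation of the initial point. It yields
the Gauss lemma and later the differential of r. On unit covectors it says θ_end - θ_start = dt. The
right side is closed, so the flow-out is Lagrangian.

Minimization. The Gauss lemma shows that short geodesics minimize (`exists_isNormalNhd`), and the
Hopf-Rinow argument produces a minimizing geodesic between any two points
(`exists_endp_eq_of_properMetric`). Under geodesic convexity it is the only geodesic, so every
geodesic minimizes on all of its length, and q ↦ (initial point, endpoint) is a bijection from T*M
to M × M.

No conjugate points. A smooth bijection may have critical points, and excluding them is the
essential step (`GeodesicallyConvex.isNondeg`). Geodesics minimize beyond their endpoints, so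
triangle inequalities through points slightly before and slightly beyond the endpoint squeeze the
squared distance from a fixed point between two paraboloids touching at the endpoint, with slope the
end covector. The bounds are uniform along a family of geodesics. If the endpoints are stationary to
first order, comparing the expansions makes the end covectors stationary as well
(`hasDerivAt_slope`). Running the smooth flow backwards, the initial covectors are stationary, so
the exponential map has no critical point.

Conclusion. The exponential map is a diffeomorphism T*M → M × M. Hence r = √(2p + 1), evaluated at
the initial covector, is smooth off the diagonal, and first variation identifies its differential
with the pair of end and initial covectors. Time on the flow-out equals r of the two base points, a
continuous function, so time together with coordinates of the unit sphere bundle gives half-space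
charts for the subspace topology. The map `smulCov c` with c = 1 or c = -1 treats both sign
conventions at once (`isLagrangianSubmanifold_flowGraph`). -/

noncomputable section


namespace AHM

/-! ### Inverse function theorem with a smooth inverse -/

section InverseFunction

variable {E F : Type*} [NormedAddCommGroup E] [NormedSpace ℝ E] [CompleteSpace E]
  [NormedAddCommGroup F] [NormedSpace ℝ F]

/-- Inverse function theorem, with an inverse which is smooth on its whole domain. -/
theorem exists_openPartialHomeomorph_contDiffOn {f : E → F} {U : Set E} (hU : IsOpen U)
    (hf : ContDiffOn ℝ ∞ f U) {a : E} (ha : a ∈ U) (f' : E ≃L[ℝ] F)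
    (hf' : HasFDerivAt f (f' : E →L[ℝ] F) a) :
    ∃ e : OpenPartialHomeomorph E F, a ∈ e.source ∧ e.source ⊆ U ∧ (∀ x, e x = f x) ∧
      ContDiffOn ℝ ∞ e.symm e.target := by
  have hfa : ContDiffAt ℝ ∞ f a := hf.contDiffAt (hU.mem_nhds ha)
  have hn : (∞ : WithTop ℕ∞) ≠ 0 := by simp
  let e₀ := hfa.toOpenPartialHomeomorph f hf' hn
  have hcont : ContinuousOn (fderiv ℝ f) U :=
    hf.continuousOn_fderiv_of_isOpen hU (by exact_mod_cast le_top)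
  -- Invertible operators form an open set, so the inverse is smooth at every point of a whole
  -- neighbourhood and not only at the image of `a`.
  let V : Set E := U ∩ fderiv ℝ f ⁻¹' range ((↑) : (E ≃L[ℝ] F) → E →L[ℝ] F)
  have hV : IsOpen V := hcont.isOpen_inter_preimage hU ContinuousLinearEquiv.isOpen
  have haV : a ∈ V := ⟨ha, f', hf'.fderiv.symm⟩
  refine ⟨e₀.restrOpen V hV, ⟨hfa.mem_toOpenPartialHomeomorph_source hf' hn, haV⟩,
    fun x hx => hx.2.1, fun x => rfl, ?_⟩
  intro y hy
  apply ContDiffAt.contDiffWithinAt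
  have hmem : (e₀.restrOpen V hV).symm y ∈ (e₀.restrOpen V hV).source :=
    (e₀.restrOpen V hV).map_target hy
  obtain ⟨g', hg'⟩ := hmem.2.2
  have hcd : ContDiffAt ℝ ∞ f ((e₀.restrOpen V hV).symm y) :=
    hf.contDiffAt (hU.mem_nhds hmem.2.1)
  refine (e₀.restrOpen V hV).contDiffAt_symm hy (f₀' := g') ?_ hcd
  rw [hg']
  exact (hcd.differentiableAt hn).hasFDerivAt

end InverseFunction

/-! ### Smoothness of composition on spaces of continuous curves -/

section Omega

set_option synthInstance.maxHeartbeats 200000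

universe u

variable {T : Type*} [TopologicalSpace T] [CompactSpace T]

/-- Pointwise application of a continuous family of operators to a continuous family of vectors. -/
def applyFamily (T : Type*) [TopologicalSpace T] [CompactSpace T] (Z W : Type u)
    [NormedAddCommGroup Z] [NormedSpace ℝ Z] [NormedAddCommGroup W] [NormedSpace ℝ W] :
    C(T, Z →L[ℝ] W) →L[ℝ] C(T, Z) →L[ℝ] C(T, W) :=
  LinearMap.mkContinuous₂
    (LinearMap.mk₂ ℝ (fun (A : C(T, Z →L[ℝ] W)) (h : C(T, Z)) =>
        (⟨fun t => A t (h t), by fun_prop⟩ : C(T, W)))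
      (fun _ _ _ => by ext; simp) (fun _ _ _ => by ext; simp)
      (fun _ _ _ => by ext; simp) (fun _ _ _ => by ext; simp)) 1 (by
    intro A h
    rw [ContinuousMap.norm_le _ (by positivity)]
    intro t
    calc ‖A t (h t)‖ ≤ ‖A t‖ * ‖h t‖ := (A t).le_opNorm _
      _ ≤ 1 * ‖A‖ * ‖h‖ := by
        rw [one_mul]
        gcongr
        · exact A.norm_coe_le_norm t
        · exact h.norm_coe_le_norm t)

/-- The range of `u` is compact, so `f'` is uniformly continuous along it. One radius `δ` serves all
`t`, and the mean value inequality on balls of that radius bounds the Taylor remainder uniformly in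
`t`. -/
theorem hasFDerivAt_postcomp {Z W : Type u}
    [NormedAddCommGroup Z] [NormedSpace ℝ Z] [NormedAddCommGroup W] [NormedSpace ℝ W]
    (f : C(Z, W)) (f' : C(Z, Z →L[ℝ] W)) (hf : ∀ z, HasFDerivAt f (f' z) z) (u : C(T, Z)) :
    HasFDerivAt (fun u : C(T, Z) => f.comp u) (applyFamily T Z W (f'.comp u)) u := by
  rw [hasFDerivAt_iff_isLittleO_nhds_zero, Asymptotics.isLittleO_iff]
  intro c hc
  have hcomp : IsCompact (range u) := isCompact_range u.continuous
  have hunif := hcomp.uniformContinuousAt_of_continuousAt f'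
    (fun z _ => f'.continuous.continuousAt) (Metric.dist_mem_uniformity hc)
  obtain ⟨δ, hδ, hδ'⟩ := Metric.mem_uniformity_dist.1 hunif
  filter_upwards [Metric.ball_mem_nhds (0 : C(T, Z)) hδ] with h hh
  rw [ContinuousMap.norm_le _ (by positivity)]
  intro t
  have hht : ‖h t‖ ≤ ‖h‖ := h.norm_coe_le_norm t
  have hlt : ‖h‖ < δ := by simpa using hh
  have key : ‖f (u t + h t) - f (u t) - f' (u t) (u t + h t - u t)‖ ≤ c * ‖u t + h t - u t‖ := by
    refine Convex.norm_image_sub_le_of_norm_hasFDerivWithin_le' (s := Metric.ball (u t) δ)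
      (fun z _ => (hf z).hasFDerivWithinAt) ?_ (convex_ball _ _) (Metric.mem_ball_self hδ) ?_
    · intro z hz
      have := hδ' (a := u t) (b := z) (by rw [dist_comm]; exact hz) (mem_range_self t)
      have h2 : dist (f' (u t)) (f' z) < c := this
      rw [dist_comm, dist_eq_norm] at h2
      exact h2.le
    · simp only [Metric.mem_ball, dist_self_add_left]
      exact hht.trans_lt hlt
  simp only [add_sub_cancel_left] at key
  calc _ = ‖f (u t + h t) - f (u t) - f' (u t) (h t)‖ := rfl
    _ ≤ c * ‖h t‖ := key
    _ ≤ c * ‖h‖ := by gcongr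

/-- The derivative is a bounded linear map, `applyFamily`, after composition with `fderiv ℝ f`, so
each order of differentiability reduces to the preceding one. The target `W` is quantified inside
the induction because it changes to `Z →L[ℝ] W`; `Z` and `W` share a universe to permit this. -/
theorem contDiff_postcomp {Z : Type u} [NormedAddCommGroup Z] [NormedSpace ℝ Z] (n : ℕ) :
    ∀ {W : Type u} [NormedAddCommGroup W] [NormedSpace ℝ W] (f : C(Z, W)),
      ContDiff ℝ ∞ f → ContDiff ℝ n (fun u : C(T, Z) => f.comp u) := by
  induction n with
  | zero =>
    intro W _ _ f _
    rw [Nat.cast_zero, contDiff_zero]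
    exact ContinuousMap.continuous_postcomp f
  | succ n ih =>
    intro W _ _ f hf
    have hf' : ContDiff ℝ ∞ (fderiv ℝ f) := hf.fderiv_right (by simp)
    let f' : C(Z, Z →L[ℝ] W) := ⟨fderiv ℝ f, hf'.continuous⟩
    have hd := hasFDerivAt_postcomp (T := T) f f'
      (fun z => (hf.contDiffAt.differentiableAt (by simp)).hasFDerivAt)
    rw [Nat.cast_succ, contDiff_succ_iff_hasFDerivAt]
    refine ⟨fun u => applyFamily T Z W (f'.comp u), ?_, hd⟩
    exact (applyFamily T Z W).contDiff.comp (ih f' hf')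

end Omega

end AHM

end

noncomputable section


namespace AHM

/-! ### Local flows of smooth vector fields on a vector space -/

section LocalFlow

set_option synthInstance.maxHeartbeats 200000

variable {Z : Type*} [NormedAddCommGroup Z] [NormedSpace ℝ Z]

/-- The interval on which the rescaled integral equation is solved. -/
abbrev UnitIcc : Type := Icc (-1 : ℝ) 1

/-- Retraction of the line to `[-1, 1]`. -/
abbrev toUnitIcc : ℝ → UnitIcc := projIcc (-1) 1 (by norm_num)

theorem coe_toUnitIcc {s : ℝ} (hs : s ∈ Icc (-1 : ℝ) 1) : (toUnitIcc s : ℝ) = s :=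
  congrArg Subtype.val (projIcc_of_mem _ hs)

theorem continuous_toUnitIcc : Continuous toUnitIcc := continuous_projIcc

/-- The primitive vanishing at `0`, as an operator on continuous curves. -/
def primitiveOp (Z : Type*) [NormedAddCommGroup Z] [NormedSpace ℝ Z] :
    C(UnitIcc, Z) →L[ℝ] C(UnitIcc, Z) :=
  LinearMap.mkContinuous
    { toFun := fun v => ⟨fun s => ∫ τ in (0 : ℝ)..s, v (toUnitIcc τ), by
          have h : Continuous fun τ => v (toUnitIcc τ) := v.continuous.comp continuous_toUnitIcc
          exact (intervalIntegral.continuous_primitive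
            (fun a b => h.intervalIntegrable a b) 0).comp continuous_subtype_val⟩
      map_add' := fun v w => by
        ext s
        have h (v : C(UnitIcc, Z)) : Continuous fun τ => v (toUnitIcc τ) :=
          v.continuous.comp continuous_toUnitIcc
        exact intervalIntegral.integral_add ((h v).intervalIntegrable _ _)
          ((h w).intervalIntegrable _ _)
      map_smul' := fun c v => by
        ext s
        exact intervalIntegral.integral_smul c _ } 1 (by
    intro v
    rw [ContinuousMap.norm_le _ (by positivity)]
    intro s
    have h1 : ‖∫ τ in (0 : ℝ)..s, v (toUnitIcc τ)‖ ≤ ‖v‖ * |(s : ℝ) - 0| :=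
      intervalIntegral.norm_integral_le_of_norm_le_const (fun τ _ => v.norm_coe_le_norm _)
    have h2 : |(s : ℝ) - 0| ≤ 1 := by
      rw [sub_zero]; exact abs_le.2 s.2
    calc _ ≤ ‖v‖ * |(s : ℝ) - 0| := h1
      _ ≤ 1 * ‖v‖ := by rw [mul_comm]; gcongr)

/-- Constant curves. -/
def constOp (Z : Type*) [NormedAddCommGroup Z] [NormedSpace ℝ Z] : Z →L[ℝ] C(UnitIcc, Z) :=
  LinearMap.mkContinuous
    { toFun := fun z => ContinuousMap.const _ z
      map_add' := fun _ _ => rfl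
      map_smul' := fun _ _ => rfl } 1 (by
    intro v
    rw [ContinuousMap.norm_le _ (by positivity)]
    intro s
    rw [one_mul]
    exact le_rfl)

/-- Evaluation of curves. -/
def evalOp (Z : Type*) [NormedAddCommGroup Z] [NormedSpace ℝ Z] (s : UnitIcc) :
    C(UnitIcc, Z) →L[ℝ] Z :=
  ContinuousMap.evalCLM ℝ s

/-- The map whose zeros in the last component are the solutions of `u' = t f(u)`, `u 0 = x`. -/
def odeMap (f : C(Z, Z)) (p : ℝ × Z × C(UnitIcc, Z)) : ℝ × Z × C(UnitIcc, Z) :=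
  (p.1, p.2.1, p.2.2 - constOp Z p.2.1 - p.1 • primitiveOp Z (f.comp p.2.2))

theorem contDiff_odeMap (f : C(Z, Z)) (hf : ContDiff ℝ ∞ f) : ContDiff ℝ ∞ (odeMap f) := by
  have hN : ContDiff ℝ ∞ (fun u : C(UnitIcc, Z) => f.comp u) :=
    contDiff_infty.2 fun n => contDiff_postcomp n f hf
  have h2 : ContDiff ℝ ∞ (fun p : ℝ × Z × C(UnitIcc, Z) => primitiveOp Z (f.comp p.2.2)) :=
    (primitiveOp Z).contDiff.comp (hN.comp (contDiff_snd.comp contDiff_snd))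
  have h3 : ContDiff ℝ ∞ (fun p : ℝ × Z × C(UnitIcc, Z) => constOp Z p.2.1) :=
    (constOp Z).contDiff.comp (contDiff_fst.comp contDiff_snd)
  unfold odeMap
  exact contDiff_fst.prodMk ((contDiff_fst.comp contDiff_snd).prodMk
    (((contDiff_snd.comp contDiff_snd).sub h3).sub (contDiff_fst.smul h2)))

/-- The derivative of `odeMap f` at time zero. -/
def odeEquiv (b : C(UnitIcc, Z)) :
    (ℝ × Z × C(UnitIcc, Z)) ≃L[ℝ] (ℝ × Z × C(UnitIcc, Z)) :=
  ContinuousLinearEquiv.equivOfInverse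
    ((ContinuousLinearMap.fst ℝ _ _).prod
      (((ContinuousLinearMap.fst ℝ _ _).comp (ContinuousLinearMap.snd ℝ _ _)).prod
        ((ContinuousLinearMap.snd ℝ _ _).comp (ContinuousLinearMap.snd ℝ _ _) -
          (constOp Z).comp ((ContinuousLinearMap.fst ℝ _ _).comp (ContinuousLinearMap.snd ℝ _ _)) -
          (ContinuousLinearMap.fst ℝ _ _).smulRight b)))
    ((ContinuousLinearMap.fst ℝ _ _).prod
      (((ContinuousLinearMap.fst ℝ _ _).comp (ContinuousLinearMap.snd ℝ _ _)).prod
        ((ContinuousLinearMap.snd ℝ _ _).comp (ContinuousLinearMap.snd ℝ _ _) +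
          (constOp Z).comp ((ContinuousLinearMap.fst ℝ _ _).comp (ContinuousLinearMap.snd ℝ _ _)) +
          (ContinuousLinearMap.fst ℝ _ _).smulRight b)))
    (fun p => by
      obtain ⟨t, x, u⟩ := p
      simp
      abel)
    (fun p => by
      obtain ⟨t, x, u⟩ := p
      simp
      abel)

/-- At time zero the factor in front of the integral vanishes, so the nonlinear term contributes
only through its derivative in `t`. The derivative is then triangular, and invertible without any
smallness of `f`. -/
theorem hasFDerivAt_odeMap (f : C(Z, Z)) (hf : ContDiff ℝ ∞ f) (x : Z) (u : C(UnitIcc, Z)) :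
    HasFDerivAt (odeMap f)
      (odeEquiv (primitiveOp Z (f.comp u)) :
        (ℝ × Z × C(UnitIcc, Z)) →L[ℝ] (ℝ × Z × C(UnitIcc, Z))) (0, x, u) := by
  have hN : ContDiff ℝ 1 (fun u : C(UnitIcc, Z) => f.comp u) := contDiff_postcomp 1 f hf
  have h2 : ContDiff ℝ 1 (fun p : ℝ × Z × C(UnitIcc, Z) => primitiveOp Z (f.comp p.2.2)) :=
    (primitiveOp Z).contDiff.comp (hN.comp (contDiff_snd.comp contDiff_snd))
  have h3 := (h2.contDiffAt (x := (0, x, u))).differentiableAt (by simp) |>.hasFDerivAt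
  have hfst : HasFDerivAt (fun p : ℝ × Z × C(UnitIcc, Z) => p.1)
    (ContinuousLinearMap.fst ℝ _ _) (0, x, u) := hasFDerivAt_fst
  have hsnd : HasFDerivAt (fun p : ℝ × Z × C(UnitIcc, Z) => p.2)
    (ContinuousLinearMap.snd ℝ _ _) (0, x, u) := hasFDerivAt_snd
  have h4 := hfst.smul h3
  have h5 := (hsnd.snd.sub ((constOp Z).hasFDerivAt.comp (0, x, u) hsnd.fst)).sub h4
  have h6 := hfst.prodMk (hsnd.fst.prodMk h5)
  refine h6.congr_fderiv ?_
  ext p <;> simp [odeEquiv]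

/-- Inverting `odeMap` near `(0, x₀, const x₀)` gives solutions of `u' = t f(u)` on `[-1, 1]` that
are smooth in the parameters `(t, x)`. Uniqueness, from the Lipschitz bound, shows that changing the
parameter `t` amounts to changing the speed along the solution, so a parameter-dependent solution
evaluated at a fixed time is the flow. -/
theorem contDiffOn_flow_of_lipschitz [CompleteSpace Z] {f : Z → Z} (hf : ContDiff ℝ ∞ f)
    {K : NNReal} (hK : LipschitzWith K f) (x₀ : Z) :
    ∃ φ : ℝ × Z → Z, ∃ ε > (0 : ℝ), ∃ V : Set Z, IsOpen V ∧ x₀ ∈ V ∧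
      ContDiffOn ℝ ∞ φ (Ioo (-ε) ε ×ˢ V) ∧ ∀ x ∈ V, φ (0, x) = x ∧
        ∀ t ∈ Ioo (-ε) ε, HasDerivAt (fun t => φ (t, x)) (f (φ (t, x))) t := by
  let fc : C(Z, Z) := ⟨f, hf.continuous⟩
  obtain ⟨e, hae, -, he, hsymm⟩ := exists_openPartialHomeomorph_contDiffOn isOpen_univ
    (contDiff_odeMap fc hf).contDiffOn (mem_univ (0, x₀, constOp Z x₀)) _
    (hasFDerivAt_odeMap fc hf x₀ (constOp Z x₀))
  have hmem : ((0 : ℝ), x₀, (0 : C(UnitIcc, Z))) ∈ e.target := by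
    have := e.map_source hae
    rw [he] at this
    simpa [odeMap] using this
  let ι : ℝ × Z → ℝ × Z × C(UnitIcc, Z) := fun p => (p.1, p.2, 0)
  have hι : ContDiff ℝ ∞ ι := contDiff_fst.prodMk (contDiff_snd.prodMk contDiff_const)
  have hnhds : ι ⁻¹' e.target ∈ 𝓝 ((0 : ℝ), x₀) :=
    hι.continuous.continuousAt.preimage_mem_nhds (e.open_target.mem_nhds hmem)
  obtain ⟨δ, hδ, hball⟩ := Metric.mem_nhds_iff.1 hnhds
  let u : ℝ → Z → C(UnitIcc, Z) := fun t x => (e.symm (t, x, 0)).2.2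
  have hsub : ∀ t x, |t| < δ → x ∈ Metric.ball x₀ δ → (t, x, (0 : C(UnitIcc, Z))) ∈ e.target := by
    intro t x ht hx
    refine hball (?_ : (t, x) ∈ Metric.ball ((0 : ℝ), x₀) δ)
    rw [Metric.mem_ball, Prod.dist_eq, max_lt_iff]
    exact ⟨by simpa using ht, hx⟩
  have hu : ∀ t x, |t| < δ → x ∈ Metric.ball x₀ δ →
      ∀ s : UnitIcc, u t x s = x + t • ∫ τ in (0 : ℝ)..s, f (u t x (toUnitIcc τ)) := by
    intro t x ht hx s
    have h := e.right_inv (hsub t x ht hx)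
    rw [he] at h
    have h1 : (e.symm (t, x, 0)).1 = t := congrArg Prod.fst h
    have h2 : (e.symm (t, x, 0)).2.1 = x := congrArg (fun p => p.2.1) h
    have h3 := congrArg (fun p => p.2.2) h
    simp only [odeMap, h1, h2] at h3
    rw [sub_sub, sub_eq_zero] at h3
    have h4 := congrArg (fun v : C(UnitIcc, Z) => v s) h3
    exact h4
  let w : ℝ → Z → ℝ → Z := fun t x s => u t x (toUnitIcc s)
  have hw0 : ∀ t x, |t| < δ → x ∈ Metric.ball x₀ δ → w t x 0 = x := by
    intro t x ht hx
    have h0 : ((toUnitIcc 0 : UnitIcc) : ℝ) = 0 := coe_toUnitIcc (by norm_num)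
    change u t x (toUnitIcc 0) = x
    rw [hu t x ht hx, h0]
    simp
  have hw : ∀ t x, |t| < δ → x ∈ Metric.ball x₀ δ → ∀ s ∈ Ioo (-1 : ℝ) 1,
      HasDerivAt (w t x) (t • f (w t x s)) s := by
    intro t x ht hx s hs
    have hc : Continuous fun τ => f (w t x τ) :=
      hf.continuous.comp ((u t x).continuous.comp continuous_toUnitIcc)
    have hd : HasDerivAt (fun s => x + t • ∫ τ in (0 : ℝ)..s, f (w t x τ)) (t • f (w t x s)) s :=
      ((hc.integral_hasStrictDerivAt 0 s).hasDerivAt.const_smul t).const_add x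
    refine hd.congr_of_eventuallyEq ?_
    filter_upwards [Ioo_mem_nhds hs.1 hs.2] with r hr
    have h0 : ((toUnitIcc r : UnitIcc) : ℝ) = r := coe_toUnitIcc ⟨hr.1.le, hr.2.le⟩
    change u t x (toUnitIcc r) = _
    rw [hu t x ht hx, h0]
  -- Both sides solve `y' = (c t) f(y)` with value `x` at time zero.
  have hscale : ∀ t x c, |t| < δ → x ∈ Metric.ball x₀ δ → |c| ≤ 1 → ∀ s ∈ Ioo (-1 : ℝ) 1,
      w (c * t) x s = w t x (c * s) := by
    intro t x c ht hx hc
    have hct : |c * t| < δ := by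
      rw [abs_mul]
      calc |c| * |t| ≤ 1 * |t| := by gcongr
        _ < δ := by rwa [one_mul]
    have hcs : ∀ s ∈ Ioo (-1 : ℝ) 1, c * s ∈ Ioo (-1 : ℝ) 1 := by
      intro s hs
      have : |c * s| < 1 := by
        rw [abs_mul]
        calc |c| * |s| ≤ 1 * |s| := by gcongr
          _ < 1 := by rw [one_mul]; exact abs_lt.2 hs
      exact abs_lt.1 this
    have := ODE_solution_unique_of_mem_Ioo (v := fun _ z => (c * t) • f z) (s := fun _ => univ)
      (K := ‖c * t‖₊ * K) (a := -1) (b := 1) (t₀ := 0) (f := w (c * t) x)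
      (g := fun s => w t x (c * s))
      (fun _ _ => ((lipschitzWith_smul (c * t)).comp hK).lipschitzOnWith) (by norm_num)
      (fun s hs => ⟨hw _ x hct hx s hs, mem_univ _⟩)
      (fun s hs => ⟨by
        have h := (hw t x ht hx (c * s) (hcs s hs)).scomp s ((hasDerivAt_id s).const_mul c)
        simpa [Function.comp_def, smul_smul] using h, mem_univ _⟩)
      (by rw [hw0 _ x hct hx, mul_zero, hw0 t x ht hx])
    exact this
  have hT : |δ / 2| < δ := by rw [abs_of_pos (by positivity)]; linarith
  -- Evaluating at `1/2` keeps the time inside the open interval on which `w` is differentiable. The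
  -- parameter `2 t` is `4 t / δ` times `δ / 2`, and the ratio has absolute value at most one
  -- because `|t| < δ / 4`.
  have hφ : ∀ t ∈ Ioo (-(δ / 4)) (δ / 4), ∀ x ∈ Metric.ball x₀ δ,
      w (2 * t) x (1 / 2) = w (δ / 2) x ((2 / δ) * t) := by
    intro t ht x hx
    have h1 : 2 * t = (4 / δ * t) * (δ / 2) := by field_simp; ring
    rw [h1, hscale (δ / 2) x _ hT hx _ (1 / 2) (by norm_num)]
    · congr 1; ring
    · rw [abs_mul, abs_of_pos (by positivity)]
      have := abs_lt.2 ht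
      rw [div_mul_eq_mul_div, div_le_one hδ]
      linarith
  refine ⟨fun p => w (2 * p.1) p.2 (1 / 2), δ / 4, by positivity, Metric.ball x₀ δ,
    Metric.isOpen_ball, Metric.mem_ball_self hδ, ?_, ?_⟩
  · have h1 : ContDiffOn ℝ ∞ (fun p : ℝ × Z => e.symm (2 * p.1, p.2, 0))
        (Ioo (-(δ / 4)) (δ / 4) ×ˢ Metric.ball x₀ δ) := by
      refine hsymm.comp (f := fun p : ℝ × Z => (2 * p.1, p.2, (0 : C(UnitIcc, Z)))) ?_ ?_
      · exact ((contDiff_const.mul contDiff_fst).prodMk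
          (contDiff_snd.prodMk contDiff_const)).contDiffOn
      · rintro ⟨t, x⟩ ⟨ht, hx⟩
        refine hsub _ _ ?_ hx
        have := abs_lt.2 ht
        rw [abs_mul, abs_two]
        dsimp only at this ⊢
        linarith
    exact (evalOp Z (toUnitIcc (1 / 2))).contDiff.comp_contDiffOn
      ((contDiff_snd.comp contDiff_snd).comp_contDiffOn h1)
  · intro x hx
    constructor
    · have := hφ 0 (by constructor <;> linarith) x hx
      simp only [mul_zero] at this ⊢
      rw [this, hw0 _ x hT hx]
    · intro t ht
      have hmem : (2 / δ) * t ∈ Ioo (-1 : ℝ) 1 := by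
        have := abs_lt.2 ht
        refine abs_lt.1 ?_
        rw [abs_mul, abs_of_pos (by positivity), div_mul_eq_mul_div, div_lt_one hδ]
        linarith
      have hd := (hw (δ / 2) x hT hx _ hmem).scomp t ((hasDerivAt_id t).const_mul (2 / δ))
      have hd' : HasDerivAt (fun t => w (δ / 2) x ((2 / δ) * t))
          (f (w (δ / 2) x ((2 / δ) * t))) t := by
        have h1 : (2 / δ) * (δ / 2) = 1 := by field_simp
        simpa [Function.comp_def, smul_smul, h1] using hd
      dsimp only
      rw [hφ t ht x hx]
      refine hd'.congr_of_eventuallyEq ?_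
      filter_upwards [Ioo_mem_nhds ht.1 ht.2] with r hr
      exact hφ r hr x hx

/-- A smooth vector field has a smooth local flow. -/
theorem exists_contDiffOn_localFlow [FiniteDimensional ℝ Z] {X : Z → Z} {U : Set Z}
    (hU : IsOpen U) (hX : ContDiffOn ℝ ∞ X U) {x₀ : Z} (hx₀ : x₀ ∈ U) :
    ∃ φ : ℝ × Z → Z, ∃ ε > (0 : ℝ), ∃ V : Set Z, IsOpen V ∧ x₀ ∈ V ∧
      ContDiffOn ℝ ∞ φ (Ioo (-ε) ε ×ˢ V) ∧ ∀ x ∈ V, φ (0, x) = x ∧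
        ∀ t ∈ Ioo (-ε) ε, φ (t, x) ∈ U ∧ HasDerivAt (fun t => φ (t, x)) (X (φ (t, x))) t := by
  obtain ⟨r, hr, hrU⟩ := Metric.mem_nhds_iff.1 (hU.mem_nhds hx₀)
  -- Cutting off makes the field globally Lipschitz. On the ball of radius `r / 4`, where the new
  -- flow remains for short times, `χ` equals one and the two fields agree.
  let χ : ContDiffBump x₀ := ⟨r / 4, r / 2, by positivity, by linarith⟩
  let f : Z → Z := fun z => χ z • X z
  have hsupp : tsupport χ ⊆ U := by
    rw [χ.tsupport_eq]
    exact (Metric.closedBall_subset_ball (by change r / 2 < r; linarith)).trans hrU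
  have hf : ContDiff ℝ ∞ f := by
    rw [contDiff_iff_contDiffAt]
    intro z
    by_cases hz : z ∈ tsupport χ
    · exact χ.contDiffAt.smul (hX.contDiffAt (hU.mem_nhds (hsupp hz)))
    · have : f =ᶠ[𝓝 z] fun _ => 0 := by
        filter_upwards [notMem_tsupport_iff_eventuallyEq.1 hz] with y hy
        simp [f, hy]
      exact contDiffAt_const.congr_of_eventuallyEq this
  have hcs : HasCompactSupport f := χ.hasCompactSupport.smul_right
  obtain ⟨K, hK⟩ := hf.lipschitzWith_of_hasCompactSupport hcs (by simp)
  obtain ⟨φ, ε, hε, V, hV, hxV, hφ, hφ'⟩ := contDiffOn_flow_of_lipschitz hf hK x₀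
  have hcont : ContinuousAt φ (0, x₀) :=
    (hφ.contDiffAt ((isOpen_Ioo.prod hV).mem_nhds ⟨by simpa using hε, hxV⟩)).continuousAt
  have hnhds : φ ⁻¹' Metric.ball x₀ (r / 4) ∈ 𝓝 ((0 : ℝ), x₀) := by
    refine hcont.preimage_mem_nhds (Metric.isOpen_ball.mem_nhds ?_)
    rw [(hφ' x₀ hxV).1]
    exact Metric.mem_ball_self (by positivity)
  obtain ⟨A, hA, B, hB, hAB⟩ := mem_nhds_prod_iff.1 hnhds
  obtain ⟨ε', hε', hA'⟩ := Metric.mem_nhds_iff.1 hA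
  obtain ⟨B', hB', hB'o, hxB'⟩ := mem_nhds_iff.1 hB
  refine ⟨φ, min ε ε', lt_min hε hε', V ∩ B', hV.inter hB'o, ⟨hxV, hxB'⟩, ?_, ?_⟩
  · exact hφ.mono (prod_mono (Ioo_subset_Ioo (neg_le_neg (min_le_left _ _)) (min_le_left _ _))
      inter_subset_left)
  · intro x hx
    refine ⟨(hφ' x hx.1).1, fun t ht => ?_⟩
    have hball : φ (t, x) ∈ Metric.ball x₀ (r / 4) := by
      refine hAB ⟨hA' ?_, hB' hx.2⟩
      rw [Metric.mem_ball, dist_zero_right, Real.norm_eq_abs]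
      exact (abs_lt.2 ht).trans_le (min_le_right _ _)
    refine ⟨hrU (Metric.ball_subset_ball (by linarith) hball), ?_⟩
    have h := (hφ' x hx.1).2 t
      ⟨(neg_le_neg (min_le_left _ _)).trans_lt ht.1, ht.2.trans_le (min_le_left _ _)⟩
    have h1 : χ (φ (t, x)) = 1 := χ.one_of_mem_closedBall (Metric.ball_subset_closedBall hball)
    simpa [f, h1] using h

end LocalFlow

end AHM

end

noncomputable section

set_option synthInstance.maxHeartbeats 200000

namespace AHM

/-! ### Linear symplectic algebra and the Liouville form in coordinates -/

section ModelSymplectic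

variable {m : ℕ} {Z : Type*} [NormedAddCommGroup Z] [NormedSpace ℝ Z]

/-- The exterior derivative of the pulled back Liouville form is the pulled back symplectic form. -/
theorem fderiv_liouville_antisymm {F : Z → CotModel m} {u : Z} (hF : ContDiffAt ℝ 2 F u) (v w : Z) :
    fderiv ℝ (fun u => (F u).2 ((fderiv ℝ F u v).1)) u w -
      fderiv ℝ (fun u => (F u).2 ((fderiv ℝ F u w).1)) u v =
    modelForm (fderiv ℝ F u w) (fderiv ℝ F u v) := by
  have hF1 : HasFDerivAt F (fderiv ℝ F u) u := (hF.differentiableAt (by simp)).hasFDerivAt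
  have hF2 : HasFDerivAt (fderiv ℝ F) (fderiv ℝ (fderiv ℝ F) u) u :=
    ((hF.fderiv_right (m := 1) (by norm_num)).differentiableAt (by simp)).hasFDerivAt
  have hd (v : Z) : HasFDerivAt (fun u => (F u).2 ((fderiv ℝ F u v).1)) _ u :=
    hF1.snd.clm_apply (hF2.clm_apply (hasFDerivAt_const v u)).fst
  -- Second derivatives of `F` cancel by symmetry; only the terms in which the covector is
  -- differentiated survive.
  have hsymm : fderiv ℝ (fderiv ℝ F) u w v = fderiv ℝ (fderiv ℝ F) u v w :=
    (hF.isSymmSndFDerivAt (by simp)) w v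
  rw [(hd v).fderiv, (hd w).fderiv]
  simp [modelForm, hsymm]

/-- Take the exterior derivative of both sides: the term `l v` does not depend on the point and
disappears. This is how identities between Liouville forms become identities between symplectic
forms. -/
theorem modelForm_eq_of_liouville_eq {F₁ F₂ : Z → CotModel m} {u : Z} (hF₁ : ContDiffAt ℝ 2 F₁ u)
    (hF₂ : ContDiffAt ℝ 2 F₂ u) (c : ℝ) (l : Z → ℝ)
    (h : ∀ᶠ u' in 𝓝 u, ∀ v, (F₁ u').2 ((fderiv ℝ F₁ u' v).1) =
      c * (F₂ u').2 ((fderiv ℝ F₂ u' v).1) + l v) (v w : Z) :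
    modelForm (fderiv ℝ F₁ u v) (fderiv ℝ F₁ u w) =
      c * modelForm (fderiv ℝ F₂ u v) (fderiv ℝ F₂ u w) := by
  have hF1 : HasFDerivAt F₂ (fderiv ℝ F₂ u) u := (hF₂.differentiableAt (by simp)).hasFDerivAt
  have hF2 : HasFDerivAt (fderiv ℝ F₂) (fderiv ℝ (fderiv ℝ F₂) u) u :=
    ((hF₂.fderiv_right (m := 1) (by norm_num)).differentiableAt (by simp)).hasFDerivAt
  have key (v : Z) : fderiv ℝ (fun u => (F₁ u).2 ((fderiv ℝ F₁ u v).1)) u =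
      c • fderiv ℝ (fun u => (F₂ u).2 ((fderiv ℝ F₂ u v).1)) u := by
    have h1 : (fun u => (F₁ u).2 ((fderiv ℝ F₁ u v).1)) =ᶠ[𝓝 u]
        fun u => c * (F₂ u).2 ((fderiv ℝ F₂ u v).1) + l v := h.mono fun u' hu' => hu' v
    have hd : DifferentiableAt ℝ (fun u => (F₂ u).2 ((fderiv ℝ F₂ u v).1)) u :=
      (hF1.snd.clm_apply (hF2.clm_apply (hasFDerivAt_const v u)).fst).differentiableAt
    rw [h1.fderiv_eq, fderiv_add_const, fderiv_const_mul hd]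
  rw [← fderiv_liouville_antisymm hF₁, ← fderiv_liouville_antisymm hF₂, key v, key w]
  simp only [smul_apply, smul_eq_mul]
  ring

/-- Nondegeneracy of the symplectic form, tested on horizontal and on vertical vectors. -/
theorem eq_of_modelForm_eq {A B : CotModel m} (h : ∀ V, modelForm V A = modelForm V B) :
    A = B := by
  have h2 : A.2 = B.2 := by
    ext v
    have := h (v, 0)
    simpa [modelForm] using this
  have h1 : A.1 = B.1 := by
    ext j
    have := h (0, EuclideanSpace.proj j)
    simpa [modelForm] using this
  exact Prod.ext h1 h2

theorem modelHamilton_fst (dp : CotModel m →L[ℝ] ℝ) (α : EuclideanSpace ℝ (Fin m) →L[ℝ] ℝ) :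
    α (modelHamilton dp).1 = dp (0, α) := by
  have := modelForm_modelHamilton dp (0, α)
  simpa [modelForm] using this

theorem modelHamilton_snd (dp : CotModel m →L[ℝ] ℝ) (v : EuclideanSpace ℝ (Fin m)) :
    (modelHamilton dp).2 v = -dp (v, 0) := by
  simp [modelHamilton]

theorem contDiff_modelHamilton {n : WithTop ℕ∞} :
    ContDiff ℝ n (modelHamilton : (CotModel m →L[ℝ] ℝ) → CotModel m) := by
  refine ContDiff.prodMk (contDiff_euclidean.2 fun j => ?_) ?_
  · exact contDiff_id.clm_apply contDiff_const
  · exact (contDiff_id.clm_comp contDiff_const).neg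

end ModelSymplectic

end AHM

end

noncomputable section

set_option synthInstance.maxHeartbeats 200000

namespace AHM

/-! ### Canonical charts of the cotangent bundle -/

section CotangentInstances

variable {m : ℕ} {M : Type*} [TopologicalSpace M]
  [ChartedSpace (EuclideanSpace ℝ (Fin m)) M] [IsManifold (𝓡 m) ∞ M]

/-! The instances of the cotangent bundle, recorded because their synthesis is slow. -/

instance instTopologicalSpaceCotangent : TopologicalSpace (Cotangent m M) := inferInstance

instance instChartedSpaceCotangent :
    ChartedSpace (ModelProd (EuclideanSpace ℝ (Fin m)) (EuclideanSpace ℝ (Fin m) →L[ℝ] ℝ))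
      (Cotangent m M) := inferInstance

instance instIsManifoldCotangent : IsManifold (cotI m) ∞ (Cotangent m M) := inferInstance

instance instIsManifoldOneCotangent : IsManifold (cotI m) 1 (Cotangent m M) :=
  IsManifold.of_le (n := ∞) (by simp)

end CotangentInstances

section ChartDerivative

variable {m : ℕ} {M : Type*} [TopologicalSpace M]
  [ChartedSpace (EuclideanSpace ℝ (Fin m)) M] [IsManifold (𝓡 m) ∞ M]
  {Z : Type*} [NormedAddCommGroup Z] [NormedSpace ℝ Z]

/-- The derivative of the chart at `x₀`, at the point `x`. -/
def chartD (x₀ x : M) : EuclideanSpace ℝ (Fin m) →L[ℝ] EuclideanSpace ℝ (Fin m) :=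
  mfderiv (𝓡 m) 𝓘(ℝ, EuclideanSpace ℝ (Fin m)) (extChartAt (𝓡 m) x₀) x

/-- The inverse of the derivative of the chart at `x₀`, at the point `x`. -/
def chartDInv (x₀ x : M) : EuclideanSpace ℝ (Fin m) →L[ℝ] EuclideanSpace ℝ (Fin m) :=
  mfderivWithin 𝓘(ℝ, EuclideanSpace ℝ (Fin m)) (𝓡 m)
    (extChartAt (𝓡 m) x₀).symm (range (𝓡 m)) (extChartAt (𝓡 m) x₀ x)

theorem isManifold_one : IsManifold (𝓡 m) 1 M := IsManifold.of_le (n := ∞) (by simp)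

theorem chartD_chartDInv {x₀ x : M} (hx : x ∈ (chartAt (EuclideanSpace ℝ (Fin m)) x₀).source)
    (v : EuclideanSpace ℝ (Fin m)) : chartD x₀ x (chartDInv x₀ x v) = v := by
  have := isManifold_one (M := M) (m := m)
  have h := mfderiv_extChartAt_comp_mfderivWithin_extChartAt_symm' (I := 𝓡 m) (x := x₀) (y := x)
    (by rwa [extChartAt_source])
  exact congrArg (fun L => L v) h

theorem chartDInv_chartD {x₀ x : M} (hx : x ∈ (chartAt (EuclideanSpace ℝ (Fin m)) x₀).source)
    (v : EuclideanSpace ℝ (Fin m)) : chartDInv x₀ x (chartD x₀ x v) = v := by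
  have := isManifold_one (M := M) (m := m)
  have h := mfderivWithin_extChartAt_symm_comp_mfderiv_extChartAt' (I := 𝓡 m) (x := x₀) (y := x)
    (by rwa [extChartAt_source])
  exact congrArg (fun L => L v) h

theorem chartD_self (x : M) (v : EuclideanSpace ℝ (Fin m)) : chartD x x v = v := by
  have := isManifold_one (M := M) (m := m)
  have h := mfderiv_extChartAt_self (I := 𝓡 m) (x := x)
  exact congrArg (fun L => L v) h

/-- The derivative of a map into `M`, as a linear map between the model spaces. -/
def derivAt (F : Z → M) (u : Z) : Z →L[ℝ] EuclideanSpace ℝ (Fin m) :=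
  mfderiv 𝓘(ℝ, Z) (𝓡 m) F u

theorem hasFDerivAt_of_hasMFDerivAt {W : Type*} [NormedAddCommGroup W] [NormedSpace ℝ W]
    {f : Z → W} {u : Z} {f' : Z →L[ℝ] W} (h : HasMFDerivAt 𝓘(ℝ, Z) 𝓘(ℝ, W) f u f') :
    HasFDerivAt f f' u :=
  hasMFDerivAt_iff_hasFDerivAt.1 h

theorem hasFDerivAt_chart_comp {x₀ : M} {F : Z → M} {u : Z}
    (hF : MDifferentiableAt 𝓘(ℝ, Z) (𝓡 m) F u)
    (hx : F u ∈ (chartAt (EuclideanSpace ℝ (Fin m)) x₀).source) :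
    HasFDerivAt (fun u => extChartAt (𝓡 m) x₀ (F u)) ((chartD x₀ (F u)).comp (derivAt F u)) u := by
  have := isManifold_one (M := M) (m := m)
  refine hasFDerivAt_of_hasMFDerivAt ?_
  exact (mdifferentiableAt_extChartAt (I := 𝓡 m) hx).hasMFDerivAt.comp u hF.hasMFDerivAt

end ChartDerivative

section CotangentCharts

variable {m : ℕ} {M : Type*} [TopologicalSpace M]
  [ChartedSpace (EuclideanSpace ℝ (Fin m)) M] [IsManifold (𝓡 m) ∞ M]
  {Z : Type*} [NormedAddCommGroup Z] [NormedSpace ℝ Z]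

/-- The covector of a point of `T^*M`. -/
def covec (q : Cotangent m M) : EuclideanSpace ℝ (Fin m) →L[ℝ] ℝ := q.snd

/-- The canonical chart of `T^*M` over the chart of `M` at `q₀.proj`. -/
def cotChart (q₀ : Cotangent m M) : PartialEquiv (Cotangent m M) (CotModel m) :=
  extChartAt (cotI m) q₀

theorem mem_cotChart_source {q₀ q : Cotangent m M} : q ∈ (cotChart q₀).source ↔
    q.proj ∈ (chartAt (EuclideanSpace ℝ (Fin m)) q₀.proj).source := by
  rw [cotChart, extChartAt_source, FiberBundle.chartedSpace_chartAt]
  simp only [OpenPartialHomeomorph.trans_toPartialEquiv, PartialEquiv.trans_source,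
    OpenPartialHomeomorph.prod_toPartialHomeomorph, PartialEquiv.prod_source, mem_inter_iff, mem_preimage]
  have hb : (trivializationAt (EuclideanSpace ℝ (Fin m) →L[ℝ] ℝ)
      (fun x : M => TangentSpace (𝓡 m) x →L[ℝ] ℝ) q₀.proj).baseSet =
      (chartAt (EuclideanSpace ℝ (Fin m)) q₀.proj).source := by
    simp [hom_trivializationAt_baseSet]
  have h1 : q ∈ (trivializationAt (EuclideanSpace ℝ (Fin m) →L[ℝ] ℝ)
      (fun x : M => TangentSpace (𝓡 m) x →L[ℝ] ℝ) q₀.proj).source ↔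
      q.proj ∈ (chartAt (EuclideanSpace ℝ (Fin m)) q₀.proj).source := by
    rw [Trivialization.mem_source, hb]
  refine ⟨fun h => h1.1 h.1, fun h => ⟨h1.2 h, ?_⟩⟩
  have h2 := Trivialization.coe_fst (trivializationAt (EuclideanSpace ℝ (Fin m) →L[ℝ] ℝ)
      (fun x : M => TangentSpace (𝓡 m) x →L[ℝ] ℝ) q₀.proj) (h1.2 h)
  refine mk_mem_prod ?_ (mem_univ _)
  exact h

theorem cotChart_target (q₀ : Cotangent m M) :
    (cotChart q₀).target = (extChartAt (𝓡 m) q₀.proj).target ×ˢ univ := by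
  rw [cotChart, FiberBundle.extChartAt_target]
  congr 1
  refine inter_eq_left.2 fun x hx => ?_
  have := (extChartAt (𝓡 m) q₀.proj).map_target hx
  rw [extChartAt_source] at this
  simpa [hom_trivializationAt_baseSet] using this

theorem cotChart_apply {q₀ q : Cotangent m M} (hq : q ∈ (cotChart q₀).source) :
    cotChart q₀ q = (extChartAt (𝓡 m) q₀.proj q.proj,
      (covec q).comp (chartDInv q₀.proj q.proj)) :=
  extChartAt_cotangent q₀ q (mem_cotChart_source.1 hq)

theorem cotChart_symm_proj {q₀ : Cotangent m M} {z : CotModel m} (hz : z ∈ (cotChart q₀).target) :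
    ((cotChart q₀).symm z).proj = (extChartAt (𝓡 m) q₀.proj).symm z.1 := by
  have h1 := (cotChart q₀).map_target hz
  have h2 := cotChart_apply h1
  rw [(cotChart q₀).right_inv hz] at h2
  have h3 : z.1 = extChartAt (𝓡 m) q₀.proj ((cotChart q₀).symm z).proj := congrArg Prod.fst h2
  rw [h3]
  refine ((extChartAt (𝓡 m) q₀.proj).left_inv ?_).symm
  rw [extChartAt_source]
  exact mem_cotChart_source.1 h1

theorem cotChart_symm_covec {q₀ : Cotangent m M} {z : CotModel m} (hz : z ∈ (cotChart q₀).target) :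
    covec ((cotChart q₀).symm z) = z.2.comp (chartD q₀.proj ((cotChart q₀).symm z).proj) := by
  have h1 := (cotChart q₀).map_target hz
  have h2 := cotChart_apply h1
  rw [(cotChart q₀).right_inv hz] at h2
  have h3 : z.2 = _ := congrArg Prod.snd h2
  rw [h3]
  ext v
  simp [chartDInv_chartD (mem_cotChart_source.1 h1)]

theorem isOpen_cotChart_target (q₀ : Cotangent m M) : IsOpen (cotChart q₀).target :=
  isOpen_extChartAt_target q₀

theorem isOpen_cotChart_source (q₀ : Cotangent m M) : IsOpen (cotChart q₀).source :=
  isOpen_extChartAt_source q₀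

theorem contMDiffOn_cotChart (q₀ : Cotangent m M) :
    ContMDiffOn (cotI m) 𝓘(ℝ, CotModel m) ∞ (cotChart q₀) (cotChart q₀).source := by
  have := contMDiffOn_extChartAt (I := cotI m) (n := ∞) (x := q₀)
  rwa [← extChartAt_source (cotI m) q₀] at this

theorem contMDiffOn_cotChart_symm (q₀ : Cotangent m M) :
    ContMDiffOn 𝓘(ℝ, CotModel m) (cotI m) ∞ (cotChart q₀).symm (cotChart q₀).target :=
  contMDiffOn_extChartAt_symm (I := cotI m) (n := ∞) q₀

theorem contMDiffAt_cotChart {q₀ q : Cotangent m M} (hq : q ∈ (cotChart q₀).source) :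
    ContMDiffAt (cotI m) 𝓘(ℝ, CotModel m) ∞ (cotChart q₀) q :=
  (contMDiffOn_cotChart q₀).contMDiffAt ((isOpen_cotChart_source q₀).mem_nhds hq)

theorem contMDiffAt_cotChart_symm {q₀ : Cotangent m M} {z : CotModel m}
    (hz : z ∈ (cotChart q₀).target) :
    ContMDiffAt 𝓘(ℝ, CotModel m) (cotI m) ∞ (cotChart q₀).symm z :=
  (contMDiffOn_cotChart_symm q₀).contMDiffAt ((isOpen_cotChart_target q₀).mem_nhds hz)

theorem contMDiff_cotProj :
    ContMDiff (cotI m) (𝓡 m) ∞ (fun q : Cotangent m M => q.proj) :=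
  contMDiff_proj _

/-- The Liouville form in canonical coordinates. -/
theorem liouville_chart {q₀ : Cotangent m M} {F : Z → Cotangent m M} {u : Z}
    (hF : MDifferentiableAt 𝓘(ℝ, Z) (cotI m) F u) (hq : F u ∈ (cotChart q₀).source) (v : Z) :
    (cotChart q₀ (F u)).2 ((fderiv ℝ (fun u => cotChart q₀ (F u)) u v).1) =
      covec (F u) (derivAt (fun u => (F u).proj) u v) := by
  have hbase := mem_cotChart_source.1 hq
  have hproj : MDifferentiableAt 𝓘(ℝ, Z) (𝓡 m) (fun u => (F u).proj) u :=
    (contMDiff_cotProj.mdifferentiable (by simp) (F u)).comp u hF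
  have hd : DifferentiableAt ℝ (fun u => cotChart q₀ (F u)) u := by
    rw [← mdifferentiableAt_iff_differentiableAt]
    exact ((contMDiffAt_cotChart hq).mdifferentiableAt (by simp)).comp u hF
  have hev : (fun u => (cotChart q₀ (F u)).1) =ᶠ[𝓝 u]
      fun u => extChartAt (𝓡 m) q₀.proj (F u).proj := by
    filter_upwards [hF.continuousAt.preimage_mem_nhds ((isOpen_cotChart_source q₀).mem_nhds hq)]
      with u' hu'
    rw [cotChart_apply hu']
  have h1 : fderiv ℝ (fun u => (cotChart q₀ (F u)).1) u v =
      chartD q₀.proj (F u).proj (derivAt (fun u => (F u).proj) u v) := by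
    rw [hev.fderiv_eq, (hasFDerivAt_chart_comp hproj hbase).fderiv]
    rfl
  have h2 : (fderiv ℝ (fun u => cotChart q₀ (F u)) u v).1 =
      fderiv ℝ (fun u => (cotChart q₀ (F u)).1) u v := by
    rw [hd.hasFDerivAt.fst.fderiv]
    rfl
  -- The chart acts on covectors through the inverse of its action on vectors, so the pairing does
  -- not depend on the chart.
  rw [h2, h1, cotChart_apply hq]
  simp [chartDInv_chartD hbase]

end CotangentCharts

end AHM

end

noncomputable section

set_option synthInstance.maxHeartbeats 200000

namespace AHM

/-! ### The Hamilton field in an arbitrary canonical chart -/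

section HamiltonChart

variable {m : ℕ} {M : Type*} [TopologicalSpace M]
  [ChartedSpace (EuclideanSpace ℝ (Fin m)) M] [IsManifold (𝓡 m) ∞ M]
  {Z : Type*} [NormedAddCommGroup Z] [NormedSpace ℝ Z]

/-- The derivative of the canonical chart at `q₀`, at the point `q`. -/
def cotD (q₀ q : Cotangent m M) : CotModel m →L[ℝ] CotModel m :=
  mfderiv (cotI m) 𝓘(ℝ, CotModel m) (cotChart q₀) q

/-- The inverse of the derivative of the canonical chart. -/
def cotDInv (q₀ q : Cotangent m M) : CotModel m →L[ℝ] CotModel m :=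
  mfderiv 𝓘(ℝ, CotModel m) (cotI m) (cotChart q₀).symm (cotChart q₀ q)

/-- The differential of a function on `T^*M`. -/
def dAt (p : Cotangent m M → ℝ) (q : Cotangent m M) : CotModel m →L[ℝ] ℝ :=
  mfderiv (cotI m) 𝓘(ℝ, ℝ) p q

/-- The derivative of a map into `T^*M`. -/
def cotDeriv (F : Z → Cotangent m M) (u : Z) : Z →L[ℝ] CotModel m :=
  mfderiv 𝓘(ℝ, Z) (cotI m) F u

/-- The Hamilton vector field, as a vector of the model space. -/
def hamVec (p : Cotangent m M → ℝ) (q : Cotangent m M) : CotModel m := hamiltonField p q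

theorem cotD_cotDInv {q₀ q : Cotangent m M} (hq : q ∈ (cotChart q₀).source) (V : CotModel m) :
    cotD q₀ q (cotDInv q₀ q V) = V := by
  have h := mfderiv_extChartAt_comp_mfderivWithin_extChartAt_symm' (I := cotI m) (x := q₀) (y := q) hq
  rw [ModelWithCorners.range_eq_univ, mfderivWithin_univ] at h
  exact congrArg (fun L => L V) h

theorem cotDInv_cotD {q₀ q : Cotangent m M} (hq : q ∈ (cotChart q₀).source) (V : CotModel m) :
    cotDInv q₀ q (cotD q₀ q V) = V := by
  have h := mfderivWithin_extChartAt_symm_comp_mfderiv_extChartAt' (I := cotI m) (x := q₀) (y := q) hq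
  rw [ModelWithCorners.range_eq_univ, mfderivWithin_univ] at h
  exact congrArg (fun L => L V) h

theorem cotD_self (q : Cotangent m M) : cotD q q = ContinuousLinearMap.id ℝ (CotModel m) := by
  exact mfderiv_extChartAt_self (I := cotI m) (x := q)

theorem mem_cotChart_self (q : Cotangent m M) : q ∈ (cotChart q).source :=
  mem_extChartAt_source (I := cotI m) q

theorem cotDInv_self (q : Cotangent m M) (V : CotModel m) : cotDInv q q V = V := by
  have := cotD_cotDInv (mem_cotChart_self q) V
  rwa [cotD_self] at this

theorem hasFDerivAt_cotChart_comp {q₀ : Cotangent m M} {F : Z → Cotangent m M} {u : Z}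
    (hF : MDifferentiableAt 𝓘(ℝ, Z) (cotI m) F u) (hq : F u ∈ (cotChart q₀).source) :
    HasFDerivAt (fun u => cotChart q₀ (F u)) ((cotD q₀ (F u)).comp (cotDeriv F u)) u := by
  refine hasFDerivAt_of_hasMFDerivAt ?_
  exact ((contMDiffAt_cotChart hq).mdifferentiableAt (by simp)).hasMFDerivAt.comp u hF.hasMFDerivAt

theorem fderiv_comp_cotChart_symm {p : Cotangent m M → ℝ} {q₀ q : Cotangent m M}
    (hp : MDifferentiableAt (cotI m) 𝓘(ℝ, ℝ) p q) (hq : q ∈ (cotChart q₀).source) :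
    HasFDerivAt (fun z => p ((cotChart q₀).symm z)) ((dAt p q).comp (cotDInv q₀ q))
      (cotChart q₀ q) := by
  refine hasFDerivAt_of_hasMFDerivAt ?_
  have h1 := (cotChart q₀).left_inv hq
  have h2 : MDifferentiableAt 𝓘(ℝ, CotModel m) (cotI m) (cotChart q₀).symm (cotChart q₀ q) :=
    (contMDiffAt_cotChart_symm ((cotChart q₀).map_source hq)).mdifferentiableAt (by simp)
  have h3 : HasMFDerivAt (cotI m) 𝓘(ℝ, ℝ) p ((cotChart q₀).symm (cotChart q₀ q))
      (dAt p q) := by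
    rw [h1]; exact hp.hasMFDerivAt
  exact h3.comp _ h2.hasMFDerivAt

/-- In every canonical chart the Liouville form is the same intrinsic pairing, by `liouville_chart`,
so transitions between such charts preserve its exterior derivative. This permits computing with the
symplectic form and the Hamilton field, both defined pointwise in preferred charts, in any one
canonical chart around the point. -/
theorem modelForm_cotD {q₀ q : Cotangent m M} (hq : q ∈ (cotChart q₀).source) (V W : CotModel m) :
    modelForm (cotD q₀ q V) (cotD q₀ q W) = modelForm V W := by
  set u := cotChart q q with hu
  have hu' : u ∈ (cotChart q).target := (cotChart q).map_source (mem_cotChart_self q)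
  have hFu : (cotChart q).symm u = q := (cotChart q).left_inv (mem_cotChart_self q)
  have hF : ContMDiffOn 𝓘(ℝ, CotModel m) (cotI m) ∞ (cotChart q).symm (cotChart q).target :=
    contMDiffOn_cotChart_symm q
  have hO : IsOpen ((cotChart q).target ∩ (cotChart q).symm ⁻¹' (cotChart q₀).source) :=
    hF.continuousOn.isOpen_inter_preimage (isOpen_cotChart_target q) (isOpen_cotChart_source q₀)
  have hmem : u ∈ (cotChart q).target ∩ (cotChart q).symm ⁻¹' (cotChart q₀).source :=
    ⟨hu', by rw [mem_preimage, hFu]; exact hq⟩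
  have hFd : ∀ u' ∈ (cotChart q).target, ContMDiffAt 𝓘(ℝ, CotModel m) (cotI m) ∞
      (cotChart q).symm u' := fun u' h => contMDiffAt_cotChart_symm h
  have hc (q₁ : Cotangent m M) (h : q ∈ (cotChart q₁).source) :
      ContDiffAt ℝ 2 (fun u => cotChart q₁ ((cotChart q).symm u)) u := by
    refine (contMDiffAt_iff_contDiffAt.1 ?_).of_le (n := ∞) ENat.LEInfty.out
    refine ContMDiffAt.comp u (I' := cotI m) ?_ (hFd u hu')
    rw [hFu]
    exact contMDiffAt_cotChart h
  -- The factor is `1` and the constant form is `0`, because the two Liouville forms coincide on the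
  -- overlap.
  have key := modelForm_eq_of_liouville_eq (hc q₀ hq) (hc q (mem_cotChart_self q)) 1 (fun _ => 0) (by
    filter_upwards [hO.mem_nhds hmem] with u' hu'' v
    rw [liouville_chart ((hFd u' hu''.1).mdifferentiableAt (by simp)) hu''.2,
      liouville_chart ((hFd u' hu''.1).mdifferentiableAt (by simp))
        ((cotChart q).map_target hu''.1)]
    ring)
  have hd (q₁ : Cotangent m M) (h : q ∈ (cotChart q₁).source) (V : CotModel m) :
      fderiv ℝ (fun u => cotChart q₁ ((cotChart q).symm u)) u V = cotD q₁ q V := by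
    rw [(hasFDerivAt_cotChart_comp (q₀ := q₁) ((hFd u hu').mdifferentiableAt (by simp))
      (by rw [hFu]; exact h)).fderiv]
    have h2 : cotDeriv (cotChart q).symm u V = V := cotDInv_self q V
    rw [ContinuousLinearMap.comp_apply, h2, hFu]
  have := key V W
  rw [hd q₀ hq, hd q₀ hq, hd q (mem_cotChart_self q), hd q (mem_cotChart_self q), cotD_self] at this
  simpa using this

/-- The Hamilton vector field in canonical coordinates. -/
theorem cotD_hamiltonField {p : Cotangent m M → ℝ} {q₀ q : Cotangent m M}
    (hp : MDifferentiableAt (cotI m) 𝓘(ℝ, ℝ) p q) (hq : q ∈ (cotChart q₀).source) :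
    cotD q₀ q (hamiltonField p q) =
      modelHamilton (fderiv ℝ (fun z => p ((cotChart q₀).symm z)) (cotChart q₀ q)) := by
  refine eq_of_modelForm_eq fun V => ?_
  rw [modelForm_modelHamilton, (fderiv_comp_cotChart_symm hp hq).fderiv]
  have h1 := modelForm_cotD hq (cotDInv q₀ q V) (hamiltonField p q)
  rw [cotD_cotDInv hq] at h1
  rw [h1]
  exact modelForm_modelHamilton (dAt p q) _

/-- The preferred chart changes along a curve; fixing `q₀` turns the equation into Hamilton's
equations in one chart. Continuity is a separate clause because the coordinates alone do not keep
nearby points of the curve in the chart. -/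
theorem hasMFDerivWithinAt_iff_chart {p : Cotangent m M → ℝ} {q₀ : Cotangent m M}
    {γ : ℝ → Cotangent m M} {s : Set ℝ} {t : ℝ}
    (hp : MDifferentiableAt (cotI m) 𝓘(ℝ, ℝ) p (γ t)) (hq : γ t ∈ (cotChart q₀).source) :
    HasMFDerivWithinAt 𝓘(ℝ, ℝ) (cotI m) γ s t
      ((1 : ℝ →L[ℝ] ℝ).smulRight (hamiltonField p (γ t))) ↔
    ContinuousWithinAt γ s t ∧ HasDerivWithinAt (fun t => cotChart q₀ (γ t))
      (modelHamilton (fderiv ℝ (fun z => p ((cotChart q₀).symm z)) (cotChart q₀ (γ t)))) s t := by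
  have hc : HasMFDerivAt (cotI m) 𝓘(ℝ, CotModel m) (cotChart q₀) (γ t) (cotD q₀ (γ t)) :=
    ((contMDiffAt_cotChart hq).mdifferentiableAt (by simp)).hasMFDerivAt
  rw [← cotD_hamiltonField hp hq]
  have hone (v : CotModel m) : ((1 : ℝ →L[ℝ] ℝ).smulRight v) 1 = v := by simp
  change _ ↔ ContinuousWithinAt γ s t ∧ HasDerivWithinAt _ (cotD q₀ (γ t) (hamVec p (γ t))) s t
  constructor
  · intro h
    refine ⟨h.continuousWithinAt, ?_⟩
    have h2 := hc.comp_hasMFDerivWithinAt t h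
    have h3 : HasFDerivWithinAt (fun t => cotChart q₀ (γ t)) ((cotD q₀ (γ t)).comp
        ((1 : ℝ →L[ℝ] ℝ).smulRight (hamVec p (γ t)))) s t :=
      hasMFDerivWithinAt_iff_hasFDerivWithinAt.1 h2
    refine h3.hasDerivWithinAt.congr_deriv ?_
    exact congrArg (cotD q₀ (γ t)) (hone (hamVec p (γ t)))
  · rintro ⟨h1, h2⟩
    have hi : HasMFDerivAt 𝓘(ℝ, CotModel m) (cotI m) (cotChart q₀).symm (cotChart q₀ (γ t))
        (cotDInv q₀ (γ t)) :=
      ((contMDiffAt_cotChart_symm ((cotChart q₀).map_source hq)).mdifferentiableAt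
        (by simp)).hasMFDerivAt
    have h3 : HasMFDerivWithinAt 𝓘(ℝ, ℝ) 𝓘(ℝ, CotModel m) (fun t => cotChart q₀ (γ t)) s t
        ((1 : ℝ →L[ℝ] ℝ).smulRight (cotD q₀ (γ t) (hamVec p (γ t)))) :=
      hasMFDerivWithinAt_iff_hasFDerivWithinAt.2 h2.hasFDerivWithinAt
    have h4 := hi.comp_hasMFDerivWithinAt t h3
    have h5 : HasMFDerivWithinAt 𝓘(ℝ, ℝ) (cotI m) γ s t
        ((cotDInv q₀ (γ t)).comp
          ((1 : ℝ →L[ℝ] ℝ).smulRight (cotD q₀ (γ t) (hamVec p (γ t))))) := by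
      refine HasMFDerivWithinAt.congr_of_eventuallyEq (f := (cotChart q₀).symm ∘ fun t => cotChart q₀ (γ t)) ?_ ?_ ?_
      · exact h4
      · filter_upwards [h1.preimage_mem_nhdsWithin ((isOpen_cotChart_source q₀).mem_nhds hq)]
          with t' ht'
        exact ((cotChart q₀).left_inv ht').symm
      · exact ((cotChart q₀).left_inv hq).symm
    have h6 : (cotDInv q₀ (γ t)).comp
        ((1 : ℝ →L[ℝ] ℝ).smulRight (cotD q₀ (γ t) (hamVec p (γ t)))) =
        (1 : ℝ →L[ℝ] ℝ).smulRight (hamVec p (γ t)) := by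
      ext1
      simp [cotDInv_cotD hq]
    exact (congrArg (fun L : ℝ →L[ℝ] CotModel m =>
      HasMFDerivWithinAt 𝓘(ℝ, ℝ) (cotI m) γ s t L) h6).mp h5

end HamiltonChart

end AHM

end

noncomputable section

set_option synthInstance.maxHeartbeats 200000

namespace AHM

/-! ### The metric, the energy and its Hamilton field in coordinates -/

section MetricChart

variable {m : ℕ} {M : Type*} [TopologicalSpace M]
  [ChartedSpace (EuclideanSpace ℝ (Fin m)) M] [IsManifold (𝓡 m) ∞ M]

/-- The metric at a point, as a bilinear form on the model space. -/
def metAt (g : Metric (𝓡 m) M) (x : M) :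
    EuclideanSpace ℝ (Fin m) →L[ℝ] EuclideanSpace ℝ (Fin m) →L[ℝ] ℝ := g.inner x

/-- The components of the metric in the chart at `x₀`. -/
def metChart (g : Metric (𝓡 m) M) (x₀ x : M) :
    EuclideanSpace ℝ (Fin m) →L[ℝ] EuclideanSpace ℝ (Fin m) →L[ℝ] ℝ :=
  (metAt g x).bilinearComp (chartDInv x₀ x) (chartDInv x₀ x)

/-- The tangent vector that corresponds to a covector. -/
def sharp (g : Metric (𝓡 m) M) (q : Cotangent m M) : EuclideanSpace ℝ (Fin m) :=
  (flat g q.proj).symm q.snd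

theorem metAt_sharp (g : Metric (𝓡 m) M) (q : Cotangent m M) : metAt g q.proj (sharp g q) = covec q :=
  (flat g q.proj).apply_symm_apply q.snd

theorem metAt_symm (g : Metric (𝓡 m) M) (x : M) (v w : EuclideanSpace ℝ (Fin m)) :
    metAt g x v w = metAt g x w v := g.symm x v w

theorem metAt_pos (g : Metric (𝓡 m) M) (x : M) {v : EuclideanSpace ℝ (Fin m)} (hv : v ≠ 0) :
    0 < metAt g x v v := g.pos x v hv

theorem metAt_nonneg (g : Metric (𝓡 m) M) (x : M) (v : EuclideanSpace ℝ (Fin m)) :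
    0 ≤ metAt g x v v := by
  by_cases h : v = 0
  · simp [h]
  · exact (metAt_pos g x h).le

theorem dualMetric_eq (g : Metric (𝓡 m) M) (q : Cotangent m M) :
    dualMetric g q.proj q.snd q.snd = covec q (sharp g q) := by
  rw [← metAt_sharp g q]; rfl

theorem energy_eq (g : Metric (𝓡 m) M) (q : Cotangent m M) :
    energy g q = (covec q (sharp g q) - 1) / 2 := by
  rw [energy, dualMetric_eq]

theorem contMDiffOn_metChart (g : Metric (𝓡 m) M) (x₀ : M) :
    ContMDiffOn (𝓡 m) 𝓘(ℝ, EuclideanSpace ℝ (Fin m) →L[ℝ] EuclideanSpace ℝ (Fin m) →L[ℝ] ℝ) ∞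
      (metChart g x₀) (chartAt (EuclideanSpace ℝ (Fin m)) x₀).source := by
  set e := trivializationAt (EuclideanSpace ℝ (Fin m) →L[ℝ] EuclideanSpace ℝ (Fin m) →L[ℝ] ℝ)
    (fun x : M => TangentSpace (𝓡 m) x →L[ℝ] TangentSpace (𝓡 m) x →L[ℝ] ℝ) x₀ with he
  have hb : e.baseSet = (chartAt (EuclideanSpace ℝ (Fin m)) x₀).source := by
    simp [he, hom_trivializationAt_baseSet]
  have h := (e.contMDiffOn_section_iff (n := ∞) (IB := 𝓡 m)
    (chartAt (EuclideanSpace ℝ (Fin m)) x₀).open_source hb.ge).1 g.contMDiff.contMDiffOn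
  refine h.congr fun x hx => ?_
  ext v w
  rw [he, hom_trivializationAt_apply]
  have hx' : x ∈ (trivializationAt (EuclideanSpace ℝ (Fin m)) (TangentSpace (𝓡 m)) x₀).baseSet := by
    simpa using hx
  have h2 := inCoordinates_apply_eq₂ (x := x) (x₀ := x₀) (ϕ := g.inner x)
    (F₁ := EuclideanSpace ℝ (Fin m)) (F₂ := EuclideanSpace ℝ (Fin m)) (F₃ := ℝ)
    (E₁ := fun x : M => TangentSpace (𝓡 m) x) (E₂ := fun x : M => TangentSpace (𝓡 m) x)
    (E₃ := Bundle.Trivial M ℝ)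
    (v := v) (w := w) hx' hx' (by simp)
  refine Eq.trans ?_ h2.symm
  have h3 (v : EuclideanSpace ℝ (Fin m)) : chartDInv x₀ x v =
      (trivializationAt (EuclideanSpace ℝ (Fin m)) (TangentSpace (𝓡 m)) x₀).symm x v := by
    rw [← Trivialization.symmL_apply (R := ℝ) _ hx']
    exact congrArg (fun L => L v) (TangentBundle.symmL_trivializationAt (I := 𝓡 m) hx).symm
  change metAt g x (chartDInv x₀ x v) (chartDInv x₀ x w) = _
  rw [h3, h3]
  simp
  rfl

theorem metChart_apply (g : Metric (𝓡 m) M) (x₀ x : M) (v w : EuclideanSpace ℝ (Fin m)) :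
    metChart g x₀ x v w = metAt g x (chartDInv x₀ x v) (chartDInv x₀ x w) := rfl

theorem exists_metChart_equiv (g : Metric (𝓡 m) M) {x₀ x : M}
    (hx : x ∈ (chartAt (EuclideanSpace ℝ (Fin m)) x₀).source) :
    ∃ e : EuclideanSpace ℝ (Fin m) ≃L[ℝ] (EuclideanSpace ℝ (Fin m) →L[ℝ] ℝ),
      (e : EuclideanSpace ℝ (Fin m) →L[ℝ] (EuclideanSpace ℝ (Fin m) →L[ℝ] ℝ)) =
        metChart g x₀ x := by
  have hinj : Function.Injective (metChart g x₀ x).toLinearMap := by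
    rw [← LinearMap.ker_eq_bot, LinearMap.ker_eq_bot']
    intro v hv
    have h0 : metChart g x₀ x v v = 0 := congrArg (fun L => L v) hv
    rw [metChart_apply] at h0
    have h1 : chartDInv x₀ x v = 0 := by
      by_contra hne
      exact (metAt_pos g x hne).ne' h0
    have := chartD_chartDInv hx v
    rw [h1, map_zero] at this
    exact this.symm
  refine ⟨(LinearEquiv.ofInjectiveOfFinrankEq (metChart g x₀ x).toLinearMap hinj
    finrank_dual_eq).toContinuousLinearEquiv, ?_⟩
  ext v w
  rfl

/-- The components of the covector `q` in the chart at `x₀`. -/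
theorem metChart_sharp (g : Metric (𝓡 m) M) {q₀ : Cotangent m M} {z : CotModel m}
    (hz : z ∈ (cotChart q₀).target) :
    metChart g q₀.proj ((cotChart q₀).symm z).proj
      (chartD q₀.proj ((cotChart q₀).symm z).proj (sharp g ((cotChart q₀).symm z))) = z.2 := by
  have hs := mem_cotChart_source.1 ((cotChart q₀).map_target hz)
  ext w
  rw [metChart_apply, chartDInv_chartD hs, metAt_sharp, cotChart_symm_covec hz]
  simp [chartD_chartDInv hs]

/-- The Hamiltonian in canonical coordinates. -/
theorem energy_cotChart_symm (g : Metric (𝓡 m) M) {q₀ : Cotangent m M} {z : CotModel m}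
    (hz : z ∈ (cotChart q₀).target) :
    energy g ((cotChart q₀).symm z) =
      (z.2 (ContinuousLinearMap.inverse
        (metChart g q₀.proj ((extChartAt (𝓡 m) q₀.proj).symm z.1)) z.2) - 1) / 2 := by
  have hs := mem_cotChart_source.1 ((cotChart q₀).map_target hz)
  have h1 := metChart_sharp g hz
  rw [← cotChart_symm_proj hz]
  obtain ⟨e, he⟩ := exists_metChart_equiv g hs
  have h2 : ContinuousLinearMap.inverse (metChart g q₀.proj ((cotChart q₀).symm z).proj) z.2 =
      chartD q₀.proj ((cotChart q₀).symm z).proj (sharp g ((cotChart q₀).symm z)) := by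
    rw [← he, ContinuousLinearMap.inverse_equiv]
    rw [← he] at h1
    rw [← h1]
    exact e.symm_apply_apply _
  rw [h2, energy_eq, cotChart_symm_covec hz]
  simp

theorem contDiffOn_metChart_symm (g : Metric (𝓡 m) M) (x₀ : M) :
    ContDiffOn ℝ ∞ (fun y => metChart g x₀ ((extChartAt (𝓡 m) x₀).symm y))
      (extChartAt (𝓡 m) x₀).target := by
  rw [← contMDiffOn_iff_contDiffOn]
  refine (contMDiffOn_metChart g x₀).comp (contMDiffOn_extChartAt_symm x₀) fun y hy => ?_
  rw [← extChartAt_source (𝓡 m)]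
  exact (extChartAt (𝓡 m) x₀).map_target hy

theorem contDiffOn_inverse_metChart_symm (g : Metric (𝓡 m) M) (x₀ : M) :
    ContDiffOn ℝ ∞ (fun y => ContinuousLinearMap.inverse
      (metChart g x₀ ((extChartAt (𝓡 m) x₀).symm y))) (extChartAt (𝓡 m) x₀).target := by
  intro y hy
  have hs : (extChartAt (𝓡 m) x₀).symm y ∈ (chartAt (EuclideanSpace ℝ (Fin m)) x₀).source := by
    rw [← extChartAt_source (𝓡 m)]
    exact (extChartAt (𝓡 m) x₀).map_target hy
  obtain ⟨e, he⟩ := exists_metChart_equiv g hs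
  have h2 : ContDiffAt ℝ ∞ ContinuousLinearMap.inverse
      (metChart g x₀ ((extChartAt (𝓡 m) x₀).symm y)) := by
    rw [← he]
    exact contDiffAt_map_inverse e
  exact h2.comp_contDiffWithinAt y (contDiffOn_metChart_symm g x₀ y hy)

theorem contDiffOn_energy_cotChart_symm (g : Metric (𝓡 m) M) (q₀ : Cotangent m M) :
    ContDiffOn ℝ ∞ (fun z => energy g ((cotChart q₀).symm z)) (cotChart q₀).target := by
  refine ContDiffOn.congr ?_ fun z hz => energy_cotChart_symm g hz
  have h1 : ContDiffOn ℝ ∞ (fun z : CotModel m => ContinuousLinearMap.inverse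
      (metChart g q₀.proj ((extChartAt (𝓡 m) q₀.proj).symm z.1))) (cotChart q₀).target := by
    refine (contDiffOn_inverse_metChart_symm g q₀.proj).comp contDiff_fst.contDiffOn fun z hz => ?_
    rw [cotChart_target] at hz
    exact hz.1
  exact ((contDiff_snd.contDiffOn.clm_apply (h1.clm_apply contDiff_snd.contDiffOn)).sub
    contDiffOn_const).div_const 2

theorem contMDiff_energy (g : Metric (𝓡 m) M) : ContMDiff (cotI m) 𝓘(ℝ, ℝ) ∞ (energy g) := by
  intro q
  have h1 : ContMDiffAt (cotI m) 𝓘(ℝ, ℝ) ∞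
      ((fun z => energy g ((cotChart q).symm z)) ∘ cotChart q) q := by
    refine ContMDiffAt.comp q (I' := 𝓘(ℝ, CotModel m)) ?_ (contMDiffAt_cotChart (mem_cotChart_self q))
    rw [contMDiffAt_iff_contDiffAt]
    exact (contDiffOn_energy_cotChart_symm g q).contDiffAt
      ((isOpen_cotChart_target q).mem_nhds ((cotChart q).map_source (mem_cotChart_self q)))
  refine h1.congr_of_eventuallyEq ?_
  filter_upwards [(isOpen_cotChart_source q).mem_nhds (mem_cotChart_self q)] with q' hq'
  simp [(cotChart q).left_inv hq']

theorem mdifferentiableAt_energy (g : Metric (𝓡 m) M) (q : Cotangent m M) :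
    MDifferentiableAt (cotI m) 𝓘(ℝ, ℝ) (energy g) q :=
  (contMDiff_energy g).mdifferentiable (by simp) q

/-- The Hamilton vector field of the energy in canonical coordinates. -/
def hamChart (g : Metric (𝓡 m) M) (q₀ : Cotangent m M) (z : CotModel m) : CotModel m :=
  modelHamilton (fderiv ℝ (fun z => energy g ((cotChart q₀).symm z)) z)

theorem contDiffOn_hamChart (g : Metric (𝓡 m) M) (q₀ : Cotangent m M) :
    ContDiffOn ℝ ∞ (hamChart g q₀) (cotChart q₀).target :=
  contDiff_modelHamilton.comp_contDiffOn
    ((contDiffOn_energy_cotChart_symm g q₀).fderiv_of_isOpen (isOpen_cotChart_target q₀)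
      (by simp))

theorem cotD_hamVec_energy (g : Metric (𝓡 m) M) {q₀ q : Cotangent m M}
    (hq : q ∈ (cotChart q₀).source) :
    cotD q₀ q (hamVec (energy g) q) = hamChart g q₀ (cotChart q₀ q) :=
  cotD_hamiltonField (mdifferentiableAt_energy g q) hq

/-- On a fibre the energy is the quadratic form of the dual metric, up to a factor and a constant,
so its derivative at `ζ` in the direction `α` is `g^*(ζ, α) = α(ζ^♯)`. Projected integral curves
therefore have velocity `sharp`. -/
theorem hamVec_energy_fst (g : Metric (𝓡 m) M) (q : Cotangent m M) :
    (hamVec (energy g) q).1 = sharp g q := by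
  have h0 := cotD_hamVec_energy g (mem_cotChart_self q)
  rw [cotD_self] at h0
  set z := cotChart q q with hz
  have hz' : z ∈ (cotChart q).target := (cotChart q).map_source (mem_cotChart_self q)
  have hq : (cotChart q).symm z = q := (cotChart q).left_inv (mem_cotChart_self q)
  have hzf : (extChartAt (𝓡 m) q.proj).symm z.1 = q.proj := by
    rw [← cotChart_symm_proj hz', hq]
  have hms := metChart_sharp g hz'
  rw [hq] at hms
  rw [chartD_self] at hms
  have hsrc : q.proj ∈ (chartAt (EuclideanSpace ℝ (Fin m)) q.proj).source := mem_chart_source _ _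
  obtain ⟨e, he⟩ := exists_metChart_equiv g hsrc
  have hinv (β : EuclideanSpace ℝ (Fin m) →L[ℝ] ℝ) :
      ContinuousLinearMap.inverse (metChart g q.proj q.proj) β = e.symm β := by
    rw [← he, ContinuousLinearMap.inverse_equiv]; rfl
  have hes : e.symm z.2 = sharp g q := by
    rw [← hms, ← he]; exact e.symm_apply_apply _
  have hsym (β γ : EuclideanSpace ℝ (Fin m) →L[ℝ] ℝ) : β (e.symm γ) = γ (e.symm β) := by
    have h1 (β : EuclideanSpace ℝ (Fin m) →L[ℝ] ℝ) : metChart g q.proj q.proj (e.symm β) = β := by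
      rw [← he]; exact e.apply_symm_apply β
    rw [← h1 β, ← h1 γ, metChart_apply, metChart_apply, metAt_symm]
    rw [h1 β, h1 γ]
  have key (α : EuclideanSpace ℝ (Fin m) →L[ℝ] ℝ) :
      fderiv ℝ (fun z => energy g ((cotChart q).symm z)) z (0, α) = α (sharp g q) := by
    have hd : DifferentiableAt ℝ (fun z => energy g ((cotChart q).symm z)) z :=
      ((contDiffOn_energy_cotChart_symm g q).contDiffAt
        ((isOpen_cotChart_target q).mem_nhds hz')).differentiableAt (by simp)
    have hl : HasDerivAt (fun s : ℝ => z + s • ((0, α) : CotModel m)) (0, α) 0 := by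
      simpa using ((hasDerivAt_id (0 : ℝ)).smul_const ((0, α) : CotModel m)).const_add z
    have hd' : HasFDerivAt (fun z => energy g ((cotChart q).symm z))
      (fderiv ℝ (fun z => energy g ((cotChart q).symm z)) z)
      (z + (0 : ℝ) • ((0, α) : CotModel m)) := by simpa using hd.hasFDerivAt
    have h1 := hd'.comp_hasDerivAt 0 hl
    have h2 : HasDerivAt (fun s : ℝ => ((z.2 + s • α) (e.symm (z.2 + s • α)) - 1) / 2)
        (α (sharp g q)) 0 := by
      -- Symmetry of the dual metric merges the two cross terms and leaves a quadratic polynomial in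
      -- `s`.
      have h3 : (fun s : ℝ => ((z.2 + s • α) (e.symm (z.2 + s • α)) - 1) / 2) = fun s : ℝ =>
          (z.2 (e.symm z.2) + s * (2 * α (sharp g q)) + s ^ 2 * α (e.symm α) - 1) / 2 := by
        funext s
        have := hsym z.2 α
        simp only [map_add, map_smul, add_apply, smul_apply, smul_eq_mul, hes] at this ⊢
        rw [this]; ring
      rw [h3]
      have h4 := ((((((hasDerivAt_id (0 : ℝ)).mul_const (2 * α (sharp g q))).const_add
        (z.2 (e.symm z.2))).add (((hasDerivAt_id (0 : ℝ)).pow 2).mul_const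
          (α (e.symm α)))).sub_const 1).div_const 2)
      refine h4.congr_deriv ?_
      simp
    refine h1.unique (h2.congr_of_eventuallyEq ?_)
    refine Filter.Eventually.of_forall fun s => ?_
    have hmem : z + s • ((0, α) : CotModel m) ∈ (cotChart q).target := by
      rw [cotChart_target] at hz' ⊢
      refine ⟨?_, mem_univ _⟩
      simpa using hz'.1
    have h5 := energy_cotChart_symm g hmem
    simp only [Function.comp_apply]
    have h6 : (z + s • ((0, α) : CotModel m)).1 = z.1 := by simp
    rw [h5, h6, hzf, hinv]
    simp
  have h2 : hamVec (energy g) q = hamChart g q z := h0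
  rw [h2]
  have h3 (α : EuclideanSpace ℝ (Fin m) →L[ℝ] ℝ) : α (hamChart g q z).1 = α (sharp g q) := by
    rw [hamChart, modelHamilton_fst, key]
  ext j
  exact h3 (EuclideanSpace.proj j)

/-- The derivative of the projection `T^*M → M` in the preferred charts. -/
theorem hasMFDerivAt_cotProj (q : Cotangent m M) :
    HasMFDerivAt (cotI m) (𝓡 m) (fun q : Cotangent m M => q.proj) q
      (ContinuousLinearMap.fst ℝ (EuclideanSpace ℝ (Fin m)) (EuclideanSpace ℝ (Fin m) →L[ℝ] ℝ)) := by
  have := isManifold_one (M := M) (m := m)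
  have h0 := (contMDiff_cotProj.mdifferentiable (by simp) q).hasMFDerivAt
  set P : CotModel m →L[ℝ] EuclideanSpace ℝ (Fin m) :=
    mfderiv (cotI m) (𝓡 m) (fun q : Cotangent m M => q.proj) q with hP
  have h1 : HasMFDerivAt (cotI m) 𝓘(ℝ, EuclideanSpace ℝ (Fin m))
      (fun q' : Cotangent m M => extChartAt (𝓡 m) q.proj q'.proj) q ((chartD q.proj q.proj).comp P) :=
    (mdifferentiableAt_extChartAt (I := 𝓡 m) (mem_chart_source _ _)).hasMFDerivAt.comp q h0
  have h2 : HasMFDerivAt (cotI m) 𝓘(ℝ, CotModel m) (cotChart q) q (cotD q q) :=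
    ((contMDiffAt_cotChart (mem_cotChart_self q)).mdifferentiableAt (by simp)).hasMFDerivAt
  have h3 : HasMFDerivAt (cotI m) 𝓘(ℝ, EuclideanSpace ℝ (Fin m))
      (fun q' : Cotangent m M => (cotChart q q').1) q
      ((ContinuousLinearMap.fst ℝ (EuclideanSpace ℝ (Fin m))
        (EuclideanSpace ℝ (Fin m) →L[ℝ] ℝ)).comp (cotD q q)) :=
    (ContinuousLinearMap.hasMFDerivAt (ContinuousLinearMap.fst ℝ (EuclideanSpace ℝ (Fin m))
        (EuclideanSpace ℝ (Fin m) →L[ℝ] ℝ))).comp q h2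
  have h4 : HasMFDerivAt (cotI m) 𝓘(ℝ, EuclideanSpace ℝ (Fin m))
      (fun q' : Cotangent m M => extChartAt (𝓡 m) q.proj q'.proj) q
      ((ContinuousLinearMap.fst ℝ (EuclideanSpace ℝ (Fin m))
        (EuclideanSpace ℝ (Fin m) →L[ℝ] ℝ)).comp (cotD q q)) := by
    refine h3.congr_of_eventuallyEq ?_
    filter_upwards [(isOpen_cotChart_source q).mem_nhds (mem_cotChart_self q)] with q' hq'
    rw [cotChart_apply hq']
  have h5 : (chartD q.proj q.proj).comp P = (ContinuousLinearMap.fst ℝ (EuclideanSpace ℝ (Fin m))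
        (EuclideanSpace ℝ (Fin m) →L[ℝ] ℝ)).comp (cotD q q) := hasMFDerivAt_unique h1 h4
  have h6 : P = ContinuousLinearMap.fst ℝ (EuclideanSpace ℝ (Fin m))
        (EuclideanSpace ℝ (Fin m) →L[ℝ] ℝ) := by
    refine ContinuousLinearMap.ext fun V => ?_
    have := congrArg (fun L => L V) h5
    simpa [cotD_self, chartD_self] using this
  exact (congrArg (fun L : CotModel m →L[ℝ] EuclideanSpace ℝ (Fin m) => HasMFDerivAt (cotI m) (𝓡 m) (fun q : Cotangent m M => q.proj) q L) h6).mp h0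

/-- The Hamilton vector field is a smooth section of the tangent bundle. -/
theorem contMDiff_hamiltonField_energy (g : Metric (𝓡 m) M) :
    ContMDiff (cotI m) (cotI m).tangent ∞
      (fun q => (⟨q, hamiltonField (energy g) q⟩ : TangentBundle (cotI m) (Cotangent m M))) := by
  intro q₀
  rw [contMDiffAt_section]
  have h1 : ContMDiffAt (cotI m) 𝓘(ℝ, CotModel m) ∞
      (fun q => hamChart g q₀ (cotChart q₀ q)) q₀ := by
    refine ContMDiffAt.comp q₀ (I' := 𝓘(ℝ, CotModel m)) (g := hamChart g q₀) ?_
      (contMDiffAt_cotChart (mem_cotChart_self q₀))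
    rw [contMDiffAt_iff_contDiffAt]
    exact (contDiffOn_hamChart g q₀).contDiffAt
      ((isOpen_cotChart_target q₀).mem_nhds ((cotChart q₀).map_source (mem_cotChart_self q₀)))
  refine h1.congr_of_eventuallyEq ?_
  filter_upwards [(isOpen_cotChart_source q₀).mem_nhds (mem_cotChart_self q₀)] with q hq
  rw [← cotD_hamVec_energy g hq]
  have hq' : q ∈ (chartAt (ModelProd (EuclideanSpace ℝ (Fin m)) (EuclideanSpace ℝ (Fin m) →L[ℝ] ℝ)) q₀).source := by
    rwa [cotChart, extChartAt_source] at hq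
  have h2 := TangentBundle.continuousLinearMapAt_trivializationAt (I := cotI m) hq'
  have h3 := congrArg (fun L => L (hamiltonField (energy g) q)) h2
  refine Eq.trans ?_ h3
  have hb : q ∈ (trivializationAt (CotModel m) (TangentSpace (cotI m)) q₀).baseSet := by
    rwa [TangentBundle.trivializationAt_baseSet]
  exact (Trivialization.continuousLinearMapAt_apply_of_mem ℝ _ hb _).symm

end MetricChart
end AHM

end

noncomputable section

set_option synthInstance.maxHeartbeats 200000

namespace AHM

/-! ### Lengths of paths and the Riemannian distance -/

section Distance

open MeasureTheory
open scoped ENNReal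

variable {m : ℕ} {M : Type*} [TopologicalSpace M]
  [ChartedSpace (EuclideanSpace ℝ (Fin m)) M] [IsManifold (𝓡 m) ∞ M]

/-- The Riemannian distance as an extended nonnegative number. -/
def redist (g : Metric (𝓡 m) M) (x y : M) : ℝ≥0∞ :=
  let _ : RiemannianBundle (fun x : M => TangentSpace (𝓡 m) x) := ⟨g.toRiemannianMetric⟩
  riemannianEDist (𝓡 m) x y

theorem rdist_eq_toReal (g : Metric (𝓡 m) M) (x y : M) : rdist g x y = (redist g x y).toReal := rfl

/-- The length of a path. -/
def plen (g : Metric (𝓡 m) M) (γ : ℝ → M) (a b : ℝ) : ℝ≥0∞ :=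
  let _ : RiemannianBundle (fun x : M => TangentSpace (𝓡 m) x) := ⟨g.toRiemannianMetric⟩
  pathELength (𝓡 m) γ a b

/-- The norm of a tangent vector. -/
def gnorm (g : Metric (𝓡 m) M) (x : M) (v : EuclideanSpace ℝ (Fin m)) : ℝ := √(metAt g x v v)

theorem gnorm_nonneg (g : Metric (𝓡 m) M) (x : M) (v : EuclideanSpace ℝ (Fin m)) :
    0 ≤ gnorm g x v := Real.sqrt_nonneg _

theorem enorm_eq_gnorm (g : Metric (𝓡 m) M) (x : M) (v : TangentSpace (𝓡 m) x) :
    letI : RiemannianBundle (fun x : M => TangentSpace (𝓡 m) x) := ⟨g.toRiemannianMetric⟩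
    ‖v‖ₑ = ENNReal.ofReal (gnorm g x v) := by
  let _ : RiemannianBundle (fun x : M => TangentSpace (𝓡 m) x) := ⟨g.toRiemannianMetric⟩
  rw [← ofReal_norm]
  congr 1

theorem plen_eq (g : Metric (𝓡 m) M) (γ : ℝ → M) (a b : ℝ) :
    plen g γ a b = ∫⁻ t in Icc a b, ENNReal.ofReal (gnorm g (γ t) (derivAt γ t 1)) := by
  let _ : RiemannianBundle (fun x : M => TangentSpace (𝓡 m) x) := ⟨g.toRiemannianMetric⟩
  rw [plen, pathELength_eq_lintegral_mfderiv_Icc]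
  congr 1
  funext t
  exact enorm_eq_gnorm g (γ t) _

theorem plen_mono (g : Metric (𝓡 m) M) (γ : ℝ → M) {a b a' b' : ℝ} (h : a' ≤ a) (h' : b ≤ b') :
    plen g γ a b ≤ plen g γ a' b' := by
  let _ : RiemannianBundle (fun x : M => TangentSpace (𝓡 m) x) := ⟨g.toRiemannianMetric⟩
  exact pathELength_mono h h'

theorem plen_add (g : Metric (𝓡 m) M) (γ : ℝ → M) {a b c : ℝ} (h : a ≤ b) (h' : b ≤ c) :
    plen g γ a b + plen g γ b c = plen g γ a c := by
  let _ : RiemannianBundle (fun x : M => TangentSpace (𝓡 m) x) := ⟨g.toRiemannianMetric⟩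
  exact pathELength_add h h'

theorem redist_self (g : Metric (𝓡 m) M) (x : M) : redist g x x = 0 := by
  let _ : RiemannianBundle (fun x : M => TangentSpace (𝓡 m) x) := ⟨g.toRiemannianMetric⟩
  exact riemannianEDist_self

theorem redist_comm (g : Metric (𝓡 m) M) (x y : M) : redist g x y = redist g y x := by
  let _ : RiemannianBundle (fun x : M => TangentSpace (𝓡 m) x) := ⟨g.toRiemannianMetric⟩
  exact riemannianEDist_comm

theorem redist_triangle (g : Metric (𝓡 m) M) (x y z : M) :
    redist g x z ≤ redist g x y + redist g y z := by
  let _ : RiemannianBundle (fun x : M => TangentSpace (𝓡 m) x) := ⟨g.toRiemannianMetric⟩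
  exact riemannianEDist_triangle

theorem redist_le_plen (g : Metric (𝓡 m) M) {γ : ℝ → M} {a b : ℝ} (hab : a ≤ b)
    (hγ : ContMDiffOn 𝓘(ℝ, ℝ) (𝓡 m) 1 γ (Icc a b)) : redist g (γ a) (γ b) ≤ plen g γ a b := by
  let _ : RiemannianBundle (fun x : M => TangentSpace (𝓡 m) x) := ⟨g.toRiemannianMetric⟩
  exact riemannianEDist_le_pathELength hγ rfl rfl hab

theorem exists_path_of_redist_lt (g : Metric (𝓡 m) M) {x y : M} {r : ℝ≥0∞}
    (h : redist g x y < r) : ∃ γ : ℝ → M, γ 0 = x ∧ γ 1 = y ∧ ContMDiff 𝓘(ℝ, ℝ) (𝓡 m) 1 γ ∧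
      plen g γ 0 1 < r := by
  let _ : RiemannianBundle (fun x : M => TangentSpace (𝓡 m) x) := ⟨g.toRiemannianMetric⟩
  obtain ⟨γ, h0, h1, h2, h3, -⟩ := exists_lt_locally_constant_of_riemannianEDist_lt
    (I := 𝓡 m) h zero_lt_one
  exact ⟨γ, h0, h1, h2, h3⟩

theorem eventually_redist_lt (g : Metric (𝓡 m) M) (x : M) {c : ℝ≥0∞} (hc : 0 < c) :
    ∀ᶠ y in 𝓝 x, redist g x y < c := by
  let _ : RiemannianBundle (fun x : M => TangentSpace (𝓡 m) x) := ⟨g.toRiemannianMetric⟩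
  have : IsContinuousRiemannianBundle (EuclideanSpace ℝ (Fin m))
    (fun x : M => TangentSpace (𝓡 m) x) := ⟨⟨g.inner, g.contMDiff.continuous, fun b v w => rfl⟩⟩
  have := isManifold_one (M := M) (m := m)
  exact eventually_riemannianEDist_lt (𝓡 m) x hc

theorem redist_lt_subset_nhds [RegularSpace M] (g : Metric (𝓡 m) M) {x : M} {s : Set M}
    (hs : s ∈ 𝓝 x) : ∃ c > 0, {y | redist g x y < c} ⊆ s := by
  let _ : RiemannianBundle (fun x : M => TangentSpace (𝓡 m) x) := ⟨g.toRiemannianMetric⟩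
  have : IsContinuousRiemannianBundle (EuclideanSpace ℝ (Fin m))
    (fun x : M => TangentSpace (𝓡 m) x) := ⟨⟨g.inner, g.contMDiff.continuous, fun b v w => rfl⟩⟩
  have := isManifold_one (M := M) (m := m)
  exact setOfPred_riemannianEDist_lt_subset_nhds' (𝓡 m) hs

theorem eq_of_redist_eq_zero [RegularSpace M] [T2Space M] (g : Metric (𝓡 m) M) {x y : M}
    (h : redist g x y = 0) : x = y := by
  by_contra hne
  obtain ⟨c, hc, hsub⟩ := redist_lt_subset_nhds g (isOpen_compl_singleton.mem_nhds
    (mem_compl_singleton_iff.2 hne))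
  exact hsub (show redist g x y < c by rw [h]; exact hc) rfl

/-- A function whose derivative along a path is bounded by the speed varies at most by the length. -/
theorem abs_sub_le_of_deriv_le_gnorm (g : Metric (𝓡 m) M) {γ : ℝ → M} {a b : ℝ} (hab : a ≤ b)
    {f : ℝ → ℝ} (hf : ContDiffOn ℝ 1 f (Icc a b)) {L : ℝ} (hL : 0 ≤ L)
    (h : ∀ t ∈ Ioo a b, |deriv f t| ≤ L * gnorm g (γ t) (derivAt γ t 1)) :
    ENNReal.ofReal |f b - f a| ≤ ENNReal.ofReal L * plen g γ a b := by
  have h1 := enorm_sub_le_lintegral_deriv_of_contDiffOn_Icc hf hab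
  rw [Real.enorm_eq_ofReal_abs] at h1
  refine h1.trans ?_
  rw [plen_eq, ← lintegral_const_mul' _ _ ENNReal.ofReal_ne_top, ← restrict_Ioo_eq_restrict_Icc]
  refine setLIntegral_mono' measurableSet_Ioo fun t ht => ?_
  rw [Real.enorm_eq_ofReal_abs, ← ENNReal.ofReal_mul hL]
  exact ENNReal.ofReal_le_ofReal (h t ht)

theorem plen_le_of_gnorm_le (g : Metric (𝓡 m) M) {γ : ℝ → M} {a b s : ℝ} (hab : a ≤ b)
    (h : ∀ t ∈ Ioo a b, gnorm g (γ t) (derivAt γ t 1) ≤ s) :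
    plen g γ a b ≤ ENNReal.ofReal ((b - a) * s) := by
  rw [plen_eq, ← restrict_Ioo_eq_restrict_Icc]
  calc ∫⁻ t in Ioo a b, ENNReal.ofReal (gnorm g (γ t) (derivAt γ t 1))
      ≤ ∫⁻ _ in Ioo a b, ENNReal.ofReal s :=
        setLIntegral_mono' measurableSet_Ioo fun t ht => ENNReal.ofReal_le_ofReal (h t ht)
    _ = ENNReal.ofReal ((b - a) * s) := by
        rw [setLIntegral_const, Real.volume_Ioo, mul_comm, ENNReal.ofReal_mul (by linarith)]

omit [IsManifold (𝓡 m) ∞ M] in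
theorem derivAt_comp_apply {f : M → ℝ} {γ : ℝ → M} {t : ℝ} {f' : EuclideanSpace ℝ (Fin m) →L[ℝ] ℝ}
    (hf : HasMFDerivAt (𝓡 m) 𝓘(ℝ, ℝ) f (γ t) f') (hγ : MDifferentiableAt 𝓘(ℝ, ℝ) (𝓡 m) γ t) :
    HasDerivAt (fun t => f (γ t)) (f' (derivAt γ t 1)) t := by
  have h := hasFDerivAt_of_hasMFDerivAt (f' := f'.comp (derivAt γ t)) (hf.comp t hγ.hasMFDerivAt)
  exact h.hasDerivAt

end Distance
end AHM

end

noncomputable section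

set_option synthInstance.maxHeartbeats 200000

namespace AHM

/-! ### Asymptotically hyperbolic metrics have compact closed balls -/

section Completeness

open scoped ENNReal

variable {m : ℕ} {M : Type*} [TopologicalSpace M]
  [ChartedSpace (EuclideanSpace ℝ (Fin m)) M] [IsManifold (𝓡 m) ∞ M]

/-- Closed bounded sets are compact (the metric is complete). -/
def ProperMetric (g : Metric (𝓡 m) M) : Prop :=
  ∀ (x : M) (R : ℝ), IsCompact {y | redist g x y ≤ ENNReal.ofReal R}

theorem isClosed_redist_le (g : Metric (𝓡 m) M) (x : M) (R : ℝ≥0∞) :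
    IsClosed {y | redist g x y ≤ R} := by
  refine isClosed_of_closure_subset fun y hy => ?_
  refine ENNReal.le_of_forall_pos_le_add fun ε hε _ => ?_
  obtain ⟨y', h1, h2⟩ := mem_closure_iff_nhds.1 hy _
    (eventually_redist_lt g y (c := ε) (by exact_mod_cast hε))
  have h3 : redist g y y' < ε := h1
  have h4 : redist g x y' ≤ R := h2
  calc redist g x y ≤ redist g x y' + redist g y' y := redist_triangle g x y' y
    _ ≤ R + ε := by
      refine add_le_add h4 ?_
      rw [redist_comm]
      exact h3.le

variable [NeZero m] {X : Type*} [TopologicalSpace X] [ChartedSpace (EuclideanHalfSpace m) X]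
  [IsManifold (𝓡∂ m) ∞ X]

/-- The differential of a function, as a linear form on the model space. -/
def dAtX (ρ : X → ℝ) (y : X) : EuclideanSpace ℝ (Fin m) →L[ℝ] ℝ := mfderiv (𝓡∂ m) 𝓘(ℝ, ℝ) ρ y

/-- The metric at a point of a manifold with boundary. -/
def metAtX (g : Metric (𝓡∂ m) X) (x : X) :
    EuclideanSpace ℝ (Fin m) →L[ℝ] EuclideanSpace ℝ (Fin m) →L[ℝ] ℝ := g.inner x

/-- In the trivialization at `y₀` both sides are compared with the Euclidean norm: the components of
the differential are continuous at `y₀`, and the trivialization is bounded for the metric near `y₀`.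
-/
theorem eventually_abs_dAtX_le (gbar : Metric (𝓡∂ m) X) {ρ : X → ℝ}
    (hρ : ContMDiff (𝓡∂ m) 𝓘(ℝ, ℝ) ∞ ρ) (y₀ : X) :
    ∃ C : ℝ, 0 < C ∧ ∀ᶠ y in 𝓝 y₀, ∀ w, |dAtX ρ y w| ≤ C * √(metAtX gbar y w w) := by
  let _ : RiemannianBundle (fun x : X => TangentSpace (𝓡∂ m) x) := ⟨gbar.toRiemannianMetric⟩
  have : IsContinuousRiemannianBundle (EuclideanSpace ℝ (Fin m))
    (fun x : X => TangentSpace (𝓡∂ m) x) :=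
      ⟨⟨gbar.inner, gbar.contMDiff.continuous, fun b v w => rfl⟩⟩
  have : IsManifold (𝓡∂ m) 1 X := IsManifold.of_le (n := ∞) (by simp)
  obtain ⟨C₂, hC₂, h2⟩ := eventually_norm_trivializationAt_lt (EuclideanSpace ℝ (Fin m))
    (fun x : X => TangentSpace (𝓡∂ m) x) y₀
  let D : X → (EuclideanSpace ℝ (Fin m) →L[ℝ] ℝ) :=
    inTangentCoordinates (𝓡∂ m) 𝓘(ℝ, ℝ) id ρ (mfderiv (𝓡∂ m) 𝓘(ℝ, ℝ) ρ) y₀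
  have hD : ContinuousAt D y₀ :=
    ((hρ y₀).mfderiv_const (m := 0) (by simp)).continuousAt
  have h1 : ∀ᶠ y in 𝓝 y₀, ‖D y‖ < ‖D y₀‖ + 1 :=
    hD.norm.eventually_lt continuousAt_const (by linarith)
  refine ⟨(‖D y₀‖ + 1) * C₂, by positivity, ?_⟩
  filter_upwards [h1, h2, (chartAt (EuclideanHalfSpace m) y₀).open_source.mem_nhds
    (mem_chart_source _ y₀)] with y hy1 hy2 hy3 w
  let A : EuclideanSpace ℝ (Fin m) →L[ℝ] EuclideanSpace ℝ (Fin m) :=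
    mfderiv (𝓡∂ m) 𝓘(ℝ, EuclideanSpace ℝ (Fin m)) (extChartAt (𝓡∂ m) y₀) y
  have hA : ‖A w‖ ≤ C₂ * √(metAtX gbar y w w) := by
    have h3 := ContinuousLinearMap.le_of_opNorm_le _ hy2.le w
    have h4 : A w = (trivializationAt (EuclideanSpace ℝ (Fin m))
        (fun x : X => TangentSpace (𝓡∂ m) x) y₀).continuousLinearMapAt ℝ y w :=
      congrArg (fun L => L w)
        (TangentBundle.continuousLinearMapAt_trivializationAt (I := 𝓡∂ m) hy3).symm
    rw [h4]
    exact h3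
  have hDA : dAtX ρ y w = D y (A w) := by
    have h3 : D y = _ := inTangentCoordinates_eq_mfderiv_comp (I := 𝓡∂ m) (I' := 𝓘(ℝ, ℝ))
      (f := id) (g := ρ) (ϕ := mfderiv (𝓡∂ m) 𝓘(ℝ, ℝ) ρ) (x₀ := y₀) (x := y) hy3
      (by rw [chartAt_self_eq]; exact mem_univ _)
    let B : EuclideanSpace ℝ (Fin m) →L[ℝ] EuclideanSpace ℝ (Fin m) :=
      mfderivWithin 𝓘(ℝ, EuclideanSpace ℝ (Fin m)) (𝓡∂ m) (extChartAt (𝓡∂ m) y₀).symm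
        (range (𝓡∂ m)) (extChartAt (𝓡∂ m) y₀ y)
    have hBA : B (A w) = w := by
      have h4 := mfderivWithin_extChartAt_symm_comp_mfderiv_extChartAt' (I := 𝓡∂ m) (x := y₀)
        (y := y) (by rwa [extChartAt_source])
      exact congrArg (fun L => L w) h4
    have h5 : D y (A w) = dAtX ρ y (B (A w)) := by
      rw [h3]
      have h6 : mfderiv 𝓘(ℝ, ℝ) 𝓘(ℝ, ℝ) (extChartAt 𝓘(ℝ, ℝ) (ρ y₀)) (ρ y) =
          ContinuousLinearMap.id ℝ ℝ := by
        rw [extChartAt_model_space_eq_id]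
        exact mfderiv_id
      exact congrArg (fun L : ℝ →L[ℝ] ℝ => L (dAtX ρ y (B (A w)))) h6
    rw [h5, hBA]
  rw [hDA, ← Real.norm_eq_abs]
  calc ‖D y (A w)‖ ≤ ‖D y‖ * ‖A w‖ := (D y).le_opNorm _
    _ ≤ (‖D y₀‖ + 1) * (C₂ * √(metAtX gbar y w w)) := by gcongr
    _ = _ := by ring

theorem exists_abs_dAtX_le [CompactSpace X] (gbar : Metric (𝓡∂ m) X) {ρ : X → ℝ}
    (hρ : ContMDiff (𝓡∂ m) 𝓘(ℝ, ℝ) ∞ ρ) :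
    ∃ C : ℝ, 0 < C ∧ ∀ y w, |dAtX ρ y w| ≤ C * √(metAtX gbar y w w) := by
  have key : ∃ C : ℝ, 0 < C ∧ ∀ y ∈ (univ : Set X), ∀ w, |dAtX ρ y w| ≤ C * √(metAtX gbar y w w) := by
    refine isCompact_univ.induction_on (p := fun s => ∃ C : ℝ, 0 < C ∧ ∀ y ∈ s, ∀ w,
      |dAtX ρ y w| ≤ C * √(metAtX gbar y w w)) ⟨1, one_pos, by simp⟩ ?_ ?_ ?_
    · rintro s t hst ⟨C, hC, h⟩
      exact ⟨C, hC, fun y hy => h y (hst hy)⟩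
    · rintro s t ⟨C, hC, h⟩ ⟨C', hC', h'⟩
      refine ⟨max C C', lt_max_of_lt_left hC, fun y hy w => ?_⟩
      rcases hy with hy | hy
      · exact (h y hy w).trans (by gcongr; exact le_max_left _ _)
      · exact (h' y hy w).trans (by gcongr; exact le_max_right _ _)
    · intro y _
      obtain ⟨C, hC, h⟩ := eventually_abs_dAtX_le gbar hρ y
      exact ⟨_, mem_nhdsWithin_of_mem_nhds h, C, hC, fun y hy => hy⟩
  simpa using key

variable {ι : M → X} {g : Metric (𝓡 m) M}

theorem IsAsymptoticallyHyperbolic.isOpenEmbedding (h : IsAsymptoticallyHyperbolic ι g) :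
    Topology.IsOpenEmbedding ι :=
  h.localDiffeo.isLocalHomeomorph.isOpenEmbedding_of_injective h.injective

theorem IsAsymptoticallyHyperbolic.t2Space [T2Space X] (h : IsAsymptoticallyHyperbolic ι g) :
    T2Space M := h.isOpenEmbedding.isEmbedding.t2Space

/-- The conformal factor turns `|d log ρ|_g` into `|dρ|` for the extended metric, which is bounded
on the compact `X`. Hence `log ρ` is Lipschitz, a ball lies in a set `{ρ ≥ c}` with `c > 0`, and
such a set is compact and disjoint from the boundary. -/
theorem IsAsymptoticallyHyperbolic.properMetric [T2Space X] [CompactSpace X]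
    (h : IsAsymptoticallyHyperbolic ι g) : ProperMetric g := by
  obtain ⟨ρ, gbar, hρ, hconf, -⟩ := h.conformal
  obtain ⟨C, hC, hbound⟩ := exists_abs_dAtX_le gbar hρ.smooth
  have hpos (x : M) : 0 < ρ (ι x) := hρ.pos _ (h.range_eq ▸ mem_range_self x)
  have hι : ContMDiff (𝓡 m) (𝓡∂ m) ∞ ι := h.localDiffeo.contMDiff
  have hlog : ContMDiff (𝓡 m) 𝓘(ℝ, ℝ) ∞ (fun x => Real.log (ρ (ι x))) := fun x =>
    ContMDiffAt.comp x (I' := 𝓘(ℝ, ℝ)) (g := Real.log) (f := fun x => ρ (ι x))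
      (contMDiffAt_iff_contDiffAt.2 (Real.contDiffAt_log.2 (hpos x).ne'))
      ((hρ.smooth.comp hι) x)
  let ιD (x : M) : EuclideanSpace ℝ (Fin m) →L[ℝ] EuclideanSpace ℝ (Fin m) :=
    mfderiv (𝓡 m) (𝓡∂ m) ι x
  have hder (x : M) : HasMFDerivAt (𝓡 m) 𝓘(ℝ, ℝ) (fun x => Real.log (ρ (ι x))) x
      ((ρ (ι x))⁻¹ • (dAtX ρ (ι x)).comp (ιD x)) := by
    have h1 : HasMFDerivAt (𝓡 m) 𝓘(ℝ, ℝ) (fun x => ρ (ι x)) x ((dAtX ρ (ι x)).comp (ιD x)) :=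
      ((hρ.smooth.mdifferentiable (by simp)) (ι x)).hasMFDerivAt.comp x
        ((hι.mdifferentiable (by simp)) x).hasMFDerivAt
    have h2 := (Real.hasDerivAt_log (hpos x).ne').hasFDerivAt.hasMFDerivAt.comp x h1
    refine (congrArg (fun L : EuclideanSpace ℝ (Fin m) →L[ℝ] ℝ =>
      HasMFDerivAt (𝓡 m) 𝓘(ℝ, ℝ) (fun x => Real.log (ρ (ι x))) x L) ?_).mp h2
    ext v
    change (ContinuousLinearMap.toSpanSingleton ℝ (ρ (ι x))⁻¹) (dAtX ρ (ι x) (ιD x v)) = _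
    simp [mul_comm]
    rfl
  have hbd (x : M) (v : EuclideanSpace ℝ (Fin m)) :
      |((ρ (ι x))⁻¹ • (dAtX ρ (ι x)).comp (ιD x)) v| ≤ C * gnorm g x v := by
    have h1 : metAtX gbar (ι x) (ιD x v) (ιD x v) = ρ (ι x) ^ 2 * metAt g x v v := hconf x v v
    have h2 := hbound (ι x) (ιD x v)
    rw [h1, Real.sqrt_mul (sq_nonneg _), Real.sqrt_sq (hpos x).le] at h2
    have h3 : ((ρ (ι x))⁻¹ • (dAtX ρ (ι x)).comp (ιD x)) v =
        (ρ (ι x))⁻¹ * dAtX ρ (ι x) (ιD x v) := rfl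
    rw [h3, abs_mul, abs_of_pos (inv_pos.2 (hpos x)), inv_mul_le_iff₀ (hpos x)]
    calc _ ≤ _ := h2
      _ = _ := by rw [gnorm]; ring
  -- The extra unit in `R + 1` leaves room for a path that is only nearly shortest.
  have hlip (x y : M) (R : ℝ) (hR : 0 ≤ R) (hxy : redist g x y ≤ ENNReal.ofReal R) :
      Real.log (ρ (ι x)) - C * (R + 1) ≤ Real.log (ρ (ι y)) := by
    have hlt : redist g x y < ENNReal.ofReal (R + 1) :=
      hxy.trans_lt ((ENNReal.ofReal_lt_ofReal_iff (by linarith)).2 (by linarith))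
    obtain ⟨γ, h0, h1, hγ, hlen⟩ := exists_path_of_redist_lt g hlt
    have hd (t : ℝ) : HasDerivAt (fun t => Real.log (ρ (ι (γ t)))) _ t :=
      derivAt_comp_apply (f := fun x => Real.log (ρ (ι x))) (γ := γ) (hder (γ t)) (hγ.mdifferentiable (by simp) t)
    have hf : ContDiff ℝ 1 (fun t => Real.log (ρ (ι (γ t)))) := by
      rw [← contMDiff_iff_contDiff]
      exact (hlog.of_le (by simp)).comp hγ
    have h2 := abs_sub_le_of_deriv_le_gnorm g (γ := γ) zero_le_one hf.contDiffOn hC.le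
      (fun t _ => by rw [(hd t).deriv]; exact hbd _ _)
    have h3 : ENNReal.ofReal |Real.log (ρ (ι (γ 1))) - Real.log (ρ (ι (γ 0)))| ≤
        ENNReal.ofReal (C * (R + 1)) := by
      refine h2.trans ?_
      rw [ENNReal.ofReal_mul hC.le]
      gcongr
    rw [ENNReal.ofReal_le_ofReal_iff (by positivity), h0, h1] at h3
    have := (abs_le.1 h3).1
    linarith
  intro x R
  -- A negative radius is sent to zero by `ENNReal.ofReal`, so the ball of radius zero covers this
  -- case.
  wlog hR : 0 ≤ R generalizing R
  · have h1 := this 0 le_rfl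
    refine h1.of_isClosed_subset (isClosed_redist_le g x _) fun y hy => ?_
    have : ENNReal.ofReal R ≤ ENNReal.ofReal 0 := ENNReal.ofReal_le_ofReal (by linarith)
    exact le_trans hy this
  set c : ℝ := Real.exp (Real.log (ρ (ι x)) - C * (R + 1)) with hc
  have hK : IsCompact {y : X | c ≤ ρ y} :=
    (isClosed_le continuous_const hρ.smooth.continuous).isCompact
  have hsub : {y : X | c ≤ ρ y} ⊆ range ι := by
    intro y hy
    rw [h.range_eq]
    rcases ((𝓡∂ m).interior_union_boundary_eq_univ (M := X)).ge (mem_univ y) with h1 | h1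
    · exact h1
    · have h2 := hρ.zero y h1
      have h3 : c ≤ ρ y := hy
      rw [h2] at h3
      exact absurd h3 (not_le.2 (Real.exp_pos _))
  have hK' : IsCompact (ι ⁻¹' {y : X | c ≤ ρ y}) :=
    h.isOpenEmbedding.isInducing.isCompact_preimage_iff hsub |>.2 hK
  refine hK'.of_isClosed_subset (isClosed_redist_le g x _) fun y hy => ?_
  have h1 := hlip x y R hR hy
  rw [mem_preimage, mem_ofPred_eq, hc]
  calc _ ≤ Real.exp (Real.log (ρ (ι y))) := Real.exp_le_exp.2 h1
    _ = _ := Real.exp_log (hpos y)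

end Completeness
end AHM

end

noncomputable section

set_option synthInstance.maxHeartbeats 200000

namespace AHM

/-! ### Compactness of disc bundles over compact sets -/

section DiscBundle

variable {m : ℕ} {M : Type*} [TopologicalSpace M]
  [ChartedSpace (EuclideanSpace ℝ (Fin m)) M] [IsManifold (𝓡 m) ∞ M]

theorem continuous_cotProj : Continuous (fun q : Cotangent m M => q.proj) :=
  contMDiff_cotProj.continuous

theorem t2Space_cotangent [T2Space M] : T2Space (Cotangent m M) := by
  refine ⟨fun q₁ q₂ hne => ?_⟩
  by_cases h : q₁.proj = q₂.proj
  · have h1 := mem_cotChart_self q₁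
    have h2 : q₂ ∈ (cotChart q₁).source := by
      rw [mem_cotChart_source, ← h]; exact mem_chart_source _ _
    have hne' : cotChart q₁ q₁ ≠ cotChart q₁ q₂ := fun h3 => hne ((cotChart q₁).injOn h1 h2 h3)
    obtain ⟨U, V, hU, hV, hqU, hqV, hUV⟩ := t2_separation hne'
    have hc := (contMDiffOn_cotChart q₁).continuousOn
    exact ⟨_, _, hc.isOpen_inter_preimage (isOpen_cotChart_source q₁) hU,
      hc.isOpen_inter_preimage (isOpen_cotChart_source q₁) hV, ⟨h1, hqU⟩, ⟨h2, hqV⟩,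
      (hUV.preimage (cotChart q₁)).mono inter_subset_right inter_subset_right⟩
  · obtain ⟨U, V, hU, hV, hqU, hqV, hUV⟩ := t2_separation h
    exact ⟨_, _, hU.preimage continuous_cotProj, hV.preimage continuous_cotProj, hqU, hqV,
      hUV.preimage _⟩

/-- The squared norm of a covector. -/
def normSq (g : Metric (𝓡 m) M) (q : Cotangent m M) : ℝ := covec q (sharp g q)

theorem energy_eq_normSq (g : Metric (𝓡 m) M) (q : Cotangent m M) :
    energy g q = (normSq g q - 1) / 2 := energy_eq g q

theorem normSq_eq_energy (g : Metric (𝓡 m) M) (q : Cotangent m M) :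
    normSq g q = 2 * energy g q + 1 := by rw [energy_eq_normSq]; ring

theorem normSq_eq_metAt (g : Metric (𝓡 m) M) (q : Cotangent m M) :
    normSq g q = metAt g q.proj (sharp g q) (sharp g q) := by rw [metAt_sharp]; rfl

theorem normSq_nonneg (g : Metric (𝓡 m) M) (q : Cotangent m M) : 0 ≤ normSq g q := by
  rw [normSq_eq_metAt]; exact metAt_nonneg g _ _

theorem gnorm_sharp (g : Metric (𝓡 m) M) (q : Cotangent m M) :
    gnorm g q.proj (sharp g q) = √(normSq g q) := by rw [gnorm, normSq_eq_metAt]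

theorem normSq_pos (g : Metric (𝓡 m) M) {q : Cotangent m M} (hq : covec q ≠ 0) :
    0 < normSq g q := by
  rw [normSq_eq_metAt]
  refine metAt_pos g _ fun h => hq ?_
  rw [← metAt_sharp g q, h, map_zero]

theorem continuous_normSq (g : Metric (𝓡 m) M) : Continuous (normSq g) := by
  have : normSq g = fun q => 2 * energy g q + 1 := funext fun q => normSq_eq_energy g q
  rw [this]
  exact ((contMDiff_energy g).continuous.const_mul 2).add_const 1

theorem normSq_cotChart_symm (g : Metric (𝓡 m) M) {q₀ : Cotangent m M} {z : CotModel m}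
    (hz : z ∈ (cotChart q₀).target) :
    normSq g ((cotChart q₀).symm z) =
      z.2 (ContinuousLinearMap.inverse
        (metChart g q₀.proj ((extChartAt (𝓡 m) q₀.proj).symm z.1)) z.2) := by
  rw [normSq_eq_energy, energy_cotChart_symm g hz]; ring

/-- Over a closed coordinate ball the squared norm is bounded below by a positive multiple of
`‖ζ‖²`, by minimizing over the compact unit sphere and scaling. The disc bundle is then a closed
subset of a product of closed balls. -/
theorem exists_nhds_isCompact_disc [T2Space M] (g : Metric (𝓡 m) M) (x₀ : M) (c : ℝ) :
    ∃ N ∈ 𝓝 x₀, IsCompact {q : Cotangent m M | q.proj ∈ N ∧ normSq g q ≤ c} := by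
  let q₀ : Cotangent m M := ⟨x₀, 0⟩
  set φ := extChartAt (𝓡 m) x₀ with hφ
  have ht : φ.target ∈ 𝓝 (φ x₀) := extChartAt_target_mem_nhds x₀
  obtain ⟨r, hr, hrt⟩ := Metric.nhds_basis_closedBall.mem_iff.1 ht
  set B := Metric.closedBall (φ x₀) r with hB
  have hBc : IsCompact B := isCompact_closedBall _ _
  have htgt : ∀ z : CotModel m, z.1 ∈ B → z ∈ (cotChart q₀).target := fun z hz => by
    rw [cotChart_target]; exact ⟨hrt hz, mem_univ _⟩
  have hns : ContinuousOn (fun z : CotModel m => normSq g ((cotChart q₀).symm z))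
      (B ×ˢ univ) :=
    (continuous_normSq g).comp_continuousOn ((contMDiffOn_cotChart_symm q₀).continuousOn.mono
      fun z hz => htgt z hz.1)
  have hform (z : CotModel m) (hz : z.1 ∈ B) := normSq_cotChart_symm g (htgt z hz)
  obtain ⟨l, hl, hlb⟩ : ∃ l : ℝ, 0 < l ∧ ∀ z : CotModel m, z.1 ∈ B →
      l * ‖z.2‖ ^ 2 ≤ normSq g ((cotChart q₀).symm z) := by
    have hsphere : IsCompact (B ×ˢ Metric.sphere (0 : EuclideanSpace ℝ (Fin m) →L[ℝ] ℝ) 1) :=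
      hBc.prod (isCompact_sphere _ _)
    have hscale (z : CotModel m) (hz : z.1 ∈ B) (s : ℝ) :
        normSq g ((cotChart q₀).symm (z.1, s • z.2)) = s ^ 2 * normSq g ((cotChart q₀).symm z) := by
      rw [hform z hz, hform (z.1, s • z.2) hz]
      simp only [map_smul, smul_apply, smul_eq_mul]
      ring
    have hmain : ∃ l : ℝ, 0 < l ∧
        ∀ z ∈ B ×ˢ Metric.sphere (0 : EuclideanSpace ℝ (Fin m) →L[ℝ] ℝ) 1,
          l ≤ normSq g ((cotChart q₀).symm z) := by
      -- The unit sphere is empty in dimension zero, where any positive constant will do.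
      rcases (B ×ˢ Metric.sphere (0 : EuclideanSpace ℝ (Fin m) →L[ℝ] ℝ) 1).eq_empty_or_nonempty
        with h | h
      · exact ⟨1, one_pos, by simp [h]⟩
      · obtain ⟨z, hz, hmin⟩ := hsphere.exists_isMinOn h
          (hns.mono (prod_mono_right (subset_univ _)))
        refine ⟨_, normSq_pos g ?_, hmin⟩
        rw [cotChart_symm_covec (htgt z hz.1)]
        intro h0
        have hsrc := mem_cotChart_source.1 ((cotChart q₀).map_target (htgt z hz.1))
        have h1 : z.2 = 0 := by
          ext v
          have := congrArg (fun L => L (chartDInv q₀.proj ((cotChart q₀).symm z).proj v)) h0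
          simpa [chartD_chartDInv hsrc] using this
        have h2 : ‖z.2‖ = 1 := by simpa using hz.2
        rw [h1, norm_zero] at h2
        exact zero_ne_one h2
    obtain ⟨l, hl, h⟩ := hmain
    refine ⟨l, hl, fun z hz => ?_⟩
    by_cases h0 : z.2 = 0
    · rw [h0]; simpa using normSq_nonneg g _
    · have hn : 0 < ‖z.2‖ := norm_pos_iff.2 h0
      have h1 := h (z.1, ‖z.2‖⁻¹ • z.2) ⟨hz, by simp [norm_smul, hn.ne']⟩
      rw [hscale z hz] at h1
      have h2 : normSq g ((cotChart q₀).symm z) =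
          ‖z.2‖ ^ 2 * (‖z.2‖⁻¹ ^ 2 * normSq g ((cotChart q₀).symm z)) := by
        field_simp
      rw [h2, mul_comm l]
      gcongr
  have hcomp : IsCompact {z : CotModel m | z ∈ B ×ˢ univ ∧
      normSq g ((cotChart q₀).symm z) ≤ c} := by
    refine (hBc.prod (isCompact_closedBall (0 : EuclideanSpace ℝ (Fin m) →L[ℝ] ℝ)
      (√(c / l)))).of_isClosed_subset ?_ ?_
    · have := hns.preimage_isClosed_of_isClosed (Metric.isClosed_closedBall.prod isClosed_univ)
        (isClosed_Iic (a := c))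
      exact this
    · rintro z ⟨hz, hzc⟩
      refine ⟨hz.1, ?_⟩
      rw [mem_closedBall_zero_iff]
      refine Real.le_sqrt_of_sq_le ?_
      rw [le_div_iff₀ hl, mul_comm]
      exact (hlb z hz.1).trans hzc
  refine ⟨φ.source ∩ φ ⁻¹' B, ?_, ?_⟩
  · exact Filter.inter_mem (extChartAt_source_mem_nhds x₀)
      ((continuousAt_extChartAt x₀).preimage_mem_nhds (Metric.closedBall_mem_nhds _ hr))
  · have := hcomp.image_of_continuousOn (f := (cotChart q₀).symm)
      ((contMDiffOn_cotChart_symm q₀).continuousOn.mono fun z hz => htgt z hz.1.1)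
    convert this using 1
    ext q
    constructor
    · rintro ⟨⟨h1, h2⟩, h3⟩
      have hq : q ∈ (cotChart q₀).source := by
        rw [mem_cotChart_source, ← extChartAt_source (𝓡 m)]; exact h1
      have hli := (cotChart q₀).left_inv hq
      refine ⟨cotChart q₀ q, ⟨⟨?_, mem_univ _⟩, ?_⟩, hli⟩
      · rw [cotChart_apply hq]; exact h2
      · rw [hli]; exact h3
    · rintro ⟨z, ⟨⟨h1, -⟩, h2⟩, rfl⟩
      refine ⟨?_, h2⟩
      rw [cotChart_symm_proj (htgt z h1)]
      refine ⟨φ.map_target (hrt h1), ?_⟩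
      have h3 : φ (φ.symm z.1) = z.1 := φ.right_inv (hrt h1)
      rw [mem_preimage, h3]
      exact h1

theorem isCompact_disc [T2Space M] (g : Metric (𝓡 m) M) {K : Set M} (hK : IsCompact K) (c : ℝ) :
    IsCompact {q : Cotangent m M | q.proj ∈ K ∧ normSq g q ≤ c} := by
  have key : ∃ N, K ⊆ N ∧ IsCompact {q : Cotangent m M | q.proj ∈ N ∧ normSq g q ≤ c} := by
    refine hK.induction_on (p := fun s => ∃ N, s ⊆ N ∧
      IsCompact {q : Cotangent m M | q.proj ∈ N ∧ normSq g q ≤ c}) ⟨∅, by simp⟩ ?_ ?_ ?_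
    · rintro s t hst ⟨N, hN, h⟩
      exact ⟨N, hst.trans hN, h⟩
    · rintro s t ⟨N, hN, h⟩ ⟨N', hN', h'⟩
      refine ⟨N ∪ N', union_subset_union hN hN', ?_⟩
      convert h.union h' using 1
      ext q
      simp only [mem_union, mem_ofPred_eq]
      tauto
    · intro x _
      obtain ⟨N, hN, h⟩ := exists_nhds_isCompact_disc g x c
      exact ⟨N, mem_nhdsWithin_of_mem_nhds hN, N, subset_rfl, h⟩
  obtain ⟨N, hN, h⟩ := key
  refine h.of_isClosed_subset ?_ fun q hq => ⟨hN hq.1, hq.2⟩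
  exact (hK.isClosed.preimage continuous_cotProj).inter
    (isClosed_le (continuous_normSq g) continuous_const)

end DiscBundle

/-! ### Local flow of the Hamilton field on the cotangent bundle -/

section LocalFlow

variable {m : ℕ} {M : Type*} [TopologicalSpace M]
  [ChartedSpace (EuclideanSpace ℝ (Fin m)) M] [IsManifold (𝓡 m) ∞ M]

/-- The Hamilton vector field has a smooth local flow. -/
theorem exists_contMDiffOn_localFlow (g : Metric (𝓡 m) M) (q : Cotangent m M) :
    ∃ φ : ℝ × Cotangent m M → Cotangent m M, ∃ ε > 0, ∃ V, IsOpen V ∧ q ∈ V ∧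
      ContMDiffOn (𝓘(ℝ, ℝ).prod (cotI m)) (cotI m) ∞ φ (Ioo (-ε) ε ×ˢ V) ∧
      ∀ a ∈ V, φ (0, a) = a ∧
        IsMIntegralCurveOn (I := cotI m) (fun t => φ (t, a)) (hamiltonField (energy g))
          (Ioo (-ε) ε) := by
  obtain ⟨φ, ε, hε, V, hV, hqV, hφ, h⟩ := exists_contDiffOn_localFlow (isOpen_cotChart_target q)
    (contDiffOn_hamChart g q) ((cotChart q).map_source (mem_cotChart_self q))
  have hV' : IsOpen ((cotChart q).source ∩ cotChart q ⁻¹' V) :=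
    (contMDiffOn_cotChart q).continuousOn.isOpen_inter_preimage (isOpen_cotChart_source q) hV
  refine ⟨fun x => (cotChart q).symm (φ (x.1, cotChart q x.2)), ε, hε, _, hV',
    ⟨mem_cotChart_self q, hqV⟩, ?_, ?_⟩
  · have h1 : ContMDiffOn (𝓘(ℝ, ℝ).prod (cotI m)) 𝓘(ℝ, ℝ × CotModel m) ∞
        (fun x : ℝ × Cotangent m M => (x.1, cotChart q x.2))
        (Ioo (-ε) ε ×ˢ ((cotChart q).source ∩ cotChart q ⁻¹' V)) :=
      contMDiffOn_fst.prodMk_space ((contMDiffOn_cotChart q).comp contMDiffOn_snd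
        fun x hx => hx.2.1)
    have h2 : ContMDiffOn 𝓘(ℝ, ℝ × CotModel m) 𝓘(ℝ, CotModel m) ∞ φ (Ioo (-ε) ε ×ˢ V) := by
      rw [contMDiffOn_iff_contDiffOn]; exact hφ
    exact (contMDiffOn_cotChart_symm q).comp (h2.comp h1 fun x hx => ⟨hx.1, hx.2.2⟩)
      fun x hx => (((h _ hx.2.2).2 _ hx.1)).1
  · rintro a ⟨ha, haV⟩
    obtain ⟨h0, h1⟩ := h _ haV
    refine ⟨?_, fun t ht => ?_⟩
    · change (cotChart q).symm (φ (0, cotChart q a)) = a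
      rw [h0, (cotChart q).left_inv ha]
    · have htgt := (h1 t ht).1
      have hchart (t' : ℝ) (ht' : t' ∈ Ioo (-ε) ε) :
          cotChart q ((cotChart q).symm (φ (t', cotChart q a))) = φ (t', cotChart q a) :=
        (cotChart q).right_inv (h1 t' ht').1
      refine (hasMFDerivWithinAt_iff_chart (q₀ := q) (mdifferentiableAt_energy g _)
        ((cotChart q).map_target htgt)).2 ⟨?_, ?_⟩
      · have h2 : ContinuousAt (cotChart q).symm (φ (t, cotChart q a)) :=
          (contMDiffAt_cotChart_symm htgt).continuousAt
        exact (ContinuousAt.comp (f := fun t => φ (t, cotChart q a)) h2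
          (h1 t ht).2.continuousAt).continuousWithinAt
      · rw [hchart t ht]
        refine ((h1 t ht).2.hasDerivWithinAt).congr (fun t' ht' => hchart t' ht') (hchart t ht)

end LocalFlow
end AHM

end

noncomputable section

set_option synthInstance.maxHeartbeats 200000

namespace AHM

/-! ### Conservation of energy, completeness and smoothness of the flow -/

section GlobalFlow

variable {m : ℕ} {M : Type*} [TopologicalSpace M]
  [ChartedSpace (EuclideanSpace ℝ (Fin m)) M] [IsManifold (𝓡 m) ∞ M]

/-- Integral curves of the Hamilton vector field of the energy. -/
abbrev IsHam (g : Metric (𝓡 m) M) (γ : ℝ → Cotangent m M) (s : Set ℝ) : Prop :=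
  IsMIntegralCurveOn (I := cotI m) γ (hamiltonField (energy g)) s

theorem contMDiff_one_hamiltonField (g : Metric (𝓡 m) M) :
    ContMDiff (cotI m) (cotI m).tangent 1
      (fun q => (⟨q, hamiltonField (energy g) q⟩ : TangentBundle (cotI m) (Cotangent m M))) :=
  (contMDiff_hamiltonField_energy g).of_le (by simp)

theorem IsHam.hasMFDerivAt {g : Metric (𝓡 m) M} {γ : ℝ → Cotangent m M} {s : Set ℝ} {t : ℝ}
    (h : IsHam g γ s) (ht : s ∈ 𝓝 t) : HasMFDerivAt 𝓘(ℝ, ℝ) (cotI m) γ t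
      ((1 : ℝ →L[ℝ] ℝ).smulRight (hamVec (energy g) (γ t))) :=
  (h t (mem_of_mem_nhds ht)).hasMFDerivAt ht

/-- Antisymmetry of the symplectic form: `dp(H_p) = ω(H_p, H_p)`. -/
theorem dAt_energy_hamVec (g : Metric (𝓡 m) M) (q : Cotangent m M) :
    dAt (energy g) q (hamVec (energy g) q) = 0 := by
  have h := modelForm_modelHamilton (dAt (energy g) q) (modelHamilton (dAt (energy g) q))
  have h2 : dAt (energy g) q (hamVec (energy g) q) =
    dAt (energy g) q (modelHamilton (dAt (energy g) q)) := rfl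
  rw [h2, ← h]
  simp [modelForm]

theorem IsHam.hasDerivAt_energy {g : Metric (𝓡 m) M} {γ : ℝ → Cotangent m M} {s : Set ℝ} {t : ℝ}
    (h : IsHam g γ s) (ht : s ∈ 𝓝 t) : HasDerivAt (fun t => energy g (γ t)) 0 t := by
  have h1 : HasMFDerivAt (cotI m) 𝓘(ℝ, ℝ) (energy g) (γ t) (dAt (energy g) (γ t)) :=
    (mdifferentiableAt_energy g (γ t)).hasMFDerivAt
  have h2 := hasFDerivAt_of_hasMFDerivAt (f' := (dAt (energy g) (γ t)).comp
    ((1 : ℝ →L[ℝ] ℝ).smulRight (hamVec (energy g) (γ t)))) (h1.comp t (h.hasMFDerivAt ht))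
  refine h2.hasDerivAt.congr_deriv ?_
  have hone (v : CotModel m) : ((1 : ℝ →L[ℝ] ℝ).smulRight v) 1 = v := by simp
  rw [ContinuousLinearMap.comp_apply, hone, dAt_energy_hamVec]

theorem IsHam.derivAt_proj {g : Metric (𝓡 m) M} {γ : ℝ → Cotangent m M} {s : Set ℝ} {t : ℝ}
    (h : IsHam g γ s) (ht : s ∈ 𝓝 t) : derivAt (fun t => (γ t).proj) t 1 = sharp g (γ t) := by
  have h2 := (hasMFDerivAt_cotProj (γ t)).comp t (h.hasMFDerivAt ht)
  have hone (v : CotModel m) : ((1 : ℝ →L[ℝ] ℝ).smulRight v) 1 = v := by simp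
  have h3 : derivAt (fun t => (γ t).proj) t = (ContinuousLinearMap.fst ℝ (EuclideanSpace ℝ (Fin m))
    (EuclideanSpace ℝ (Fin m) →L[ℝ] ℝ)).comp
      ((1 : ℝ →L[ℝ] ℝ).smulRight (hamVec (energy g) (γ t))) := h2.mfderiv
  rw [h3, ContinuousLinearMap.comp_apply, hone, ← hamVec_energy_fst]
  rfl

theorem IsHam.energy_eq {g : Metric (𝓡 m) M} {γ : ℝ → Cotangent m M} {a b s t : ℝ}
    (h : IsHam g γ (Ioo a b)) (hs : s ∈ Ioo a b) (ht : t ∈ Ioo a b) :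
    energy g (γ s) = energy g (γ t) := by
  have hd : ∀ u ∈ Ioo a b, HasDerivAt (fun t => energy g (γ t)) 0 u := fun u hu =>
    h.hasDerivAt_energy (Ioo_mem_nhds hu.1 hu.2)
  refine (convex_Ioo a b).is_const_of_fderivWithin_eq_zero (𝕜 := ℝ)
    (fun u hu => (hd u hu).differentiableAt.differentiableWithinAt) (fun u hu => ?_) hs ht
  rw [fderivWithin_of_isOpen isOpen_Ioo hu]
  ext
  simp [(hd u hu).deriv]

theorem IsHam.normSq_eq {g : Metric (𝓡 m) M} {γ : ℝ → Cotangent m M} {a b s t : ℝ}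
    (h : IsHam g γ (Ioo a b)) (hs : s ∈ Ioo a b) (ht : t ∈ Ioo a b) :
    normSq g (γ s) = normSq g (γ t) := by
  rw [normSq_eq_energy, normSq_eq_energy, h.energy_eq hs ht]

/-- Uniqueness makes the curve agree near `t` with an orbit of a smooth local flow. -/
theorem IsHam.contMDiffAt [T2Space M] {g : Metric (𝓡 m) M} {γ : ℝ → Cotangent m M} {a b t : ℝ}
    (h : IsHam g γ (Ioo a b)) (ht : t ∈ Ioo a b) : ContMDiffAt 𝓘(ℝ, ℝ) (cotI m) ∞ γ t := by
  have := t2Space_cotangent (M := M) (m := m)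
  obtain ⟨φ, ε, hε, V, hV, hqV, hφ, hloc⟩ := exists_contMDiffOn_localFlow g (γ t)
  obtain ⟨h0, h1⟩ := hloc _ hqV
  have h2 : IsHam g (fun s => φ (s - t, γ t)) (Ioo (t - ε) (t + ε)) := by
    have h3 := (isMIntegralCurveOn_comp_sub (dt := t)).2 h1
    refine IsMIntegralCurveOn.mono h3 fun s hs => ?_
    rw [mem_ofPred_eq, mem_Ioo]
    constructor <;> linarith [hs.1, hs.2]
  have ht' : t ∈ Ioo (max a (t - ε)) (min b (t + ε)) :=
    ⟨max_lt ht.1 (by linarith), lt_min ht.2 (by linarith)⟩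
  have heq := isMIntegralCurveOn_Ioo_eqOn_of_contMDiff_boundaryless ht'
    (contMDiff_one_hamiltonField g)
    (h.mono (Ioo_subset_Ioo (le_max_left _ _) (min_le_left _ _)))
    (h2.mono (Ioo_subset_Ioo (le_max_right _ _) (min_le_right _ _))) (by simp [h0])
  have h4 : ContMDiffAt 𝓘(ℝ, ℝ) (cotI m) ∞ (fun s => φ (s - t, γ t)) t := by
    have h5 : ContMDiffAt (𝓘(ℝ, ℝ).prod (cotI m)) (cotI m) ∞ φ (t - t, γ t) :=
      hφ.contMDiffAt ((isOpen_Ioo.prod hV).mem_nhds ⟨by constructor <;> linarith, hqV⟩)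
    refine ContMDiffAt.comp t (f := fun s => (s - t, γ t)) h5 ?_
    refine ContMDiffAt.prodMk ?_ contMDiffAt_const
    rw [contMDiffAt_iff_contDiffAt]
    exact contDiffAt_id.sub contDiffAt_const
  refine h4.congr_of_eventuallyEq ?_
  filter_upwards [Ioo_mem_nhds ht'.1 ht'.2] with s hs using heq hs

/-- The projected curve has constant speed `√normSq` by conservation of energy, so its length is
speed times elapsed time. -/
theorem IsHam.redist_le [T2Space M] {g : Metric (𝓡 m) M} {γ : ℝ → Cotangent m M} {a b s t : ℝ}
    (h : IsHam g γ (Ioo a b)) (hs : s ∈ Ioo a b) (ht : t ∈ Ioo a b) (hst : s ≤ t) :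
    redist g (γ s).proj (γ t).proj ≤ ENNReal.ofReal ((t - s) * √(normSq g (γ s))) := by
  have hsub : Icc s t ⊆ Ioo a b := fun u hu => ⟨hs.1.trans_le hu.1, hu.2.trans_lt ht.2⟩
  refine (redist_le_plen g (γ := fun u => (γ u).proj) hst fun u hu => ?_).trans
    (plen_le_of_gnorm_le g hst fun u hu => ?_)
  · refine ContMDiffAt.contMDiffWithinAt ?_
    exact ((contMDiff_cotProj.contMDiffAt).comp u (h.contMDiffAt (hsub hu))).of_le (by simp)
  · have hu' := hsub (Ioo_subset_Icc_self hu)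
    rw [h.derivAt_proj (Ioo_mem_nhds hu'.1 hu'.2), gnorm_sharp, h.normSq_eq hu' hs]

/-- A local integral curve can be extended as long as the existence time of the local integral
curves is bounded from below along it. -/
theorem exists_isHam_Ioo_of_uniform [T2Space M] (g : Metric (𝓡 m) M) {a : Cotangent m M}
    {K : Set (Cotangent m M)} {r ε : ℝ} (hε : 0 < ε)
    (hK : ∀ γ : ℝ → Cotangent m M, ∀ s ≤ r, γ 0 = a → IsHam g γ (Ioo (-s) s) →
      ∀ t ∈ Ioo (-s) s, γ t ∈ K) (haK : a ∈ K)
    (h : ∀ q ∈ K, ∃ γ : ℝ → Cotangent m M, γ 0 = q ∧ IsHam g γ (Ioo (-ε) ε)) :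
    ∃ γ : ℝ → Cotangent m M, γ 0 = a ∧ IsHam g γ (Ioo (-r) r) := by
  have := t2Space_cotangent (M := M) (m := m)
  have hv := contMDiff_one_hamiltonField g
  -- Local solutions restarted at `±(b - ε / 2)`, inside the interval already reached, gain `ε / 2`
  -- at each end.
  have step (b : ℝ) (hb : ε ≤ b) (hbr : b ≤ r)
      (hP : ∃ γ : ℝ → Cotangent m M, γ 0 = a ∧ IsHam g γ (Ioo (-b) b)) :
      ∃ γ : ℝ → Cotangent m M, γ 0 = a ∧ IsHam g γ (Ioo (-(b + ε / 2)) (b + ε / 2)) := by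
    obtain ⟨γ, h0, hγ⟩ := hP
    have hmem1 : -(b - ε / 2) ∈ Ioo (-b) b := by constructor <;> linarith
    have hmem2 : b - ε / 2 ∈ Ioo (-b) b := by constructor <;> linarith
    obtain ⟨γ₁, h10, hγ1⟩ := h _ (hK γ b hbr h0 hγ _ hmem1)
    obtain ⟨γ₂, h20, hγ2⟩ := h _ (hK γ b hbr h0 hγ _ hmem2)
    have hγ1' : IsHam g (γ₁ ∘ (· + (b - ε / 2))) (Ioo (-(b + ε / 2)) (-(b - ε / 2) + ε)) := by
      refine IsMIntegralCurveOn.mono ((isMIntegralCurveOn_comp_add (dt := b - ε / 2)).2 hγ1)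
        fun s hs => ?_
      rw [mem_ofPred_eq, mem_Ioo]
      constructor <;> linarith [hs.1, hs.2]
    have hγ2' : IsHam g (γ₂ ∘ (· - (b - ε / 2))) (Ioo (b - ε / 2 - ε) (b + ε / 2)) := by
      refine IsMIntegralCurveOn.mono ((isMIntegralCurveOn_comp_sub (dt := b - ε / 2)).2 hγ2)
        fun s hs => ?_
      rw [mem_ofPred_eq, mem_Ioo]
      constructor <;> linarith [hs.1, hs.2]
    have hA := isMIntegralCurveOn_piecewise (t₀ := -(b - ε / 2)) hv hγ hγ1'
      ⟨hmem1, ⟨by linarith, by linarith⟩⟩ (by simp [h10])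
    have hA' := IsMIntegralCurveOn.mono hA (s' := Ioo (-(b + ε / 2)) b)
      (union_comm _ _ ▸ Ioo_subset_Ioo_union_Ioo le_rfl (by linarith) le_rfl)
    have hB := isMIntegralCurveOn_piecewise (t₀ := b - ε / 2) hv hA' hγ2'
      ⟨⟨by linarith, by linarith⟩, ⟨by linarith, by linarith⟩⟩
      (by rw [piecewise, if_pos hmem2]; simp [h20])
    refine ⟨_, ?_, IsMIntegralCurveOn.mono hB
      (Ioo_subset_Ioo_union_Ioo le_rfl (by linarith) le_rfl)⟩
    rw [piecewise, if_pos ⟨by linarith, by linarith⟩, piecewise,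
      if_pos ⟨by linarith, by linarith⟩, h0]
  have iter (n : ℕ) : ε + n * (ε / 2) ≤ r + ε / 2 →
      ∃ γ : ℝ → Cotangent m M, γ 0 = a ∧ IsHam g γ (Ioo (-(ε + n * (ε / 2))) (ε + n * (ε / 2))) := by
    induction n with
    | zero =>
      intro _
      simpa using h a haK
    | succ n ih =>
      intro hn
      push_cast at hn ⊢
      have h1 : 0 ≤ (n : ℝ) * (ε / 2) := by positivity
      obtain ⟨γ, h0, hγ⟩ := step (ε + n * (ε / 2)) (by linarith) (by linarith) (ih (by linarith))
      refine ⟨γ, h0, ?_⟩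
      have h2 : ε + ((n : ℝ) + 1) * (ε / 2) = ε + n * (ε / 2) + ε / 2 := by ring
      rw [h2]; exact hγ
  by_cases hr : r ≤ ε
  · obtain ⟨γ, h0, hγ⟩ := h a haK
    exact ⟨γ, h0, IsMIntegralCurveOn.mono hγ (Ioo_subset_Ioo (by linarith) hr)⟩
  · push Not at hr
    set n := ⌈(r - ε) / (ε / 2)⌉₊ with hn
    have h1 : (r - ε) / (ε / 2) ≤ n := Nat.le_ceil _
    have h2 : (n : ℝ) < (r - ε) / (ε / 2) + 1 :=
      Nat.ceil_lt_add_one (div_nonneg (by linarith) (by linarith))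
    rw [div_le_iff₀ (by linarith)] at h1
    have h3 : (n : ℝ) * (ε / 2) < r - ε + ε / 2 := by
      have := mul_lt_mul_of_pos_right h2 (by linarith : 0 < ε / 2)
      rwa [add_mul, div_mul_cancel₀ _ (by linarith), one_mul] at this
    obtain ⟨γ, h0, hγ⟩ := iter n (by linarith)
    exact ⟨γ, h0, IsMIntegralCurveOn.mono hγ (Ioo_subset_Ioo (by linarith) (by linarith))⟩

theorem exists_uniform_localFlow (g : Metric (𝓡 m) M) {K : Set (Cotangent m M)}
    (hK : IsCompact K) : ∃ ε > 0, ∀ q ∈ K,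
    ∃ φ : ℝ × Cotangent m M → Cotangent m M, ∃ V, IsOpen V ∧ q ∈ V ∧
      ContMDiffOn (𝓘(ℝ, ℝ).prod (cotI m)) (cotI m) ∞ φ (Ioo (-ε) ε ×ˢ V) ∧
      ∀ a ∈ V, φ (0, a) = a ∧ IsHam g (fun t => φ (t, a)) (Ioo (-ε) ε) := by
  refine hK.induction_on (p := fun s => ∃ ε > 0, ∀ q ∈ s,
    ∃ φ : ℝ × Cotangent m M → Cotangent m M, ∃ V, IsOpen V ∧ q ∈ V ∧
      ContMDiffOn (𝓘(ℝ, ℝ).prod (cotI m)) (cotI m) ∞ φ (Ioo (-ε) ε ×ˢ V) ∧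
      ∀ a ∈ V, φ (0, a) = a ∧ IsHam g (fun t => φ (t, a)) (Ioo (-ε) ε))
    ⟨1, one_pos, by simp⟩ ?_ ?_ ?_
  · rintro s t hst ⟨ε, hε, h⟩
    exact ⟨ε, hε, fun q hq => h q (hst hq)⟩
  · have key (ε ε' : ℝ) (hle : ε' ≤ ε) (s : Set (Cotangent m M)) (h : ∀ q ∈ s,
        ∃ φ : ℝ × Cotangent m M → Cotangent m M, ∃ V, IsOpen V ∧ q ∈ V ∧
        ContMDiffOn (𝓘(ℝ, ℝ).prod (cotI m)) (cotI m) ∞ φ (Ioo (-ε) ε ×ˢ V) ∧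
        ∀ a ∈ V, φ (0, a) = a ∧ IsHam g (fun t => φ (t, a)) (Ioo (-ε) ε)) : ∀ q ∈ s,
        ∃ φ : ℝ × Cotangent m M → Cotangent m M, ∃ V, IsOpen V ∧ q ∈ V ∧
        ContMDiffOn (𝓘(ℝ, ℝ).prod (cotI m)) (cotI m) ∞ φ (Ioo (-ε') ε' ×ˢ V) ∧
        ∀ a ∈ V, φ (0, a) = a ∧ IsHam g (fun t => φ (t, a)) (Ioo (-ε') ε') := by
      intro q hq
      have hsub : Ioo (-ε') ε' ⊆ Ioo (-ε) ε := Ioo_subset_Ioo (by linarith) hle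
      obtain ⟨φ, V, hV, hqV, hφ, h1⟩ := h q hq
      exact ⟨φ, V, hV, hqV, hφ.mono (prod_mono_left hsub), fun a ha =>
        ⟨(h1 a ha).1, IsMIntegralCurveOn.mono (h1 a ha).2 hsub⟩⟩
    rintro s t ⟨ε, hε, h⟩ ⟨ε', hε', h'⟩
    refine ⟨min ε ε', lt_min hε hε', fun q hq => ?_⟩
    rcases hq with hq | hq
    · exact key ε _ (min_le_left _ _) s h q hq
    · exact key ε' _ (min_le_right _ _) t h' q hq
  · intro q _
    obtain ⟨φ, ε, hε, V, hV, hqV, hφ, h⟩ := exists_contMDiffOn_localFlow g q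
    exact ⟨V, mem_nhdsWithin_of_mem_nhds (hV.mem_nhds hqV), ε, hε,
      fun q' hq' => ⟨φ, V, hV, hq', hφ, h⟩⟩

/-- The Hamilton flow of a complete metric is complete. -/
theorem exists_isMIntegralCurve [T2Space M] {g : Metric (𝓡 m) M} (hp : ProperMetric g)
    (a : Cotangent m M) : ∃ γ : ℝ → Cotangent m M, γ 0 = a ∧
      IsMIntegralCurve (I := cotI m) γ (hamiltonField (energy g)) := by
  have := t2Space_cotangent (M := M) (m := m)
  refine (exists_isMIntegralCurve_iff_exists_isMIntegralCurveOn_Ioo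
    (contMDiff_one_hamiltonField g) a).2 fun r => ?_
  -- Conservation of energy bounds the covector, and the length estimate bounds the distance
  -- travelled before time `r`. The resulting set is compact because closed balls are, so the local
  -- existence time is uniform on it.
  set K : Set (Cotangent m M) := {q | q.proj ∈ {y | redist g a.proj y ≤
    ENNReal.ofReal (r * √(normSq g a))} ∧ normSq g q ≤ normSq g a} with hKdef
  have hKc : IsCompact K := isCompact_disc g (hp _ _) _
  obtain ⟨ε, hε, h⟩ := exists_uniform_localFlow g hKc
  refine exists_isHam_Ioo_of_uniform g hε (K := K) ?_ ?_ ?_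
  · intro γ s hs h0 hγ t ht
    have hs0 : 0 < s := by linarith [ht.1, ht.2]
    have h0s : (0 : ℝ) ∈ Ioo (-s) s := ⟨by linarith, hs0⟩
    have hn : normSq g (γ t) = normSq g a := by rw [hγ.normSq_eq ht h0s, h0]
    refine ⟨?_, hn.le⟩
    have hsqrt := Real.sqrt_nonneg (normSq g a)
    rw [mem_ofPred_eq]
    rcases le_total 0 t with h1 | h1
    · have h2 := hγ.redist_le h0s ht h1
      rw [h0] at h2
      exact h2.trans (ENNReal.ofReal_le_ofReal (by
        gcongr; linarith [ht.2]))
    · have h2 := hγ.redist_le ht h0s h1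
      rw [h0, redist_comm, hn] at h2
      exact h2.trans (ENNReal.ofReal_le_ofReal (by
        gcongr; linarith [ht.1]))
  · exact ⟨by simp [redist_self], le_rfl⟩
  · intro q hq
    obtain ⟨φ, V, hV, hqV, -, h1⟩ := h q hq
    exact ⟨fun t => φ (t, q), (h1 q hqV).1, (h1 q hqV).2⟩

open Classical in
/-- The Hamilton flow of the energy. -/
def flow (g : Metric (𝓡 m) M) (t : ℝ) (a : Cotangent m M) : Cotangent m M :=
  if h : ∃ γ : ℝ → Cotangent m M, γ 0 = a ∧
    IsMIntegralCurve (I := cotI m) γ (hamiltonField (energy g)) then h.choose t else a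

section Flow

variable [T2Space M] {g : Metric (𝓡 m) M} (hp : ProperMetric g)
include hp

theorem isMIntegralCurve_flow (a : Cotangent m M) :
    IsMIntegralCurve (I := cotI m) (fun t => flow g t a) (hamiltonField (energy g)) := by
  have h := exists_isMIntegralCurve hp a
  have h1 : (fun t => flow g t a) = h.choose := by
    funext t
    rw [flow, dif_pos h]
  rw [h1]
  exact h.choose_spec.2

theorem flow_zero (a : Cotangent m M) : flow g 0 a = a := by
  have h := exists_isMIntegralCurve hp a
  rw [flow, dif_pos h]
  exact h.choose_spec.1

theorem isHam_flow (a : Cotangent m M) (s : Set ℝ) : IsHam g (fun t => flow g t a) s :=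
  (isMIntegralCurve_flow hp a).isMIntegralCurveOn s

theorem eq_flow_of_isMIntegralCurve {γ : ℝ → Cotangent m M}
    (h : IsMIntegralCurve (I := cotI m) γ (hamiltonField (energy g))) (t : ℝ) :
    γ t = flow g t (γ 0) := by
  have := t2Space_cotangent (M := M) (m := m)
  have h1 := isMIntegralCurve_Ioo_eq_of_contMDiff_boundaryless (t₀ := 0)
    (contMDiff_one_hamiltonField g) h (isMIntegralCurve_flow hp (γ 0)) (flow_zero hp _).symm
  exact congrFun h1 t

theorem eqOn_flow_of_isHam {γ : ℝ → Cotangent m M} {a b t₀ : ℝ} (h : IsHam g γ (Ioo a b))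
    (ht₀ : t₀ ∈ Ioo a b) {t : ℝ} (ht : t ∈ Ioo a b) : γ t = flow g (t - t₀) (γ t₀) := by
  have := t2Space_cotangent (M := M) (m := m)
  have h2 : IsMIntegralCurve (I := cotI m) (fun t => flow g (t - t₀) (γ t₀))
      (hamiltonField (energy g)) :=
    isMIntegralCurve_comp_sub (dt := t₀).2 (isMIntegralCurve_flow hp (γ t₀))
  exact isMIntegralCurveOn_Ioo_eqOn_of_contMDiff_boundaryless ht₀
    (contMDiff_one_hamiltonField g) h (h2.isMIntegralCurveOn _) (by simp [flow_zero hp]) ht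

theorem flow_add (s t : ℝ) (a : Cotangent m M) : flow g (s + t) a = flow g s (flow g t a) := by
  have h2 : IsMIntegralCurve (I := cotI m) (fun s => flow g (s + t) a)
      (hamiltonField (energy g)) :=
    isMIntegralCurve_comp_add (dt := t).2 (isMIntegralCurve_flow hp a)
  have := eq_flow_of_isMIntegralCurve hp h2 s
  simpa using this

theorem continuous_flow_left (a : Cotangent m M) : Continuous (fun t => flow g t a) :=
  (isMIntegralCurve_flow hp a).continuous

/-- Near the compact orbit segment through `a₀` the local flows share an existence time `ε`. Cutting
time into `N` steps with `|t₀| / N < ε` writes the flow as a composition of `N` local flows, each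
smooth in time and initial point. -/
theorem contMDiff_flow :
    ContMDiff (𝓘(ℝ, ℝ).prod (cotI m)) (cotI m) ∞
      (fun x : ℝ × Cotangent m M => flow g x.1 x.2) := by
  rintro ⟨t₀, a₀⟩
  have hKc : IsCompact ((fun t => flow g t a₀) '' Icc (-|t₀|) |t₀|) :=
    isCompact_Icc.image (continuous_flow_left hp a₀)
  obtain ⟨ε, hε, h⟩ := exists_uniform_localFlow g hKc
  obtain ⟨N, hN⟩ := exists_nat_gt (|t₀| / ε)
  have hN0 : (0 : ℝ) < N := (div_nonneg (abs_nonneg _) hε.le).trans_lt hN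
  have hsmall : |t₀ / N| < ε := by
    rw [abs_div, abs_of_pos hN0, div_lt_iff₀ hN0]
    rwa [div_lt_iff₀ hε, mul_comm] at hN
  have key (k : ℕ) : k ≤ N → ContMDiffAt (𝓘(ℝ, ℝ).prod (cotI m)) (cotI m) ∞
      (fun x : ℝ × Cotangent m M => flow g (k * (x.1 / N)) x.2) (t₀, a₀) := by
    induction k with
    | zero =>
      intro _
      have h1 : (fun x : ℝ × Cotangent m M => flow g ((0 : ℕ) * (x.1 / N)) x.2) = Prod.snd := by
        funext x
        simp [flow_zero hp]
      rw [h1]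
      exact contMDiffAt_snd
    | succ k ih =>
      intro hk
      have hkN : (k : ℝ) ≤ N := by exact_mod_cast (Nat.le_succ k).trans hk
      have hmem : flow g (k * (t₀ / N)) a₀ ∈ (fun t => flow g t a₀) '' Icc (-|t₀|) |t₀| := by
        refine ⟨k * (t₀ / N), abs_le.1 ?_, rfl⟩
        rw [abs_mul, abs_div, abs_of_pos hN0, Nat.abs_cast, ← mul_div_assoc, div_le_iff₀ hN0,
          mul_comm]
        gcongr
      obtain ⟨φ, V, hV, hqV, hφ, h1⟩ := h _ hmem
      have h2 : ContMDiffAt (𝓘(ℝ, ℝ).prod (cotI m)) (cotI m) ∞ φ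
          (t₀ / N, flow g (k * (t₀ / N)) a₀) :=
        hφ.contMDiffAt ((isOpen_Ioo.prod hV).mem_nhds ⟨abs_lt.1 hsmall, hqV⟩)
      have h3 : ContMDiffAt (𝓘(ℝ, ℝ).prod (cotI m)) 𝓘(ℝ, ℝ) ∞
          (fun x : ℝ × Cotangent m M => x.1 / N) (t₀, a₀) := by
        have : ContMDiff 𝓘(ℝ, ℝ) 𝓘(ℝ, ℝ) ∞ (fun t : ℝ => t / N) := by
          rw [contMDiff_iff_contDiff]; exact contDiff_id.div_const _
        exact this.contMDiffAt.comp (t₀, a₀) contMDiffAt_fst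
      have h4 := ContMDiffAt.comp (t₀, a₀) (g := φ)
        (f := fun x : ℝ × Cotangent m M => (x.1 / N, flow g (k * (x.1 / N)) x.2)) h2
        (h3.prodMk (ih (by omega)))
      refine h4.congr_of_eventuallyEq ?_
      have h5 : ∀ᶠ x : ℝ × Cotangent m M in 𝓝 (t₀, a₀), flow g (k * (x.1 / N)) x.2 ∈ V :=
        (ih (by omega)).continuousAt.preimage_mem_nhds (hV.mem_nhds hqV)
      have h6 : ∀ᶠ x : ℝ × Cotangent m M in 𝓝 (t₀, a₀), x.1 / N ∈ Ioo (-ε) ε :=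
        h3.continuousAt.preimage_mem_nhds (isOpen_Ioo.mem_nhds (abs_lt.1 hsmall))
      filter_upwards [h5, h6] with x hx5 hx6
      obtain ⟨h7, h8⟩ := h1 _ hx5
      have h9 := eqOn_flow_of_isHam hp h8 (t₀ := 0) ⟨by linarith, hε⟩ hx6
      simp only [h7, sub_zero] at h9
      simp only [Function.comp_apply]
      rw [h9, ← flow_add hp]
      congr 1
      push_cast; ring
  have h1 := key N le_rfl
  have h2 : (fun x : ℝ × Cotangent m M => flow g (N * (x.1 / N)) x.2) =
      fun x : ℝ × Cotangent m M => flow g x.1 x.2 := by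
    funext x
    rw [mul_div_cancel₀ _ hN0.ne']
  rwa [h2] at h1

theorem normSq_flow (t : ℝ) (a : Cotangent m M) : normSq g (flow g t a) = normSq g a := by
  have h := (isHam_flow hp a (Ioo (-(|t| + 1)) (|t| + 1))).normSq_eq (s := t) (t := 0)
    ⟨by linarith [neg_abs_le t], by linarith [le_abs_self t]⟩
    ⟨by linarith [abs_nonneg t], by linarith [abs_nonneg t]⟩
  rwa [flow_zero hp] at h

theorem energy_flow (t : ℝ) (a : Cotangent m M) : energy g (flow g t a) = energy g a := by
  rw [energy_eq_normSq, energy_eq_normSq, normSq_flow hp]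

theorem redist_flow_le {t : ℝ} (ht : 0 ≤ t) (a : Cotangent m M) :
    redist g a.proj (flow g t a).proj ≤ ENNReal.ofReal (t * √(normSq g a)) := by
  have h := (isHam_flow hp a (Ioo (-1) (t + 1))).redist_le (s := 0) (t := t)
    ⟨by linarith, by linarith⟩ ⟨by linarith, by linarith⟩ ht
  simpa [flow_zero hp] using h

/-- Integral curves on compact intervals are given by the flow. -/
theorem eqOn_flow_of_isHam_Icc {γ : ℝ → Cotangent m M} {t : ℝ} (h : IsHam g γ (Icc 0 t)) {s : ℝ}
    (hs : s ∈ Icc 0 t) : γ s = flow g s (γ 0) := by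
  have := t2Space_cotangent (M := M) (m := m)
  rcases (hs.1.trans hs.2).eq_or_lt with h0 | h0
  · have : s = 0 := le_antisymm (h0 ▸ hs.2) hs.1
    rw [this, flow_zero hp]
  set c := t / 2 with hc
  have hcm : c ∈ Ioo 0 t := ⟨by linarith, by linarith⟩
  -- Uniqueness is available on open intervals. Starting from the midpoint and passing to the
  -- closure by continuity includes both endpoints.
  have h1 : EqOn γ (fun u => flow g (u - c) (γ c)) (Icc 0 t) := by
    refine EqOn.of_subset_closure (s := Ioo 0 t) (fun u hu => ?_) h.continuousOn ?_
      Ioo_subset_Icc_self (closure_Ioo h0.ne).ge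
    · exact eqOn_flow_of_isHam hp (IsMIntegralCurveOn.mono h Ioo_subset_Icc_self) hcm hu
    · exact ((continuous_flow_left hp (γ c)).comp (continuous_id.sub continuous_const)).continuousOn
  have h2 : γ 0 = flow g (0 - c) (γ c) := h1 ⟨le_rfl, h0.le⟩
  have h3 : γ s = flow g (s - c) (γ c) := h1 hs
  rw [h2, h3, ← flow_add hp]
  congr 1
  ring

theorem hamiltonFlow_iff {t : ℝ} (ht : 0 ≤ t) (a b : Cotangent m M) :
    HamiltonFlow (energy g) t a b ↔ b = flow g t a := by
  constructor
  · rintro ⟨γ, hγ, rfl, rfl⟩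
    exact eqOn_flow_of_isHam_Icc hp hγ ⟨ht, le_rfl⟩
  · rintro rfl
    exact ⟨fun t => flow g t a, isHam_flow hp a _, flow_zero hp a, rfl⟩

/-- Geodesics are the projections of the orbits of the flow. -/
theorem isGeodesic_iff (α : ℝ → M) :
    IsGeodesic g α ↔ ∃ a : Cotangent m M, ∀ t ∈ Icc (0 : ℝ) 1, α t = (flow g t a).proj := by
  constructor
  · rintro ⟨γ, hγ, h⟩
    refine ⟨γ 0, fun t ht => ?_⟩
    rw [← h t ht, eqOn_flow_of_isHam_Icc hp hγ ht]
  · rintro ⟨a, h⟩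
    exact ⟨fun t => flow g t a, isHam_flow hp a _, fun t ht => (h t ht).symm⟩

end Flow

end GlobalFlow
end AHM

end

noncomputable section

set_option synthInstance.maxHeartbeats 200000

namespace AHM

/-! ### Homogeneity of the flow under dilation of covectors -/

section Scaling

variable {m : ℕ} {M : Type*} [TopologicalSpace M]
  [ChartedSpace (EuclideanSpace ℝ (Fin m)) M] [IsManifold (𝓡 m) ∞ M]

/-- Multiplication of a covector by a scalar. -/
def smulCov (s : ℝ) (q : Cotangent m M) : Cotangent m M := ⟨q.proj, s • q.snd⟩

theorem covec_smulCov (s : ℝ) (q : Cotangent m M) : covec (smulCov s q) = s • covec q := rfl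

theorem smulCov_one (q : Cotangent m M) : smulCov 1 q = q := by
  simp only [smulCov, one_smul]

theorem cotangent_ext {q q' : Cotangent m M} (h : q.proj = q'.proj)
    (h' : ∀ v, covec q v = covec q' v) : q = q' := by
  obtain ⟨x, ξ⟩ := q
  obtain ⟨y, η⟩ := q'
  obtain rfl : x = y := h
  congr 1
  exact ContinuousLinearMap.ext h'

theorem smulCov_smulCov (s t : ℝ) (q : Cotangent m M) :
    smulCov s (smulCov t q) = smulCov (s * t) q :=
  cotangent_ext rfl fun v => by simp [covec_smulCov, mul_assoc]

theorem sharp_smulCov (g : Metric (𝓡 m) M) (s : ℝ) (q : Cotangent m M) :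
    sharp g (smulCov s q) = s • sharp g q :=
  map_smul (flat g q.proj).symm s q.snd

theorem normSq_smulCov (g : Metric (𝓡 m) M) (s : ℝ) (q : Cotangent m M) :
    normSq g (smulCov s q) = s ^ 2 * normSq g q := by
  rw [normSq, normSq, covec_smulCov, sharp_smulCov]
  simp only [map_smul, smul_apply, smul_eq_mul]
  ring

theorem cotChart_smulCov_self (s : ℝ) (q : Cotangent m M) : cotChart (smulCov s q) = cotChart q :=
  rfl

theorem smulCov_mem_source {s : ℝ} {q₀ q : Cotangent m M} (h : q ∈ (cotChart q₀).source) :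
    smulCov s q ∈ (cotChart q₀).source := by
  rw [mem_cotChart_source] at h ⊢
  exact h

theorem cotChart_smulCov {s : ℝ} {q₀ q : Cotangent m M} (h : q ∈ (cotChart q₀).source) :
    cotChart q₀ (smulCov s q) = ((cotChart q₀ q).1, s • (cotChart q₀ q).2) := by
  rw [cotChart_apply h, cotChart_apply (smulCov_mem_source h)]
  rfl

theorem hamVec_eq_hamChart (g : Metric (𝓡 m) M) (q : Cotangent m M) :
    hamVec (energy g) q = hamChart g q (cotChart q q) := by
  have h0 := cotD_hamVec_energy g (mem_cotChart_self q)
  rwa [cotD_self] at h0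

/-- The energy is homogeneous of degree two in the fibre up to an additive constant, so its
derivatives along the base scale by `s ^ 2`. -/
theorem hamVec_smulCov_snd (g : Metric (𝓡 m) M) (s : ℝ) (q : Cotangent m M) :
    (hamVec (energy g) (smulCov s q)).2 = s ^ 2 • (hamVec (energy g) q).2 := by
  rw [hamVec_eq_hamChart, hamVec_eq_hamChart, cotChart_smulCov_self,
    cotChart_smulCov (mem_cotChart_self q)]
  set z := cotChart q q with hz
  set h := fun z => energy g ((cotChart q).symm z) with hh
  have hz' : z ∈ (cotChart q).target := (cotChart q).map_source (mem_cotChart_self q)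
  have htgt : ∀ z ∈ (cotChart q).target, ∀ s : ℝ, (z.1, s • z.2) ∈ (cotChart q).target := by
    intro z hz s
    rw [cotChart_target] at hz ⊢
    exact ⟨hz.1, mem_univ _⟩
  have hscale (z : CotModel m) (hz : z ∈ (cotChart q).target) :
      h (z.1, s • z.2) = s ^ 2 * h z + (s ^ 2 - 1) / 2 := by
    simp only [hh, energy_eq_normSq]
    rw [normSq_cotChart_symm g hz, normSq_cotChart_symm g (htgt z hz s)]
    simp only [map_smul, smul_apply, smul_eq_mul]
    ring
  have hd (z : CotModel m) (hz : z ∈ (cotChart q).target) : DifferentiableAt ℝ h z :=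
    ((contDiffOn_energy_cotChart_symm g q).contDiffAt
      ((isOpen_cotChart_target q).mem_nhds hz)).differentiableAt (by simp)
  let A : CotModel m →L[ℝ] CotModel m :=
    (ContinuousLinearMap.fst ℝ _ _).prod (s • ContinuousLinearMap.snd ℝ _ _)
  have h1 : HasFDerivAt (fun z => h (A z)) ((fderiv ℝ h (A z)).comp A) z :=
    (hd (A z) (htgt z hz' s)).hasFDerivAt.comp z A.hasFDerivAt
  have h2 : HasFDerivAt (fun z => h (A z)) (s ^ 2 • fderiv ℝ h z) z := by
    refine (((hd z hz').hasFDerivAt.const_mul (s ^ 2)).add_const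
      ((s ^ 2 - 1) / 2)).congr_of_eventuallyEq ?_
    filter_upwards [(isOpen_cotChart_target q).mem_nhds hz'] with z' hz''
    exact hscale z' hz''
  have h3 := h1.unique h2
  ext v
  have h4 := congrArg (fun L => L (v, 0)) h3
  have h5 : A (v, 0) = (v, 0) := by simp [A]
  have h6 : fderiv ℝ h (A z) (v, 0) = s ^ 2 * fderiv ℝ h z (v, 0) := by
    simpa [h5] using h4
  change (modelHamilton (fderiv ℝ h (A z))).2 v = s ^ 2 * (modelHamilton (fderiv ℝ h z)).2 v
  rw [modelHamilton_snd, modelHamilton_snd, h6]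
  ring

/-- Dilation by `s` multiplies the base component of the Hamilton field by `s` and the fibre
component by `s ^ 2`. One factor is absorbed by the change of time, the other by the dilation of the
covector. -/
theorem isMIntegralCurve_smulCov {g : Metric (𝓡 m) M} {γ : ℝ → Cotangent m M}
    (hγ : IsMIntegralCurve (I := cotI m) γ (hamiltonField (energy g))) (s : ℝ) :
    IsMIntegralCurve (I := cotI m) (fun t => smulCov s (γ (s * t)))
      (hamiltonField (energy g)) := by
  intro t
  obtain ⟨b, hb⟩ : ∃ b, b = γ (s * t) := ⟨_, rfl⟩
  have hmem : γ (s * t) ∈ (cotChart b).source := hb ▸ mem_cotChart_self b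
  have hcont : ContinuousAt (fun t => γ (s * t)) t :=
    ContinuousAt.comp (f := fun t => s * t) (hγ (s * t)).continuousAt
      (continuous_const.mul continuous_id).continuousAt
  have hev : ∀ᶠ t' in 𝓝 t, γ (s * t') ∈ (cotChart b).source :=
    hcont.preimage_mem_nhds ((isOpen_cotChart_source b).mem_nhds hmem)
  have h2 := ((hasMFDerivWithinAt_iff_chart (q₀ := b) (mdifferentiableAt_energy g _)
    hmem).1 ((hγ (s * t)).hasMFDerivWithinAt (s := univ))).2
  rw [hasDerivWithinAt_univ, ← hb] at h2
  have h3 : HasDerivAt (fun t => cotChart b (γ (s * t))) (s • hamVec (energy g) b) t := by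
    rw [hamVec_eq_hamChart]
    exact HasDerivAt.scomp t h2 (by simpa using (hasDerivAt_id t).const_mul s)
  have h4 : HasDerivAt (fun t => cotChart b (smulCov s (γ (s * t))))
      (hamVec (energy g) (smulCov s b)) t := by
    let A : CotModel m →L[ℝ] CotModel m :=
      (ContinuousLinearMap.fst ℝ _ _).prod (s • ContinuousLinearMap.snd ℝ _ _)
    have h5 : HasDerivAt (fun t => A (cotChart b (γ (s * t))))
      (A (s • hamVec (energy g) b)) t := A.hasFDerivAt.comp_hasDerivAt t h3
    have h6 : hamVec (energy g) (smulCov s b) = A (s • hamVec (energy g) b) := by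
      refine Prod.ext ?_ ?_
      · rw [hamVec_energy_fst, sharp_smulCov, ← hamVec_energy_fst]; rfl
      · rw [hamVec_smulCov_snd, pow_two, mul_smul]; rfl
    rw [h6]
    refine h5.congr_of_eventuallyEq ?_
    filter_upwards [hev] with t' ht'
    exact cotChart_smulCov ht'
  rw [hamVec_eq_hamChart, cotChart_smulCov_self] at h4
  have hsrc := smulCov_mem_source (s := s) hmem
  refine hasMFDerivWithinAt_univ.1 ?_
  refine (hasMFDerivWithinAt_iff_chart (γ := fun t => smulCov s (γ (s * t))) (s := univ)
    (q₀ := b) (mdifferentiableAt_energy g _) hsrc).2 ⟨?_, ?_⟩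
  · have h7 : ContinuousAt (fun t => (cotChart b).symm
        (cotChart b (smulCov s (γ (s * t))))) t :=
      ContinuousAt.comp (f := fun t => cotChart b (smulCov s (γ (s * t))))
        (contMDiffAt_cotChart_symm ((cotChart b).map_source hsrc)).continuousAt h4.continuousAt
    rw [continuousWithinAt_univ]
    refine h7.congr ?_
    filter_upwards [hev] with t' ht'
    exact (cotChart b).left_inv (smulCov_mem_source ht')
  · rw [← hb]
    exact h4.hasDerivWithinAt

variable [T2Space M] {g : Metric (𝓡 m) M} (hp : ProperMetric g)
include hp

/-- This reduces a geodesic run for any time to the flow at time one, and for `s = -1` it reverses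
geodesics. -/
theorem flow_smulCov (t s : ℝ) (q : Cotangent m M) :
    flow g t (smulCov s q) = smulCov s (flow g (s * t) q) := by
  have := eq_flow_of_isMIntegralCurve hp
    (isMIntegralCurve_smulCov (isMIntegralCurve_flow hp q) s) t
  rw [this]
  simp [flow_zero hp]

end Scaling

/-! ### The Liouville form along the flow -/

section Liouville

variable {m : ℕ} {M : Type*} [TopologicalSpace M]
  [ChartedSpace (EuclideanSpace ℝ (Fin m)) M] [IsManifold (𝓡 m) ∞ M]
  {Z : Type*} [NormedAddCommGroup Z] [NormedSpace ℝ Z]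

/-- The pull-back of the Liouville form of `T^*M`. -/
def liouville (F : Z → Cotangent m M) (u v : Z) : ℝ :=
  covec (F u) (derivAt (fun u => (F u).proj) u v)

omit [IsManifold (𝓡 m) ∞ M] in
theorem derivAt_comp_of_hasFDerivAt {Z' : Type*} [NormedAddCommGroup Z'] [NormedSpace ℝ Z']
    {G : Z' → M} {L : Z → Z'} {L' : Z →L[ℝ] Z'} {u : Z} (hL : HasFDerivAt L L' u)
    (hG : MDifferentiableAt 𝓘(ℝ, Z') (𝓡 m) G (L u)) (v : Z) :
    derivAt (m := m) (fun u => G (L u)) u v = derivAt (m := m) G (L u) (L' v) := by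
  have h := hG.hasMFDerivAt.comp u hL.hasMFDerivAt
  exact congrArg (fun A => A v) h.mfderiv

theorem liouville_add (F : Z → Cotangent m M) (u v w : Z) :
    liouville F u (v + w) = liouville F u v + liouville F u w := by
  simp [liouville]

theorem liouville_smul (F : Z → Cotangent m M) (u : Z) (c : ℝ) (v : Z) :
    liouville F u (c • v) = c * liouville F u v := by
  simp [liouville]

variable [T2Space M] {g : Metric (𝓡 m) M} (hp : ProperMetric g)
include hp

theorem contMDiffAt_flow_comp {F : Z → Cotangent m M} {u : Z} {n : WithTop ℕ∞} (hn : n ≤ ∞)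
    (hF : ContMDiffAt 𝓘(ℝ, Z) (cotI m) n F u) (t : ℝ) :
    ContMDiffAt 𝓘(ℝ, ℝ × Z) (cotI m) n (fun x : ℝ × Z => flow g x.1 (F x.2)) (t, u) := by
  have h1 : ContMDiffAt 𝓘(ℝ, ℝ × Z) (𝓘(ℝ, ℝ).prod (cotI m)) n
      (fun x : ℝ × Z => (x.1, F x.2)) (t, u) := by
    refine ContMDiffAt.prodMk ?_ ?_
    · rw [contMDiffAt_iff_contDiffAt]; exact contDiffAt_fst
    · refine ContMDiffAt.comp (t, u) (I' := 𝓘(ℝ, Z)) (g := F) hF ?_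
      rw [contMDiffAt_iff_contDiffAt]; exact contDiffAt_snd
  exact ((contMDiff_flow hp (t, F u)).of_le hn).comp (t, u) h1

/-- The Liouville form along the flow. -/
theorem liouville_flow {F : Z → Cotangent m M} {u : Z}
    (hF : ContMDiffAt 𝓘(ℝ, Z) (cotI m) 2 F u) (t : ℝ) (τ : ℝ) (v : Z) :
    liouville (fun x : ℝ × Z => flow g x.1 (F x.2)) (t, u) (τ, v) =
      τ * normSq g (F u) + liouville F u v + t * fderiv ℝ (fun u => energy g (F u)) u v := by
  set Ψ : ℝ × Z → Cotangent m M := fun x => flow g x.1 (F x.2) with hΨdef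
  have hΨ (t : ℝ) : ContMDiffAt 𝓘(ℝ, ℝ × Z) (cotI m) 2 Ψ (t, u) :=
    contMDiffAt_flow_comp hp ENat.LEInfty.out hF t
  have hΨe (t : ℝ) : ∀ᶠ x in 𝓝 (t, u), ContMDiffAt 𝓘(ℝ, ℝ × Z) (cotI m) 2 Ψ x :=
    (contMDiffAt_iff_contMDiffAt_nhds (by simp)).1 (hΨ t)
  have hproj {x : ℝ × Z} (h : ContMDiffAt 𝓘(ℝ, ℝ × Z) (cotI m) 2 Ψ x) :
      MDifferentiableAt 𝓘(ℝ, ℝ × Z) (𝓡 m) (fun x => (Ψ x).proj) x :=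
    (contMDiff_cotProj.mdifferentiable (by simp) (Ψ x)).comp x (h.mdifferentiableAt (by simp))
  have htime {x : ℝ × Z} (h : ContMDiffAt 𝓘(ℝ, ℝ × Z) (cotI m) 2 Ψ x) :
      liouville Ψ x (1, 0) = normSq g (F x.2) := by
    have hL : HasFDerivAt (fun s : ℝ => (s, x.2)) (ContinuousLinearMap.inl ℝ ℝ Z) x.1 :=
      hasFDerivAt_prodMk_left x.1 x.2
    have h1 := derivAt_comp_of_hasFDerivAt (G := fun x => (Ψ x).proj) hL (hproj h) 1
    have h2 := (isHam_flow hp (F x.2) univ).derivAt_proj (t := x.1) Filter.univ_mem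
    have h3 : derivAt (fun x => (Ψ x).proj) x (1, 0) = sharp g (Ψ x) := h1.symm.trans h2
    rw [liouville, h3, ← normSq_flow hp x.1]
    rfl
  have hen : DifferentiableAt ℝ (fun u => energy g (F u)) u := by
    rw [← mdifferentiableAt_iff_differentiableAt]
    exact (mdifferentiableAt_energy g (F u)).comp u (hF.mdifferentiableAt (by simp))
  set D := fderiv ℝ (fun u => energy g (F u)) u v with hD
  have hsnd (t : ℝ) : HasFDerivAt (fun x : ℝ × Z => energy g (F x.2))
      ((fderiv ℝ (fun u => energy g (F u)) u).comp (ContinuousLinearMap.snd ℝ ℝ Z)) (t, u) :=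
    HasFDerivAt.comp (t, u) (g := fun u => energy g (F u)) hen.hasFDerivAt hasFDerivAt_snd
  -- Cartan's formula: with `θ` the Liouville form and `H` the Hamilton field, `L_H θ = d(θ(H)) +
  -- ι_H dθ = d(2p + 1) - dp = dp`. Conservation of `p` makes this rate constant in time.
  have hderiv (t : ℝ) : HasDerivAt (fun t => liouville Ψ (t, u) (0, v)) D t := by
    set q₀ := Ψ (t, u) with hq₀
    set G : ℝ × Z → CotModel m := fun x => cotChart q₀ (Ψ x) with hG
    have hmem : ∀ᶠ x in 𝓝 (t, u), Ψ x ∈ (cotChart q₀).source :=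
      (hΨ t).continuousAt.preimage_mem_nhds
        ((isOpen_cotChart_source q₀).mem_nhds (mem_cotChart_self q₀))
    have hGc : ContDiffAt ℝ 2 G (t, u) := by
      rw [← contMDiffAt_iff_contDiffAt]
      exact ((contMDiffAt_cotChart (mem_cotChart_self q₀)).of_le ENat.LEInfty.out).comp (t, u) (hΨ t)
    have hGd : HasFDerivAt G (fderiv ℝ G (t, u)) (t, u) :=
      (hGc.differentiableAt (by simp)).hasFDerivAt
    have hliou (w : ℝ × Z) : (fun x => (G x).2 ((fderiv ℝ G x w).1)) =ᶠ[𝓝 (t, u)]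
        fun x => liouville Ψ x w := by
      filter_upwards [hmem, hΨe t] with x hx1 hx2
      exact liouville_chart (hx2.mdifferentiableAt (by simp)) hx1 w
    have hdl (w : ℝ × Z) : DifferentiableAt ℝ (fun x => (G x).2 ((fderiv ℝ G x w).1)) (t, u) := by
      have h2 : DifferentiableAt ℝ (fderiv ℝ G) (t, u) :=
        (hGc.fderiv_right (m := 1) (by norm_num)).differentiableAt (by simp)
      exact (hGd.snd.clm_apply (h2.hasFDerivAt.clm_apply
        (hasFDerivAt_const w (t, u))).fst).differentiableAt
    have key := fderiv_liouville_antisymm hGc (0, v) (1, 0)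
    have h1 : fderiv ℝ (fun x => (G x).2 ((fderiv ℝ G x (1, 0)).1)) (t, u) (0, v) = 2 * D := by
      have h2 : (fun x => (G x).2 ((fderiv ℝ G x (1, 0)).1)) =ᶠ[𝓝 (t, u)]
          fun x => 2 * energy g (F x.2) + 1 := by
        filter_upwards [hliou (1, 0), hΨe t] with x hx1 hx2
        rw [hx1, htime hx2, normSq_eq_energy]
      rw [h2.fderiv_eq, (((hsnd t).const_mul 2).add_const 1).fderiv]
      simp [hD]
    have h2 : fderiv ℝ G (t, u) (1, 0) = hamChart g q₀ (G (t, u)) := by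
      have h3 : HasDerivAt (fun s : ℝ => G (s, u)) (fderiv ℝ G (t, u) (1, 0)) t :=
        HasFDerivAt.comp_hasDerivAt t (f := fun s : ℝ => (s, u)) hGd
          ((hasDerivAt_id t).prodMk (hasDerivAt_const t u))
      have h4 := ((hasMFDerivWithinAt_iff_chart (q₀ := q₀) (s := univ)
        (mdifferentiableAt_energy g _) (mem_cotChart_self q₀)).1
        ((isMIntegralCurve_flow hp (F u) t).hasMFDerivWithinAt)).2
      rw [hasDerivWithinAt_univ] at h4
      exact h3.unique h4
    have h3 : modelForm (fderiv ℝ G (t, u) (1, 0)) (fderiv ℝ G (t, u) (0, v)) = -D := by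
      have h4 : modelForm (fderiv ℝ G (t, u) (1, 0)) (fderiv ℝ G (t, u) (0, v)) =
          -modelForm (fderiv ℝ G (t, u) (0, v)) (fderiv ℝ G (t, u) (1, 0)) := by
        simp [modelForm]
      rw [h4, h2, hamChart, modelForm_modelHamilton]
      congr 1
      have h5 : DifferentiableAt ℝ (fun z => energy g ((cotChart q₀).symm z)) (G (t, u)) :=
        ((contDiffOn_energy_cotChart_symm g q₀).contDiffAt ((isOpen_cotChart_target q₀).mem_nhds
          ((cotChart q₀).map_source (mem_cotChart_self q₀)))).differentiableAt (by simp)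
      have h6 := h5.hasFDerivAt.comp (t, u) hGd
      have h7 : (fun x : ℝ × Z => energy g (F x.2)) =ᶠ[𝓝 (t, u)]
          (fun z => energy g ((cotChart q₀).symm z)) ∘ G := by
        filter_upwards [hmem] with x hx
        simp only [hG, Function.comp_apply]
        rw [(cotChart q₀).left_inv hx, energy_flow hp]
      have h8 := (h6.congr_of_eventuallyEq h7).unique (hsnd t)
      have h9 := congrArg (fun L => L (0, v)) h8
      simpa [hD] using h9
    rw [h1, h3] at key
    have h4 : HasDerivAt (fun s : ℝ => (G (s, u)).2 ((fderiv ℝ G (s, u) (0, v)).1))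
        (fderiv ℝ (fun x => (G x).2 ((fderiv ℝ G x (0, v)).1)) (t, u) (1, 0)) t :=
      HasFDerivAt.comp_hasDerivAt t (f := fun s : ℝ => (s, u)) (hdl (0, v)).hasFDerivAt
        ((hasDerivAt_id t).prodMk (hasDerivAt_const t u))
    have h5 : fderiv ℝ (fun x => (G x).2 ((fderiv ℝ G x (0, v)).1)) (t, u) (1, 0) = D := by
      linarith
    rw [h5] at h4
    refine h4.congr_of_eventuallyEq ?_
    have hc : ContinuousAt (fun s : ℝ => (s, u)) t := by fun_prop
    exact (hc.eventually (hliou (0, v))).mono fun s hs => hs.symm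
  have hzero : liouville Ψ (0, u) (0, v) = liouville F u v := by
    have hL : HasFDerivAt (fun u : Z => ((0 : ℝ), u)) (ContinuousLinearMap.inr ℝ ℝ Z) u :=
      hasFDerivAt_prodMk_right 0 u
    have h1 := derivAt_comp_of_hasFDerivAt (G := fun x => (Ψ x).proj) hL (hproj (hΨ 0)) v
    have h2 : (fun u => (Ψ (0, u)).proj) = fun u => (F u).proj := by
      funext u
      simp [hΨdef, flow_zero hp]
    rw [h2] at h1
    rw [liouville, liouville, h1]
    simp [hΨdef, flow_zero hp]
  have haff : liouville Ψ (t, u) (0, v) = liouville F u v + t * D := by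
    have h1 : ∀ s, HasDerivAt (fun s => liouville Ψ (s, u) (0, v) - s * D) 0 s := fun s => by
      have h := (hderiv s).fun_sub ((hasDerivAt_id s).mul_const D)
      rwa [one_mul, sub_self] at h
    have h2 := is_const_of_deriv_eq_zero (fun s => (h1 s).differentiableAt)
      (fun s => (h1 s).deriv) t 0
    simp only [zero_mul, sub_zero, hzero] at h2
    linarith
  have hsplit : ((τ, v) : ℝ × Z) = τ • (1, 0) + (0, v) := by simp
  rw [hsplit, liouville_add, liouville_smul, htime (hΨ t), haff]
  ring

end Liouville
end AHM

end

noncomputable section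

set_option synthInstance.maxHeartbeats 200000

namespace AHM

/-! ### First variation of the energy -/

section FirstVariation

variable {m : ℕ} {M : Type*} [TopologicalSpace M]
  [ChartedSpace (EuclideanSpace ℝ (Fin m)) M] [IsManifold (𝓡 m) ∞ M]
  {E' : Type*} [NormedAddCommGroup E'] [NormedSpace ℝ E'] {H' : Type*} [TopologicalSpace H']
  {I : ModelWithCorners ℝ E' H'} {N : Type*} [TopologicalSpace N] [ChartedSpace H' N]
  [IsManifold I ∞ N] [I.Boundaryless]

theorem contMDiffAt_extChartAt_symm_self (y : N) :
    ContMDiffAt 𝓘(ℝ, E') I ∞ (extChartAt I y).symm (extChartAt I y y) :=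
  (contMDiffOn_extChartAt_symm y).contMDiffAt
    ((isOpen_extChartAt_target y).mem_nhds (mem_extChartAt_target y))

/-- The derivative on a manifold is read in preferred charts, and the derivative of such a chart at
its centre is the identity. This carries the first variation formula from vector spaces to manifolds
of parameters. -/
theorem derivAt_comp_extChartAt_symm {G : N → M} {y : N} {D : E' →L[ℝ] EuclideanSpace ℝ (Fin m)}
    (hG : HasMFDerivAt I (𝓡 m) G y D) :
    derivAt (fun u => G ((extChartAt I y).symm u)) (extChartAt I y y) = D := by
  set u₀ := extChartAt I y y with hu₀
  have hs : (extChartAt I y).symm u₀ = y := extChartAt_to_inv y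
  have h1 : HasFDerivAt (fun u => extChartAt (𝓡 m) (G y) (G ((extChartAt I y).symm u))) D u₀ := by
    have h := hG.2
    refine HasFDerivWithinAt.hasFDerivAt h ?_
    rw [I.range_eq_univ]; exact Filter.univ_mem
  have hmd : MDifferentiableAt 𝓘(ℝ, E') (𝓡 m) (fun u => G ((extChartAt I y).symm u)) u₀ := by
    refine MDifferentiableAt.comp u₀ (g := G) (I' := I) ?_
      ((contMDiffAt_extChartAt_symm_self y).mdifferentiableAt (by simp))
    rw [hs]
    exact hG.mdifferentiableAt
  have hmem : G ((extChartAt I y).symm u₀) ∈ (chartAt (EuclideanSpace ℝ (Fin m)) (G y)).source := by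
    rw [hs]; exact mem_chart_source _ _
  have h2 := hasFDerivAt_chart_comp (F := fun u => G ((extChartAt I y).symm u)) hmd hmem
  have h3 := h2.unique h1
  ext1 v
  rw [← h3, hs]
  exact (chartD_self (G y) _).symm

omit [IsManifold I ∞ N] [I.Boundaryless] in
theorem hasMFDerivAt_of_comp_extChartAt_symm {W : Type*} [NormedAddCommGroup W] [NormedSpace ℝ W]
    {f : N → W} {y : N} {L : E' →L[ℝ] W} (hf : ContinuousAt f y)
    (h : HasFDerivAt (fun u => f ((extChartAt I y).symm u)) L (extChartAt I y y)) :
    HasMFDerivAt I 𝓘(ℝ, W) f y L :=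
  ⟨hf, h.hasFDerivWithinAt⟩

/-- The endpoint of the geodesic with given initial covector. -/
def endp (g : Metric (𝓡 m) M) (q : Cotangent m M) : M := (flow g 1 q).proj

/-- The exponential map, as a map to pairs (initial point, endpoint). -/
def expPair (g : Metric (𝓡 m) M) (q : Cotangent m M) : M × M := (q.proj, endp g q)

variable [T2Space M] {g : Metric (𝓡 m) M} (hp : ProperMetric g)
include hp

theorem contMDiff_flow_right (t : ℝ) : ContMDiff (cotI m) (cotI m) ∞ (flow g t) :=
  (contMDiff_flow hp).comp (f := fun q : Cotangent m M => (t, q))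
    (contMDiff_const.prodMk contMDiff_id)

theorem contMDiff_endp : ContMDiff (cotI m) (𝓡 m) ∞ (endp g) :=
  contMDiff_cotProj.comp (contMDiff_flow_right hp 1)

/-- First variation of the energy, in terms of the variation of the endpoints. -/
theorem fderiv_energy_comp {Z : Type*} [NormedAddCommGroup Z] [NormedSpace ℝ Z]
    {F : Z → Cotangent m M} {u : Z} (hF : ContMDiffAt 𝓘(ℝ, Z) (cotI m) 2 F u) (v : Z) :
    fderiv ℝ (fun u => energy g (F u)) u v =
      covec (flow g 1 (F u)) (derivAt (fun u => endp g (F u)) u v) -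
        covec (F u) (derivAt (fun u => (F u).proj) u v) := by
  -- Time `1` with `τ = 0`: the formula says that the Liouville form at the end is the one at the
  -- start plus the differential of the energy.
  have h := liouville_flow hp hF 1 0 v
  have hL : HasFDerivAt (fun u : Z => ((1 : ℝ), u)) (ContinuousLinearMap.inr ℝ ℝ Z) u :=
    hasFDerivAt_prodMk_right 1 u
  have hmd : MDifferentiableAt 𝓘(ℝ, ℝ × Z) (𝓡 m)
      (fun x : ℝ × Z => (flow g x.1 (F x.2)).proj) (1, u) :=
    (contMDiff_cotProj.mdifferentiable (by simp) _).comp (1, u)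
      ((contMDiffAt_flow_comp hp ENat.LEInfty.out hF 1).mdifferentiableAt (by simp))
  have h1 := derivAt_comp_of_hasFDerivAt
    (G := fun x : ℝ × Z => (flow g x.1 (F x.2)).proj) hL hmd v
  rw [liouville, liouville] at h
  change _ = covec (flow g 1 (F u))
    (derivAt (fun u => (flow g 1 (F u)).proj) u v) - _
  rw [h1]
  change covec (flow g 1 (F u)) (derivAt (fun x : ℝ × Z => (flow g x.1 (F x.2)).proj) (1, u)
    ((0 : ℝ), v)) = _ at h
  rw [ContinuousLinearMap.inr_apply, h]
  ring

theorem hasMFDerivAt_energy_comp {F : N → Cotangent m M} {y : N}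
    (hF : ContMDiffAt I (cotI m) 2 F y) {A B : E' →L[ℝ] EuclideanSpace ℝ (Fin m)}
    (hA : HasMFDerivAt I (𝓡 m) (fun y => (F y).proj) y A)
    (hB : HasMFDerivAt I (𝓡 m) (fun y => endp g (F y)) y B) :
    HasMFDerivAt I 𝓘(ℝ, ℝ) (fun y => energy g (F y)) y
      ((covec (flow g 1 (F y))).comp B - (covec (F y)).comp A) := by
  have hs : (extChartAt I y).symm (extChartAt I y y) = y := extChartAt_to_inv y
  have hF' : ContMDiffAt 𝓘(ℝ, E') (cotI m) 2 (fun u => F ((extChartAt I y).symm u))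
      (extChartAt I y y) := by
    refine ContMDiffAt.comp (extChartAt I y y) (g := F) (I' := I) ?_
      ((contMDiffAt_extChartAt_symm_self y).of_le ENat.LEInfty.out)
    rw [hs]; exact hF
  have hd : DifferentiableAt ℝ (fun u => energy g (F ((extChartAt I y).symm u)))
      (extChartAt I y y) := by
    rw [← mdifferentiableAt_iff_differentiableAt]
    exact (mdifferentiableAt_energy g _).comp _ (hF'.mdifferentiableAt (by simp))
  refine hasMFDerivAt_of_comp_extChartAt_symm
    ((contMDiff_energy g).continuous.continuousAt.comp hF.continuousAt) ?_
  refine hd.hasFDerivAt.congr_fderiv (ContinuousLinearMap.ext fun v => ?_)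
  rw [fderiv_energy_comp hp hF', derivAt_comp_extChartAt_symm hB,
    derivAt_comp_extChartAt_symm hA, hs]
  rfl

end FirstVariation

/-! ### Local inversion of the exponential map -/

section LocalInverse

variable {m : ℕ} {M : Type*} [TopologicalSpace M]
  [ChartedSpace (EuclideanSpace ℝ (Fin m)) M] [IsManifold (𝓡 m) ∞ M]

/-- The exponential map at `q.proj` has no critical point at `q`. -/
def IsNondeg (g : Metric (𝓡 m) M) (q : Cotangent m M) : Prop :=
  ∀ α : EuclideanSpace ℝ (Fin m) →L[ℝ] ℝ,
    derivAt (m := m) (fun u => endp g ((cotChart q).symm u)) (cotChart q q) (0, α) = 0 → α = 0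

theorem finrank_cotModel : Module.finrank ℝ (CotModel m) =
    Module.finrank ℝ (EuclideanSpace ℝ (Fin m) × EuclideanSpace ℝ (Fin m)) := by
  rw [Module.finrank_prod, Module.finrank_prod, ← finrank_dual_eq]

variable [T2Space M] {g : Metric (𝓡 m) M} (hp : ProperMetric g)
include hp

/-- A smooth local inverse of `expPair g` near a point which is not critical. -/
theorem exists_expPair_localInverse {q : Cotangent m M} (hq : IsNondeg g q) :
    ∃ (S : M × M → Cotangent m M) (O : Set (Cotangent m M)) (N : Set (M × M)),
      IsOpen O ∧ IsOpen N ∧ q ∈ O ∧ MapsTo S N O ∧ MapsTo (expPair g) O N ∧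
      ContMDiffOn ((𝓡 m).prod (𝓡 m)) (cotI m) ∞ S N ∧
      (∀ x ∈ N, expPair g (S x) = x) ∧ ∀ a ∈ O, S (expPair g a) = a := by
  set φ := extChartAt (𝓡 m) q.proj with hφ
  set ψ := extChartAt (𝓡 m) (endp g q) with hψ
  set K := cotChart q with hK
  set e₀ : CotModel m → M := fun u => endp g (K.symm u) with he₀
  set f : CotModel m → EuclideanSpace ℝ (Fin m) × EuclideanSpace ℝ (Fin m) :=
    fun u => (u.1, ψ (e₀ u)) with hf
  have he₀s : ContMDiffOn 𝓘(ℝ, CotModel m) (𝓡 m) ∞ e₀ K.target :=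
    (contMDiff_endp hp).comp_contMDiffOn (contMDiffOn_cotChart_symm q)
  set U : Set (CotModel m) := K.target ∩ e₀ ⁻¹' ψ.source with hU
  have hUo : IsOpen U := he₀s.continuousOn.isOpen_inter_preimage (isOpen_cotChart_target q)
    (isOpen_extChartAt_source (endp g q))
  have hKq : K q ∈ K.target := K.map_source (mem_cotChart_self q)
  have he₀q : e₀ (K q) = endp g q := by
    simp only [he₀]; rw [K.left_inv (mem_cotChart_self q)]
  have hqU : K q ∈ U := ⟨hKq, by
    change e₀ (K q) ∈ ψ.source
    rw [he₀q]; exact mem_extChartAt_source _⟩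
  have hfs : ContDiffOn ℝ ∞ f U := by
    refine contDiffOn_fst.prodMk ?_
    rw [← contMDiffOn_iff_contDiffOn]
    exact (contMDiffOn_extChartAt (x := endp g q)).comp (he₀s.mono inter_subset_left)
      fun u hu => (extChartAt_source (𝓡 m) (endp g q)) ▸ hu.2
  have hmd : MDifferentiableAt 𝓘(ℝ, CotModel m) (𝓡 m) e₀ (K q) :=
    (he₀s.contMDiffAt ((isOpen_cotChart_target q).mem_nhds hKq)).mdifferentiableAt (by simp)
  have hder : HasFDerivAt f ((ContinuousLinearMap.fst ℝ _ _).prod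
      ((chartD (endp g q) (e₀ (K q))).comp (derivAt (m := m) e₀ (K q)))) (K q) :=
    hasFDerivAt_fst.prodMk (hasFDerivAt_chart_comp hmd (by rw [he₀q]; exact mem_chart_source _ _))
  set f' := (ContinuousLinearMap.fst ℝ (EuclideanSpace ℝ (Fin m))
    (EuclideanSpace ℝ (Fin m) →L[ℝ] ℝ)).prod
      ((chartD (endp g q) (e₀ (K q))).comp (derivAt (m := m) e₀ (K q))) with hf'
  -- The first component records the base point, so a kernel vector is vertical, and nondegeneracy
  -- at `q` makes it zero. Equality of dimensions does the rest.
  have hinj : Function.Injective f'.toLinearMap := by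
    rw [← LinearMap.ker_eq_bot, LinearMap.ker_eq_bot']
    rintro ⟨w, α⟩ h
    have h1 : w = 0 := congrArg Prod.fst h
    subst h1
    have h2 : chartD (endp g q) (e₀ (K q)) (derivAt e₀ (K q) (0, α)) = 0 := congrArg Prod.snd h
    rw [he₀q, chartD_self] at h2
    rw [hq α h2]; rfl
  let f'' : CotModel m ≃L[ℝ] EuclideanSpace ℝ (Fin m) × EuclideanSpace ℝ (Fin m) :=
    (LinearEquiv.ofInjectiveOfFinrankEq f'.toLinearMap hinj
      finrank_cotModel).toContinuousLinearEquiv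
  have hder' : HasFDerivAt f (f'' : CotModel m →L[ℝ] _) (K q) := hder
  obtain ⟨e, hes, heU, hef, hesymm⟩ :=
    exists_openPartialHomeomorph_contDiffOn hUo hfs hqU f'' hder'
  have hsymm_proj {u} (hu : u ∈ K.target) : (K.symm u).proj = φ.symm u.1 := cotChart_symm_proj hu
  have hfst {u} (hu : u ∈ K.target) : u.1 ∈ φ.target := by
    rw [cotChart_target] at hu; exact hu.1
  set N : Set (M × M) := (φ.source ×ˢ ψ.source) ∩ (fun x : M × M => (φ x.1, ψ x.2)) ⁻¹' e.target
    with hN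
  have hcont : ContMDiffOn ((𝓡 m).prod (𝓡 m)) 𝓘(ℝ, EuclideanSpace ℝ (Fin m) ×
      EuclideanSpace ℝ (Fin m)) ∞ (fun x : M × M => (φ x.1, ψ x.2)) (φ.source ×ˢ ψ.source) := by
    refine ContMDiffOn.prodMk_space ?_ ?_
    · exact (contMDiffOn_extChartAt (x := q.proj)).comp contMDiffOn_fst
        fun x hx => (extChartAt_source (𝓡 m) q.proj) ▸ hx.1
    · exact (contMDiffOn_extChartAt (x := endp g q)).comp contMDiffOn_snd
        fun x hx => (extChartAt_source (𝓡 m) (endp g q)) ▸ hx.2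
  have hopen : IsOpen (φ.source ×ˢ ψ.source) :=
    (isOpen_extChartAt_source q.proj).prod (isOpen_extChartAt_source (endp g q))
  have hmapS {x : M × M} (hx : x ∈ N) : e.symm (φ x.1, ψ x.2) ∈ U := heU (e.map_target hx.2)
  have hSf {x : M × M} (hx : x ∈ N) : f (e.symm (φ x.1, ψ x.2)) = (φ x.1, ψ x.2) := by
    rw [← hef, e.right_inv hx.2]
  refine ⟨fun x => K.symm (e.symm (φ x.1, ψ x.2)), K.source ∩ K ⁻¹' e.source, N, ?_, ?_, ?_, ?_,
    ?_, ?_, ?_, ?_⟩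
  · exact (contMDiffOn_cotChart q).continuousOn.isOpen_inter_preimage (isOpen_cotChart_source q)
      e.open_source
  · exact hcont.continuousOn.isOpen_inter_preimage hopen e.open_target
  · exact ⟨mem_cotChart_self q, hes⟩
  · intro x hx
    refine ⟨K.map_target (hmapS hx).1, ?_⟩
    rw [mem_preimage, K.right_inv (hmapS hx).1]
    exact e.map_target hx.2
  · rintro a ⟨ha, hae⟩
    have h1 := heU hae
    have h2 : e₀ (K a) = endp g a := by
      simp only [he₀]; rw [K.left_inv ha]
    have h3 : (K a).1 = φ a.proj := by
      have h4 := hsymm_proj h1.1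
      rw [K.left_inv ha] at h4
      rw [h4, φ.right_inv (hfst h1.1)]
    have h5 : endp g a ∈ ψ.source := h2 ▸ h1.2
    refine ⟨⟨?_, h5⟩, ?_⟩
    · rw [mem_cotChart_source] at ha
      rw [hφ, extChartAt_source]; exact ha
    · have h6 : (φ a.proj, ψ (endp g a)) = e (K a) := by rw [hef, ← h3, ← h2]
      change (φ a.proj, ψ (endp g a)) ∈ e.target
      rw [h6]; exact e.map_source hae
  · refine (contMDiffOn_cotChart_symm q).comp ((contMDiffOn_iff_contDiffOn.2 hesymm).comp
      (hcont.mono inter_subset_left) fun x hx => hx.2) fun x hx => (hmapS hx).1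
  · intro x hx
    have h1 := hmapS hx
    have h2 := hSf hx
    refine Prod.ext ?_ ?_
    · change (K.symm _).proj = x.1
      rw [hsymm_proj h1.1]
      have h3 : (e.symm (φ x.1, ψ x.2)).1 = φ x.1 := congrArg Prod.fst h2
      rw [h3, φ.left_inv hx.1.1]
    · have h3 : ψ (e₀ (e.symm (φ x.1, ψ x.2))) = ψ x.2 := congrArg Prod.snd h2
      exact ψ.injOn h1.2 hx.1.2 h3
  · rintro a ⟨ha, hae⟩
    have h1 := heU hae
    have h2 : e₀ (K a) = endp g a := by
      simp only [he₀]; rw [K.left_inv ha]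
    have h3 : (K a).1 = φ a.proj := by
      have h4 := hsymm_proj h1.1
      rw [K.left_inv ha] at h4
      rw [h4, φ.right_inv (hfst h1.1)]
    have h6 : (φ a.proj, ψ (endp g a)) = e (K a) := by rw [hef, ← h3, ← h2]
    change K.symm (e.symm (φ a.proj, ψ (endp g a))) = a
    rw [h6, e.left_inv hae, K.left_inv ha]

end LocalInverse

end AHM

end

noncomputable section

open scoped Manifold ContDiff Topology ENNReal
set_option synthInstance.maxHeartbeats 200000

namespace AHM

/-! ### The Cauchy-Schwarz inequality for covectors -/

section CauchySchwarz

variable {m : ℕ} {M : Type*} [TopologicalSpace M]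
  [ChartedSpace (EuclideanSpace ℝ (Fin m)) M] [IsManifold (𝓡 m) ∞ M]

/-- Positivity of the metric on `g(v, v) u - g(u, v) v`, divided by `g(v, v) > 0`. -/
theorem metAt_sq_le (g : Metric (𝓡 m) M) (x : M) (u v : EuclideanSpace ℝ (Fin m)) :
    metAt g x u v ^ 2 ≤ metAt g x u u * metAt g x v v := by
  by_cases hv : v = 0
  · simp [hv]
  have h1 := metAt_nonneg g x (metAt g x v v • u - metAt g x u v • v)
  have h2 := metAt_pos g x hv
  simp only [map_sub, map_smul, sub_apply, smul_apply, smul_eq_mul, metAt_symm g x v u] at h1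
  nlinarith

theorem abs_covec_le (g : Metric (𝓡 m) M) (q : Cotangent m M) (v : EuclideanSpace ℝ (Fin m)) :
    |covec q v| ≤ √(normSq g q) * gnorm g q.proj v := by
  have h : covec q v = metAt g q.proj (sharp g q) v := by rw [metAt_sharp]
  rw [h, gnorm, ← Real.sqrt_mul (normSq_nonneg g q), normSq_eq_metAt]
  exact Real.abs_le_sqrt (metAt_sq_le g _ _ _)

theorem covec_eq_zero_of_sharp (g : Metric (𝓡 m) M) {q : Cotangent m M} (h : sharp g q = 0) :
    covec q = 0 := by
  by_contra hne
  have := normSq_pos g hne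
  rw [normSq, h, map_zero] at this
  exact this.false

theorem covec_eq_zero_of_normSq (g : Metric (𝓡 m) M) {q : Cotangent m M} (h : normSq g q = 0) :
    covec q = 0 := by
  by_contra hne
  exact (normSq_pos g hne).ne' h

theorem eq_of_sharp_eq (g : Metric (𝓡 m) M) {q q' : Cotangent m M} (h : q.proj = q'.proj)
    (h' : sharp g q = sharp g q') : q = q' := by
  refine cotangent_ext h fun v => ?_
  have h1 : covec q v = metAt g q.proj (sharp g q) v := by rw [metAt_sharp]
  have h2 : covec q' v = metAt g q'.proj (sharp g q') v := by rw [metAt_sharp]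
  rw [h1, h2, h, h']

/-- The equality case of the Cauchy-Schwarz inequality for unit covectors. -/
theorem eq_of_covec_sharp_eq_one (g : Metric (𝓡 m) M) {q q' : Cotangent m M}
    (h : q.proj = q'.proj) (hq : normSq g q = 1) (hq' : normSq g q' = 1)
    (h1 : covec q (sharp g q') = 1) : q = q' := by
  refine eq_of_sharp_eq g h (sub_eq_zero.1 ?_)
  by_contra hne
  have h2 := metAt_pos g q.proj hne
  have h3 : metAt g q.proj (sharp g q) (sharp g q') = 1 := by rw [metAt_sharp]; exact h1
  rw [normSq_eq_metAt] at hq hq'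
  rw [← h] at hq'
  simp only [map_sub, sub_apply, metAt_symm g q.proj (sharp g q') (sharp g q)] at h2
  linarith

end CauchySchwarz

/-! ### The exponential map near the zero section -/

section Zero

variable {m : ℕ} {M : Type*} [TopologicalSpace M]
  [ChartedSpace (EuclideanSpace ℝ (Fin m)) M] [IsManifold (𝓡 m) ∞ M]

/-- The covector with given base point and components. -/
def mkCov (x : M) (α : EuclideanSpace ℝ (Fin m) →L[ℝ] ℝ) : Cotangent m M := ⟨x, α⟩

@[simp] theorem covec_mkCov (x : M) (α : EuclideanSpace ℝ (Fin m) →L[ℝ] ℝ) :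
    covec (mkCov x α) = α := rfl

theorem eq_mkCov_zero {q : Cotangent m M} (h : covec q = 0) : q = mkCov q.proj 0 :=
  cotangent_ext rfl fun v => by rw [h]; rfl

theorem cotChart_self_snd (q : Cotangent m M) : (cotChart q q).2 = covec q := by
  rw [cotChart_apply (mem_cotChart_self q)]
  refine ContinuousLinearMap.ext fun v => ?_
  have h : chartDInv q.proj q.proj v = v := by
    have := chartD_chartDInv (mem_chart_source (EuclideanSpace ℝ (Fin m)) q.proj) v
    rwa [chartD_self] at this
  change covec q (chartDInv q.proj q.proj v) = _
  rw [h]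

/-- The fibre through `q` in the preferred chart. -/
theorem cotChart_symm_fibre (q : Cotangent m M) (β : EuclideanSpace ℝ (Fin m) →L[ℝ] ℝ) :
    (cotChart q).symm ((cotChart q q).1, β) = mkCov q.proj β := by
  have ht : ((cotChart q q).1, β) ∈ (cotChart q).target := by
    have h := (cotChart q).map_source (mem_cotChart_self q)
    rw [cotChart_target] at h ⊢
    exact ⟨h.1, mem_univ _⟩
  have hproj : ((cotChart q).symm ((cotChart q q).1, β)).proj = q.proj := by
    rw [cotChart_symm_proj ht, cotChart_apply (mem_cotChart_self q)]
    exact extChartAt_to_inv q.proj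
  refine cotangent_ext hproj fun v => ?_
  rw [cotChart_symm_covec ht, hproj]
  change β (chartD q.proj q.proj v) = β v
  rw [chartD_self]

variable [T2Space M] {g : Metric (𝓡 m) M} (hp : ProperMetric g)
include hp

theorem endp_smulCov (s : ℝ) (q : Cotangent m M) : endp g (smulCov s q) = (flow g s q).proj := by
  rw [endp, flow_smulCov hp, mul_one]; rfl

omit [T2Space M] hp in
theorem mkCov_zero_eq (x : M) : mkCov x (0 : EuclideanSpace ℝ (Fin m) →L[ℝ] ℝ) =
    smulCov 0 (mkCov x 0) := cotangent_ext rfl fun v => by rw [covec_smulCov, zero_smul]; rfl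

theorem endp_mkCov_zero (x : M) : endp g (mkCov x 0) = x := by
  rw [mkCov_zero_eq, endp_smulCov hp, flow_zero hp]; rfl

theorem expPair_mkCov_zero (x : M) : expPair g (mkCov x 0) = (x, x) :=
  Prod.ext rfl (endp_mkCov_zero hp x)

/-- The derivative of the endpoint map along the fibre. -/
theorem derivAt_endp_fibre (q : Cotangent m M) (α : EuclideanSpace ℝ (Fin m) →L[ℝ] ℝ) :
    derivAt (m := m) (fun s : ℝ => endp g (mkCov q.proj (covec q + s • α))) 0 1 =
      derivAt (m := m) (fun u => endp g ((cotChart q).symm u)) (cotChart q q) (0, α) := by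
  have hL : HasFDerivAt (fun s : ℝ => ((cotChart q q).1, covec q + s • α))
      ((1 : ℝ →L[ℝ] ℝ).smulRight ((0, α) : CotModel m)) 0 := by
    have h := (hasDerivAt_const (0 : ℝ) (cotChart q q).1).prodMk
      (((hasDerivAt_id (0 : ℝ)).smul_const α).const_add (covec q))
    rw [one_smul] at h
    exact h.hasFDerivAt
  have h0 : ((cotChart q q).1, covec q + (0 : ℝ) • α) = cotChart q q := by
    rw [zero_smul, add_zero, ← cotChart_self_snd]
  have hmd : MDifferentiableAt 𝓘(ℝ, CotModel m) (𝓡 m) (fun u => endp g ((cotChart q).symm u))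
      ((cotChart q q).1, covec q + (0 : ℝ) • α) := by
    rw [h0]
    exact ((contMDiff_endp hp).mdifferentiable (by simp) _).comp _
      ((contMDiffAt_cotChart_symm ((cotChart q).map_source
        (mem_cotChart_self q))).mdifferentiableAt (by simp))
  have h := derivAt_comp_of_hasFDerivAt (G := fun u => endp g ((cotChart q).symm u)) hL hmd 1
  rw [h0] at h
  simp only [cotChart_symm_fibre] at h
  rw [h]
  simp

/-- By homogeneity the endpoint of `s α` is the point at time `s` on the geodesic of `α`, whose
initial velocity is the vector dual to `α`. -/
theorem isNondeg_mkCov_zero (x : M) : IsNondeg g (mkCov x 0) := by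
  intro α hα
  rw [← derivAt_endp_fibre hp] at hα
  have h1 : (fun s : ℝ => endp g (mkCov x ((0 : EuclideanSpace ℝ (Fin m) →L[ℝ] ℝ) + s • α))) =
      fun s => (flow g s (mkCov x α)).proj := by
    funext s
    rw [← endp_smulCov hp, zero_add]
    rfl
  have h2 := (isHam_flow hp (mkCov x α) univ).derivAt_proj (t := 0) Filter.univ_mem
  rw [← h1, flow_zero hp] at h2
  exact covec_eq_zero_of_sharp g (q := mkCov x α) (h2.symm.trans hα)

end Zero

/-! ### The Gauss lemma for local inverses of the exponential map -/

section LocalInverse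

variable {m : ℕ} {M : Type*} [TopologicalSpace M]
  [ChartedSpace (EuclideanSpace ℝ (Fin m)) M] [IsManifold (𝓡 m) ∞ M]

/-- `S` is a smooth inverse of the exponential map `expPair g : O → N`. -/
structure IsExpInverse (g : Metric (𝓡 m) M) (S : M × M → Cotangent m M)
    (O : Set (Cotangent m M)) (N : Set (M × M)) : Prop where
  isOpen_left : IsOpen O
  isOpen_right : IsOpen N
  mapsTo : MapsTo S N O
  mapsTo_exp : MapsTo (expPair g) O N
  smooth : ContMDiffOn ((𝓡 m).prod (𝓡 m)) (cotI m) ∞ S N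
  right_inv : ∀ x ∈ N, expPair g (S x) = x
  left_inv : ∀ a ∈ O, S (expPair g a) = a

namespace IsExpInverse

variable {g : Metric (𝓡 m) M} {S : M × M → Cotangent m M} {O : Set (Cotangent m M)}
  {N : Set (M × M)} (h : IsExpInverse g S O N)
include h

theorem restrict {O' : Set (Cotangent m M)} (hO' : IsOpen O') (hsub : O' ⊆ O) :
    IsExpInverse g S O' (N ∩ S ⁻¹' O') where
  isOpen_left := hO'
  isOpen_right := h.smooth.continuousOn.isOpen_inter_preimage h.isOpen_right hO'
  mapsTo x hx := hx.2
  mapsTo_exp a ha := ⟨h.mapsTo_exp (hsub ha), by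
    change S (expPair g a) ∈ O'
    rwa [h.left_inv a (hsub ha)]⟩
  smooth := h.smooth.mono inter_subset_left
  right_inv x hx := h.right_inv x hx.1
  left_inv a ha := h.left_inv a (hsub ha)

theorem proj_eq {x y : M} (hxy : (x, y) ∈ N) : (S (x, y)).proj = x :=
  congrArg Prod.fst (h.right_inv _ hxy)

theorem endp_eq {x y : M} (hxy : (x, y) ∈ N) : endp g (S (x, y)) = y :=
  congrArg Prod.snd (h.right_inv _ hxy)

theorem contMDiffAt {x : M × M} (hx : x ∈ N) :
    ContMDiffAt ((𝓡 m).prod (𝓡 m)) (cotI m) ∞ S x :=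
  h.smooth.contMDiffAt (h.isOpen_right.mem_nhds hx)

theorem contMDiffAt_right {x y : M} (hxy : (x, y) ∈ N) :
    ContMDiffAt (𝓡 m) (cotI m) ∞ (fun y => S (x, y)) y :=
  (h.contMDiffAt hxy).comp y (contMDiffAt_const.prodMk contMDiffAt_id)

variable [T2Space M] (hp : ProperMetric g)
include hp

/-- The differential of half the squared distance, in the second variable. -/
theorem hasMFDerivAt_energy_right {x y : M} (hxy : (x, y) ∈ N) :
    HasMFDerivAt (𝓡 m) 𝓘(ℝ, ℝ) (fun y => energy g (S (x, y))) y
      (covec (flow g 1 (S (x, y)))) := by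
  have hev : ∀ᶠ y' in 𝓝 y, (x, y') ∈ N :=
    (continuous_const.prodMk continuous_id).continuousAt.preimage_mem_nhds
      (h.isOpen_right.mem_nhds hxy)
  -- This is the Gauss lemma: for the family `S (x, ·)` the initial point is fixed and the endpoint
  -- is the variable itself, so first variation leaves only the end covector.
  have hA : HasMFDerivAt (𝓡 m) (𝓡 m) (fun y => (S (x, y)).proj) y
      (0 : EuclideanSpace ℝ (Fin m) →L[ℝ] EuclideanSpace ℝ (Fin m)) := by
    refine (hasMFDerivAt_const x y).congr_of_eventuallyEq ?_
    filter_upwards [hev] with y' hy'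
    exact h.proj_eq hy'
  have hB : HasMFDerivAt (𝓡 m) (𝓡 m) (fun y => endp g (S (x, y))) y
      (ContinuousLinearMap.id ℝ (EuclideanSpace ℝ (Fin m))) := by
    refine (hasMFDerivAt_id y).congr_of_eventuallyEq ?_
    filter_upwards [hev] with y' hy'
    exact h.endp_eq hy'
  have h1 := hasMFDerivAt_energy_comp hp
    ((h.contMDiffAt_right hxy).of_le ENat.LEInfty.out) hA hB
  rwa [ContinuousLinearMap.comp_id, ContinuousLinearMap.comp_zero, sub_zero] at h1

/-- The differential of half the squared distance. -/
theorem hasMFDerivAt_energy {x : M × M} (hx : x ∈ N) :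
    HasMFDerivAt ((𝓡 m).prod (𝓡 m)) 𝓘(ℝ, ℝ) (fun x => energy g (S x)) x
      ((covec (flow g 1 (S x))).comp (ContinuousLinearMap.snd ℝ _ _) -
        (covec (S x)).comp (ContinuousLinearMap.fst ℝ _ _)) := by
  have hev : ∀ᶠ x' in 𝓝 x, x' ∈ N := h.isOpen_right.mem_nhds hx
  have hA : HasMFDerivAt ((𝓡 m).prod (𝓡 m)) (𝓡 m) (fun x => (S x).proj) x
      (ContinuousLinearMap.fst ℝ (EuclideanSpace ℝ (Fin m)) (EuclideanSpace ℝ (Fin m))) := by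
    refine (hasMFDerivAt_fst (x := x)).congr_of_eventuallyEq ?_
    filter_upwards [hev] with x' hx'
    exact congrArg Prod.fst (h.right_inv x' hx')
  have hB : HasMFDerivAt ((𝓡 m).prod (𝓡 m)) (𝓡 m) (fun x => endp g (S x)) x
      (ContinuousLinearMap.snd ℝ (EuclideanSpace ℝ (Fin m)) (EuclideanSpace ℝ (Fin m))) := by
    refine (hasMFDerivAt_snd (x := x)).congr_of_eventuallyEq ?_
    filter_upwards [hev] with x' hx'
    exact congrArg Prod.snd (h.right_inv x' hx')
  exact hasMFDerivAt_energy_comp hp ((h.contMDiffAt hx).of_le ENat.LEInfty.out) hA hB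

/-- Along a path the norm of the initial covector grows at most like the length. -/
theorem sqrt_normSq_le_plen {x : M} {γ : ℝ → M} (hγ : ContMDiff 𝓘(ℝ, ℝ) (𝓡 m) 1 γ) {a b : ℝ}
    (hab : a ≤ b) (hN : ∀ t ∈ Icc a b, (x, γ t) ∈ N) (ha : normSq g (S (x, γ a)) = 0) :
    ENNReal.ofReal √(normSq g (S (x, γ b))) ≤ plen g γ a b := by
  refine ENNReal.le_of_forall_pos_le_add fun η hη _ => ?_
  -- The norm is not differentiable at zero covectors. Adding `η ^ 2` under the root removes the
  -- singularity at the cost of an error `η`, which tends to zero in the end.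
  set W : ℝ → ℝ := fun t => 2 * energy g (S (x, γ t)) + 1 + (η : ℝ) ^ 2 with hW
  have hWn (t : ℝ) : W t = normSq g (S (x, γ t)) + (η : ℝ) ^ 2 := by
    rw [hW, normSq_eq_energy]
  have hη' : (0 : ℝ) < η := by exact_mod_cast hη
  have hWpos (t : ℝ) : 0 < W t := by
    rw [hWn]; have := normSq_nonneg g (S (x, γ t)); positivity
  have hWs : ∀ t ∈ Icc a b, ContDiffAt ℝ 1 W t := by
    intro t ht
    have h1 : ContMDiffAt 𝓘(ℝ, ℝ) 𝓘(ℝ, ℝ) 1 (fun t => energy g (S (x, γ t))) t := by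
      refine ContMDiffAt.comp t (g := fun y => energy g (S (x, y))) (I' := 𝓡 m) ?_ (hγ t)
      exact (((contMDiff_energy g) _).comp (γ t) (h.contMDiffAt_right (hN t ht))).of_le (by simp)
    rw [contMDiffAt_iff_contDiffAt] at h1
    exact ((contDiffAt_const.mul h1).add contDiffAt_const).add contDiffAt_const
  have hf : ContDiffOn ℝ 1 (fun t => √(W t)) (Icc a b) := fun t ht =>
    ((hWs t ht).sqrt (hWpos t).ne').contDiffWithinAt
  have key := abs_sub_le_of_deriv_le_gnorm g (γ := γ) hab hf zero_le_one (fun t ht => by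
    have htI := Ioo_subset_Icc_self ht
    have h1 := derivAt_comp_apply (h.hasMFDerivAt_energy_right hp (hN t htI))
      (hγ.mdifferentiable (by simp) t)
    have h2 : HasDerivAt W (2 * covec (flow g 1 (S (x, γ t))) (derivAt γ t 1)) t :=
      ((h1.const_mul 2).add_const 1).add_const _
    rw [(h2.sqrt (hWpos t).ne').deriv, one_mul]
    have h3 := abs_covec_le g (flow g 1 (S (x, γ t))) (derivAt γ t 1)
    rw [normSq_flow hp] at h3
    have h4 : (flow g 1 (S (x, γ t))).proj = γ t := h.endp_eq (hN t htI)
    rw [h4] at h3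
    have h5 : √(normSq g (S (x, γ t))) ≤ √(W t) :=
      Real.sqrt_le_sqrt (by rw [hWn]; nlinarith)
    have h6 : 0 < √(W t) := Real.sqrt_pos.2 (hWpos t)
    rw [abs_div, abs_mul, abs_of_pos (by positivity : 0 < 2 * √(W t)), abs_two,
      div_le_iff₀ (by positivity)]
    have h7 := gnorm_nonneg g (γ t) (derivAt γ t 1)
    nlinarith [mul_le_mul_of_nonneg_right h5 h7])
  rw [ENNReal.ofReal_one, one_mul] at key
  have hfa : √(W a) = η := by
    rw [hWn, ha, zero_add, Real.sqrt_sq hη'.le]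
  have h8 : √(normSq g (S (x, γ b))) ≤ |√(W b) - √(W a)| + η := by
    have h9 : √(normSq g (S (x, γ b))) ≤ √(W b) := Real.sqrt_le_sqrt (by rw [hWn]; nlinarith)
    have := le_abs_self (√(W b) - √(W a))
    linarith
  calc ENNReal.ofReal √(normSq g (S (x, γ b)))
      ≤ ENNReal.ofReal (|√(W b) - √(W a)| + η) := ENNReal.ofReal_le_ofReal h8
    _ = ENNReal.ofReal |√(W b) - √(W a)| + η := by
      rw [ENNReal.ofReal_add (abs_nonneg _) hη'.le, ENNReal.ofReal_coe_nnreal]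
    _ ≤ _ := by gcongr

end IsExpInverse

end LocalInverse

end AHM

end

noncomputable section

open scoped Manifold ContDiff Topology ENNReal
set_option synthInstance.maxHeartbeats 200000

namespace AHM

/-! ### Normal neighbourhoods: short geodesics minimize -/

section NormalNhd

variable {m : ℕ} {M : Type*} [TopologicalSpace M]
  [ChartedSpace (EuclideanSpace ℝ (Fin m)) M] [IsManifold (𝓡 m) ∞ M]

theorem normSq_mkCov_zero (g : Metric (𝓡 m) M) (x : M) : normSq g (mkCov x 0) = 0 := by
  simp [normSq]

/-- The covectors of length less than `r` over `U`. -/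
def discBundle (g : Metric (𝓡 m) M) (U : Set M) (r : ℝ) : Set (Cotangent m M) :=
  {a | a.proj ∈ U ∧ √(normSq g a) < r}

/-- Geodesic balls of radius `r` with centre in `U` are normal, and `S` is the inverse of the
exponential map on them. -/
structure IsNormalNhd (g : Metric (𝓡 m) M) (S : M × M → Cotangent m M) (U : Set M) (r : ℝ)
    (N : Set (M × M)) : Prop where
  pos : 0 < r
  isOpen : IsOpen U
  inv : IsExpInverse g S (discBundle g U r) N
  mem_of_redist_lt : ∀ x ∈ U, ∀ y, redist g x y < ENNReal.ofReal r → (x, y) ∈ N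
  redist_eq : ∀ a ∈ discBundle g U r,
    redist g a.proj (endp g a) = ENNReal.ofReal √(normSq g a)

variable [T2Space M] {g : Metric (𝓡 m) M}

/-- Over a compact neighbourhood of `w` the unit disc bundle minus `O` is compact, so its image
under base point and squared norm is closed. The image misses `(w, 0)`, since the zero covector at
`w` lies in `O`. -/
theorem exists_discBundle_subset {O : Set (Cotangent m M)} (hO : IsOpen O) {w : M}
    (hw : mkCov w 0 ∈ O) : ∃ U : Set M, IsOpen U ∧ w ∈ U ∧ ∃ r > 0, discBundle g U r ⊆ O := by
  have : LocallyCompactSpace M := ChartedSpace.locallyCompactSpace (EuclideanSpace ℝ (Fin m)) M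
  obtain ⟨K, hK, hwK⟩ := exists_compact_mem_nhds w
  have hD := (isCompact_disc g hK 1).diff hO
  set D := {q : Cotangent m M | q.proj ∈ K ∧ normSq g q ≤ 1} \ O
  have hC := (hD.image (continuous_cotProj.prodMk (continuous_normSq g))).isClosed
  have hmem : (w, (0 : ℝ)) ∈ ((fun q => (q.proj, normSq g q)) '' D)ᶜ := by
    rintro ⟨q, ⟨-, hqO⟩, hq⟩
    have h1 := covec_eq_zero_of_normSq g (congrArg Prod.snd hq)
    have h2 : q.proj = w := congrArg Prod.fst hq
    rw [eq_mkCov_zero h1, h2] at hqO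
    exact hqO hw
  obtain ⟨u, v, hu, hwu, hv, h0v, huv⟩ := mem_nhds_prod_iff'.1 (hC.isOpen_compl.mem_nhds hmem)
  obtain ⟨ε, hε, hεv⟩ := Metric.isOpen_iff.1 hv 0 h0v
  -- The bound by one serves twice: it gives `r ^ 2 ≤ r`, so squared norms stay below `ε`, and it
  -- keeps covectors in the unit disc bundle.
  refine ⟨u ∩ interior K, hu.inter isOpen_interior, ⟨hwu, mem_interior_iff_mem_nhds.2 hwK⟩,
    min ε 1, by positivity, fun a ha => ?_⟩
  by_contra haO
  have hr : 0 < min ε 1 := by positivity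
  have h1 : normSq g a < (min ε 1) ^ 2 := (Real.sqrt_lt' hr).1 ha.2
  have h2 : (min ε 1) ^ 2 ≤ min ε 1 := by
    nlinarith [min_le_right ε 1]
  refine huv (Set.mk_mem_prod (a := a.proj) (b := normSq g a) ha.1.1 (hεv ?_))
    ⟨a, ⟨⟨interior_subset ha.1.2, ?_⟩, haO⟩, rfl⟩
  · rw [Metric.mem_ball, Real.dist_eq, sub_zero, abs_of_nonneg (normSq_nonneg g a)]
    exact h1.trans_le (h2.trans (min_le_left _ _))
  · exact h1.le.trans (h2.trans (min_le_right _ _))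

variable (hp : ProperMetric g)
include hp

theorem redist_endp_le (a : Cotangent m M) :
    redist g a.proj (endp g a) ≤ ENNReal.ofReal √(normSq g a) := by
  have h := redist_flow_le hp zero_le_one a
  rwa [one_mul] at h

/-- A path from `x` of length `L < r` cannot leave `N`. Before a first exit its points are endpoints
of covectors at `x` of norm at most `L`, by `sqrt_normSq_le_plen`. These covectors form a compact
set, so the exit point is such an endpoint as well and lies in `N`. The same bound at the ends of
nearly shortest paths gives the estimate of the distance. -/
theorem IsExpInverse.mem_of_redist_lt {S : M × M → Cotangent m M} {U : Set M} {r : ℝ} (hr : 0 < r)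
    {N : Set (M × M)} (h : IsExpInverse g S (discBundle g U r) N) {x y : M} (hx : x ∈ U)
    (hxy : redist g x y < ENNReal.ofReal r) : (x, y) ∈ N ∧
      ENNReal.ofReal √(normSq g (S (x, y))) ≤ redist g x y := by
  have hzero : mkCov x 0 ∈ discBundle g U r := ⟨hx, by simpa [normSq_mkCov_zero] using hr⟩
  have hNx : (x, x) ∈ N := by
    have := h.mapsTo_exp hzero
    rwa [expPair_mkCov_zero hp] at this
  have hSx : normSq g (S (x, x)) = 0 := by
    have := h.left_inv _ hzero
    rw [expPair_mkCov_zero hp] at this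
    rw [this, normSq_mkCov_zero]
  have key (γ : ℝ → M) (h0 : γ 0 = x) (hγ : ContMDiff 𝓘(ℝ, ℝ) (𝓡 m) 1 γ)
      (hlen : plen g γ 0 1 < ENNReal.ofReal r) : ∀ t ∈ Icc (0 : ℝ) 1, (x, γ t) ∈ N := by
    have hle {t : ℝ} (ht : 0 ≤ t) (hN : ∀ s ∈ Icc 0 t, (x, γ s) ∈ N) :
        ENNReal.ofReal √(normSq g (S (x, γ t))) ≤ plen g γ 0 t :=
      h.sqrt_normSq_le_plen hp hγ ht hN (by rw [h0]; exact hSx)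
    by_contra hcon
    push Not at hcon
    set B : Set ℝ := Icc 0 1 ∩ (fun t => (x, γ t)) ⁻¹' Nᶜ with hB
    have hBc : IsCompact B := isCompact_Icc.inter_right
      (h.isOpen_right.isClosed_compl.preimage (continuous_const.prodMk hγ.continuous))
    obtain ⟨t₁, ht₁, ht₁N⟩ := hcon
    obtain ⟨s, hs, hsmin⟩ := hBc.exists_isLeast ⟨t₁, ht₁, ht₁N⟩
    have hs0 : 0 < s := by
      refine lt_of_le_of_ne hs.1.1 fun h' => hs.2 ?_
      change (x, γ s) ∈ N
      rw [← h', h0]; exact hNx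
    have hlt : ∀ t ∈ Ico 0 s, (x, γ t) ∈ N := by
      intro t ht
      by_contra htN
      exact absurd (hsmin ⟨⟨ht.1, ht.2.le.trans hs.1.2⟩, htN⟩) (not_le.2 ht.2)
    set L := (plen g γ 0 1).toReal with hL
    have hfin : plen g γ 0 1 ≠ ⊤ := (hlen.trans ENNReal.ofReal_lt_top).ne
    have hLr : L < r := by
      rw [← ENNReal.ofReal_toReal hfin] at hlen
      exact (ENNReal.ofReal_lt_ofReal_iff hr).1 hlen
    set C : Set M := endp g '' {q | q.proj ∈ ({x} : Set M) ∧ normSq g q ≤ L ^ 2} with hC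
    have hCc : IsClosed C := ((isCompact_disc g isCompact_singleton (L ^ 2)).image
      (contMDiff_endp hp).continuous).isClosed
    have hsub : Ico 0 s ⊆ γ ⁻¹' C := by
      intro t ht
      have h1 := hle ht.1 fun s' hs' => hlt s' ⟨hs'.1, hs'.2.trans_lt ht.2⟩
      have h2 := h1.trans (plen_mono g γ le_rfl (ht.2.le.trans hs.1.2))
      rw [← ENNReal.ofReal_toReal hfin, ENNReal.ofReal_le_ofReal_iff ENNReal.toReal_nonneg] at h2
      exact ⟨S (x, γ t), ⟨h.proj_eq (hlt t ht), (Real.sqrt_le_left ENNReal.toReal_nonneg).1 h2⟩,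
        h.endp_eq (hlt t ht)⟩
    have h3 : Icc 0 s ⊆ γ ⁻¹' C := by
      rw [← closure_Ico hs0.ne]
      exact closure_minimal hsub (hCc.preimage hγ.continuous)
    obtain ⟨q, ⟨hqx, hqL⟩, hqs⟩ := h3 (right_mem_Icc.2 hs0.le)
    rw [mem_singleton_iff] at hqx
    refine hs.2 ?_
    have h4 : expPair g q = (x, γ s) := Prod.ext hqx hqs
    change (x, γ s) ∈ N
    rw [← h4]
    exact h.mapsTo_exp ⟨hqx ▸ hx, (Real.sqrt_le_left ENNReal.toReal_nonneg).2 hqL |>.trans_lt hLr⟩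
  have hstep (c : ℝ≥0∞) (hc : redist g x y < c) (hcr : c ≤ ENNReal.ofReal r) :
      (x, y) ∈ N ∧ ENNReal.ofReal √(normSq g (S (x, y))) ≤ c := by
    obtain ⟨γ, h0, h1, hγ, hlen⟩ := exists_path_of_redist_lt g hc
    have hN := key γ h0 hγ (hlen.trans_le hcr)
    have h2 := h.sqrt_normSq_le_plen hp hγ zero_le_one hN (by rw [h0]; exact hSx)
    have h3 := hN 1 (by simp)
    rw [h1] at h2 h3
    exact ⟨h3, h2.trans hlen.le⟩
  refine ⟨(hstep _ hxy le_rfl).1, le_of_forall_gt_imp_ge_of_dense fun c hc => ?_⟩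
  rcases le_total c (ENNReal.ofReal r) with hcr | hcr
  · exact (hstep c hc hcr).2
  · exact (hstep _ hxy le_rfl).2.trans hcr

theorem exists_isNormalNhd (w : M) : ∃ S U r N, w ∈ U ∧ IsNormalNhd g S U r N := by
  obtain ⟨S, O, N, hO, hN, hw, h1, h2, h3, h4, h5⟩ :=
    exists_expPair_localInverse hp (isNondeg_mkCov_zero hp w)
  have h : IsExpInverse g S O N := ⟨hO, hN, h1, h2, h3, h4, h5⟩
  obtain ⟨U, hU, hwU, r, hr, hsub⟩ := exists_discBundle_subset (g := g) hO hw
  have hopen : IsOpen (discBundle g U r) :=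
    (hU.preimage continuous_cotProj).inter
      (isOpen_lt (continuous_normSq g).sqrt continuous_const)
  have h' := h.restrict hopen hsub
  refine ⟨S, U, r, _, hwU, hr, hU, h', fun x hx y hxy => (h'.mem_of_redist_lt hp hr hx hxy).1,
    fun a ha => le_antisymm (redist_endp_le hp a) ?_⟩
  have h6 : redist g a.proj (endp g a) < ENNReal.ofReal r :=
    (redist_endp_le hp a).trans_lt ((ENNReal.ofReal_lt_ofReal_iff hr).2 ha.2)
  have h7 := (h'.mem_of_redist_lt hp hr ha.1 h6).2
  have h8 := h'.left_inv a ha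
  rw [expPair] at h8
  rwa [h8] at h7

end NormalNhd

end AHM

end

noncomputable section

open scoped Manifold ContDiff Topology ENNReal
set_option synthInstance.maxHeartbeats 200000

namespace AHM

/-! ### Hopf-Rinow: existence of minimizing geodesics -/

section Distance

variable {m : ℕ} {M : Type*} [TopologicalSpace M]
  [ChartedSpace (EuclideanSpace ℝ (Fin m)) M] [IsManifold (𝓡 m) ∞ M] {g : Metric (𝓡 m) M}

theorem rdist_nonneg (g : Metric (𝓡 m) M) (x y : M) : 0 ≤ rdist g x y := ENNReal.toReal_nonneg

theorem rdist_self (g : Metric (𝓡 m) M) (x : M) : rdist g x x = 0 := by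
  rw [rdist_eq_toReal, redist_self]; rfl

theorem rdist_comm (g : Metric (𝓡 m) M) (x y : M) : rdist g x y = rdist g y x := by
  rw [rdist_eq_toReal, redist_comm]; rfl

theorem rdist_le_of_redist_le {x y : M} {c : ℝ} (hc : 0 ≤ c)
    (h : redist g x y ≤ ENNReal.ofReal c) : rdist g x y ≤ c :=
  ENNReal.toReal_le_of_le_ofReal hc h

variable (hfin : ∀ x y : M, redist g x y ≠ ⊤)
include hfin

theorem ofReal_rdist (x y : M) : ENNReal.ofReal (rdist g x y) = redist g x y :=
  ENNReal.ofReal_toReal (hfin x y)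

theorem rdist_triangle (x y z : M) : rdist g x z ≤ rdist g x y + rdist g y z := by
  rw [rdist_eq_toReal, rdist_eq_toReal, rdist_eq_toReal, ← ENNReal.toReal_add (hfin _ _) (hfin _ _)]
  exact ENNReal.toReal_mono (ENNReal.add_ne_top.2 ⟨hfin _ _, hfin _ _⟩) (redist_triangle g x y z)

theorem redist_lt_ofReal_iff {x y : M} {r : ℝ} :
    redist g x y < ENNReal.ofReal r ↔ rdist g x y < r := by
  rw [← ofReal_rdist hfin]
  exact ENNReal.ofReal_lt_ofReal_iff_of_nonneg (rdist_nonneg g x y)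

theorem eventually_rdist_lt (x : M) {ε : ℝ} (hε : 0 < ε) : ∀ᶠ y in 𝓝 x, rdist g x y < ε := by
  filter_upwards [eventually_redist_lt g x (ENNReal.ofReal_pos.2 hε)] with y hy
  exact (redist_lt_ofReal_iff hfin).1 hy

theorem continuous_rdist : Continuous (fun x : M × M => rdist g x.1 x.2) := by
  rw [continuous_iff_continuousAt]
  rintro ⟨x, y⟩
  refine Metric.tendsto_nhds.2 fun ε hε => ?_
  have h1 := Filter.Eventually.prodMk_nhds (eventually_rdist_lt hfin x (half_pos hε))
    (eventually_rdist_lt hfin y (half_pos hε))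
  filter_upwards [h1] with p hp
  have a1 := rdist_triangle hfin x p.1 y
  have a2 := rdist_triangle hfin p.1 p.2 y
  have a3 := rdist_triangle hfin p.1 x p.2
  have a4 := rdist_triangle hfin x y p.2
  rw [rdist_comm g p.2 y] at a2
  rw [rdist_comm g p.1 x] at a3
  rw [Real.dist_eq, abs_lt]
  constructor <;> linarith [hp.1, hp.2]

theorem continuous_rdist_left (z : M) : Continuous (fun x : M => rdist g x z) :=
  (continuous_rdist hfin).comp (continuous_id.prodMk continuous_const)

theorem continuous_rdist_right (x : M) : Continuous (fun y : M => rdist g x y) :=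
  (continuous_rdist hfin).comp (continuous_const.prodMk continuous_id)

variable [T2Space M]

theorem eq_of_rdist_eq_zero {x y : M} (h : rdist g x y = 0) : x = y := by
  have : LocallyCompactSpace M := ChartedSpace.locallyCompactSpace (EuclideanSpace ℝ (Fin m)) M
  have : RegularSpace M := inferInstance
  refine eq_of_redist_eq_zero g ?_
  rw [← ofReal_rdist hfin, h, ENNReal.ofReal_zero]

variable (hp : ProperMetric g)
include hp

omit hfin in
theorem rdist_flow_le {t : ℝ} (ht : 0 ≤ t) {a : Cotangent m M} (ha : normSq g a = 1) :
    rdist g a.proj (flow g t a).proj ≤ t := by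
  have h := redist_flow_le hp ht a
  rw [ha, Real.sqrt_one, mul_one] at h
  exact rdist_le_of_redist_le ht h

omit hfin in
theorem rdist_flow_flow_le {s t : ℝ} (hst : s ≤ t) {a : Cotangent m M} (ha : normSq g a = 1) :
    rdist g (flow g s a).proj (flow g t a).proj ≤ t - s := by
  have h := rdist_flow_le hp (sub_nonneg.2 hst) (a := flow g s a) (by rw [normSq_flow hp, ha])
  rwa [← flow_add hp, sub_add_cancel] at h

omit [T2Space M] hp in
theorem IsNormalNhd.rdist_eq {S : M × M → Cotangent m M} {U : Set M} {r : ℝ} {N : Set (M × M)}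
    (h : IsNormalNhd g S U r N) {x y : M} (hx : x ∈ U) (hxy : rdist g x y < r) :
    (x, y) ∈ N ∧ √(normSq g (S (x, y))) = rdist g x y := by
  have hN := h.mem_of_redist_lt x hx y ((redist_lt_ofReal_iff hfin).2 hxy)
  refine ⟨hN, ?_⟩
  have h1 := h.redist_eq _ (h.inv.mapsTo hN)
  rw [h.inv.proj_eq hN, h.inv.endp_eq hN] at h1
  rw [rdist_eq_toReal, h1, ENNReal.toReal_ofReal (Real.sqrt_nonneg _)]

/-- On a small geodesic sphere around `w` there is a point which minimizes the distance to `z`. -/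
theorem IsNormalNhd.exists_sphere_min {S : M × M → Cotangent m M} {U : Set M} {r : ℝ}
    {N : Set (M × M)} (h : IsNormalNhd g S U r N) {w z : M} (hw : w ∈ U) {δ : ℝ} (hδ : 0 < δ)
    (hδr : δ < r) (hδz : δ ≤ rdist g w z) :
    ∃ a : Cotangent m M, a.proj = w ∧ normSq g a = 1 ∧
      rdist g (flow g δ a).proj z = rdist g w z - δ := by
  -- A nearly shortest path crosses the sphere of radius `δ` by the intermediate value theorem.
  -- Compactness of the unit sphere at `w` then removes the error `ε`.
  have hcross (ε : ℝ) (hε : 0 < ε) : ∃ a : Cotangent m M, a.proj = w ∧ normSq g a = 1 ∧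
      δ + rdist g (flow g δ a).proj z ≤ rdist g w z + ε := by
    have hlt : redist g w z < ENNReal.ofReal (rdist g w z + ε) :=
      (redist_lt_ofReal_iff hfin).2 (by linarith)
    obtain ⟨γ, h0, h1, hγ, hlen⟩ := exists_path_of_redist_lt g hlt
    have hc : Continuous (fun t => rdist g w (γ t)) :=
      (continuous_rdist_right hfin w).comp hγ.continuous
    have hmem : δ ∈ Icc (rdist g w (γ 0)) (rdist g w (γ 1)) := by
      rw [h0, h1, rdist_self]; exact ⟨hδ.le, hδz⟩
    obtain ⟨t, ht, hδt⟩ := intermediate_value_Icc zero_le_one hc.continuousOn hmem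
    replace hδt : rdist g w (γ t) = δ := hδt
    obtain ⟨hN, hS⟩ := h.rdist_eq hfin hw (hδt ▸ hδr)
    have hn : normSq g (S (w, γ t)) = δ ^ 2 := by
      rw [← hδt, ← hS, Real.sq_sqrt (normSq_nonneg g _)]
    refine ⟨smulCov δ⁻¹ (S (w, γ t)), h.inv.proj_eq hN, ?_, ?_⟩
    · rw [normSq_smulCov, hn]; field_simp
    · have h2 : (flow g δ (smulCov δ⁻¹ (S (w, γ t)))).proj = γ t := by
        rw [← endp_smulCov hp, smulCov_smulCov, mul_inv_cancel₀ hδ.ne', smulCov_one,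
          h.inv.endp_eq hN]
      rw [h2]
      have h3 := (add_le_add (redist_le_plen g ht.1 hγ.contMDiffOn)
        (redist_le_plen g ht.2 hγ.contMDiffOn)).trans (plen_add g γ ht.1 ht.2).le
      rw [h0, h1, ← ofReal_rdist hfin, ← ofReal_rdist hfin,
        ← ENNReal.ofReal_add (rdist_nonneg g _ _) (rdist_nonneg g _ _), hδt] at h3
      have h4 := (ENNReal.ofReal_lt_ofReal_iff_of_nonneg
        (add_nonneg hδ.le (rdist_nonneg g _ _))).1 (h3.trans_lt hlen)
      exact h4.le
  set Sph : Set (Cotangent m M) := {a | a.proj = w ∧ normSq g a = 1} with hSph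
  have hcpt : IsCompact Sph := by
    have : T2Space (Cotangent m M) := t2Space_cotangent
    refine (isCompact_disc g (isCompact_singleton (x := w)) 1).of_isClosed_subset ?_
      fun a ha => ⟨ha.1, ha.2.le⟩
    exact (isClosed_singleton.preimage continuous_cotProj).inter
      (isClosed_eq (continuous_normSq g) continuous_const)
  obtain ⟨a₁, ha₁, ha₁', -⟩ := hcross 1 one_pos
  have hf : Continuous (fun a : Cotangent m M => rdist g (flow g δ a).proj z) :=
    (continuous_rdist_left hfin z).comp
      (continuous_cotProj.comp (contMDiff_flow_right hp δ).continuous)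
  obtain ⟨a, ⟨haw, han⟩, hmin⟩ := hcpt.exists_isMinOn ⟨a₁, ha₁, ha₁'⟩ hf.continuousOn
  refine ⟨a, haw, han, le_antisymm ?_ ?_⟩
  · refine le_of_forall_pos_le_add fun ε hε => ?_
    obtain ⟨b, hb, hb', hbε⟩ := hcross ε hε
    have h5 : rdist g (flow g δ a).proj z ≤ rdist g (flow g δ b).proj z := hmin ⟨hb, hb'⟩
    linarith
  · have h5 := rdist_triangle hfin w (flow g δ a).proj z
    have h6 := rdist_flow_le hp hδ.le han
    rw [haw] at h6
    linarith

/-- A minimizing broken geodesic has no corner. -/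
theorem eq_of_rdist_flow_flow {b a : Cotangent m M} (hba : b.proj = a.proj) (hb : normSq g b = 1)
    (ha : normSq g a = 1) {ε₀ s₀ : ℝ} (hε₀ : 0 < ε₀) (hs₀ : 0 < s₀)
    (h : ∀ ε ∈ Icc 0 ε₀, ∀ s ∈ Icc 0 s₀,
      rdist g (flow g (-ε) b).proj (flow g s a).proj = ε + s) : b = a := by
  obtain ⟨S, U, r, N, hU, hN⟩ := exists_isNormalNhd hp a.proj
  have hcont : ContinuousAt (fun ε => (flow g (-ε) b).proj) 0 :=
    ((continuous_cotProj.comp (continuous_flow_left hp b)).comp continuous_neg).continuousAt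
  have hev : ∀ᶠ ε in 𝓝 (0 : ℝ), (flow g (-ε) b).proj ∈ U := by
    refine hcont.preimage_mem_nhds (hN.isOpen.mem_nhds ?_)
    simpa [flow_zero hp, hba] using hU
  have hev2 : ∀ᶠ ε in 𝓝[>] (0 : ℝ), (flow g (-ε) b).proj ∈ U ∧ ε < r ∧ ε < ε₀ ∧ 0 < ε := by
    refine (hev.filter_mono nhdsWithin_le_nhds).and (((eventually_lt_nhds hN.pos).filter_mono
      nhdsWithin_le_nhds).and (((eventually_lt_nhds hε₀).filter_mono nhdsWithin_le_nhds).and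
      self_mem_nhdsWithin))
  obtain ⟨ε, hεU, hεr, hεε₀, hε⟩ := hev2.exists
  set p := (flow g (-ε) b).proj with hpdef
  set c := smulCov ε (flow g (-ε) b) with hc
  have hflow : flow g ε (flow g (-ε) b) = b := by
    rw [← flow_add hp, add_neg_cancel, flow_zero hp]
  have hcN : c ∈ discBundle g U r := by
    refine ⟨hεU, ?_⟩
    rw [hc, normSq_smulCov, normSq_flow hp, hb, mul_one, Real.sqrt_sq hε.le]
    exact hεr
  have hexp : expPair g c = (p, a.proj) := by
    refine Prod.ext rfl ?_
    change endp g c = a.proj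
    rw [hc, endp_smulCov hp, hflow, hba]
  have hpa : (p, a.proj) ∈ N := hexp ▸ hN.inv.mapsTo_exp hcN
  have hS : S (p, a.proj) = c := by rw [← hexp]; exact hN.inv.left_inv c hcN
  have h1 := hN.inv.hasMFDerivAt_energy_right hp hpa
  have hγ : MDifferentiableAt 𝓘(ℝ, ℝ) (𝓡 m) (fun s => (flow g s a).proj) 0 :=
    (contMDiff_cotProj.mdifferentiable (by simp) _).comp (0 : ℝ)
      ((isMIntegralCurve_flow hp a) 0).mdifferentiableAt
  have h0 : (flow g 0 a).proj = a.proj := by rw [flow_zero hp]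
  have h2 : HasDerivAt (fun s => energy g (S (p, (flow g s a).proj)))
      (covec (flow g 1 (S (p, a.proj))) (derivAt (m := m) (fun s => (flow g s a).proj) 0 1)) 0 :=
    derivAt_comp_apply (f := fun y => energy g (S (p, y))) (γ := fun s => (flow g s a).proj)
      (h0.symm ▸ h1) hγ
  have h3 := (isHam_flow hp a univ).derivAt_proj (t := 0) Filter.univ_mem
  rw [h3, hS, flow_zero hp, hc, flow_smulCov hp, mul_one, hflow, covec_smulCov] at h2
  -- Along the second geodesic the distance from `p` is `ε + s`, so the energy grows at rate `ε`;
  -- the Gauss lemma gives the rate `ε` times the pairing of the two unit covectors. The pairing is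
  -- therefore one, the equality case of Cauchy-Schwarz. The distances are known only for `s ≥ 0`,
  -- hence the one-sided derivative.
  have h4 : HasDerivWithinAt (fun s : ℝ => ((ε + s) ^ 2 - 1) / 2) (ε • covec b (sharp g a))
      (Ici 0) 0 := by
    refine h2.hasDerivWithinAt.congr_of_eventuallyEq ?_ ?_
    · have h5 : ∀ᶠ s in 𝓝[Ici 0] (0 : ℝ), s < s₀ ∧ s < r - ε ∧ 0 ≤ s :=
        ((eventually_lt_nhds hs₀).filter_mono nhdsWithin_le_nhds).and
          (((eventually_lt_nhds (sub_pos.2 hεr)).filter_mono nhdsWithin_le_nhds).and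
            self_mem_nhdsWithin)
      filter_upwards [h5] with s hs
      have h6 := h ε ⟨hε.le, hεε₀.le⟩ s ⟨hs.2.2, hs.1.le⟩
      have h7 := (hN.rdist_eq hfin hεU (h6.trans_lt (by linarith))).2
      rw [energy_eq_normSq, ← Real.sq_sqrt (normSq_nonneg g (S _)), h7, h6]
    · simp only [flow_zero hp, hS, add_zero, energy_eq_normSq]
      rw [hc, normSq_smulCov, normSq_flow hp, hb, mul_one]
  have h5 : HasDerivAt (fun s : ℝ => ((ε + s) ^ 2 - 1) / 2) ε 0 := by
    have := ((((hasDerivAt_id (0 : ℝ)).const_add ε).pow 2).sub_const 1).div_const 2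
    refine this.congr_deriv ?_
    simp
  have h6 := (uniqueDiffWithinAt_Ici (0 : ℝ)).eq_deriv _ h4 h5.hasDerivWithinAt
  refine eq_of_covec_sharp_eq_one g hba hb ha ?_
  rw [smul_eq_mul] at h6
  exact mul_left_cancel₀ hε.ne' (h6.trans (mul_one ε).symm)

/-- Any two points are joined by a minimizing geodesic. -/
theorem exists_endp_eq_of_properMetric (x z : M) : ∃ q : Cotangent m M, q.proj = x ∧
    endp g q = z ∧ √(normSq g q) = rdist g x z := by
  set D := rdist g x z with hD
  rcases (rdist_nonneg g x z).eq_or_lt with hD0 | hDpos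
  · have hxz := eq_of_rdist_eq_zero hfin hD0.symm
    exact ⟨mkCov x 0, rfl, by rw [endp_mkCov_zero hp, hxz], by
      rw [normSq_mkCov_zero, Real.sqrt_zero]; exact hD0⟩
  rw [← hD] at hDpos
  obtain ⟨S, U, r, N, hxU, hN⟩ := exists_isNormalNhd hp x
  have hr := hN.pos
  set δ := min (r / 2) D with hδ
  have hδpos : 0 < δ := by positivity
  obtain ⟨a, hax, han, haδ⟩ := hN.exists_sphere_min hfin hp hxU hδpos
    ((min_le_left _ _).trans_lt (half_lt_self hr)) (min_le_right (r / 2) D)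
  -- These are the times at which the geodesic has made full progress towards `z`. If the largest
  -- one were below `D`, a minimizing direction on a small sphere around the current point would
  -- continue the geodesic without a corner, and progress would go on.
  set A : Set ℝ := Icc 0 D ∩ {t | rdist g (flow g t a).proj z ≤ D - t} with hA
  have hcont : Continuous (fun t => rdist g (flow g t a).proj z) :=
    (continuous_rdist_left hfin z).comp (continuous_cotProj.comp (continuous_flow_left hp a))
  have hAc : IsCompact A := isCompact_Icc.inter_right
    (isClosed_le hcont (continuous_const.sub continuous_id))
  have hδA : δ ∈ A := ⟨⟨hδpos.le, min_le_right _ _⟩, haδ.le⟩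
  obtain ⟨T, hT, hTmax⟩ := hAc.exists_isGreatest ⟨δ, hδA⟩
  have hTpos : 0 < T := hδpos.trans_le (hTmax hδA)
  have hTD : T = D := by
    by_contra hne
    have hlt : T < D := lt_of_le_of_ne hT.1.2 hne
    have hb : normSq g (flow g T a) = 1 := by rw [normSq_flow hp, han]
    have hpz : D - T ≤ rdist g (flow g T a).proj z := by
      have h1 := rdist_triangle hfin x (flow g T a).proj z
      have h2 := rdist_flow_le hp hTpos.le han
      rw [hax] at h2
      linarith
    have hpz' : rdist g (flow g T a).proj z = D - T := le_antisymm hT.2 hpz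
    obtain ⟨S', U', r', N', hpU, hN'⟩ := exists_isNormalNhd hp (flow g T a).proj
    have hr' := hN'.pos
    set δ' := min (r' / 2) (D - T) with hδ'
    have hδ'pos : 0 < δ' := lt_min (half_pos hr') (sub_pos.2 hlt)
    obtain ⟨a', hax', han', haδ'⟩ := hN'.exists_sphere_min hfin hp hpU hδ'pos
      ((min_le_left _ _).trans_lt (half_lt_self hr')) ((min_le_right _ _).trans hpz)
    rw [hpz'] at haδ'
    have heq : flow g T a = a' := by
      refine eq_of_rdist_flow_flow hfin hp hax'.symm hb han' hTpos hδ'pos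
        fun ε hε s hs => le_antisymm ?_ ?_
      · have h1 := rdist_triangle hfin (flow g (-ε) (flow g T a)).proj (flow g T a).proj
          (flow g s a').proj
        have h2 := rdist_flow_flow_le hp (neg_nonpos.2 hε.1) hb
        have h3 := rdist_flow_le hp hs.1 han'
        rw [flow_zero hp] at h2
        rw [hax'] at h3
        linarith
      · have h1 := rdist_triangle hfin x (flow g (-ε) (flow g T a)).proj z
        have h2 := rdist_triangle hfin (flow g (-ε) (flow g T a)).proj (flow g s a').proj z
        have h3 := rdist_triangle hfin (flow g s a').proj (flow g δ' a').proj z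
        have h4 := rdist_flow_flow_le hp hs.2 han'
        have h5 := rdist_flow_le hp (t := -ε + T) (by linarith [hε.2]) han
        rw [hax, flow_add hp] at h5
        linarith
    have hmem : δ' + T ∈ A := by
      refine ⟨⟨by positivity, by linarith [min_le_right (r' / 2) (D - T)]⟩, ?_⟩
      change rdist g (flow g (δ' + T) a).proj z ≤ D - (δ' + T)
      rw [flow_add hp, heq, haδ']
      linarith
    linarith [hTmax hmem]
  have hfinal : (flow g D a).proj = z := by
    refine eq_of_rdist_eq_zero hfin (le_antisymm ?_ (rdist_nonneg g _ _))
    have := hT.2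
    rw [hTD] at this
    exact this.trans (sub_self D).le
  refine ⟨smulCov D a, hax, by rw [endp_smulCov hp, hfinal], ?_⟩
  rw [normSq_smulCov, han, mul_one, Real.sqrt_sq hDpos.le]

end Distance

/-! ### Bijectivity of the exponential map and minimality of all geodesics -/

section Convex

variable {m : ℕ} {M : Type*} [TopologicalSpace M]
  [ChartedSpace (EuclideanSpace ℝ (Fin m)) M] [IsManifold (𝓡 m) ∞ M] {g : Metric (𝓡 m) M}
  [T2Space M] (hp : ProperMetric g) (hconv : GeodesicallyConvex g)
include hp hconv

theorem GeodesicallyConvex.redist_ne_top (x y : M) : redist g x y ≠ ⊤ := by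
  obtain ⟨⟨α, hα, h0, h1⟩, -⟩ := hconv x y
  obtain ⟨a, ha⟩ := (isGeodesic_iff hp α).1 hα
  have h2 : x = a.proj := by
    rw [← h0, ha 0 (by simp), flow_zero hp]
  have h3 : y = endp g a := by
    rw [← h1, ha 1 (by simp)]; rfl
  rw [h2, h3]
  exact ((redist_endp_le hp a).trans_lt ENNReal.ofReal_lt_top).ne

omit hconv in
-- The projected curve on `[0, 1]` determines its one-sided velocity at `0`, hence the initial
-- covector.
theorem eq_of_eqOn_proj_flow {q q' : Cotangent m M}
    (h : EqOn (fun t => (flow g t q).proj) (fun t => (flow g t q').proj) (Icc 0 1)) : q = q' := by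
  have h0 : q.proj = q'.proj := by
    have := h (left_mem_Icc.2 zero_le_one)
    simpa [flow_zero hp] using this
  have hd (a : Cotangent m M) : HasDerivAt
      (fun t => extChartAt (𝓡 m) a.proj (flow g t a).proj) (sharp g a) 0 := by
    have hmd : MDifferentiableAt 𝓘(ℝ, ℝ) (𝓡 m) (fun s => (flow g s a).proj) 0 :=
      (contMDiff_cotProj.mdifferentiable (by simp) _).comp (0 : ℝ)
        ((isMIntegralCurve_flow hp a) 0).mdifferentiableAt
    have h1 := hasFDerivAt_chart_comp (x₀ := a.proj) hmd
      (by rw [flow_zero hp]; exact mem_chart_source _ _)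
    have h2 := h1.hasDerivAt
    have h3 := (isHam_flow hp a univ).derivAt_proj (t := 0) Filter.univ_mem
    rw [ContinuousLinearMap.comp_apply, h3, flow_zero hp, chartD_self] at h2
    exact h2
  refine eq_of_sharp_eq g h0 ?_
  have h1 := hd q'
  rw [← h0] at h1
  have h2 : HasDerivWithinAt (fun t => extChartAt (𝓡 m) q.proj (flow g t q).proj) (sharp g q')
      (Icc 0 1) 0 := by
    refine h1.hasDerivWithinAt.congr (fun t ht => ?_) ?_
    · exact congrArg _ (h ht)
    · exact congrArg _ (h (left_mem_Icc.2 zero_le_one))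
  exact ((uniqueDiffOn_Icc_zero_one 0 (left_mem_Icc.2 zero_le_one)).eq_deriv _
    (hd q).hasDerivWithinAt h2)

theorem GeodesicallyConvex.expPair_injective : Function.Injective (expPair g) := by
  intro q q' h
  have h1 : q.proj = q'.proj := congrArg Prod.fst h
  have h2 : endp g q = endp g q' := congrArg Prod.snd h
  refine eq_of_eqOn_proj_flow hp ((hconv q.proj (endp g q)).2 _ _
    ((isGeodesic_iff hp _).2 ⟨q, fun _ _ => rfl⟩) ?_ rfl
    ((isGeodesic_iff hp _).2 ⟨q', fun _ _ => rfl⟩) ?_ h2.symm)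
  · simp [flow_zero hp]
  · simp [flow_zero hp, h1]

theorem GeodesicallyConvex.expPair_surjective : Function.Surjective (expPair g) := by
  rintro ⟨x, z⟩
  obtain ⟨q, hq, hq', -⟩ := exists_endp_eq_of_properMetric (hconv.redist_ne_top hp) hp x z
  exact ⟨q, Prod.ext hq hq'⟩

/-- All geodesics are minimizing. -/
theorem GeodesicallyConvex.rdist_endp (q : Cotangent m M) :
    rdist g q.proj (endp g q) = √(normSq g q) := by
  -- The minimizing geodesic has the same endpoints, and by uniqueness the same covector.
  obtain ⟨q', hq, hq', hn⟩ :=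
    exists_endp_eq_of_properMetric (hconv.redist_ne_top hp) hp q.proj (endp g q)
  rw [← hn, hconv.expPair_injective hp (Prod.ext hq hq' : expPair g q' = expPair g q)]

end Convex

end AHM

end

noncomputable section

open scoped Manifold ContDiff Topology ENNReal
set_option synthInstance.maxHeartbeats 200000

namespace AHM

/-! ### Functions squeezed between paraboloids -/

section Paraboloids

variable {Z : Type*} [NormedAddCommGroup Z] [NormedSpace ℝ Z]

/-- The first derivative is Lipschitz near `x`, and the mean value inequality along segments gives a
quadratic remainder. The constant is uniform in the centre `a` of the expansion, as needed for
families of geodesics. -/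
theorem exists_taylor_bound {G : Z → ℝ} {x : Z} (hG : ContDiffAt ℝ 2 G x) :
    ∃ K ≥ 0, ∃ ρ > 0, ∀ a ∈ Metric.ball x ρ, ∀ b ∈ Metric.ball x ρ,
      |G b - G a - fderiv ℝ G a (b - a)| ≤ K * ‖b - a‖ ^ 2 := by
  obtain ⟨K, t, ht, hK⟩ := (hG.fderiv_right (m := 1) (by norm_num)).exists_lipschitzOnWith
  have hd : ∀ᶠ y in 𝓝 x, DifferentiableAt ℝ G y :=
    (hG.eventually (by simp)).mono fun y hy =>
      hy.differentiableAt (by simp)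
  obtain ⟨ρ, hρ, hsub⟩ := Metric.mem_nhds_iff.1 (Filter.inter_mem ht hd)
  refine ⟨K, K.2, ρ, hρ, fun a ha b hb => ?_⟩
  have hseg : segment ℝ a b ⊆ Metric.ball x ρ := (convex_ball x ρ).segment_subset ha hb
  have h := (convex_segment a b).norm_image_sub_le_of_norm_hasFDerivWithin_le'
    (f := G) (f' := fderiv ℝ G) (φ := fderiv ℝ G a) (C := K * ‖b - a‖)
    (fun y hy => (hsub (hseg hy)).2.hasFDerivAt.hasFDerivWithinAt) (fun y hy => ?_)
    (left_mem_segment ℝ a b) (right_mem_segment ℝ a b)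
  · rw [Real.norm_eq_abs] at h
    calc _ ≤ _ := h
      _ = _ := by ring
  · have h1 := hK.dist_le_mul _ (hsub (hseg hy)).1 _ (hsub ha).1
    rw [dist_eq_norm, dist_eq_norm] at h1
    refine h1.trans (mul_le_mul_of_nonneg_left ?_ K.2)
    obtain ⟨θ, hθ, rfl⟩ := (segment_eq_image' ℝ a b ▸ hy : y ∈ _)
    rw [add_sub_cancel_left, norm_smul, Real.norm_eq_abs, abs_of_nonneg hθ.1]
    exact mul_le_of_le_one_left (norm_nonneg _) hθ.2

/-- If a function has first order expansions at the points of a curve, with a uniform quadratic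
error, then the slopes are stationary where the curve is. -/
theorem hasDerivAt_slope {h : Z → ℝ} {u : ℝ → Z} {ζ : ℝ → Z →L[ℝ] ℝ} {K ρ₀ : ℝ} (hK : 0 ≤ K)
    (hρ₀ : 0 < ρ₀) (hu : HasDerivAt u 0 0)
    (hb : ∀ᶠ s in 𝓝 (0 : ℝ), ∀ v ∈ Metric.ball (u 0) ρ₀,
      |h v - h (u s) - ζ s (v - u s)| ≤ K * ‖v - u s‖ ^ 2) : HasDerivAt ζ 0 0 := by
  rw [hasDerivAt_iff_isLittleO, Asymptotics.isLittleO_iff] at hu ⊢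
  intro c hc
  set κ := c / (6 * K + 1) with hκ
  have hκpos : 0 < κ := by positivity
  have hκc : 6 * K * κ ≤ c := by
    rw [hκ, ← mul_div_assoc, div_le_iff₀ (by positivity)]
    nlinarith
  have hsmall : ∀ᶠ s in 𝓝 (0 : ℝ), κ * |s| < ρ₀ / 2 := by
    have : Filter.Tendsto (fun s : ℝ => κ * |s|) (𝓝 0) (𝓝 (κ * |0|)) :=
      (continuous_const.mul continuous_abs).continuousAt
    rw [abs_zero, mul_zero] at this
    exact this.eventually (eventually_lt_nhds (half_pos hρ₀))
  have hb0 := hb.self_of_nhds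
  filter_upwards [hu hκpos, hsmall, hb] with s h1 h2 h3
  simp only [sub_zero, smul_zero, Real.norm_eq_abs] at h1 ⊢
  rcases eq_or_ne s 0 with rfl | hs
  · simp
  set ρ := κ * |s| with hρ
  have hρpos : 0 < ρ := by positivity
  -- Compare the expansion at `u s` with the one at `u 0`, at the points `u s + v` and `u s`. Since
  -- `‖u s - u 0‖ ≤ ρ`, the three errors are at most `K ρ²`, `4 K ρ²` and `K ρ²`. Testing on vectors
  -- of length `ρ = κ |s|` bounds the change of slope by `6 K κ |s|`.
  have key (v : Z) (hv : ‖v‖ ≤ ρ) : (ζ s - ζ 0) v ≤ 6 * K * ρ ^ 2 := by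
    have hm1 : u s + v ∈ Metric.ball (u 0) ρ₀ := by
      rw [Metric.mem_ball, dist_eq_norm]
      calc ‖u s + v - u 0‖ = ‖(u s - u 0) + v‖ := by congr 1; abel
        _ ≤ ‖u s - u 0‖ + ‖v‖ := norm_add_le _ _
        _ < ρ₀ := by linarith
    have hm2 : u s ∈ Metric.ball (u 0) ρ₀ := by
      rw [Metric.mem_ball, dist_eq_norm]; linarith
    have e1 := (abs_le.1 (h3 _ hm1)).1
    have e2 := (abs_le.1 (hb0 _ hm1)).2
    have e3 := (abs_le.1 (hb0 _ hm2)).1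
    have n1 : ‖u s + v - u s‖ ^ 2 ≤ ρ ^ 2 := by
      rw [add_sub_cancel_left]; gcongr
    have n2 : ‖u s + v - u 0‖ ^ 2 ≤ (2 * ρ) ^ 2 := by
      gcongr
      calc ‖u s + v - u 0‖ = ‖(u s - u 0) + v‖ := by congr 1; abel
        _ ≤ ‖u s - u 0‖ + ‖v‖ := norm_add_le _ _
        _ ≤ 2 * ρ := by linarith
    have n3 : ‖u s - u 0‖ ^ 2 ≤ ρ ^ 2 := by gcongr
    have m1 := mul_le_mul_of_nonneg_left n1 hK
    have m2 := mul_le_mul_of_nonneg_left n2 hK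
    have m3 := mul_le_mul_of_nonneg_left n3 hK
    rw [add_sub_cancel_left] at e1
    have l1 : ζ 0 (u s + v - u 0) = ζ 0 (u s - u 0) + ζ 0 v := by
      rw [← map_add]; congr 1; abel
    rw [l1] at e2
    rw [sub_apply]
    rw [add_sub_cancel_left] at m1
    nlinarith
  have hop : ‖ζ s - ζ 0‖ ≤ 6 * K * ρ := by
    refine ContinuousLinearMap.opNorm_le_bound _ (by positivity) fun x => ?_
    rcases eq_or_ne x 0 with rfl | hx
    · simp
    have hxpos : 0 < ‖x‖ := norm_pos_iff.2 hx
    have k1 := key ((ρ / ‖x‖) • x) (by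
      rw [norm_smul, Real.norm_eq_abs, abs_of_pos (by positivity), div_mul_cancel₀ _ hxpos.ne'])
    have k2 := key ((-(ρ / ‖x‖)) • x) (by
      rw [norm_smul, Real.norm_eq_abs, abs_neg, abs_of_pos (by positivity),
        div_mul_cancel₀ _ hxpos.ne'])
    rw [map_smul, smul_eq_mul] at k1 k2
    rw [Real.norm_eq_abs]
    have e : 6 * K * ρ ^ 2 = ρ / ‖x‖ * (6 * K * ρ * ‖x‖) := by field_simp
    rw [e] at k1 k2
    have hq : 0 < ρ / ‖x‖ := by positivity
    rw [abs_le]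
    constructor
    · have := le_of_mul_le_mul_left (by linarith : ρ / ‖x‖ * (-((ζ s - ζ 0) x)) ≤
        ρ / ‖x‖ * (6 * K * ρ * ‖x‖)) hq
      linarith
    · exact le_of_mul_le_mul_left k1 hq
  calc _ ≤ _ := hop
    _ = 6 * K * κ * |s| := by rw [hρ]; ring
    _ ≤ c * |s| := by gcongr

/-- Convexity of the square, with weights adapted to the two triangle inequalities, bounds `d ^ 2`
from above through a point before the endpoint and `a ^ 2` from above through a point beyond it. The
second bound is one for `d ^ 2` from below. Both expansions have the same slope `X` after division
by `±ε`; `ε ≤ 1` keeps the weight `1 - ε` nonnegative. -/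
theorem abs_sub_le_of_triangle {ε a d d₁ d₂ X n K₁ K₂ : ℝ} (hε : 0 < ε) (hε1 : ε ≤ 1)
    (ha0 : 0 ≤ a) (p0 : 0 ≤ d) (hn : 0 ≤ n) (hK₁ : 0 ≤ K₁)
    (hK₂ : 0 ≤ K₂) (t1 : d ≤ (1 - ε) * a + d₁) (t2 : (1 - -ε) * a ≤ d + d₂)
    (h1 : |(d₁ ^ 2 - 1) / 2 - (ε ^ 2 * a ^ 2 - 1) / 2 - ε * X| ≤ K₁ * n)
    (h2 : |(d₂ ^ 2 - 1) / 2 - ((-ε) ^ 2 * a ^ 2 - 1) / 2 - -ε * X| ≤ K₂ * n) :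
    |d ^ 2 / 2 - a ^ 2 / 2 - X| ≤ (K₁ + K₂) / ε * n := by
  have i1 := (abs_le.1 h1).2
  have i2 := (abs_le.1 h2).2
  have u1 : ε * (d ^ 2 - a ^ 2) ≤ d₁ ^ 2 - ε ^ 2 * a ^ 2 := by
    have e1 : d ^ 2 ≤ ((1 - ε) * a + d₁) ^ 2 := by gcongr
    have e2 := mul_le_mul_of_nonneg_left e1 hε.le
    have e3 : 0 ≤ (1 - ε) * (d₁ - ε * a) ^ 2 := mul_nonneg (by linarith) (sq_nonneg _)
    linarith
  have u2 : -(d₂ ^ 2 - ε ^ 2 * a ^ 2) ≤ ε * (d ^ 2 - a ^ 2) := by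
    have e0 : 0 ≤ (1 - -ε) * a := mul_nonneg (by linarith) ha0
    have e1 : ((1 - -ε) * a) ^ 2 ≤ (d + d₂) ^ 2 := by gcongr
    have e3 : 0 ≤ (ε * d - d₂) ^ 2 := sq_nonneg _
    have e4 := mul_le_mul_of_nonneg_right e1 hε.le
    have e5 : (1 + ε) * ((1 + ε) * a ^ 2 * ε) ≤ (1 + ε) * (ε * d ^ 2 + d₂ ^ 2) := by linarith
    have e6 := le_of_mul_le_mul_left e5 (by linarith)
    linarith
  have k1 : 0 ≤ K₁ * n := by positivity
  have k2 : 0 ≤ K₂ * n := by positivity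
  have e : (K₁ + K₂) / ε * n = (K₁ * n + K₂ * n) / ε := by ring
  rw [e, le_div_iff₀ hε, ← abs_of_pos hε, ← abs_mul, abs_le]
  constructor <;> linarith

end Paraboloids

/-! ### Absence of conjugate points -/

section Nondegenerate

variable {m : ℕ} {M : Type*} [TopologicalSpace M]
  [ChartedSpace (EuclideanSpace ℝ (Fin m)) M] [IsManifold (𝓡 m) ∞ M]

theorem hasFDerivAt_comp_chart_symm {f : M → ℝ} {x₀ x : M}
    {f' : EuclideanSpace ℝ (Fin m) →L[ℝ] ℝ} (hf : HasMFDerivAt (𝓡 m) 𝓘(ℝ, ℝ) f x f')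
    (hx : x ∈ (chartAt (EuclideanSpace ℝ (Fin m)) x₀).source) :
    HasFDerivAt (fun u => f ((extChartAt (𝓡 m) x₀).symm u)) (f'.comp (chartDInv x₀ x))
      (extChartAt (𝓡 m) x₀ x) := by
  have hx' : x ∈ (extChartAt (𝓡 m) x₀).source := by rwa [extChartAt_source]
  have ht : extChartAt (𝓡 m) x₀ x ∈ (extChartAt (𝓡 m) x₀).target :=
    (extChartAt (𝓡 m) x₀).map_source hx'
  have hs : MDifferentiableWithinAt 𝓘(ℝ, EuclideanSpace ℝ (Fin m)) (𝓡 m)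
      (extChartAt (𝓡 m) x₀).symm (range (𝓡 m)) (extChartAt (𝓡 m) x₀ x) :=
    ((contMDiffOn_extChartAt_symm (n := ∞) x₀).contMDiffAt
      ((isOpen_extChartAt_target x₀).mem_nhds ht)).mdifferentiableAt
        (by simp) |>.mdifferentiableWithinAt
  have h1 := hs.hasMFDerivWithinAt
  have hl : (extChartAt (𝓡 m) x₀).symm (extChartAt (𝓡 m) x₀ x) = x :=
    (extChartAt (𝓡 m) x₀).left_inv hx'
  have h2 := HasMFDerivWithinAt.comp (I' := 𝓡 m) (g := f) (u := univ)
    (extChartAt (𝓡 m) x₀ x) (hl.symm ▸ hf.hasMFDerivWithinAt) h1 (subset_univ _)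
  have hr : range (𝓡 m) = univ := (𝓡 m).range_eq_univ
  rw [hr] at h2
  refine hasFDerivAt_of_hasMFDerivAt (hasMFDerivWithinAt_univ.1 ?_)
  unfold chartDInv
  rw [hr]
  exact h2

variable [T2Space M] {g : Metric (𝓡 m) M} (hp : ProperMetric g)
include hp

/-- The covector which leads from a point of a geodesic to its endpoint. -/
def tailCov (g : Metric (𝓡 m) M) (σ : ℝ) (q : Cotangent m M) : Cotangent m M :=
  smulCov σ (flow g (1 - σ) q)

theorem flow_one_tailCov (σ : ℝ) (q : Cotangent m M) :
    flow g 1 (tailCov g σ q) = smulCov σ (flow g 1 q) := by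
  rw [tailCov, flow_smulCov hp, mul_one, ← flow_add hp, add_sub_cancel]

theorem expPair_tailCov (σ : ℝ) (q : Cotangent m M) :
    expPair g (tailCov g σ q) = ((flow g (1 - σ) q).proj, endp g q) := by
  refine Prod.ext rfl ?_
  change (flow g 1 (tailCov g σ q)).proj = _
  rw [flow_one_tailCov hp]; rfl

theorem normSq_tailCov (σ : ℝ) (q : Cotangent m M) :
    normSq g (tailCov g σ q) = σ ^ 2 * normSq g q := by
  rw [tailCov, normSq_smulCov, normSq_flow hp]

omit [T2Space M] hp in
theorem contMDiff_smulCov (s : ℝ) :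
    ContMDiff (cotI m) (cotI m) ∞ (smulCov s : Cotangent m M → Cotangent m M) := by
  intro q
  let A : CotModel m →L[ℝ] CotModel m :=
    (ContinuousLinearMap.fst ℝ _ _).prod (s • ContinuousLinearMap.snd ℝ _ _)
  have hsrc := smulCov_mem_source (s := s) (mem_cotChart_self q)
  have hA : cotChart q (smulCov s q) = A (cotChart q q) := cotChart_smulCov (mem_cotChart_self q)
  have h1 : ContMDiffAt (cotI m) 𝓘(ℝ, CotModel m) ∞ (fun q' => A (cotChart q q')) q :=
    A.contDiff.contMDiff.contMDiffAt.comp q (contMDiffAt_cotChart (mem_cotChart_self q))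
  have h2 : ContMDiffAt (cotI m) (cotI m) ∞ (fun q' => (cotChart q).symm (A (cotChart q q'))) q :=
    ContMDiffAt.comp q (g := (cotChart q).symm)
      (contMDiffAt_cotChart_symm (hA ▸ (cotChart q).map_source hsrc)) h1
  refine h2.congr_of_eventuallyEq ?_
  filter_upwards [(isOpen_cotChart_source q).mem_nhds (mem_cotChart_self q)] with q' hq'
  have h3 : A (cotChart q q') = cotChart q (smulCov s q') := (cotChart_smulCov hq').symm
  rw [h3, (cotChart q).left_inv (smulCov_mem_source hq')]

/-- Along a family of geodesics, the squared distance from a point shortly before (or after) the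
endpoint has a uniform first order expansion at the endpoint. -/
theorem IsNormalNhd.exists_tail_expansion {Γ : ℝ → Cotangent m M}
    (hΓ : ContMDiff 𝓘(ℝ, ℝ) (cotI m) ∞ Γ) {S : M × M → Cotangent m M} {U : Set M} {r : ℝ}
    {N : Set (M × M)} (hN : IsNormalNhd g S U r N) {σ : ℝ} (hU : (flow g (1 - σ) (Γ 0)).proj ∈ U)
    (hr : |σ| * √(normSq g (Γ 0)) < r) :
    ∃ K ≥ 0, ∃ ρ > 0, ∀ᶠ s in 𝓝 (0 : ℝ),
      ∀ v ∈ Metric.ball (cotChart (flow g 1 (Γ 0)) (flow g 1 (Γ 0))).1 ρ,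
      ((flow g (1 - σ) (Γ s)).proj, (extChartAt (𝓡 m) (endp g (Γ 0))).symm v) ∈ N ∧
      |energy g (S ((flow g (1 - σ) (Γ s)).proj, (extChartAt (𝓡 m) (endp g (Γ 0))).symm v)) -
        energy g (tailCov g σ (Γ s)) - σ * (cotChart (flow g 1 (Γ 0)) (flow g 1 (Γ s))).2
          (v - (cotChart (flow g 1 (Γ 0)) (flow g 1 (Γ s))).1)| ≤
        K * ‖v - (cotChart (flow g 1 (Γ 0)) (flow g 1 (Γ s))).1‖ ^ 2 := by
  set b : ℝ → Cotangent m M := fun s => flow g 1 (Γ s) with hbdef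
  have hb : ContMDiff 𝓘(ℝ, ℝ) (cotI m) ∞ b := (contMDiff_flow_right hp 1).comp hΓ
  set z₀ := endp g (Γ 0) with hz₀
  set ψ := extChartAt (𝓡 m) z₀ with hψ
  set w : ℝ → M := fun s => (flow g (1 - σ) (Γ s)).proj with hw
  have hws : ContMDiff 𝓘(ℝ, ℝ) (𝓡 m) ∞ w :=
    contMDiff_cotProj.comp ((contMDiff_flow_right hp (1 - σ)).comp hΓ)
  have hbsrc : ∀ᶠ s in 𝓝 (0 : ℝ), b s ∈ (cotChart (b 0)).source :=
    hb.continuous.continuousAt.preimage_mem_nhds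
      ((isOpen_cotChart_source (b 0)).mem_nhds (mem_cotChart_self (b 0)))
  have hfst {s : ℝ} (hs : b s ∈ (cotChart (b 0)).source) :
      (cotChart (b 0) (b s)).1 = ψ (b s).proj := by
    rw [cotChart_apply hs]; rfl
  have hsnd {s : ℝ} (hs : b s ∈ (cotChart (b 0)).source) :
      (cotChart (b 0) (b s)).2 = (covec (b s)).comp (chartDInv z₀ (b s).proj) := by
    rw [cotChart_apply hs]; rfl
  set u₀ := (cotChart (b 0) (b 0)).1 with hu₀
  have hu₀' : u₀ = ψ z₀ := hfst (mem_cotChart_self (b 0))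
  have htail : ∀ᶠ s in 𝓝 (0 : ℝ), tailCov g σ (Γ s) ∈ discBundle g U r := by
    have h1 : ∀ᶠ s in 𝓝 (0 : ℝ), w s ∈ U :=
      hws.continuous.continuousAt.preimage_mem_nhds (hN.isOpen.mem_nhds hU)
    have h2 : Continuous fun s => |σ| * √(normSq g (Γ s)) :=
      continuous_const.mul ((continuous_normSq g).comp hΓ.continuous).sqrt
    filter_upwards [h1, h2.continuousAt.eventually (eventually_lt_nhds hr)] with s hs1 hs2
    refine ⟨hs1, ?_⟩
    rw [normSq_tailCov hp, Real.sqrt_mul (sq_nonneg σ), Real.sqrt_sq_eq_abs]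
    exact hs2
  have hmemN {s : ℝ} (hs : tailCov g σ (Γ s) ∈ discBundle g U r) : (w s, (b s).proj) ∈ N := by
    have := hN.inv.mapsTo_exp hs
    rwa [expPair_tailCov hp] at this
  have hS {s : ℝ} (hs : tailCov g σ (Γ s) ∈ discBundle g U r) :
      S (w s, (b s).proj) = tailCov g σ (Γ s) := by
    have := hN.inv.left_inv _ hs
    rwa [expPair_tailCov hp] at this
  have hP : ContMDiffAt 𝓘(ℝ, ℝ × EuclideanSpace ℝ (Fin m)) ((𝓡 m).prod (𝓡 m)) ∞
      (fun x : ℝ × EuclideanSpace ℝ (Fin m) => (w x.1, ψ.symm x.2)) (0, u₀) := by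
    refine ContMDiffAt.prodMk ?_ ?_
    · refine ContMDiffAt.comp (0, u₀) (I' := 𝓘(ℝ, ℝ)) (g := w) (hws _) ?_
      rw [contMDiffAt_iff_contDiffAt]; exact contDiffAt_fst
    · refine ContMDiffAt.comp (0, u₀) (I' := 𝓘(ℝ, EuclideanSpace ℝ (Fin m))) (g := ψ.symm) ?_ ?_
      · change ContMDiffAt _ _ _ _ u₀
        rw [hu₀']; exact contMDiffAt_extChartAt_symm_self z₀
      · rw [contMDiffAt_iff_contDiffAt]; exact contDiffAt_snd
  have hP0 : (w 0, ψ.symm u₀) ∈ N := by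
    rw [hu₀', extChartAt_to_inv]
    exact hmemN htail.self_of_nhds
  have hG : ContDiffAt ℝ 2 (fun x : ℝ × EuclideanSpace ℝ (Fin m) =>
      energy g (S (w x.1, ψ.symm x.2))) (0, u₀) := by
    rw [← contMDiffAt_iff_contDiffAt]
    have h1 := (hN.inv.contMDiffAt hP0).comp (0, u₀)
      (f := fun x : ℝ × EuclideanSpace ℝ (Fin m) => (w x.1, ψ.symm x.2)) hP
    exact (((contMDiff_energy g) _).comp (0, u₀) h1).of_le ENat.LEInfty.out
  set G : ℝ × EuclideanSpace ℝ (Fin m) → ℝ := fun x => energy g (S (w x.1, ψ.symm x.2)) with hGdef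
  -- The bound is taken jointly in `(s, v)`, so one constant serves all nearby geodesics. Only
  -- points with equal `s` are compared afterwards, and the derivative in `s` never enters.
  obtain ⟨K, hK, ρ, hρ, hT⟩ := exists_taylor_bound hG
  have hevN : ∀ᶠ x in 𝓝 ((0 : ℝ), u₀), (w x.1, ψ.symm x.2) ∈ N ∧ DifferentiableAt ℝ G x := by
    refine Filter.Eventually.and
      (hP.continuousAt.preimage_mem_nhds (hN.inv.isOpen_right.mem_nhds hP0)) ?_
    exact (hG.eventually (by simp)).mono fun y hy => hy.differentiableAt (by simp)
  obtain ⟨ρ', hρ', hsub⟩ := Metric.mem_nhds_iff.1 hevN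
  have hucont : ContinuousAt (fun s => (cotChart (b 0) (b s)).1) 0 :=
    continuousAt_fst.comp (ContinuousAt.comp (f := b) (contMDiffAt_cotChart
      (mem_cotChart_self (b 0))).continuousAt hb.continuous.continuousAt)
  have hρρ : 0 < min ρ ρ' := lt_min hρ hρ'
  have hball {s : ℝ} {v : EuclideanSpace ℝ (Fin m)} (hs : s ∈ Metric.ball 0 (min ρ ρ'))
      (hv : v ∈ Metric.ball u₀ (min ρ ρ')) : (s, v) ∈ Metric.ball ((0 : ℝ), u₀) ρ ∧
        (s, v) ∈ Metric.ball ((0 : ℝ), u₀) ρ' := by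
    rw [← ball_prod_same, ← ball_prod_same]
    exact ⟨⟨Metric.ball_subset_ball (min_le_left _ _) hs, Metric.ball_subset_ball (min_le_left _ _) hv⟩,
      ⟨Metric.ball_subset_ball (min_le_right _ _) hs, Metric.ball_subset_ball (min_le_right _ _) hv⟩⟩
  refine ⟨K, hK, min ρ ρ', hρρ, ?_⟩
  filter_upwards [hbsrc, htail, Metric.ball_mem_nhds (0 : ℝ) hρρ,
    hucont.preimage_mem_nhds (Metric.ball_mem_nhds _ hρρ)] with s hs1 hs2 hs3 hs4 v hv
  have hs4' : (cotChart (b 0) (b s)).1 ∈ Metric.ball u₀ (min ρ ρ') := hs4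
  refine ⟨(hsub (hball hs3 hv).2).1, ?_⟩
  have h1 := hT _ (hball hs3 hs4').1 _ (hball hs3 hv).1
  have hzsrc : (b s).proj ∈ (chartAt (EuclideanSpace ℝ (Fin m)) z₀).source :=
    mem_cotChart_source.1 hs1
  have hinv : ψ.symm (cotChart (b 0) (b s)).1 = (b s).proj := by
    rw [hfst hs1]
    exact ψ.left_inv (by rwa [hψ, extChartAt_source])
  have hGs : G (s, (cotChart (b 0) (b s)).1) = energy g (tailCov g σ (Γ s)) := by
    simp only [hGdef]; rw [hinv, hS hs2]
  have hdG : fderiv ℝ G (s, (cotChart (b 0) (b s)).1)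
      (0, v - (cotChart (b 0) (b s)).1) =
        σ * (cotChart (b 0) (b s)).2 (v - (cotChart (b 0) (b s)).1) := by
    have h2 := hasFDerivAt_comp_chart_symm
      (hN.inv.hasMFDerivAt_energy_right hp (hmemN hs2)) hzsrc
    have h3 := (hsub (hball hs3 hs4').2).2.hasFDerivAt
    have h4 : HasFDerivAt (fun v => G (s, v)) ((fderiv ℝ G (s, (cotChart (b 0) (b s)).1)).comp
        (ContinuousLinearMap.inr ℝ ℝ (EuclideanSpace ℝ (Fin m)))) (cotChart (b 0) (b s)).1 :=
      HasFDerivAt.comp (f := fun v => (s, v)) _ h3 (hasFDerivAt_prodMk_right s _)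
    rw [hfst hs1] at h4
    have h5 := congrArg (fun L => L (v - (cotChart (b 0) (b s)).1)) (h4.unique h2)
    rw [hS hs2, flow_one_tailCov hp, covec_smulCov, ← hfst hs1] at h5
    rw [hsnd hs1]
    exact h5
  rw [Prod.mk_sub_mk, sub_self, hdG, hGs, Prod.norm_mk, norm_zero,
    max_eq_right (norm_nonneg _)] at h1
  exact h1

/-- A geodesically convex manifold has no conjugate points. -/
theorem GeodesicallyConvex.isNondeg (hconv : GeodesicallyConvex g) (q : Cotangent m M) :
    IsNondeg g q := by
  intro α hα
  rw [← derivAt_endp_fibre hp] at hα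
  -- The geodesics with initial covectors `q + s α` have endpoints stationary at `s = 0`. The
  -- squared distance from `q.proj` is squeezed between paraboloids at these endpoints, with the end
  -- covectors as slopes, so the end covectors are stationary too. Running the smooth flow
  -- backwards, the initial covectors are stationary, which means `α = 0`.
  set Γ : ℝ → Cotangent m M := fun s => mkCov q.proj (covec q + s • α) with hΓdef
  have hΓ0 : Γ 0 = q := cotangent_ext rfl fun v => by simp [hΓdef]
  have hline : ContDiff ℝ ∞ (fun s : ℝ => (((cotChart q q).1, covec q + s • α) : CotModel m)) :=
    contDiff_const.prodMk (contDiff_const.add (contDiff_id.smul contDiff_const))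
  have htgt (β : EuclideanSpace ℝ (Fin m) →L[ℝ] ℝ) :
      ((cotChart q q).1, β) ∈ (cotChart q).target := by
    have h := (cotChart q).map_source (mem_cotChart_self q)
    rw [cotChart_target] at h ⊢
    exact ⟨h.1, mem_univ _⟩
  have hΓ : ContMDiff 𝓘(ℝ, ℝ) (cotI m) ∞ Γ := by
    intro s
    have h1 : Γ = fun s => (cotChart q).symm ((cotChart q q).1, covec q + s • α) := by
      funext s; exact (cotChart_symm_fibre q _).symm
    rw [h1]
    exact ContMDiffAt.comp s (g := (cotChart q).symm) (contMDiffAt_cotChart_symm (htgt _))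
      hline.contMDiff.contMDiffAt
  have hΓc (s : ℝ) : cotChart q (Γ s) = ((cotChart q q).1, covec q + s • α) := by
    have h1 : Γ s = (cotChart q).symm ((cotChart q q).1, covec q + s • α) :=
      (cotChart_symm_fibre q _).symm
    rw [h1, (cotChart q).right_inv (htgt _)]
  set b : ℝ → Cotangent m M := fun s => flow g 1 (Γ s) with hbdef
  have hb : ContMDiff 𝓘(ℝ, ℝ) (cotI m) ∞ b := (contMDiff_flow_right hp 1).comp hΓ
  set z₀ := endp g (Γ 0) with hz₀
  set B : ℝ → CotModel m := fun s => cotChart (b 0) (b s) with hB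
  have hBd : DifferentiableAt ℝ B 0 := by
    have h1 : ContMDiffAt 𝓘(ℝ, ℝ) 𝓘(ℝ, CotModel m) ∞ B 0 :=
      ContMDiffAt.comp (0 : ℝ) (f := b) (contMDiffAt_cotChart (mem_cotChart_self (b 0))) (hb 0)
    rw [contMDiffAt_iff_contDiffAt] at h1
    exact h1.differentiableAt (by simp)
  have hbsrc : ∀ᶠ s in 𝓝 (0 : ℝ), b s ∈ (cotChart (b 0)).source :=
    hb.continuous.continuousAt.preimage_mem_nhds
      ((isOpen_cotChart_source (b 0)).mem_nhds (mem_cotChart_self (b 0)))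
  have hu : HasDerivAt (fun s => (B s).1) 0 0 := by
    have hmd : MDifferentiableAt 𝓘(ℝ, ℝ) (𝓡 m) (fun s => endp g (Γ s)) 0 :=
      ((contMDiff_endp hp).comp hΓ).mdifferentiable (by simp) 0
    have h1 := (hasFDerivAt_chart_comp (x₀ := z₀) hmd (mem_chart_source _ _)).hasDerivAt
    rw [ContinuousLinearMap.comp_apply, hα, map_zero] at h1
    refine h1.congr_of_eventuallyEq ?_
    filter_upwards [hbsrc] with s hs
    simp only [hB]
    rw [cotChart_apply hs]; rfl
  obtain ⟨S, U, r, N, hzU, hN⟩ := exists_isNormalNhd hp z₀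
  have hev : ∀ᶠ σ in 𝓝 (0 : ℝ), (flow g (1 - σ) (Γ 0)).proj ∈ U ∧ |σ| * √(normSq g (Γ 0)) < r := by
    refine Filter.Eventually.and ?_ ?_
    · have h1 : Continuous (fun σ => (flow g (1 - σ) (Γ 0)).proj) :=
        continuous_cotProj.comp ((continuous_flow_left hp (Γ 0)).comp (continuous_const.sub
          continuous_id))
      refine h1.continuousAt.preimage_mem_nhds (hN.isOpen.mem_nhds ?_)
      rw [sub_zero]; exact hzU
    · have h1 : Continuous (fun σ : ℝ => |σ| * √(normSq g (Γ 0))) := by fun_prop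
      refine h1.continuousAt.eventually (eventually_lt_nhds ?_)
      simpa using hN.pos
  have hev' : ∀ᶠ σ in 𝓝 (0 : ℝ), (flow g (1 - -σ) (Γ 0)).proj ∈ U ∧
      |-σ| * √(normSq g (Γ 0)) < r :=
    (continuous_neg.tendsto' (0 : ℝ) 0 neg_zero).eventually hev
  have hev'' : ∀ᶠ σ in 𝓝[>] (0 : ℝ), _ := (((hev.and hev').and
    (eventually_lt_nhds one_pos)).filter_mono nhdsWithin_le_nhds).and self_mem_nhdsWithin
  -- The points at parameters `1 - ε` and `1 + ε` must both be close enough to the endpoint for the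
  -- squared distance from them to be smooth near it.
  obtain ⟨ε, ⟨⟨hε1, hε2⟩, hεlt⟩, hε⟩ := hev''.exists
  obtain ⟨K₁, hK₁, ρ₁, hρ₁, hT₁⟩ := hN.exists_tail_expansion hp hΓ hε1.1 hε1.2
  obtain ⟨K₂, hK₂, ρ₂, hρ₂, hT₂⟩ := hN.exists_tail_expansion hp hΓ hε2.1 hε2.2
  have hfin := hconv.redist_ne_top hp
  have hζ : HasDerivAt (fun s => (B s).2) 0 0 := by
    refine hasDerivAt_slope (h := fun v => rdist g q.proj
      ((extChartAt (𝓡 m) z₀).symm v) ^ 2 / 2) (u := fun s => (B s).1) (K := (K₁ + K₂) / ε)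
      (ρ₀ := min ρ₁ ρ₂) (by positivity) (lt_min hρ₁ hρ₂) hu ?_
    filter_upwards [hT₁, hT₂, hbsrc] with s h1 h2 h3 v hv
    obtain ⟨hv1, hv1'⟩ := h1 v (Metric.ball_subset_ball (min_le_left _ _) hv)
    obtain ⟨hv2, hv2'⟩ := h2 v (Metric.ball_subset_ball (min_le_right _ _) hv)
    clear h1 h2
    set y := (extChartAt (𝓡 m) z₀).symm v with hy
    have hus : (extChartAt (𝓡 m) z₀).symm (B s).1 = (b s).proj := by
      simp only [hB]
      rw [cotChart_apply h3]
      exact (extChartAt (𝓡 m) z₀).left_inv (by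
        rw [extChartAt_source]; exact mem_cotChart_source.1 h3)
    set a := √(normSq g (Γ s)) with ha
    have ha0 : 0 ≤ a := Real.sqrt_nonneg _
    have hasq : normSq g (Γ s) = a ^ 2 := (Real.sq_sqrt (normSq_nonneg g _)).symm
    have hd0 : rdist g q.proj (b s).proj = a := hconv.rdist_endp hp (Γ s)
    have hen (σ : ℝ) (hNσ : ((flow g (1 - σ) (Γ s)).proj, y) ∈ N) :
        energy g (S ((flow g (1 - σ) (Γ s)).proj, y)) =
          (rdist g (flow g (1 - σ) (Γ s)).proj y ^ 2 - 1) / 2 := by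
      have h4 := hconv.rdist_endp hp (S ((flow g (1 - σ) (Γ s)).proj, y))
      rw [hN.inv.proj_eq hNσ, hN.inv.endp_eq hNσ] at h4
      rw [energy_eq_normSq, h4, Real.sq_sqrt (normSq_nonneg g _)]
    have hw (t : ℝ) (ht : 0 ≤ t) : rdist g q.proj (flow g t (Γ s)).proj = t * a := by
      have h4 := hconv.rdist_endp hp (smulCov t (Γ s))
      rw [endp_smulCov hp, normSq_smulCov, Real.sqrt_mul (sq_nonneg t), Real.sqrt_sq ht] at h4
      exact h4
    rw [hen _ hv1, energy_eq_normSq, normSq_tailCov hp, hasq] at hv1'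
    rw [hen _ hv2, energy_eq_normSq, normSq_tailCov hp, hasq] at hv2'
    have t1 := rdist_triangle hfin q.proj (flow g (1 - ε) (Γ s)).proj y
    have t2 := rdist_triangle hfin q.proj y (flow g (1 - -ε) (Γ s)).proj
    rw [hw _ (by linarith)] at t1 t2
    rw [rdist_comm g y] at t2
    set d := rdist g q.proj y with hd
    set d₁ := rdist g (flow g (1 - ε) (Γ s)).proj y with hd₁
    set d₂ := rdist g (flow g (1 - -ε) (Γ s)).proj y with hd₂
    have p0 : 0 ≤ d := rdist_nonneg g _ _
    have p1 : 0 ≤ d₁ := rdist_nonneg g _ _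
    have p2 : 0 ≤ d₂ := rdist_nonneg g _ _
    rw [hus, hd0]
    change |d ^ 2 / 2 - a ^ 2 / 2 - (B s).2 (v - (B s).1)| ≤ _
    change |(d₁ ^ 2 - 1) / 2 - (ε ^ 2 * a ^ 2 - 1) / 2 - ε * (B s).2 (v - (B s).1)| ≤
      K₁ * ‖v - (B s).1‖ ^ 2 at hv1'
    change |(d₂ ^ 2 - 1) / 2 - ((-ε) ^ 2 * a ^ 2 - 1) / 2 - -ε * (B s).2 (v - (B s).1)| ≤
      K₂ * ‖v - (B s).1‖ ^ 2 at hv2'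
    exact abs_sub_le_of_triangle hε hεlt.le ha0 p0 (sq_nonneg _) hK₁ hK₂ t1 t2 hv1' hv2'
  -- Base and covector of the end are both stationary, so the whole curve of end covectors is, and a
  -- differentiable map preserves this.
  have hB0 : HasDerivAt B 0 0 := hu.prodMk hζ
  set Θ : CotModel m → CotModel m :=
    fun x => cotChart q (flow g (-1) ((cotChart (b 0)).symm x)) with hΘ
  have hback (s : ℝ) : flow g (-1) (b s) = Γ s := by
    rw [hbdef, ← flow_add hp, neg_add_cancel, flow_zero hp]
  have hΘd : DifferentiableAt ℝ Θ (B 0) := by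
    have h1 : ContMDiffAt 𝓘(ℝ, CotModel m) 𝓘(ℝ, CotModel m) ∞ Θ (B 0) := by
      have hl : (cotChart (b 0)).symm (B 0) = b 0 := (cotChart (b 0)).left_inv (mem_cotChart_self _)
      refine ContMDiffAt.comp (B 0) (g := cotChart q) (I' := cotI m) ?_
        ((contMDiff_flow_right hp (-1)).contMDiffAt.comp (B 0)
        (contMDiffAt_cotChart_symm ((cotChart (b 0)).map_source (mem_cotChart_self _))))
      rw [hl, hback, hΓ0]
      exact contMDiffAt_cotChart (mem_cotChart_self q)
    rw [contMDiffAt_iff_contDiffAt] at h1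
    exact h1.differentiableAt (by simp)
  have h1 : HasDerivAt (fun s => Θ (B s)) (fderiv ℝ Θ (B 0) 0) 0 :=
    hΘd.hasFDerivAt.comp_hasDerivAt 0 hB0
  have h2 : HasDerivAt (fun s => Θ (B s)) (0, α) 0 := by
    have h3 : HasDerivAt (fun s : ℝ => (((cotChart q q).1, covec q + s • α) : CotModel m))
        (0, α) 0 := by
      have h := (hasDerivAt_const (0 : ℝ) (cotChart q q).1).prodMk
        (((hasDerivAt_id (0 : ℝ)).smul_const α).const_add (covec q))
      rwa [one_smul] at h
    refine h3.congr_of_eventuallyEq ?_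
    filter_upwards [hbsrc] with s hs
    simp only [hΘ, hB]
    rw [(cotChart (b 0)).left_inv hs, hback, hΓc]
  have h3 := h2.unique h1
  rw [map_zero] at h3
  exact congrArg Prod.snd h3

end Nondegenerate

end AHM

end

noncomputable section

open scoped Manifold ContDiff Topology ENNReal
set_option synthInstance.maxHeartbeats 200000

namespace AHM

/-! ### Smoothness and differential of the distance function -/

section DistanceSmooth

variable {m : ℕ} {M : Type*} [TopologicalSpace M]
  [ChartedSpace (EuclideanSpace ℝ (Fin m)) M] [IsManifold (𝓡 m) ∞ M] {g : Metric (𝓡 m) M}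
  [T2Space M] (hp : ProperMetric g) (hconv : GeodesicallyConvex g)
include hp hconv

/-- The exponential map of a geodesically convex manifold is a diffeomorphism. -/
theorem GeodesicallyConvex.exists_isExpInverse :
    ∃ S : M × M → Cotangent m M, IsExpInverse g S univ univ := by
  set S := Function.surjInv (hconv.expPair_surjective hp) with hS
  have hright (x : M × M) : expPair g (S x) = x := Function.surjInv_eq _ x
  refine ⟨S, isOpen_univ, isOpen_univ, mapsTo_univ _ _, mapsTo_univ _ _, ?_, fun x _ => hright x,
    fun a _ => hconv.expPair_injective hp (hright _)⟩
  intro x _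
  obtain ⟨S', O, N, -, hN, hxO, -, h2, h3, h4, -⟩ :=
    exists_expPair_localInverse hp (hconv.isNondeg hp (S x))
  have hxN : x ∈ N := hright x ▸ h2 hxO
  -- Injectivity forces the global inverse to agree with the smooth local one near `x`.
  refine ((h3.contMDiffAt (hN.mem_nhds hxN)).congr_of_eventuallyEq ?_).contMDiffWithinAt
  filter_upwards [hN.mem_nhds hxN] with y hy
  exact hconv.expPair_injective hp ((hright y).trans (h4 y hy).symm)

theorem GeodesicallyConvex.rdist_ne_zero {x y : M} (h : x ≠ y) : rdist g x y ≠ 0 :=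
  fun h0 => h (eq_of_rdist_eq_zero (hconv.redist_ne_top hp) h0)

theorem GeodesicallyConvex.rdist_eq_sqrt {S : M × M → Cotangent m M}
    (hS : IsExpInverse g S univ univ) (x : M × M) :
    rdist g x.1 x.2 = √(2 * energy g (S x) + 1) := by
  have h := hconv.rdist_endp hp (S x)
  rwa [hS.proj_eq (mem_univ _), hS.endp_eq (mem_univ _), normSq_eq_energy] at h

/-- The distance is `√(2p + 1)` at the initial covector of the joining geodesic, which depends
smoothly on the endpoints, and the radicand is nonzero off the diagonal. -/
theorem GeodesicallyConvex.contMDiffOn_rdist :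
    ContMDiffOn ((𝓡 m).prod (𝓡 m)) 𝓘(ℝ, ℝ) ∞ (fun x : M × M => rdist g x.1 x.2)
      {x | x.1 ≠ x.2} := by
  obtain ⟨S, hS⟩ := hconv.exists_isExpInverse hp
  have heq : (fun x : M × M => rdist g x.1 x.2) = fun x => √(2 * energy g (S x) + 1) :=
    funext fun x => hconv.rdist_eq_sqrt hp hS x
  intro x hx
  have hpos : 2 * energy g (S x) + 1 ≠ 0 := fun h0 => hconv.rdist_ne_zero hp hx (by
    rw [hconv.rdist_eq_sqrt hp hS, h0, Real.sqrt_zero])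
  rw [heq]
  have h1 : ContMDiffAt ((𝓡 m).prod (𝓡 m)) 𝓘(ℝ, ℝ) ∞ (fun x => energy g (S x)) x :=
    ((contMDiff_energy g) _).comp x (hS.contMDiffAt (mem_univ x))
  have h2 : ContDiffAt ℝ ∞ (fun e : ℝ => √(2 * e + 1)) (energy g (S x)) :=
    ((contDiffAt_const.mul contDiffAt_id).add contDiffAt_const).sqrt hpos
  exact (ContMDiffAt.comp x (g := fun e : ℝ => √(2 * e + 1)) h2.contMDiffAt h1).contMDiffWithinAt

/-- The differential of the distance function along a unit speed geodesic. -/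
theorem GeodesicallyConvex.hasMFDerivAt_rdist {a : Cotangent m M} (ha : normSq g a = 1) {t : ℝ}
    (ht : 0 < t) {x y : M} (hx : a.proj = x) (hy : (flow g t a).proj = y) :
    HasMFDerivAt ((𝓡 m).prod (𝓡 m)) 𝓘(ℝ, ℝ) (fun x : M × M => rdist g x.1 x.2) (x, y)
      ((covec (flow g t a)).comp (ContinuousLinearMap.snd ℝ _ _) -
        (covec a).comp (ContinuousLinearMap.fst ℝ _ _)) := by
  obtain ⟨S, hS⟩ := hconv.exists_isExpInverse hp
  have heq : (fun x : M × M => rdist g x.1 x.2) = fun x => √(2 * energy g (S x) + 1) :=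
    funext fun x => hconv.rdist_eq_sqrt hp hS x
  have hexp : expPair g (smulCov t a) = (x, y) := by
    refine Prod.ext hx ?_
    change endp g (smulCov t a) = y
    rw [endp_smulCov hp, hy]
  have hSxy : S (x, y) = smulCov t a := by
    rw [← hexp]; exact hS.left_inv _ (mem_univ _)
  have h1 := hS.hasMFDerivAt_energy hp (mem_univ (x, y))
  have hE : 2 * energy g (S (x, y)) + 1 = t ^ 2 := by
    rw [← normSq_eq_energy, hSxy, normSq_smulCov, ha, mul_one]
  have h2 : HasDerivAt (fun e : ℝ => √(2 * e + 1)) (1 / t) (energy g (S (x, y))) := by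
    have h3 := (((hasDerivAt_id (energy g (S (x, y)))).const_mul 2).add_const 1).sqrt
      (by simp only [id, hE]; positivity)
    refine h3.congr_deriv ?_
    simp only [id, hE]
    rw [Real.sqrt_sq ht.le]
    field_simp
  rw [heq]
  have h4 := HasMFDerivAt.comp (x, y) (g := fun e : ℝ => √(2 * e + 1)) (I' := 𝓘(ℝ, ℝ))
    h2.hasFDerivAt.hasMFDerivAt h1
  rw [hSxy, flow_smulCov hp, mul_one, covec_smulCov, covec_smulCov] at h4
  refine (congrArg (fun L : EuclideanSpace ℝ (Fin m) × EuclideanSpace ℝ (Fin m) →L[ℝ] ℝ =>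
    HasMFDerivAt ((𝓡 m).prod (𝓡 m)) 𝓘(ℝ, ℝ) (fun x => √(2 * energy g (S x) + 1)) (x, y) L)
    (ContinuousLinearMap.ext fun V => ?_)).mp h4
  change (t * covec (flow g t a) V.2 - t * covec a V.1) * (1 / t) =
    covec (flow g t a) V.2 - covec a V.1
  field_simp

/-- The differential of the distance function, with the endpoint as the first variable. -/
theorem GeodesicallyConvex.hasMFDerivAt_rdist_swap {a : Cotangent m M} (ha : normSq g a = 1)
    {t : ℝ} (ht : 0 < t) {x y : M} (hx : a.proj = x) (hy : (flow g t a).proj = y) :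
    HasMFDerivAt ((𝓡 m).prod (𝓡 m)) 𝓘(ℝ, ℝ) (fun x : M × M => rdist g x.1 x.2) (y, x)
      ((covec (flow g t a)).comp (ContinuousLinearMap.fst ℝ _ _) -
        (covec a).comp (ContinuousLinearMap.snd ℝ _ _)) := by
  -- The reversed geodesic starts with minus the end covector and arrives with minus the initial
  -- one.
  have hback : flow g t (smulCov (-1) (flow g t a)) = smulCov (-1) a := by
    rw [flow_smulCov hp, ← flow_add hp]
    congr 1
    rw [neg_one_mul, neg_add_cancel, flow_zero hp]
  have hn : normSq g (smulCov (-1) (flow g t a)) = 1 := by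
    rw [normSq_smulCov, normSq_flow hp, ha]; norm_num
  have h := hconv.hasMFDerivAt_rdist hp hn ht (x := y) (y := x) hy (by rw [hback]; exact hx)
  rw [hback, covec_smulCov, covec_smulCov] at h
  refine (congrArg (fun L : EuclideanSpace ℝ (Fin m) × EuclideanSpace ℝ (Fin m) →L[ℝ] ℝ =>
    HasMFDerivAt ((𝓡 m).prod (𝓡 m)) 𝓘(ℝ, ℝ) (fun x => rdist g x.1 x.2) (y, x) L)
    (ContinuousLinearMap.ext fun V => ?_)).mp h
  change -1 * covec a V.2 - -1 * covec (flow g t a) V.1 = covec (flow g t a) V.1 - covec a V.2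
  ring

theorem GeodesicallyConvex.hasMFDerivAt_rdist_left {a : Cotangent m M} (ha : normSq g a = 1)
    {t : ℝ} (ht : 0 < t) {x y : M} (hx : a.proj = x) (hy : (flow g t a).proj = y) :
    HasMFDerivAt (𝓡 m) 𝓘(ℝ, ℝ) (fun z => rdist g z x) y (covec (flow g t a)) := by
  have hc : HasMFDerivAt (𝓡 m) ((𝓡 m).prod (𝓡 m)) (fun z : M => (z, x)) y
      ((ContinuousLinearMap.id ℝ (EuclideanSpace ℝ (Fin m))).prod
        (0 : EuclideanSpace ℝ (Fin m) →L[ℝ] EuclideanSpace ℝ (Fin m))) :=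
    (hasMFDerivAt_id y).prodMk (hasMFDerivAt_const x y)
  have h := HasMFDerivAt.comp y (f := fun z : M => (z, x))
    (hconv.hasMFDerivAt_rdist_swap hp ha ht hx hy) hc
  refine (congrArg (fun L : EuclideanSpace ℝ (Fin m) →L[ℝ] ℝ =>
    HasMFDerivAt (𝓡 m) 𝓘(ℝ, ℝ) (fun z => rdist g z x) y L)
    (ContinuousLinearMap.ext fun v => ?_)).mp h
  change covec (flow g t a) v - covec a 0 = covec (flow g t a) v
  rw [map_zero, sub_zero]

theorem GeodesicallyConvex.hasMFDerivAt_rdist_right {a : Cotangent m M} (ha : normSq g a = 1)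
    {t : ℝ} (ht : 0 < t) {x y : M} (hx : a.proj = x) (hy : (flow g t a).proj = y) :
    HasMFDerivAt (𝓡 m) 𝓘(ℝ, ℝ) (fun z => rdist g y z) x (-covec a) := by
  have hc : HasMFDerivAt (𝓡 m) ((𝓡 m).prod (𝓡 m)) (fun z : M => (y, z)) x
      ((0 : EuclideanSpace ℝ (Fin m) →L[ℝ] EuclideanSpace ℝ (Fin m)).prod
        (ContinuousLinearMap.id ℝ (EuclideanSpace ℝ (Fin m)))) :=
    (hasMFDerivAt_const y x).prodMk (hasMFDerivAt_id x)
  have h := HasMFDerivAt.comp x (f := fun z : M => (y, z))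
    (hconv.hasMFDerivAt_rdist_swap hp ha ht hx hy) hc
  refine (congrArg (fun L : EuclideanSpace ℝ (Fin m) →L[ℝ] ℝ =>
    HasMFDerivAt (𝓡 m) 𝓘(ℝ, ℝ) (fun z => rdist g y z) x L)
    (ContinuousLinearMap.ext fun v => ?_)).mp h
  change covec (flow g t a) 0 - covec a v = -covec a v
  rw [map_zero, zero_sub]

theorem GeodesicallyConvex.rdist_flow {a : Cotangent m M} (ha : normSq g a = 1) {t : ℝ}
    (ht : 0 ≤ t) : rdist g a.proj (flow g t a).proj = t := by
  have h := hconv.rdist_endp hp (smulCov t a)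
  rwa [endp_smulCov hp, normSq_smulCov, ha, mul_one, Real.sqrt_sq ht] at h

/-- Two distinct points are joined by a unit speed geodesic. -/
theorem GeodesicallyConvex.exists_unit_flow {x y : M} (h : x ≠ y) :
    ∃ (a : Cotangent m M) (t : ℝ), 0 < t ∧ normSq g a = 1 ∧ a.proj = x ∧
      (flow g t a).proj = y := by
  obtain ⟨q, hq, hq', hn⟩ := exists_endp_eq_of_properMetric (hconv.redist_ne_top hp) hp x y
  have hpos : 0 < rdist g x y :=
    lt_of_le_of_ne (rdist_nonneg g x y) (hconv.rdist_ne_zero hp h).symm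
  refine ⟨smulCov (rdist g x y)⁻¹ q, rdist g x y, hpos, ?_, hq, ?_⟩
  · rw [normSq_smulCov, ← Real.sq_sqrt (normSq_nonneg g q), hn]
    field_simp
  · rw [← endp_smulCov hp, smulCov_smulCov, mul_inv_cancel₀ hpos.ne', smulCov_one, hq']

end DistanceSmooth

/-! ### The flow-outs as sets and their description by the distance -/

section Flowout

variable {m : ℕ} {M : Type*} [TopologicalSpace M]
  [ChartedSpace (EuclideanSpace ℝ (Fin m)) M] [IsManifold (𝓡 m) ∞ M] {g : Metric (𝓡 m) M}

theorem Lam_eq (g : Metric (𝓡 m) M) : Lam g =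
    {q | ∃ t : ℝ, 0 ≤ t ∧ HamiltonFlow (energy g) t q.2 q.1 ∧ energy g q.2 = 0} := by
  ext q
  simp only [Lam, flowout, sDiag, mem_iUnion, mem_Ici, mem_ofPred_eq, exists_prop]
  constructor
  · rintro ⟨t, ht, ⟨a, b⟩, ⟨h1, h2⟩, h3, h4⟩
    simp only at h1 h2 h3 h4
    subst h1 h4
    exact ⟨t, ht, h3, h2⟩
  · rintro ⟨t, ht, h1, h2⟩
    exact ⟨t, ht, (q.2, q.2), ⟨rfl, h2⟩, h1, rfl⟩

theorem energy_eq_zero_iff {q : Cotangent m M} : energy g q = 0 ↔ normSq g q = 1 := by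
  rw [energy_eq_normSq]
  constructor <;> intro h <;> linarith

theorem covec_neg_apply (q : Cotangent m M) (v : EuclideanSpace ℝ (Fin m)) :
    covec (smulCov (-1) q) v = -covec q v := by
  change -1 * covec q v = -covec q v
  ring

theorem neg_eq_smulCov (q : Cotangent m M) : (⟨q.proj, -q.snd⟩ : Cotangent m M) = smulCov (-1) q :=
  cotangent_ext rfl fun v => (covec_neg_apply q v).symm

theorem smulCov_neg_neg (q : Cotangent m M) : smulCov (-1) (smulCov (-1) q) = q := by
  rw [smulCov_smulCov]
  norm_num [smulCov_one]

theorem normSq_neg (q : Cotangent m M) : normSq g (smulCov (-1) q) = normSq g q := by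
  rw [normSq_smulCov]; norm_num

variable [T2Space M] (hp : ProperMetric g)
include hp

theorem mem_Lam {q : Cotangent m M × Cotangent m M} :
    q ∈ Lam g ↔ ∃ t : ℝ, 0 ≤ t ∧ q.1 = flow g t q.2 ∧ normSq g q.2 = 1 := by
  rw [Lam_eq, mem_ofPred_eq]
  refine exists_congr fun t => and_congr_right fun ht => ?_
  rw [hamiltonFlow_iff hp ht, energy_eq_zero_iff]

theorem mem_LamConormal {q : Cotangent m M × Cotangent m M} :
    q ∈ LamConormal g ↔ ∃ t : ℝ, 0 ≤ t ∧ q.1 = flow g t (smulCov (-1) q.2) ∧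
      normSq g q.2 = 1 := by
  simp only [LamConormal, flowout, sConormal, mem_iUnion, mem_Ici, mem_ofPred_eq, exists_prop]
  constructor
  · rintro ⟨t, ht, ⟨a, b⟩, ⟨h1, h2⟩, h3, h4⟩
    simp only at h1 h2 h3 h4
    rw [neg_eq_smulCov] at h1
    subst h1 h4
    exact ⟨t, ht, (hamiltonFlow_iff hp ht _ _).1 h3, energy_eq_zero_iff.1 h2⟩
  · rintro ⟨t, ht, h1, h2⟩
    exact ⟨t, ht, (smulCov (-1) q.2, q.2), ⟨(neg_eq_smulCov _).symm, energy_eq_zero_iff.2 h2⟩,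
      (hamiltonFlow_iff hp ht _ _).2 h1, rfl⟩

theorem LamConormal_eq : LamConormal g =
    {q | (q.1, (⟨q.2.proj, -q.2.snd⟩ : Cotangent m M)) ∈ Lam g} := by
  ext q
  rw [mem_LamConormal hp, mem_ofPred_eq, mem_Lam hp]
  simp only [neg_eq_smulCov, normSq_neg]

omit [T2Space M] hp in
theorem mem_sDiag {q : Cotangent m M × Cotangent m M} :
    q ∈ sDiag g ↔ q.1 = q.2 ∧ normSq g q.2 = 1 := by
  rw [sDiag, mem_ofPred_eq, energy_eq_zero_iff]

omit [T2Space M] hp in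
theorem mem_sConormal {q : Cotangent m M × Cotangent m M} :
    q ∈ sConormal g ↔ q.1 = smulCov (-1) q.2 ∧ normSq g q.2 = 1 := by
  rw [sConormal, mem_ofPred_eq, energy_eq_zero_iff, neg_eq_smulCov]

variable (hconv : GeodesicallyConvex g)
include hconv

/-- Points joined by a unit speed geodesic in time `t` are at distance `t`, so the flow-out meets
the diagonal of the base only at `t = 0`. Removing the boundary is the same as removing `z = z'`. -/
theorem mem_Lam_diff_sDiag {q : Cotangent m M × Cotangent m M} :
    q ∈ Lam g \ sDiag g ↔ q.1.proj ≠ q.2.proj ∧ ∃ a t, 0 < t ∧ normSq g a = 1 ∧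
      q.1 = flow g t a ∧ q.2 = a := by
  rw [mem_sdiff, mem_Lam hp, mem_sDiag]
  constructor
  · rintro ⟨⟨t, ht, h1, h2⟩, h3⟩
    have ht' : 0 < t := by
      refine lt_of_le_of_ne ht fun h0 => h3 ⟨?_, h2⟩
      rw [h1, ← h0, flow_zero hp]
    refine ⟨fun h4 => ?_, q.2, t, ht', h2, h1, rfl⟩
    have h5 := hconv.rdist_flow hp h2 ht
    rw [← h1, h4, rdist_self] at h5
    exact ht'.ne h5
  · rintro ⟨h0, a, t, ht, h1, h2, rfl⟩
    exact ⟨⟨t, ht.le, h2, h1⟩, fun h3 => h0 (congrArg _ h3.1)⟩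

/-- For `z ≠ z'` a unit speed geodesic joins `z'` to `z`; by first variation its end covector and
minus its initial covector are the partial differentials of the distance. The right-hand side
determines both covectors, so they are those of that geodesic. -/
theorem Lam_diff_sDiag : Lam g \ sDiag g =
      {q | q.1.proj ≠ q.2.proj ∧
        (∀ v : TangentSpace (𝓡 m) q.1.proj, q.1.snd v =
          mfderiv (𝓡 m) 𝓘(ℝ, ℝ) (fun z : M => rdist g z q.2.proj) q.1.proj v) ∧
        ∀ v : TangentSpace (𝓡 m) q.2.proj, q.2.snd v =
          -mfderiv (𝓡 m) 𝓘(ℝ, ℝ) (fun z' : M => rdist g q.1.proj z') q.2.proj v} := by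
  ext ⟨q₁, q₂⟩
  rw [mem_Lam_diff_sDiag hp hconv, mem_ofPred_eq]
  refine and_congr_right fun hne => ?_
  simp only at hne ⊢
  constructor
  · rintro ⟨a, t, ht, ha, h1, rfl⟩
    have hl := (hconv.hasMFDerivAt_rdist_left hp ha ht rfl (congrArg _ h1.symm)).mfderiv
    have hr := (hconv.hasMFDerivAt_rdist_right hp ha ht rfl (congrArg _ h1.symm)).mfderiv
    refine ⟨fun v => ?_, fun v => ?_⟩
    · have h2 := congrArg (fun L : EuclideanSpace ℝ (Fin m) →L[ℝ] ℝ => L v) hl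
      refine Eq.trans ?_ h2.symm
      change covec q₁ v = covec (flow g t q₂) v
      rw [h1]
    · have h2 := congrArg (fun L : EuclideanSpace ℝ (Fin m) →L[ℝ] ℝ => -L v) hr
      refine Eq.trans ?_ h2.symm
      change covec q₂ v = -(-covec q₂ v)
      rw [neg_neg]
  · rintro ⟨h1, h2⟩
    obtain ⟨a, t, ht, ha, hx, hy⟩ := hconv.exists_unit_flow hp hne.symm
    have hl := (hconv.hasMFDerivAt_rdist_left hp ha ht hx hy).mfderiv
    have hr := (hconv.hasMFDerivAt_rdist_right hp ha ht hx hy).mfderiv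
    refine ⟨a, t, ht, ha, cotangent_ext hy.symm fun v => ?_, cotangent_ext hx.symm fun v => ?_⟩
    · exact (h1 v).trans (congrArg (fun L : EuclideanSpace ℝ (Fin m) →L[ℝ] ℝ => L v) hl)
    · refine ((h2 v).trans
        (congrArg (fun L : EuclideanSpace ℝ (Fin m) →L[ℝ] ℝ => -L v) hr)).trans ?_
      change -(-covec a v) = covec a v
      rw [neg_neg]

/-- Reversing the sign of the second covector carries the previous description over, now with the
full differential of the distance on the product. Testing on `(v, 0)` and `(0, w)` separates the two
covectors. -/
theorem LamConormal_diff_sConormal : LamConormal g \ sConormal g =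
      {q | q.1.proj ≠ q.2.proj ∧
        ∀ (v : TangentSpace (𝓡 m) q.1.proj) (w : TangentSpace (𝓡 m) q.2.proj),
          q.1.snd v + q.2.snd w =
            mfderiv ((𝓡 m).prod (𝓡 m)) 𝓘(ℝ, ℝ)
              (fun x : M × M => rdist g x.1 x.2) (q.1.proj, q.2.proj) (v, w)} := by
  ext ⟨q₁, q₂⟩
  have hiff : (q₁, q₂) ∈ LamConormal g \ sConormal g ↔ q₁.proj ≠ q₂.proj ∧ ∃ a t, 0 < t ∧
      normSq g a = 1 ∧ q₁ = flow g t a ∧ q₂ = smulCov (-1) a := by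
    have h := mem_Lam_diff_sDiag hp hconv (q := (q₁, smulCov (-1) q₂))
    have h1 : (q₁, q₂) ∈ LamConormal g \ sConormal g ↔
        (q₁, smulCov (-1) q₂) ∈ Lam g \ sDiag g := by
      rw [mem_sdiff, mem_sdiff, mem_LamConormal hp, mem_Lam hp, mem_sConormal, mem_sDiag]
      simp only [normSq_neg]
    rw [h1, h]
    refine and_congr_right fun _ => exists_congr fun a => exists_congr fun t => ?_
    refine and_congr_right fun _ => and_congr_right fun _ => and_congr_right fun _ => ?_
    constructor
    · intro h2
      change smulCov (-1) q₂ = a at h2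
      rw [← h2, smulCov_neg_neg]
    · rintro rfl
      exact smulCov_neg_neg a
  rw [hiff, mem_ofPred_eq]
  refine and_congr_right fun hne => ?_
  simp only at hne ⊢
  constructor
  · rintro ⟨a, t, ht, ha, h1, rfl⟩
    have hd := (hconv.hasMFDerivAt_rdist_swap hp ha ht rfl (congrArg _ h1.symm)).mfderiv
    intro v w
    have h2 := congrArg (fun L : EuclideanSpace ℝ (Fin m) × EuclideanSpace ℝ (Fin m) →L[ℝ] ℝ =>
      L (v, w)) hd
    refine Eq.trans ?_ h2.symm
    have h3 (v w : EuclideanSpace ℝ (Fin m)) :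
        covec q₁ v + covec (smulCov (-1) a) w = covec (flow g t a) v - covec a w := by
      rw [h1, covec_neg_apply]; ring
    exact h3 v w
  · intro h
    obtain ⟨a, t, ht, ha, hx, hy⟩ := hconv.exists_unit_flow hp hne.symm
    have hd := (hconv.hasMFDerivAt_rdist_swap hp ha ht hx hy).mfderiv
    have key (v w : EuclideanSpace ℝ (Fin m)) :
        covec q₁ v + covec q₂ w = covec (flow g t a) v - covec a w :=
      (h v w).trans (congrArg (fun L : EuclideanSpace ℝ (Fin m) × EuclideanSpace ℝ (Fin m) →L[ℝ] ℝ
        => L (v, w)) hd)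
    refine ⟨a, t, ht, ha, cotangent_ext hy.symm fun v => ?_, cotangent_ext hx.symm fun w => ?_⟩
    · simpa using key v 0
    · have := key 0 w
      rw [covec_neg_apply]
      simpa using this

end Flowout

end AHM

end

noncomputable section

set_option synthInstance.maxHeartbeats 200000

namespace AHM

/-! ### Local normal form of immersions -/

section Immersions

variable {V F E : Type*} [NormedAddCommGroup V] [NormedSpace ℝ V] [FiniteDimensional ℝ V]
  [NormedAddCommGroup F] [NormedSpace ℝ F] [FiniteDimensional ℝ F]
  [NormedAddCommGroup E] [NormedSpace ℝ E] [FiniteDimensional ℝ E]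

/-- The dimension count makes a complement of the range of `D` isomorphic to `F`. -/
theorem exists_equiv_extending (D : V →L[ℝ] E) (hD : Function.Injective D)
    (hdim : Module.finrank ℝ V + Module.finrank ℝ F = Module.finrank ℝ E) :
    ∃ (A : (V × F) ≃L[ℝ] E) (ι : F →L[ℝ] E), ∀ v f, A (v, f) = D v + ι f := by
  obtain ⟨C, hC⟩ := Submodule.exists_isCompl (LinearMap.range D.toLinearMap)
  have h1 := Submodule.finrank_add_eq_of_isCompl hC
  rw [LinearMap.finrank_range_of_inj (f := D.toLinearMap) hD, ← hdim] at h1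
  let φ : F ≃ₗ[ℝ] C := LinearEquiv.ofFinrankEq _ _ (Nat.add_left_cancel h1).symm
  let B := ((LinearEquiv.ofInjective D.toLinearMap hD).prodCongr φ).trans
    (Submodule.prodEquivOfIsCompl _ _ hC)
  refine ⟨B.toContinuousLinearEquiv, (C.subtype.comp φ.toLinearMap).toContinuousLinearMap,
    fun v f => ?_⟩
  rfl

/-- In suitable coordinates of the target, an immersion is a linear inclusion. -/
theorem exists_straightening {f : V → E} {U : Set V} (hU : IsOpen U) (hf : ContDiffOn ℝ ∞ f U)
    {a : V} (ha : a ∈ U) (hinj : Function.Injective (fderiv ℝ f a))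
    (hdim : Module.finrank ℝ V + Module.finrank ℝ F = Module.finrank ℝ E) :
    ∃ (_ : (V × F) ≃L[ℝ] E) (e : OpenPartialHomeomorph (V × F) E), (a, 0) ∈ e.source ∧
      ContDiffOn ℝ ∞ e e.source ∧ ContDiffOn ℝ ∞ e.symm e.target ∧
      (∀ x ∈ e.source, x.1 ∈ U) ∧ ∀ w, e (w, 0) = f w := by
  have := FiniteDimensional.complete ℝ V
  have := FiniteDimensional.complete ℝ F
  obtain ⟨A, ι, hA⟩ := exists_equiv_extending (F := F) _ hinj hdim
  have hΦ : ContDiffOn ℝ ∞ (fun x : V × F => f x.1 + ι x.2) (U ×ˢ univ) :=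
    (hf.comp contDiffOn_fst fun x hx => hx.1).add (ι.contDiff.comp contDiff_snd).contDiffOn
  have hd : HasFDerivAt (fun x : V × F => f x.1 + ι x.2) (A : (V × F) →L[ℝ] E) (a, 0) := by
    have h1 : HasFDerivAt f (fderiv ℝ f a) (((a, 0) : V × F)).1 :=
      ((hf.contDiffAt (hU.mem_nhds ha)).differentiableAt (by simp)).hasFDerivAt
    have h2 := (h1.comp ((a, 0) : V × F) hasFDerivAt_fst).add
      (ι.hasFDerivAt.comp ((a, 0) : V × F) hasFDerivAt_snd)
    refine h2.congr_fderiv (ContinuousLinearMap.ext fun x => ?_)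
    exact (hA x.1 x.2).symm
  obtain ⟨e, h1, h2, h3, h4⟩ := exists_openPartialHomeomorph_contDiffOn
    (hU.prod isOpen_univ) hΦ (a := (a, 0)) ⟨ha, mem_univ _⟩ A hd
  refine ⟨A, e, h1, ?_, h4, fun x hx => (h2 hx).1, fun w => ?_⟩
  · exact (hΦ.mono h2).congr fun x _ => h3 x
  · rw [h3]; simp

variable {H N : Type*} [TopologicalSpace H] {J : ModelWithCorners ℝ E H} [J.Boundaryless]
  [TopologicalSpace N] [ChartedSpace H N] [IsManifold J ∞ N]

/-- In a suitable chart of the target manifold, an immersion is a linear inclusion. -/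
theorem exists_chart_straightening {P : V → N} {O : Set V} (hO : IsOpen O)
    (hP : ContMDiffOn 𝓘(ℝ, V) J ∞ P O) {a : V} (ha : a ∈ O)
    (hinj : Function.Injective (mfderiv 𝓘(ℝ, V) J P a))
    (hdim : Module.finrank ℝ V + Module.finrank ℝ F = Module.finrank ℝ E) :
    ∃ (A : (V × F) ≃L[ℝ] E) (ψ : OpenPartialHomeomorph N H) (W : Set V),
      ψ ∈ IsManifold.maximalAtlas J ∞ N ∧ IsOpen W ∧ a ∈ W ∧ W ⊆ O ∧
      ∀ w ∈ W, P w ∈ ψ.source ∧ J (ψ (P w)) = A (w, 0) := by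
  have : IsManifold J 1 N := IsManifold.of_le (n := ∞) (by simp)
  set c := extChartAt J (P a) with hc
  set O' := O ∩ P ⁻¹' c.source with hO'
  have hO'o : IsOpen O' := hP.continuousOn.isOpen_inter_preimage hO (isOpen_extChartAt_source (P a))
  have haO' : a ∈ O' := ⟨ha, mem_extChartAt_source (P a)⟩
  have hcs : ContMDiffOn J 𝓘(ℝ, E) ∞ c c.source := by
    rw [hc, extChartAt_source]; exact contMDiffOn_extChartAt
  have hf : ContDiffOn ℝ ∞ (fun w => c (P w)) O' :=
    contMDiffOn_iff_contDiffOn.1 (hcs.comp (hP.mono inter_subset_left) fun w hw => hw.2)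
  have hfd : fderiv ℝ (fun w => c (P w)) a = mfderiv 𝓘(ℝ, V) J P a := by
    have h1 : HasMFDerivAt J 𝓘(ℝ, E) c (P a) (ContinuousLinearMap.id ℝ (TangentSpace J (P a))) := by
      rw [← mfderiv_extChartAt_self]
      exact (((hcs _ haO'.2).contMDiffAt ((isOpen_extChartAt_source (P a)).mem_nhds
        haO'.2)).mdifferentiableAt (by simp)).hasMFDerivAt
    have h2 := h1.comp a (((hP a ha).contMDiffAt (hO.mem_nhds ha)).mdifferentiableAt
      (by simp)).hasMFDerivAt
    exact (hasFDerivAt_of_hasMFDerivAt h2).fderiv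
  obtain ⟨A, e, h1, h2, h3, h4, h5⟩ := exists_straightening (F := F) hO'o hf haO'
    (by rw [hfd]; exact hinj) hdim
  set c' := (chartAt H (P a)).trans J.toHomeomorph.toOpenPartialHomeomorph with hc'
  have hc's : c'.source = c.source := by simp [hc', hc]
  -- An ambient chart followed by the inverse of the straightening; `A` and `J.symm` only return the
  -- result to the model space `H`.
  set ψ := (c'.trans e.symm).trans
    (A.toHomeomorph.trans J.toHomeomorph.symm).toOpenPartialHomeomorph with hψ
  have hψs : ψ.source = c.source ∩ c ⁻¹' e.target := by
    simp only [hψ, hc's, mfld_simps]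
    rfl
  have hψa (q : N) : ψ q = J.symm (A (e.symm (c q))) := rfl
  have hψt : ψ.target = J ⁻¹' (A.symm ⁻¹' (e.source ∩ e ⁻¹' c.target)) := by
    ext h
    have : c'.target = c.target := by
      simp only [hc', hc, mfld_simps, J.range_eq_univ, univ_inter]
      rfl
    simp only [hψ, this, mfld_simps]
    rfl
  have hψs' (h : H) : ψ.symm h = c.symm (e (A.symm (J h))) := rfl
  refine ⟨A, ψ, {w | (w, 0) ∈ e.source}, ?_, ?_, h1, fun w hw => (h4 _ hw).1, fun w hw => ?_⟩
  · refine ψ.mem_maximalAtlas_of_contMDiffOn ?_ ?_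
    · rw [hψs]
      have := (J.contMDiffOn_symm (n := ∞))
      rw [J.range_eq_univ, contMDiffOn_univ] at this
      refine this.comp_contMDiffOn (A.contDiff.contMDiff.comp_contMDiffOn ?_)
      exact h3.contMDiffOn.comp (hcs.mono inter_subset_left) fun q hq => hq.2
    · rw [hψt]
      refine (contMDiffOn_extChartAt_symm (P a)).comp (h2.contMDiffOn.comp
        (A.symm.contDiff.contMDiff.comp J.contMDiff).contMDiffOn fun h hh => hh.1) fun h hh => hh.2
  · exact e.open_source.preimage (by fun_prop)
  · have hw' : w ∈ O' := h4 _ hw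
    rw [hψs, hψa, ← h5, e.left_inv hw]
    refine ⟨⟨hw'.2, ?_⟩, J.right_inv (by rw [J.range_eq_univ]; trivial)⟩
    rw [mem_preimage, ← h5]
    exact e.map_source hw

end Immersions

/-! ### Submanifolds with boundary from immersed half-space charts -/

section Submanifolds

variable {k : ℕ} [NeZero k] {E : Type*} [NormedAddCommGroup E] [NormedSpace ℝ E]
  {H N : Type*} [TopologicalSpace H] (J : ModelWithCorners ℝ E H)
  [TopologicalSpace N] [ChartedSpace H N] (L : Set N)

/-- A chart of a subset of a manifold, with values in a half-space, whose inverse extends to a smooth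
immersion of an open set. -/
structure ImmersedChart (k : ℕ) [NeZero k] where
  chart : OpenPartialHomeomorph L (EuclideanHalfSpace k)
  param : EuclideanSpace ℝ (Fin k) → N
  dom : Set (EuclideanSpace ℝ (Fin k))
  isOpen_dom : IsOpen dom
  contMDiffOn_param : ContMDiffOn 𝓘(ℝ, EuclideanSpace ℝ (Fin k)) J ∞ param dom
  mem_dom : ∀ u ∈ chart.target, u.val ∈ dom
  param_eq : ∀ u ∈ chart.target, param u.val = chart.symm u
  injective : ∀ u ∈ chart.target,
    Function.Injective (mfderiv 𝓘(ℝ, EuclideanSpace ℝ (Fin k)) J param u.val)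

variable {J L}

/-- The charted space structure given by a chart around every point. -/
abbrev immersedChartedSpace (φ : L → ImmersedChart J L k)
    (hφ : ∀ x, x ∈ (φ x).chart.source) : ChartedSpace (EuclideanHalfSpace k) L where
  atlas := range fun x => (φ x).chart
  chartAt x := (φ x).chart
  mem_chart_source := hφ
  chart_mem_atlas x := ⟨x, rfl⟩

theorem halfSpace_symm (u : EuclideanHalfSpace k) : (𝓡∂ k).symm u.val = u :=
  (𝓡∂ k).left_inv u

theorem halfSpace_of_mem_range {w : EuclideanSpace ℝ (Fin k)} (hw : w ∈ range (𝓡∂ k)) :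
    ((𝓡∂ k).symm w).val = w :=
  (𝓡∂ k).right_inv hw

variable [FiniteDimensional ℝ E] [J.Boundaryless] [IsManifold J ∞ N] {j : ℕ}
  (hdim : k + j = Module.finrank ℝ E)
include hdim

/-- Straightening the second parametrization makes its inverse on the subset the restriction of a
smooth ambient map. The transition is that map after `φ.param`, which is smooth on an open set
reaching across the edge of the half-space, hence the transition is smooth up to the boundary. -/
theorem ImmersedChart.contDiffOn_transition (φ φ' : ImmersedChart J L k) :
    ContDiffOn ℝ ∞ ((𝓡∂ k) ∘ φ.chart.symm ≫ₕ φ'.chart ∘ (𝓡∂ k).symm)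
      ((𝓡∂ k).symm ⁻¹' (φ.chart.symm ≫ₕ φ'.chart).source ∩ range (𝓡∂ k)) := by
  rintro _ ⟨hw₁, ⟨u, rfl⟩⟩
  set w := (𝓡∂ k) u with hw
  have hu : (𝓡∂ k).symm w = u := halfSpace_symm u
  rw [mem_preimage, hu] at hw₁
  have hut : u ∈ φ.chart.target := hw₁.1
  have hus : φ.chart.symm u ∈ φ'.chart.source := hw₁.2
  set u' := φ'.chart (φ.chart.symm u) with hu'
  have hu't : u' ∈ φ'.chart.target := φ'.chart.map_source hus
  obtain ⟨A, ψ, W, hψ, hWo, haW, -, hW⟩ := exists_chart_straightening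
    (F := EuclideanSpace ℝ (Fin j)) φ'.isOpen_dom φ'.contMDiffOn_param (φ'.mem_dom u' hu't)
    (φ'.injective u' hu't) (by simpa using hdim)
  have hPw : φ.param w = φ'.param u'.val := by
    rw [φ'.param_eq u' hu't, hu', φ'.chart.left_inv hus]
    exact φ.param_eq u hut
  have hR : ContDiffAt ℝ ∞ (fun w => (A.symm (J (ψ (φ.param w)))).1) w := by
    rw [← contMDiffAt_iff_contDiffAt]
    have h1 : ContMDiffAt 𝓘(ℝ, EuclideanSpace ℝ (Fin k)) J ∞ φ.param w :=
      (φ.contMDiffOn_param _ (φ.mem_dom u hut)).contMDiffAt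
        (φ.isOpen_dom.mem_nhds (φ.mem_dom u hut))
    have hmem : φ.param w ∈ ψ.source := hPw ▸ (hW _ haW).1
    have h2 : ContMDiffAt J J ∞ ψ (φ.param w) :=
      (contMDiffOn_of_mem_maximalAtlas hψ _ hmem).contMDiffAt (ψ.open_source.mem_nhds hmem)
    have h3 : ContDiff ℝ ∞ fun e => (A.symm e).1 := contDiff_fst.comp A.symm.contDiff
    exact ContMDiffAt.comp w (g := fun e => (A.symm e).1) h3.contMDiff.contMDiffAt
      ((J.contMDiff _).comp w (h2.comp w h1))
  have key (u₁ : EuclideanHalfSpace k) (h : u₁ ∈ (φ.chart.symm ≫ₕ φ'.chart).source)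
      (hw₁ : (φ'.chart (φ.chart.symm u₁)).val ∈ W) :
      (φ'.chart (φ.chart.symm u₁)).val = (A.symm (J (ψ (φ.param u₁.val)))).1 := by
    have h1 := (hW _ hw₁).2
    have h2 : φ.chart.symm u₁ ∈ φ'.chart.source := h.2
    rw [φ'.param_eq _ (φ'.chart.map_source h2), φ'.chart.left_inv h2,
      ← φ.param_eq u₁ h.1] at h1
    rw [h1, A.symm_apply_apply]
  refine hR.contDiffWithinAt.congr_of_eventuallyEq ?_ ?_
  · have hc : ContinuousAt (fun w => (φ'.chart (φ.chart.symm ((𝓡∂ k).symm w))).val) w := by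
      refine continuous_subtype_val.continuousAt.comp ?_
      refine ContinuousAt.comp (g := φ'.chart ∘ φ.chart.symm) ?_ (𝓡∂ k).continuousAt_symm
      rw [hu]
      exact (φ'.chart.continuousAt hus).comp (φ.chart.symm.continuousAt hut)
    have hWn : ∀ᶠ w' in 𝓝 w, (φ'.chart (φ.chart.symm ((𝓡∂ k).symm w'))).val ∈ W :=
      hc.preimage_mem_nhds (hWo.mem_nhds (by rw [hu]; exact haW))
    filter_upwards [self_mem_nhdsWithin, mem_nhdsWithin_of_mem_nhds hWn] with w' hw' hw''
    have := key _ hw'.1 hw''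
    rw [halfSpace_of_mem_range hw'.2] at this
    exact this
  · have := key u hw₁ haW
    change (φ'.chart (φ.chart.symm ((𝓡∂ k).symm w))).val = _
    rw [hu]
    exact this

variable (φ : L → ImmersedChart J L k) (hφ : ∀ x, x ∈ (φ x).chart.source)

theorem isManifold_immersed :
    letI := immersedChartedSpace φ hφ
    IsManifold (𝓡∂ k) ∞ L := by
  let := immersedChartedSpace φ hφ
  refine isManifold_of_contDiffOn _ _ _ ?_
  rintro _ _ ⟨x, rfl⟩ ⟨y, rfl⟩
  exact (φ x).contDiffOn_transition hdim (φ y)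

/-- The straightened ambient charts put the inclusion into the linear normal form of an immersion,
and the topology of `L` is the subspace topology by construction. -/
theorem isSmoothEmbedding_immersed :
    letI := immersedChartedSpace φ hφ
    IsSmoothEmbedding (𝓡∂ k) J ∞ (Subtype.val : L → N) := by
  let := immersedChartedSpace φ hφ
  have := isManifold_immersed hdim φ hφ
  refine ⟨IsImmersionOfComplement.isImmersion (F := EuclideanSpace ℝ (Fin j)) fun x => ?_,
    Topology.IsEmbedding.subtypeVal⟩
  set e := (φ x).chart with he
  have hxt : e x ∈ e.target := e.map_source (hφ x)
  obtain ⟨A, ψ, W, hψ, hWo, haW, -, hW⟩ := exists_chart_straightening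
    (F := EuclideanSpace ℝ (Fin j)) (φ x).isOpen_dom (φ x).contMDiffOn_param
    ((φ x).mem_dom (e x) hxt) ((φ x).injective (e x) hxt) (by simpa using hdim)
  have hpar (y : L) (hy : y ∈ e.source) : (φ x).param (e y).val = y := by
    rw [(φ x).param_eq _ (e.map_source hy)]
    exact congrArg _ (e.left_inv hy)
  have hSo : IsOpen (e.source ∩ e ⁻¹' (Subtype.val ⁻¹' W)) :=
    e.isOpen_inter_preimage (hWo.preimage continuous_subtype_val)
  set S := e.source ∩ e ⁻¹' (Subtype.val ⁻¹' W) with hS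
  have he's : (e.restr S).source = S := by
    rw [e.restr_source, hSo.interior_eq, hS, ← inter_assoc, inter_self]
  refine IsImmersionAtOfComplement.mk_of_continuousAt continuous_subtype_val.continuousAt A
    (e.restr S) ψ (he's.symm ▸ (⟨hφ x, haW⟩ : x ∈ S)) ?_ ?_ hψ ?_
  · have := (hW _ haW).1
    rwa [hpar x (hφ x)] at this
  · exact restr_mem_maximalAtlas _
      (IsManifold.chart_mem_maximalAtlas (I := 𝓡∂ k) x) hSo
  · intro w hw
    have h1 := ((e.restr S).extend (𝓡∂ k)).map_target hw
    have h2 := ((e.restr S).extend (𝓡∂ k)).right_inv hw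
    set y := ((e.restr S).extend (𝓡∂ k)).symm w with hy
    rw [OpenPartialHomeomorph.extend_source, he's] at h1
    have h3 : (e y).val = w := h2
    have h4 := (hW _ h1.2).2
    rw [hpar y h1.1, h3] at h4
    exact h4

/-- The derivative of the inclusion is the derivative of the local parametrization. -/
theorem mfderiv_subtypeVal_immersed (x : L) :
    letI := immersedChartedSpace φ hφ
    mfderiv (𝓡∂ k) J (Subtype.val : L → N) x =
      (mfderiv 𝓘(ℝ, EuclideanSpace ℝ (Fin k)) J (φ x).param ((φ x).chart x).val :
        EuclideanSpace ℝ (Fin k) →L[ℝ] E) := by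
  let := immersedChartedSpace φ hφ
  have := isManifold_immersed hdim φ hφ
  have : IsManifold (𝓡∂ k) 1 L := IsManifold.of_le (n := ∞) (by simp)
  have hxt := (φ x).mem_dom _ ((φ x).chart.map_source (hφ x))
  have h1 : HasMFDerivAt (𝓡∂ k) 𝓘(ℝ, EuclideanSpace ℝ (Fin k)) (extChartAt (𝓡∂ k) x) x
      (ContinuousLinearMap.id ℝ (TangentSpace (𝓡∂ k) x)) := by
    rw [← mfderiv_extChartAt_self]
    exact (contMDiffAt_extChartAt.mdifferentiableAt (n := ∞) (by simp)).hasMFDerivAt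
  have h2 := HasMFDerivAt.comp x (g := (φ x).param)
    ((((φ x).contMDiffOn_param _ hxt).contMDiffAt
    ((φ x).isOpen_dom.mem_nhds hxt)).mdifferentiableAt (by simp)).hasMFDerivAt h1
  refine HasMFDerivAt.mfderiv ?_
  refine h2.congr_of_eventuallyEq ?_
  filter_upwards [(φ x).chart.open_source.mem_nhds (hφ x)] with y hy
  have h3 := (φ x).param_eq _ ((φ x).chart.map_source hy)
  rw [(φ x).chart.left_inv hy] at h3
  exact h3.symm

omit hdim [FiniteDimensional ℝ E] [J.Boundaryless] [IsManifold J ∞ N] in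
theorem mem_boundary_immersed (x : L) :
    letI := immersedChartedSpace φ hφ
    x ∈ (𝓡∂ k).boundary L ↔ ((φ x).chart x).val 0 = 0 := by
  let := immersedChartedSpace φ hφ
  change extChartAt (𝓡∂ k) x x ∈ frontier (range (𝓡∂ k)) ↔ _
  rw [frontier_range_modelWithCornersEuclideanHalfSpace]
  exact eq_comm

end Submanifolds

end AHM

end

noncomputable section

set_option synthInstance.maxHeartbeats 200000

namespace AHM

/-! ### Coordinates with a prescribed first coordinate -/

section DropZero

variable {k : ℕ} [NeZero k]

/-- The projection of `ℝ^k` onto the hyperplane where the coordinate `0` vanishes. -/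
def dropZero (k : ℕ) [NeZero k] : EuclideanSpace ℝ (Fin k) →L[ℝ] EuclideanSpace ℝ (Fin k) :=
  ContinuousLinearMap.id ℝ _ -
    (EuclideanSpace.proj (0 : Fin k) : EuclideanSpace ℝ (Fin k) →L[ℝ] ℝ).smulRight
      (EuclideanSpace.single 0 (1 : ℝ))

theorem dropZero_apply (v : EuclideanSpace ℝ (Fin k)) :
    dropZero k v = v - v 0 • EuclideanSpace.single 0 (1 : ℝ) := rfl

theorem dropZero_apply_zero (v : EuclideanSpace ℝ (Fin k)) : dropZero k v 0 = 0 := by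
  simp [dropZero_apply]

theorem dropZero_eq_self {v : EuclideanSpace ℝ (Fin k)} (h : v 0 = 0) : dropZero k v = v := by
  rw [dropZero_apply, h, zero_smul, sub_zero]

theorem dropZero_add_smul (v : EuclideanSpace ℝ (Fin k)) (t : ℝ) :
    dropZero k (v + t • EuclideanSpace.single 0 (1 : ℝ)) = dropZero k v := by
  rw [dropZero_apply, dropZero_apply]
  simp [add_smul]

theorem add_smul_single_zero (v : EuclideanSpace ℝ (Fin k)) (h : v 0 = 0) (t : ℝ) :
    (v + t • EuclideanSpace.single 0 (1 : ℝ) : EuclideanSpace ℝ (Fin k)) 0 = t := by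
  simp [h]

/-- A function with nonzero derivative is the coordinate `0` of a local coordinate system. -/
theorem exists_coordinates_extending {E : Type*} [NormedAddCommGroup E] [NormedSpace ℝ E]
    [FiniteDimensional ℝ E] (hdim : Module.finrank ℝ E = k) {f : E → ℝ} {U : Set E}
    (hU : IsOpen U) (hf : ContDiffOn ℝ ∞ f U) {a : E} (ha : a ∈ U) (hne : fderiv ℝ f a ≠ 0) :
    ∃ e : OpenPartialHomeomorph E (EuclideanSpace ℝ (Fin k)), a ∈ e.source ∧ e.source ⊆ U ∧
      ContDiffOn ℝ ∞ e e.source ∧ ContDiffOn ℝ ∞ e.symm e.target ∧ ∀ x, e x 0 = f x := by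
  have := FiniteDimensional.complete ℝ E
  obtain ⟨v₀, hv₀⟩ : ∃ v, fderiv ℝ f a v ≠ 0 := by
    by_contra! h
    exact hne (ContinuousLinearMap.ext h)
  have hv₀' : v₀ ≠ 0 := fun h => hv₀ (by rw [h, map_zero])
  -- The axis of coordinate `0` is put along a direction in which `f` has nonzero derivative, so
  -- that replacing this coordinate by `f` keeps the derivative injective.
  obtain ⟨A, hA⟩ : ∃ A : E ≃L[ℝ] EuclideanSpace ℝ (Fin k),
      A v₀ = EuclideanSpace.single 0 (1 : ℝ) := by
    let A₁ : E ≃L[ℝ] EuclideanSpace ℝ (Fin k) :=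
      ContinuousLinearEquiv.ofFinrankEq (by simpa using hdim)
    obtain ⟨B, hB⟩ := SeparatingDual.exists_continuousLinearEquiv_apply_eq (R := ℝ)
      (x := A₁ v₀) (y := EuclideanSpace.single (0 : Fin k) (1 : ℝ)) (by simpa using hv₀')
      (by simp)
    exact ⟨A₁.trans B, hB⟩
  set D : E →L[ℝ] EuclideanSpace ℝ (Fin k) := (dropZero k).comp (A : E →L[ℝ] _) +
    (fderiv ℝ f a).smulRight (EuclideanSpace.single 0 (1 : ℝ)) with hD
  have hDv (v : E) : D v = dropZero k (A v) + fderiv ℝ f a v • EuclideanSpace.single 0 (1 : ℝ) :=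
    rfl
  have hinj : Function.Injective D := by
    rw [injective_iff_map_eq_zero]
    intro v hv
    rw [hDv] at hv
    have h1 : fderiv ℝ f a v = 0 := by
      rw [← add_smul_single_zero (dropZero k (A v)) (dropZero_apply_zero _) (fderiv ℝ f a v), hv]
      rfl
    rw [h1, zero_smul, add_zero, dropZero_apply, sub_eq_zero, ← hA, ← map_smul] at hv
    have h2 := A.injective hv
    rw [h2, map_smul, smul_eq_mul, mul_eq_zero, or_iff_left hv₀] at h1
    rw [h2, h1, zero_smul]
  let D' : E ≃L[ℝ] EuclideanSpace ℝ (Fin k) := (LinearEquiv.ofInjectiveOfFinrankEq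
    D.toLinearMap hinj (by simpa using hdim)).toContinuousLinearEquiv
  have hT : ContDiffOn ℝ ∞ (fun x => dropZero k (A x) +
      f x • EuclideanSpace.single (0 : Fin k) (1 : ℝ)) U :=
    ((dropZero k).contDiff.comp A.contDiff).contDiffOn.add (hf.smul contDiffOn_const)
  have hd : HasFDerivAt (fun x => dropZero k (A x) +
      f x • EuclideanSpace.single (0 : Fin k) (1 : ℝ)) (D' : E →L[ℝ] _) a := by
    have h1 := ((hf.contDiffAt (hU.mem_nhds ha)).differentiableAt (by simp)).hasFDerivAt
    exact (((dropZero k).hasFDerivAt.comp a A.hasFDerivAt).add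
      (h1.smul_const (EuclideanSpace.single (0 : Fin k) (1 : ℝ)))).congr_fderiv rfl
  obtain ⟨e, h1, h2, h3, h4⟩ := exists_openPartialHomeomorph_contDiffOn hU hT ha D' hd
  refine ⟨e, h1, h2, (hT.mono h2).congr fun x _ => h3 x, h4, fun x => ?_⟩
  rw [h3]
  exact add_smul_single_zero (dropZero k (A x)) (dropZero_apply_zero _) _

end DropZero

/-! ### Charts of the cotangent bundle adapted to the energy -/

section EnergyChart

variable {m : ℕ} [NeZero m] {M : Type*} [TopologicalSpace M]
  [ChartedSpace (EuclideanSpace ℝ (Fin m)) M] [IsManifold (𝓡 m) ∞ M]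

omit [NeZero m] in
-- If the differential vanished, so would the Hamilton field; but its base component is `sharp`,
-- whose vanishing makes the norm zero.
theorem dAt_energy_ne_zero (g : Metric (𝓡 m) M) {a : Cotangent m M} (ha : normSq g a ≠ 0) :
    dAt (energy g) a ≠ 0 := by
  intro h
  have h1 : hamVec (energy g) a = modelHamilton (dAt (energy g) a) := rfl
  have h2 : (hamVec (energy g) a).1 = 0 := by
    rw [h1, h]
    ext i
    rfl
  rw [hamVec_energy_fst] at h2
  refine ha ?_
  rw [normSq, h2, map_zero]

/-- Near a nonzero covector there are coordinates of the cotangent bundle one of which is the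
energy. -/
theorem exists_energyChart (g : Metric (𝓡 m) M) {a : Cotangent m M} (ha : normSq g a ≠ 0) :
    ∃ κ : OpenPartialHomeomorph (Cotangent m M) (EuclideanSpace ℝ (Fin (2 * m))), a ∈ κ.source ∧
      ContMDiffOn (cotI m) 𝓘(ℝ, EuclideanSpace ℝ (Fin (2 * m))) ∞ κ κ.source ∧
      ContMDiffOn 𝓘(ℝ, EuclideanSpace ℝ (Fin (2 * m))) (cotI m) ∞ κ.symm κ.target ∧
      ∀ q ∈ κ.source, κ q 0 = energy g q := by
  set K := cotChart a with hK
  have haK : a ∈ K.source := mem_cotChart_self a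
  have hf : ContDiffOn ℝ ∞ (fun z => energy g (K.symm z)) K.target :=
    contMDiffOn_iff_contDiffOn.1
      ((contMDiff_energy g).comp_contMDiffOn (contMDiffOn_cotChart_symm a))
  have hne : fderiv ℝ (fun z => energy g (K.symm z)) (K a) ≠ 0 := by
    rw [(fderiv_comp_cotChart_symm (mdifferentiableAt_energy g a) haK).fderiv]
    intro h
    refine dAt_energy_ne_zero g ha (ContinuousLinearMap.ext fun v => ?_)
    have h1 := congrArg (fun L => L v) h
    rw [← cotDInv_self a v]
    exact h1
  obtain ⟨e, h1, h2, h3, h4, h5⟩ := exists_coordinates_extending (k := 2 * m)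
    (by rw [finrank_cotModel, Module.finrank_prod, finrank_euclideanSpace_fin, two_mul]) (isOpen_cotChart_target a) hf (K.map_source haK) hne
  have hs : IsOpen (K.trans e.toPartialEquiv).source :=
    (contMDiffOn_cotChart a).continuousOn.isOpen_inter_preimage (isOpen_cotChart_source a)
      e.open_source
  have ht : (K.trans e.toPartialEquiv).target = e.target :=
    inter_eq_left.2 fun w hw => h2 (e.map_target hw)
  have hc : ContMDiffOn (cotI m) 𝓘(ℝ, EuclideanSpace ℝ (Fin (2 * m))) ∞
      (K.trans e.toPartialEquiv) (K.trans e.toPartialEquiv).source :=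
    h3.contMDiffOn.comp ((contMDiffOn_cotChart a).mono inter_subset_left) fun q hq => hq.2
  have hc' : ContMDiffOn 𝓘(ℝ, EuclideanSpace ℝ (Fin (2 * m))) (cotI m) ∞
      (K.trans e.toPartialEquiv).symm (K.trans e.toPartialEquiv).target :=
    (contMDiffOn_cotChart_symm a).comp (h4.contMDiffOn.mono ht.le)
      fun w hw => h2 (e.map_target (ht.le hw))
  refine ⟨{ toPartialEquiv := K.trans e.toPartialEquiv
            open_source := hs
            open_target := ht ▸ e.open_target
            continuousOn_toFun := hc.continuousOn
            continuousOn_invFun := hc'.continuousOn }, ⟨haK, h1⟩, hc, hc', fun q hq => ?_⟩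
  change e (K q) 0 = _
  rw [h5, K.left_inv hq.1]

end EnergyChart

end AHM

end

noncomputable section

set_option synthInstance.maxHeartbeats 200000

namespace AHM

/-! ### From Liouville forms to symplectic forms on the cotangent bundle -/

section LiouvilleDerivative

variable {m : ℕ} {M : Type*} [TopologicalSpace M]
  [ChartedSpace (EuclideanSpace ℝ (Fin m)) M] [IsManifold (𝓡 m) ∞ M]
  {Z : Type*} [NormedAddCommGroup Z] [NormedSpace ℝ Z]

theorem fderiv_cotChart_self_comp {F : Z → Cotangent m M} {u : Z}
    (hF : MDifferentiableAt 𝓘(ℝ, Z) (cotI m) F u) :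
    fderiv ℝ (fun u' => cotChart (F u) (F u')) u = cotDeriv F u := by
  rw [(hasFDerivAt_cotChart_comp hF (mem_cotChart_self (F u))).fderiv, cotD_self,
    ContinuousLinearMap.id_comp]

theorem liouville_eq_zero_of_cotDeriv {F : Z → Cotangent m M} {u : Z}
    (hF : MDifferentiableAt 𝓘(ℝ, Z) (cotI m) F u) {v : Z} (hv : cotDeriv F u v = 0) :
    liouville F u v = 0 := by
  have h := liouville_chart hF (mem_cotChart_self (F u)) v
  rw [fderiv_cotChart_self_comp hF, hv] at h
  rw [liouville, ← h]
  exact map_zero _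

/-- If the Liouville forms pulled back by two maps are proportional modulo a constant form, then so
are the symplectic forms. -/
theorem modelForm_cotDeriv_of_liouville {F₁ F₂ : Z → Cotangent m M} {O : Set Z} (hO : IsOpen O)
    (h₁ : ContMDiffOn 𝓘(ℝ, Z) (cotI m) ∞ F₁ O) (h₂ : ContMDiffOn 𝓘(ℝ, Z) (cotI m) ∞ F₂ O)
    (c : ℝ) (l : Z → ℝ) (h : ∀ u ∈ O, ∀ v, liouville F₁ u v = c * liouville F₂ u v + l v)
    {u : Z} (hu : u ∈ O) (v w : Z) :
    modelForm (cotDeriv F₁ u v) (cotDeriv F₁ u w) =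
      c * modelForm (cotDeriv F₂ u v) (cotDeriv F₂ u w) := by
  have hd {F : Z → Cotangent m M} (hF : ContMDiffOn 𝓘(ℝ, Z) (cotI m) ∞ F O) {u : Z} (hu : u ∈ O) :
      ContMDiffAt 𝓘(ℝ, Z) (cotI m) ∞ F u := (hF u hu).contMDiffAt (hO.mem_nhds hu)
  have hc {F : Z → Cotangent m M} (hF : ContMDiffOn 𝓘(ℝ, Z) (cotI m) ∞ F O) :
      ContDiffAt ℝ 2 (fun u' => cotChart (F u) (F u')) u :=
    (contMDiffAt_iff_contDiffAt.1 (ContMDiffAt.comp u (I' := cotI m)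
      (contMDiffAt_cotChart (mem_cotChart_self (F u))) (hd hF hu))).of_le ENat.LEInfty.out
  have hev {F : Z → Cotangent m M} (hF : ContMDiffOn 𝓘(ℝ, Z) (cotI m) ∞ F O) :
      ∀ᶠ u' in 𝓝 u, F u' ∈ (cotChart (F u)).source :=
    (hd hF hu).continuousAt.preimage_mem_nhds
      ((isOpen_cotChart_source (F u)).mem_nhds (mem_cotChart_self (F u)))
  have key := modelForm_eq_of_liouville_eq (hc h₁) (hc h₂) c l (by
    filter_upwards [hO.mem_nhds hu, hev h₁, hev h₂] with u' hu' hu₁ hu₂ v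
    rw [liouville_chart ((hd h₁ hu').mdifferentiableAt (by simp)) hu₁,
      liouville_chart ((hd h₂ hu').mdifferentiableAt (by simp)) hu₂]
    exact h u' hu' v) v w
  rwa [fderiv_cotChart_self_comp ((hd h₁ hu).mdifferentiableAt (by simp)),
    fderiv_cotChart_self_comp ((hd h₂ hu).mdifferentiableAt (by simp))] at key

end LiouvilleDerivative

/-! ### Parametrization of the flow-out by time and unit covectors -/

section FlowGraph

variable {m : ℕ} [NeZero m] {M : Type*} [TopologicalSpace M]
  [ChartedSpace (EuclideanSpace ℝ (Fin m)) M] [IsManifold (𝓡 m) ∞ M]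

/-- The union over `t ≥ 0` of the graphs of `exp(t H_p)` composed with the multiplication of
covectors by `c`, over the unit sphere bundle. -/
def flowGraph (g : Metric (𝓡 m) M) (c : ℝ) : Set (Cotangent m M × Cotangent m M) :=
  {q | ∃ t : ℝ, 0 ≤ t ∧ q.1 = flow g t (smulCov c q.2) ∧ normSq g q.2 = 1}

/-- Coordinates of the cotangent bundle such that the coordinate `0` is the energy. -/
structure IsEnergyChart (g : Metric (𝓡 m) M)
    (κ : OpenPartialHomeomorph (Cotangent m M) (EuclideanSpace ℝ (Fin (2 * m)))) : Prop where
  contMDiffOn : ContMDiffOn (cotI m) 𝓘(ℝ, EuclideanSpace ℝ (Fin (2 * m))) ∞ κ κ.source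
  contMDiffOn_symm : ContMDiffOn 𝓘(ℝ, EuclideanSpace ℝ (Fin (2 * m))) (cotI m) ∞ κ.symm κ.target
  energy_eq : ∀ q ∈ κ.source, κ q 0 = energy g q

/-- The parametrization of the unit sphere bundle given by an energy chart. -/
def slice (κ : OpenPartialHomeomorph (Cotangent m M) (EuclideanSpace ℝ (Fin (2 * m))))
    (w : EuclideanSpace ℝ (Fin (2 * m))) : Cotangent m M :=
  κ.symm (dropZero (2 * m) w)

/-- The endpoint of the geodesic of length `w 0` which starts at a point of the slice. -/
def sliceFlow (g : Metric (𝓡 m) M) (c : ℝ)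
    (κ : OpenPartialHomeomorph (Cotangent m M) (EuclideanSpace ℝ (Fin (2 * m))))
    (w : EuclideanSpace ℝ (Fin (2 * m))) : Cotangent m M :=
  flow g (w 0) (smulCov c (slice κ w))

variable {g : Metric (𝓡 m) M} {c : ℝ}
  {κ : OpenPartialHomeomorph (Cotangent m M) (EuclideanSpace ℝ (Fin (2 * m)))}

theorem isOpen_sliceDomain : IsOpen (dropZero (2 * m) ⁻¹' κ.target) :=
  κ.open_target.preimage (dropZero (2 * m)).continuous

/-- On the unit sphere bundle coordinate `0`, the energy, is zero, so that slot is free to carry the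
time. -/
theorem slice_of_mem {a : Cotangent m M} (hκ : IsEnergyChart g κ) (ha : a ∈ κ.source)
    (hn : normSq g a = 1) (t : ℝ) :
    slice κ (dropZero (2 * m) (κ a) + t • EuclideanSpace.single 0 (1 : ℝ)) = a := by
  have h0 : κ a 0 = 0 := by rw [hκ.energy_eq a ha, energy_eq_zero_iff.2 hn]
  rw [slice, dropZero_add_smul, dropZero_eq_self (dropZero_apply_zero _), dropZero_eq_self h0,
    κ.left_inv ha]

theorem IsEnergyChart.contMDiffOn_slice (hκ : IsEnergyChart g κ) :
    ContMDiffOn 𝓘(ℝ, EuclideanSpace ℝ (Fin (2 * m))) (cotI m) ∞ (slice κ)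
      (dropZero (2 * m) ⁻¹' κ.target) :=
  hκ.contMDiffOn_symm.comp (dropZero (2 * m)).contDiff.contMDiff.contMDiffOn fun _ hw => hw

theorem IsEnergyChart.normSq_slice (hκ : IsEnergyChart g κ) {w : EuclideanSpace ℝ (Fin (2 * m))}
    (hw : dropZero (2 * m) w ∈ κ.target) : normSq g (slice κ w) = 1 := by
  have h := hκ.energy_eq _ (κ.map_target hw)
  rw [κ.right_inv hw, dropZero_apply_zero] at h
  exact energy_eq_zero_iff.1 h.symm

variable [T2Space M] (hp : ProperMetric g) (hκ : IsEnergyChart g κ)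
include hp hκ

theorem IsEnergyChart.contMDiffOn_sliceFlow :
    ContMDiffOn 𝓘(ℝ, EuclideanSpace ℝ (Fin (2 * m))) (cotI m) ∞ (sliceFlow g c κ)
      (dropZero (2 * m) ⁻¹' κ.target) := by
  refine (contMDiff_flow hp).comp_contMDiffOn
    (f := fun w : EuclideanSpace ℝ (Fin (2 * m)) => (w 0, smulCov c (slice κ w))) ?_
  refine ContMDiffOn.prodMk ?_ ((contMDiff_smulCov c).comp_contMDiffOn hκ.contMDiffOn_slice)
  exact (EuclideanSpace.proj (0 : Fin (2 * m)) :
    EuclideanSpace ℝ (Fin (2 * m)) →L[ℝ] ℝ).contDiff.contMDiff.contMDiffOn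

/-- The energy vanishes identically on the slice, also after multiplication by `c` because `c ^ 2 =
1`. Its differential therefore drops out of `liouville_flow`, and the time direction contributes
exactly `dt`. The identity `θ₁ = c θ₂ + dt` contains the Lagrangian property, since `dt` is closed.
-/
theorem IsEnergyChart.liouville_sliceFlow (hc : c ^ 2 = 1) {w : EuclideanSpace ℝ (Fin (2 * m))}
    (hw : dropZero (2 * m) w ∈ κ.target) (v : EuclideanSpace ℝ (Fin (2 * m))) :
    liouville (sliceFlow g c κ) w v = c * liouville (slice κ) w v + v 0 := by
  set F := fun w => smulCov c (slice κ w) with hF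
  have hFd : ContMDiffAt 𝓘(ℝ, EuclideanSpace ℝ (Fin (2 * m))) (cotI m) ∞ F w :=
    ((contMDiff_smulCov c).comp_contMDiffOn hκ.contMDiffOn_slice w hw).contMDiffAt
      (isOpen_sliceDomain.mem_nhds hw)
  have hn {w : EuclideanSpace ℝ (Fin (2 * m))} (hw : dropZero (2 * m) w ∈ κ.target) :
      normSq g (F w) = 1 := by
    rw [hF, normSq_smulCov, hc, hκ.normSq_slice hw, one_mul]
  have h1 := liouville_flow hp (hFd.of_le ENat.LEInfty.out) (w 0) (v 0) v
  have h2 : fderiv ℝ (fun u => energy g (F u)) w = 0 := by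
    have h3 : (fun u => energy g (F u)) =ᶠ[𝓝 w] fun _ => (0 : ℝ) := by
      filter_upwards [isOpen_sliceDomain.mem_nhds hw] with u hu
      exact energy_eq_zero_iff.2 (hn hu)
    rw [h3.fderiv_eq, fderiv_const_apply]
  rw [hn hw, h2] at h1
  let Λ : EuclideanSpace ℝ (Fin (2 * m)) →L[ℝ] ℝ × EuclideanSpace ℝ (Fin (2 * m)) :=
    (EuclideanSpace.proj (0 : Fin (2 * m))).prod (ContinuousLinearMap.id ℝ _)
  have h4 : liouville (sliceFlow g c κ) w v =
      liouville (fun x : ℝ × EuclideanSpace ℝ (Fin (2 * m)) => flow g x.1 (F x.2)) (w 0, w)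
        (v 0, v) := by
    have hs := contMDiffAt_flow_comp hp le_rfl hFd (w 0)
    exact congrArg (covec (sliceFlow g c κ w)) (derivAt_comp_of_hasFDerivAt (m := m)
      (G := fun x : ℝ × EuclideanSpace ℝ (Fin (2 * m)) => (flow g x.1 (F x.2)).proj)
      (L := Λ) Λ.hasFDerivAt ((contMDiff_cotProj.contMDiffAt.comp (w 0, w) hs).mdifferentiableAt
        (by simp)) v)
  have h5 : liouville F w v = c * liouville (slice κ) w v := rfl
  rw [h4, h1, h5]
  simp
  ring

theorem IsEnergyChart.contMDiffOn_param :
    ContMDiffOn 𝓘(ℝ, EuclideanSpace ℝ (Fin (2 * m))) (cotI₂ m) ∞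
      (fun w => (sliceFlow g c κ w, slice κ w)) (dropZero (2 * m) ⁻¹' κ.target) :=
  (hκ.contMDiffOn_sliceFlow hp).prodMk hκ.contMDiffOn_slice

theorem IsEnergyChart.mfderiv_param {w : EuclideanSpace ℝ (Fin (2 * m))}
    (hw : dropZero (2 * m) w ∈ κ.target) :
    mfderiv 𝓘(ℝ, EuclideanSpace ℝ (Fin (2 * m))) (cotI₂ m)
      (fun w => (sliceFlow g c κ w, slice κ w)) w =
      ((cotDeriv (sliceFlow g c κ) w).prod (cotDeriv (slice κ) w) :
        EuclideanSpace ℝ (Fin (2 * m)) →L[ℝ] CotModel m × CotModel m) := by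
  have hO := (isOpen_sliceDomain (κ := κ)).mem_nhds hw
  exact mfderiv_prodMk
    ((((hκ.contMDiffOn_sliceFlow (c := c) hp) w hw).contMDiffAt hO).mdifferentiableAt (by simp))
    (((hκ.contMDiffOn_slice w hw).contMDiffAt hO).mdifferentiableAt (by simp))

/-- For a kernel vector the Liouville identity gives vanishing time component, and the slice, which
`κ` inverts, gives vanishing of all the other coordinates. -/
theorem IsEnergyChart.injective_mfderiv_param (hc : c ^ 2 = 1)
    {w : EuclideanSpace ℝ (Fin (2 * m))} (hw : dropZero (2 * m) w ∈ κ.target) :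
    Function.Injective ((cotDeriv (sliceFlow g c κ) w).prod (cotDeriv (slice κ) w)) := by
  have hO := (isOpen_sliceDomain (κ := κ)).mem_nhds hw
  have hd₁ := (((hκ.contMDiffOn_sliceFlow (c := c) hp) w hw).contMDiffAt hO).mdifferentiableAt
    (by simp)
  have hd₂ := ((hκ.contMDiffOn_slice w hw).contMDiffAt hO).mdifferentiableAt (by simp)
  rw [injective_iff_map_eq_zero]
  intro v hv
  have hv₁ : cotDeriv (sliceFlow g c κ) w v = 0 := congrArg Prod.fst hv
  have hv₂ : cotDeriv (slice κ) w v = 0 := congrArg Prod.snd hv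
  have h0 := hκ.liouville_sliceFlow hp hc hw v
  rw [liouville_eq_zero_of_cotDeriv hd₁ hv₁, liouville_eq_zero_of_cotDeriv hd₂ hv₂, mul_zero,
    zero_add] at h0
  have hκd : MDifferentiableAt (cotI m) 𝓘(ℝ, EuclideanSpace ℝ (Fin (2 * m))) κ (slice κ w) :=
    ((hκ.contMDiffOn _ (κ.map_target hw)).contMDiffAt
      (κ.open_source.mem_nhds (κ.map_target hw))).mdifferentiableAt (by simp)
  have h1 := hasFDerivAt_of_hasMFDerivAt (hκd.hasMFDerivAt.comp w hd₂.hasMFDerivAt)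
  have h2 : HasFDerivAt (κ ∘ slice κ) (dropZero (2 * m)) w := by
    refine (dropZero (2 * m)).hasFDerivAt.congr_of_eventuallyEq ?_
    filter_upwards [hO] with u hu
    exact κ.right_inv hu
  have h3 := congrArg (fun L => L v) (h2.unique h1)
  have h4 : dropZero (2 * m) v = 0 := by
    refine h3.trans ?_
    change mfderiv (cotI m) 𝓘(ℝ, EuclideanSpace ℝ (Fin (2 * m))) κ (slice κ w)
      (cotDeriv (slice κ) w v) = 0
    rw [hv₂]
    exact map_zero _
  rwa [dropZero_eq_self h0.symm] at h4

end FlowGraph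

end AHM

end

noncomputable section

set_option synthInstance.maxHeartbeats 200000

namespace AHM

theorem finrank_cotModel_prod (m : ℕ) :
    2 * m + 2 * m = Module.finrank ℝ (CotModel m × CotModel m) := by
  rw [Module.finrank_prod, finrank_cotModel, Module.finrank_prod, finrank_euclideanSpace_fin]
  ring

/-! ### Half-space charts and the Lagrangian property -/

section FlowGraphManifold

variable {m : ℕ} [NeZero m] {M : Type*} [TopologicalSpace M]
  [ChartedSpace (EuclideanSpace ℝ (Fin m)) M] [IsManifold (𝓡 m) ∞ M]
  {g : Metric (𝓡 m) M} {c : ℝ}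
  {κ : OpenPartialHomeomorph (Cotangent m M) (EuclideanSpace ℝ (Fin (2 * m)))}

/-- The length of the geodesic underlying a point of a flow graph. -/
def flowTime (g : Metric (𝓡 m) M) (q : Cotangent m M × Cotangent m M) : ℝ :=
  rdist g q.2.proj q.1.proj

/-- Coordinates of a flow graph: the time and the coordinates of the initial point. -/
def flowCoord (g : Metric (𝓡 m) M)
    (κ : OpenPartialHomeomorph (Cotangent m M) (EuclideanSpace ℝ (Fin (2 * m))))
    (q : Cotangent m M × Cotangent m M) : EuclideanSpace ℝ (Fin (2 * m)) :=
  dropZero (2 * m) (κ q.2) + flowTime g q • EuclideanSpace.single 0 (1 : ℝ)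

theorem flowCoord_zero (q : Cotangent m M × Cotangent m M) : flowCoord g κ q 0 = flowTime g q :=
  add_smul_single_zero _ (dropZero_apply_zero _) _

theorem dropZero_flowCoord (q : Cotangent m M × Cotangent m M) :
    dropZero (2 * m) (flowCoord g κ q) = dropZero (2 * m) (κ q.2) := by
  rw [flowCoord, dropZero_add_smul, dropZero_eq_self (dropZero_apply_zero _)]

theorem IsEnergyChart.dropZero_apply (hκ : IsEnergyChart g κ) {a : Cotangent m M}
    (ha : a ∈ κ.source) (hn : normSq g a = 1) : dropZero (2 * m) (κ a) = κ a :=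
  dropZero_eq_self (by rw [hκ.energy_eq a ha, energy_eq_zero_iff.2 hn])

variable [T2Space M] (hp : ProperMetric g) (hconv : GeodesicallyConvex g)
include hp hconv

omit [NeZero m] in
-- Elapsed time along a unit speed geodesic is the distance of its ends, so the time is a continuous
-- function on the ambient space. This makes the flow-out embedded and not merely immersed: the
-- parametrization has a continuous inverse.
theorem GeodesicallyConvex.flowTime_eq (hc : c ^ 2 = 1) {b a : Cotangent m M} {t : ℝ}
    (ht : 0 ≤ t) (hb : b = flow g t (smulCov c a)) (hn : normSq g a = 1) :
    flowTime g (b, a) = t := by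
  have h := hconv.rdist_flow hp (a := smulCov c a) (by rw [normSq_smulCov, hc, hn, one_mul]) ht
  rwa [← hb] at h

omit [NeZero m] in
theorem GeodesicallyConvex.fst_eq_flow (hc : c ^ 2 = 1) {q : Cotangent m M × Cotangent m M}
    (hq : q ∈ flowGraph g c) : q.1 = flow g (flowTime g q) (smulCov c q.2) := by
  obtain ⟨t, ht, h1, h2⟩ := hq
  have h3 : flowTime g q = t := hconv.flowTime_eq hp hc ht h1 h2
  rw [h3, ← h1]

omit [NeZero m] in
theorem GeodesicallyConvex.continuous_flowTime :
    Continuous (flowTime g : Cotangent m M × Cotangent m M → ℝ) :=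
  (continuous_rdist (hconv.redist_ne_top hp)).comp
    ((continuous_cotProj.comp continuous_snd).prodMk (continuous_cotProj.comp continuous_fst))

omit hp hconv [T2Space M] [NeZero m] in
theorem flowTime_nonneg (q : Cotangent m M × Cotangent m M) : 0 ≤ flowTime g q :=
  rdist_nonneg _ _ _

omit hconv [T2Space M] hp in
theorem IsEnergyChart.param_mem (hκ : IsEnergyChart g κ) {u : EuclideanHalfSpace (2 * m)}
    (hu : dropZero (2 * m) u.val ∈ κ.target) :
    (sliceFlow g c κ u.val, slice κ u.val) ∈ flowGraph g c :=
  ⟨u.val 0, u.property, rfl, hκ.normSq_slice hu⟩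

theorem GeodesicallyConvex.param_flowCoord (hc : c ^ 2 = 1) (hκ : IsEnergyChart g κ)
    {q : Cotangent m M × Cotangent m M} (hq : q ∈ flowGraph g c) (hs : q.2 ∈ κ.source) :
    (sliceFlow g c κ (flowCoord g κ q), slice κ (flowCoord g κ q)) = q := by
  have h1 : slice κ (flowCoord g κ q) = q.2 := slice_of_mem hκ hs hq.choose_spec.2.2 _
  refine Prod.ext ?_ h1
  rw [sliceFlow, h1, flowCoord_zero]
  exact (hconv.fst_eq_flow hp hc hq).symm

theorem GeodesicallyConvex.flowCoord_param (hc : c ^ 2 = 1) (hκ : IsEnergyChart g κ)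
    {w : EuclideanSpace ℝ (Fin (2 * m))} (hw₀ : 0 ≤ w 0) (hw : dropZero (2 * m) w ∈ κ.target) :
    flowCoord g κ (sliceFlow g c κ w, slice κ w) = w := by
  have h1 : flowTime g (sliceFlow g c κ w, slice κ w) = w 0 :=
    hconv.flowTime_eq hp hc hw₀ rfl (hκ.normSq_slice hw)
  have h2 : κ (slice κ w) = dropZero (2 * m) w := κ.right_inv hw
  rw [flowCoord, h1, h2, dropZero_eq_self (dropZero_apply_zero _), AHM.dropZero_apply,
    sub_add_cancel]

open Classical in
/-- The chart of a flow graph given by an energy chart. -/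
def flowGraphChart (hc : c ^ 2 = 1) (hκ : IsEnergyChart g κ) (x : flowGraph g c) :
    OpenPartialHomeomorph (flowGraph g c) (EuclideanHalfSpace (2 * m)) where
  toFun y := ⟨flowCoord g κ y.val, by rw [flowCoord_zero]; exact flowTime_nonneg _⟩
  -- Off the target the value is irrelevant; `x` supplies one.
  invFun u := if h : dropZero (2 * m) u.val ∈ κ.target then ⟨_, hκ.param_mem h⟩ else x
  source := {y | y.val.2 ∈ κ.source}
  target := {u | dropZero (2 * m) u.val ∈ κ.target}
  map_source' := by
    intro y hy
    rw [mem_ofPred_eq] at hy ⊢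
    have hn : normSq g y.val.2 = 1 := y.property.choose_spec.2.2
    rw [dropZero_flowCoord, hκ.dropZero_apply hy hn]
    exact κ.map_source hy
  map_target' := by
    intro u hu
    rw [mem_ofPred_eq] at hu ⊢
    rw [dif_pos hu]
    exact κ.map_target hu
  left_inv' := by
    intro y hy
    have hn : normSq g y.val.2 = 1 := y.property.choose_spec.2.2
    have h : dropZero (2 * m) (flowCoord g κ y.val) ∈ κ.target := by
      rw [dropZero_flowCoord, hκ.dropZero_apply hy hn]
      exact κ.map_source hy
    rw [dif_pos h]
    exact Subtype.ext (hconv.param_flowCoord hp hc hκ y.property hy)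
  right_inv' := by
    intro u hu
    rw [mem_ofPred_eq] at hu
    refine Subtype.ext ?_
    rw [dif_pos hu]
    exact hconv.flowCoord_param hp hc hκ u.property hu
  open_source := κ.open_source.preimage (continuous_snd.comp continuous_subtype_val)
  open_target := isOpen_sliceDomain.preimage continuous_subtype_val
  continuousOn_toFun := by
    refine (Topology.IsInducing.subtypeVal (Y := EuclideanSpace ℝ (Fin (2 * m)))
      (t := {w | 0 ≤ w 0})).continuousOn_iff.2 ?_
    refine ((dropZero (2 * m)).continuous.comp_continuousOn (κ.continuousOn.comp
      (continuous_snd.comp continuous_subtype_val).continuousOn fun y hy => hy)).add ?_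
    exact (((hconv.continuous_flowTime hp).comp continuous_subtype_val).smul
      continuous_const).continuousOn
  continuousOn_invFun := by
    rw [Topology.IsInducing.subtypeVal.continuousOn_iff]
    refine ((hκ.contMDiffOn_param (c := c) hp).continuousOn.comp
      continuous_subtype_val.continuousOn fun u hu => hu).congr fun u hu => ?_
    have hu' : dropZero (2 * m) u.val ∈ κ.target := hu
    exact congrArg Subtype.val (dif_pos hu')

/-- The chart of a flow graph given by an energy chart, with its parametrization. -/
def flowGraphImmersedChart (hc : c ^ 2 = 1) (hκ : IsEnergyChart g κ) (x : flowGraph g c) :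
    ImmersedChart (cotI₂ m) (flowGraph g c) (2 * m) where
  chart := flowGraphChart hp hconv hc hκ x
  param w := (sliceFlow g c κ w, slice κ w)
  dom := dropZero (2 * m) ⁻¹' κ.target
  isOpen_dom := isOpen_sliceDomain
  contMDiffOn_param := hκ.contMDiffOn_param hp
  mem_dom _ hu := hu
  param_eq u hu := by
    have hu' : dropZero (2 * m) u.val ∈ κ.target := hu
    have h : (flowGraphChart hp hconv hc hκ x).symm u = ⟨_, hκ.param_mem hu'⟩ := dif_pos hu'
    rw [h]
  injective u hu := by
    rw [hκ.mfderiv_param hp hu]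
    exact hκ.injective_mfderiv_param hp hc hu

/-- The flow graph is a Lagrangian submanifold for the form `ω₁ - c ω₂`. -/
theorem isLagrangianSubmanifold_flowGraph (hc : c ^ 2 = 1)
    {Ω : ∀ q : Cotangent m M × Cotangent m M,
      TangentSpace (cotI₂ m) q → TangentSpace (cotI₂ m) q → ℝ}
    (hΩ : ∀ q (V W : CotModel m × CotModel m),
      Ω q V W = modelForm V.1 W.1 - c * modelForm V.2 W.2) :
    IsLagrangianSubmanifold Ω (flowGraph g c)
      {q | q.1 = smulCov c q.2 ∧ normSq g q.2 = 1} := by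
  have hex (x : flowGraph g c) : ∃ κ : OpenPartialHomeomorph (Cotangent m M)
      (EuclideanSpace ℝ (Fin (2 * m))), x.val.2 ∈ κ.source ∧ IsEnergyChart g κ := by
    have hn : normSq g x.val.2 = 1 := x.property.choose_spec.2.2
    obtain ⟨κ, h1, h2, h3, h4⟩ := exists_energyChart g (a := x.val.2) (by rw [hn]; norm_num)
    exact ⟨κ, h1, h2, h3, h4⟩
  choose κ hκs hκ using hex
  let φ (x : flowGraph g c) : ImmersedChart (cotI₂ m) (flowGraph g c) (2 * m) :=
    flowGraphImmersedChart hp hconv hc (hκ x) x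
  have hφ (x : flowGraph g c) : x ∈ (φ x).chart.source := hκs x
  have hdim := finrank_cotModel_prod m
  refine ⟨immersedChartedSpace φ hφ, isManifold_immersed hdim φ hφ,
    isSmoothEmbedding_immersed hdim φ hφ, ?_, fun x v w => ?_⟩
  -- The coordinate that must be nonnegative is the time, so the boundary is the part at time zero.
  · have hb (x : flowGraph g c) : ((φ x).chart x).val 0 = flowTime g x.val := flowCoord_zero _
    ext q
    constructor
    · rintro ⟨x, hx, rfl⟩
      rw [mem_boundary_immersed φ hφ, hb] at hx
      refine ⟨?_, x.property.choose_spec.2.2⟩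
      have h := hconv.fst_eq_flow hp hc x.property
      rwa [hx, flow_zero hp] at h
    · rintro ⟨h1, h2⟩
      have hq : q.1 = flow g 0 (smulCov c q.2) := by rw [flow_zero hp, h1]
      refine ⟨⟨q, 0, le_rfl, hq, h2⟩, ?_, rfl⟩
      rw [mem_boundary_immersed φ hφ, hb]
      exact hconv.flowTime_eq hp hc le_rfl hq h2
  · have hx : dropZero (2 * m) ((φ x).chart x).val ∈ (κ x).target :=
      (φ x).chart.map_source (hφ x)
    have h1 := mfderiv_subtypeVal_immersed hdim φ hφ x
    have h2 := h1.trans ((hκ x).mfderiv_param (c := c) hp hx)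
    -- Exterior differentiation of `θ₁ - c θ₂ = dt`.
    have h3 := modelForm_cotDeriv_of_liouville isOpen_sliceDomain
      ((hκ x).contMDiffOn_sliceFlow (c := c) hp) (hκ x).contMDiffOn_slice c (fun v => v 0)
      (fun w hw v => (hκ x).liouville_sliceFlow hp hc hw v) hx v w
    rw [h2]
    refine (hΩ x.val _ _).trans ?_
    exact sub_eq_zero.2 h3

end FlowGraphManifold

/-! ### The two sign conventions -/

section Lagrangian

variable {m : ℕ} [NeZero m] {M : Type*} [TopologicalSpace M]
  [ChartedSpace (EuclideanSpace ℝ (Fin m)) M] [IsManifold (𝓡 m) ∞ M]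
  {g : Metric (𝓡 m) M} [T2Space M] (hp : ProperMetric g) (hconv : GeodesicallyConvex g)
include hp hconv

theorem isLagrangianSubmanifold_Lam :
    IsLagrangianSubmanifold twistedForm (Lam g) (sDiag g) := by
  have h1 : Lam g = flowGraph g 1 := by
    ext q; rw [mem_Lam hp, flowGraph, mem_ofPred_eq, smulCov_one]
  have h2 : sDiag g = {q | q.1 = smulCov 1 q.2 ∧ normSq g q.2 = 1} := by
    ext q; rw [mem_sDiag, mem_ofPred_eq, smulCov_one]
  rw [h1, h2]
  refine isLagrangianSubmanifold_flowGraph hp hconv (by norm_num) fun q V W => ?_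
  rw [one_mul]
  rfl

/-- With `c = -1` the form `ω₁ - c ω₂` becomes the sum of the two symplectic forms. -/
theorem isLagrangianSubmanifold_LamConormal :
    IsLagrangianSubmanifold sumForm (LamConormal g) (sConormal g) := by
  have h1 : LamConormal g = flowGraph g (-1) := by
    ext q; rw [mem_LamConormal hp, flowGraph, mem_ofPred_eq]
  have h2 : sConormal g = {q | q.1 = smulCov (-1) q.2 ∧ normSq g q.2 = 1} := by
    ext q; rw [mem_sConormal, mem_ofPred_eq]
  rw [h1, h2]
  refine isLagrangianSubmanifold_flowGraph hp hconv (by norm_num) fun q V W => ?_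
  rw [neg_one_mul, sub_neg_eq_add]
  rfl

end Lagrangian

end AHM

end

theorem proposition3p1 (n : ℕ)
    {M : Type*} [TopologicalSpace M]
    [ChartedSpace (EuclideanSpace ℝ (Fin (n + 1))) M] [IsManifold (𝓡 (n + 1)) ∞ M]
    {X : Type*} [TopologicalSpace X] [T2Space X] [CompactSpace X]
    [ChartedSpace (EuclideanHalfSpace (n + 1)) X] [IsManifold (𝓡∂ (n + 1)) ∞ X]
    (ι : M → X) (g : AHM.Metric (𝓡 (n + 1)) M)
    (hg : AHM.IsAsymptoticallyHyperbolic ι g) (hconv : AHM.GeodesicallyConvex g) :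
    -- the two descriptions of `Λ`
    AHM.Lam g =
      {q | ∃ t : ℝ, 0 ≤ t ∧ AHM.HamiltonFlow (AHM.energy g) t q.2 q.1 ∧
        AHM.energy g q.2 = 0} ∧
    -- `Λ` is a smooth embedded Lagrangian submanifold with boundary `S^*Diag`
    AHM.IsLagrangianSubmanifold AHM.twistedForm (AHM.Lam g) (AHM.sDiag g) ∧
    -- the distance function is smooth off the diagonal
    ContMDiffOn ((𝓡 (n + 1)).prod (𝓡 (n + 1))) 𝓘(ℝ, ℝ) ∞
      (fun x : M × M => AHM.rdist g x.1 x.2) {x | x.1 ≠ x.2} ∧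
    -- `Λ` off the diagonal: `ζ = d_z r`, `ζ' = -d_{z'} r`
    AHM.Lam g \ AHM.sDiag g =
      {q | q.1.proj ≠ q.2.proj ∧
        (∀ v : TangentSpace (𝓡 (n + 1)) q.1.proj, q.1.snd v =
          mfderiv (𝓡 (n + 1)) 𝓘(ℝ, ℝ) (fun z : M => AHM.rdist g z q.2.proj) q.1.proj v) ∧
        ∀ v : TangentSpace (𝓡 (n + 1)) q.2.proj, q.2.snd v =
          -mfderiv (𝓡 (n + 1)) 𝓘(ℝ, ℝ) (fun z' : M => AHM.rdist g q.1.proj z') q.2.proj v} ∧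
    -- the same with the sign of `ζ'` reversed: a Lagrangian submanifold for the canonical form of
    -- `T^*(M × M)` which is the graph of the differential of `r`
    AHM.LamConormal g = {q | (q.1, ⟨q.2.proj, -q.2.snd⟩) ∈ AHM.Lam g} ∧
    AHM.IsLagrangianSubmanifold AHM.sumForm (AHM.LamConormal g) (AHM.sConormal g) ∧
    AHM.LamConormal g \ AHM.sConormal g =
      {q | q.1.proj ≠ q.2.proj ∧
        ∀ (v : TangentSpace (𝓡 (n + 1)) q.1.proj) (w : TangentSpace (𝓡 (n + 1)) q.2.proj),
          q.1.snd v + q.2.snd w =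
            mfderiv ((𝓡 (n + 1)).prod (𝓡 (n + 1))) 𝓘(ℝ, ℝ)
              (fun x : M × M => AHM.rdist g x.1 x.2) (q.1.proj, q.2.proj) (v, w)} := by
  have : T2Space M := hg.t2Space
  have hp := hg.properMetric
  exact ⟨AHM.Lam_eq g, AHM.isLagrangianSubmanifold_Lam hp hconv, hconv.contMDiffOn_rdist hp,
    AHM.Lam_diff_sDiag hp hconv, AHM.LamConormal_eq hp,
    AHM.isLagrangianSubmanifold_LamConormal hp hconv,
    AHM.LamConormal_diff_sConormal hp hconv⟩
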